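/- Let $B=\mathbb{Q}+\mathbb{Q}i+\mathbb{Q}j+\mathbb{Q}ij$ ($i^2=j^2=-1$, $ij=-ji$) be the definite quaternion algebra of discriminant $2$, $\mathcal{O}=\mathbb{Z}+\mathbb{Z}i+\mathbb{Z}j+\mathbb{Z}\frac{1+i+j+ij}{2}$ the Hurwitz order, $B_p=B\otimes\mathbb{Q}_p$, $\mathcal{O}_p=\mathcal{O}\otimes\mathbb{Z}_p$, $\mathbb{H}=B\otimes\mathbb{R}$, $\nu$ the reduced norm, $|x|=\sqrt{\nu(x)}$ on $\mathbb{H}$, and $\varpi_2=1+i$. Put $K_p=\mathrm{GL}_2(\mathcal{O}_p)$, $K=\{k\in\mathrm{GL}_2(\mathbb{H}) : {}^t\bar k k=1\}$, $Z^+=\mathbb{R}_{>0}\cdot 1_2$, $n(x)=\begin{pmatrix}1&x\\0&1\end{pmatrix}$, $a_y=\begin{pmatrix}\sqrt y&0\\0&1/\sqrt y\end{pmatrix}$. For $r\in\mathbb{C}$ let $\mathcal{M}(\mathrm{GL}_2(\mathcal{O}),r)$ be the space of smooth functions $F$ of moderate growth on $\mathrm{GL}_2(\mathbb{H})$ with $F(z\gamma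 gk)=F(g)$ for $z\in Z^+,\gamma\in\mathrm{GL}_2(\mathcal{O}),k\in K$ and $\Omega F=-\frac12\left(\frac{r^2}{4}+1\right)F$, where $\Omega$ is the Casimir operator of $\mathfrak{sl}_2(\mathbb{H})$ for its Killing form. Let $\mathcal{S}=\varpi_2\mathcal{O}$ be the dual lattice of $\mathcal{O}$ for $(x,y)\mapsto\mathrm{Re}(xy)$; such an $F$ has a Fourier expansion $$F(n(x)a_y)=u_0(y)+\sum_{\beta\in\mathcal{S}\setminus\{0\}}A(\beta)\,y^2K_{\sqrt{-1}r}(2\pi|\beta|y)\,e^{2\pi\sqrt{-1}\,\mathrm{Re}(\beta x)}.$$ Let $\mathcal{S}^{prim}$ be the set of $\beta\in\mathcal{S}\setminus\{0\}$ divisible in $\mathcal{O}$ neither by $\varpi_2^2$ nor by any odd integer $n>1$. Every $\beta\in\mathcal{S}\setminus\{0\}$ is uniquely $\varpi_2^u n\beta_0$ with $u\ge 0$, $n\ge1$ odd, $\beta_0\in\mathcal{S}^{prim}$. Let $\epsilon\in\{\pm1\}$ and let $F\in\mathcal{M}(\mathrm{GL}_2(\mathcal{O}),r)$ belong to the Maass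 space $\mathcal{M}^*(\mathrm{GL}_2(\mathcal{O}),r)$ with sign $\epsilon$. That is, $A(\beta)=A(K,u,n)$ depends only on $K=|\beta|^2$, $u$ and $n$, and for all $(K,u,n)$ arising from some $\beta$, $$A(K,u,n)=-\tfrac{3\epsilon}{\sqrt2}A(\tfrac K2,u-1,n)-A(\tfrac K4,u-2,n)\quad(u\ge1),\qquad A(K,u,n)=\sum_{d\mid n}d\,A(\tfrac{K}{d^2},u,1),$$ where $A(K,u,n)=0$ for $u<0$. Assume that $F$ is cuspidal, i.e. $\int_{\mathbb{H}/\mathcal{O}}F(n(x)g)\,dx=0$ for all $g$, and a (nonzero) Hecke eigenform. That is, the function $\Phi_F$ on $\mathrm{GL}_2(B_{\mathbb{A}})=\mathrm{GL}_2(B)\,\mathrm{GL}_2(\mathbb{H})\prod_pK_p$ given by $\Phi_F(\gamma xk)=F(x)$ is an eigenfunction of all Hecke operators of $(\mathrm{GL}_2(B_p),K_p)$, for all primes $p$. Let $\Pi_F\simeq\otimes'_{p\le\infty}\Pi_{F,p}$ be the automorphic representation generated by $\Phi_F$ under right translation by $\mathrm{GL}_2(B_{\mathbb{A}_f})$ and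 $K$ and under the Lie algebra of $\mathrm{GL}_2(\mathbb{H})$. Here the local component $\Pi_{F,p}$ is the irreducible representation of $\mathrm{GL}_2(B_p)$ (irreducible $(\mathfrak{g},K)$-module if $p=\infty$), determined up to isomorphism, such that $\Pi_F$ is the tensor product of $\Pi_{F,p}$ with a representation of the adelic group away from $p$. Then the local components $\Pi_{F,2}$ and $\Pi_{F,\infty}$ exist, and the following hold, where $\mathrm{Ind}$ is normalized induction from upper triangular matrices. (a) $\Pi_{F,2}$ is (up to isomorphism) the unique irreducible constituent of the unramified principal series representation $\mathrm{Ind}(\chi_1\times\chi_2)$ of $\mathrm{GL}_2(B_2)$, where $\chi_1,\chi_2$ are the unramified characters of $B_2^\times$ (trivial on $\mathcal{O}_2^\times$) with $$\chi_1(\varpi_2)=-\sqrt2\,\epsilon,\qquad \chi_2(\varpi_2)=-\epsilon/\sqrt2 .$$ (b) $\Pi_{F,\infty}$ is isomorphic to (the $(\mathfrak{g},K)$-module of $K$-finite vectors of) the principal series representation $\mathrm{Ind}(\chi_s)$ of $\mathrm{GL}_2(\mathbb{H})$, both for $s=\frac{\sqrt{-1}r}{2}$ and for $s=-\frac{\sqrt{-1}r}{2}$,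 where $$\chi_s\begin{pmatrix}a&*\\0&d\end{pmatrix}=\nu(ad^{-1})^s .$$ -/

import Mathlib

open scoped Quaternion TensorProduct RestrictedProduct

noncomputable section

namespace QuatMaass

/-! ### Quaternions, the Hurwitz order and the groups `GL₂`

`ℍ[K]` is the Hamilton quaternion algebra with coefficients in `K`; thus `ℍ[ℚ]` is the definite
quaternion algebra `B` of discriminant two, `ℍ[ℚ_[p]] = B ⊗ ℚ_p` and `ℍ[ℝ] = B ⊗ ℝ`. -/

instance factPrime (p : Nat.Primes) : Fact (p : ℕ).Prime := ⟨p.2⟩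

/-- The quaternion `a + b i + c j + d ij`. -/
def quat {K : Type} (a b c d : K) [Field K] : ℍ[K] := ⟨a, b, c, d⟩

@[simp] lemma quat_re {K : Type} [Field K] (a b c d : K) : (quat a b c d).re = a := rfl
@[simp] lemma quat_imI {K : Type} [Field K] (a b c d : K) : (quat a b c d).imI = b := rfl
@[simp] lemma quat_imJ {K : Type} [Field K] (a b c d : K) : (quat a b c d).imJ = c := rfl
@[simp] lemma quat_imK {K : Type} [Field K] (a b c d : K) : (quat a b c d).imK = d := rfl

/-- `GL₂` of the quaternions with coefficients in `K`. -/
abbrev GLH (K : Type) [Field K] := Matrix.GeneralLinearGroup (Fin 2) ℍ[K]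

/-- Extension of scalars for quaternions. -/
def quatMap {K L : Type} [Field K] [Field L] (f : K →+* L) : ℍ[K] →+* ℍ[L] where
  toFun x := quat (f x.re) (f x.imI) (f x.imJ) (f x.imK)
  map_one' := by ext <;> simp
  map_zero' := by ext <;> simp
  map_add' x y := by ext <;> simp
  map_mul' x y := by ext <;> simp

/-- Extension of scalars for `GL₂`. -/
def glMap {K L : Type} [Field K] [Field L] (f : K →+* L) : GLH K →* GLH L :=
  Units.map (quatMap f).mapMatrix.toMonoidHom

/-- The `Z`-span of `1, i, j, (1 + i + j + ij) / 2`. For `Z = ℤ` this is the Hurwitz order `𝓞`, and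
for `Z = ℤ_[p]`, `K = ℚ_[p]` it is the completion `𝓞_p`. -/
def hurwitz (Z K : Type) [CommRing Z] [Field K] [CharZero K] [Algebra Z K] : Subring ℍ[K] where
  carrier := {x | ∃ a b c d : Z, x = quat (algebraMap Z K a + algebraMap Z K d / 2)
    (algebraMap Z K b + algebraMap Z K d / 2) (algebraMap Z K c + algebraMap Z K d / 2)
    (algebraMap Z K d / 2)}
  one_mem' := ⟨1, 0, 0, 0, by ext <;> simp⟩
  zero_mem' := ⟨0, 0, 0, 0, by ext <;> simp⟩
  add_mem' := by
    rintro _ _ ⟨a, b, c, d, rfl⟩ ⟨a', b', c', d', rfl⟩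
    refine ⟨a + a', b + b', c + c', d + d', ?_⟩
    ext <;> simp <;> ring
  neg_mem' := by
    rintro _ ⟨a, b, c, d, rfl⟩
    refine ⟨-a, -b, -c, -d, ?_⟩
    ext <;> simp <;> ring
  mul_mem' := by
    rintro _ _ ⟨a, b, c, d, rfl⟩ ⟨a', b', c', d', rfl⟩
    refine ⟨a * a' - b * b' - c * c' - b * c' + c * b' - b * d' - d * c' - d * d',
      a * b' + b * a' - b * c' + c * b' + d * b' + c * d' - d * c',
      a * c' + c * a' - b * c' + c * b' - b * d' + c * d' + d * b',
      2 * (b * c') - 2 * (c * b') + a * d' + b * d' - c * d' + d * a' - d * b' + d * c' + d * d',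
      ?_⟩
    ext <;> simp only [Quaternion.re_mul, Quaternion.imI_mul, Quaternion.imJ_mul,
      Quaternion.imK_mul, quat_re, quat_imI, quat_imJ, quat_imK, map_add, map_sub, map_mul,
      map_ofNat] <;> ring

/-- `GL₂(𝓞)`, respectively `GL₂(𝓞_p)`: the invertible matrices which, together with their inverse,
have entries in the order. -/
def glOrder (Z K : Type) [CommRing Z] [Field K] [CharZero K] [Algebra Z K] : Subgroup (GLH K) :=
  ((hurwitz Z K).matrix (n := Fin 2)).toSubmonoid.units

/-- The upper triangular matrix with rows `(a, x)` and `(0, d)`. -/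
def upper {K : Type} [Field K] (a d : ℍ[K]ˣ) (x : ℍ[K]) : GLH K where
  val := !![(a : ℍ[K]), x; 0, (d : ℍ[K])]
  inv := !![((a⁻¹ : ℍ[K]ˣ) : ℍ[K]), -(((a⁻¹ : ℍ[K]ˣ) : ℍ[K]) * x * ((d⁻¹ : ℍ[K]ˣ) : ℍ[K]));
    0, ((d⁻¹ : ℍ[K]ˣ) : ℍ[K])]
  val_inv := by
    ext i j : 1
    fin_cases i <;> fin_cases j <;> simp [Matrix.mul_apply, ← mul_assoc]
  inv_val := by
    ext i j : 1
    fin_cases i <;> fin_cases j <;> simp [Matrix.mul_apply, mul_assoc]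

/-- The element `ϖ₂ = 1 + i`. -/
def varpi (K : Type) [Field K] : ℍ[K] := quat 1 1 0 0

/-- `ϖ₂ = 1 + i` as a unit, with inverse `(1 - i) / 2`. -/
def varpiUnit (K : Type) [Field K] [CharZero K] : ℍ[K]ˣ where
  val := varpi K
  inv := quat (1 / 2) (-(1 / 2)) 0 0
  val_inv := by ext <;> norm_num [varpi]
  inv_val := by ext <;> norm_num [varpi]

/-- A nonzero real number, as a unit of `ℍ[ℝ]`. -/
def realUnit (c : ℝ) (hc : c ≠ 0) : ℍ[ℝ]ˣ where
  val := (c : ℍ[ℝ])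
  inv := ((c⁻¹ : ℝ) : ℍ[ℝ])
  val_inv := by rw [← Quaternion.coe_mul, mul_inv_cancel₀ hc, Quaternion.coe_one]
  inv_val := by rw [← Quaternion.coe_mul, inv_mul_cancel₀ hc, Quaternion.coe_one]

/-- The unipotent matrix `n(x)`. -/
def nMat (x : ℍ[ℝ]) : GLH ℝ := upper 1 1 x

/-- The diagonal matrix `a_y` with entries `√y` and `1 / √y`, for `y > 0`. -/
def aMat (y : ℝ) (hy : 0 < y) : GLH ℝ :=
  upper (realUnit √y (Real.sqrt_pos.2 hy).ne') (realUnit √y (Real.sqrt_pos.2 hy).ne')⁻¹ 0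

/-- The scalar matrix with diagonal entries `c > 0`; these matrices form the group `Z⁺`. -/
def zMat (c : ℝ) (hc : 0 < c) : GLH ℝ := upper (realUnit c hc.ne') (realUnit c hc.ne') 0

/-- The maximal compact subgroup `K` of `GL₂(ℍ)`: the matrices `k` whose conjugate transpose is
their inverse. -/
def maxCompact : Subgroup (GLH ℝ) := (unitary (Matrix (Fin 2) (Fin 2) ℍ[ℝ])).units

/-! ### Differential operators on `GL₂(ℍ)` -/

/-- The extension by zero to `M₂(ℍ)`, a real normed space of dimension 16, of a function on its
open subset `GL₂(ℍ)`. -/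
def extend (f : GLH ℝ → ℂ) (A : Fin 2 → Fin 2 → ℍ[ℝ]) : ℂ :=
  open Classical in if h : IsUnit (Matrix.of A) then f h.unit else 0

/-- Smooth functions on `GL₂(ℍ)`. -/
def IsSmooth (f : GLH ℝ → ℂ) : Prop :=
  ContDiffOn ℝ (⊤ : ℕ∞) (extend f) {A | IsUnit (Matrix.of A)}

/-- The action of `X` in the Lie algebra `M₂(ℍ)` by right translation: the derivative of `f` at `g`
in the direction of the tangent vector `g X` of the curve `t ↦ g exp(tX)`. -/
def lieDeriv (X : Matrix (Fin 2) (Fin 2) ℍ[ℝ]) (f : GLH ℝ → ℂ) (g : GLH ℝ) : ℂ :=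
  fderiv ℝ (extend f) (Matrix.of.symm (g : Matrix (Fin 2) (Fin 2) ℍ[ℝ]))
    (Matrix.of.symm ((g : Matrix (Fin 2) (Fin 2) ℍ[ℝ]) * X))

/-- The basis `1, i, j, ij` of `ℍ[ℝ]`. -/
def quatBasis : Fin 4 → ℍ[ℝ] := ![1, quat 0 1 0 0, quat 0 0 1 0, quat 0 0 0 1]

/-- The Casimir operator `Ω` of `sl₂(ℍ)` with respect to its Killing form
`(X, Y) ↦ 16 Re tr(XY)`. It is the Casimir operator of `M₂(ℍ)` with respect to the same bilinear
form, where `E_{ab} q` is dual to `E_{ba} q̄ / 16`, minus the contribution of the scalar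
matrices. On functions invariant under `Z⁺` and `K` it is `1/8` of the hyperbolic Laplacian
`y² (∂_y² + ∑ ∂_{x_i}²) - 3 y ∂_y`. -/
def casimir (f : GLH ℝ → ℂ) (g : GLH ℝ) : ℂ :=
  (1 / 16) * ((∑ a : Fin 2, ∑ b : Fin 2, ∑ q : Fin 4,
      lieDeriv (Matrix.single a b (quatBasis q))
        (lieDeriv (Matrix.single b a (star (quatBasis q))) f) g)
    - (1 / 2) * lieDeriv 1 (lieDeriv 1 f) g)

/-! ### Automorphic forms on `GL₂(ℍ)` for `GL₂(𝓞)` -/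

/-- Moderate growth, for the norm `∑ (|g_ab|² + |(g⁻¹)_ab|²)` on `GL₂(ℍ)`. -/
def ModerateGrowth (F : GLH ℝ → ℂ) : Prop :=
  ∃ (C : ℝ) (N : ℕ), ∀ g : GLH ℝ,
    ‖F g‖ ≤ C * (∑ a : Fin 2, ∑ b : Fin 2, (‖g.val a b‖ ^ 2 + ‖(g⁻¹).val a b‖ ^ 2)) ^ N

/-- The space `𝓜(GL₂(𝓞), r)`. -/
structure IsMaassForm (r : ℂ) (F : GLH ℝ → ℂ) : Prop where
  smooth : IsSmooth F
  casimir_eq : ∀ g, casimir F g = -(1 / 2) * (r ^ 2 / 4 + 1) * F g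
  invariant : ∀ (c : ℝ) (hc : 0 < c), ∀ γ ∈ glOrder ℤ ℝ, ∀ g, ∀ k ∈ maxCompact,
    F (zMat c hc * γ * g * k) = F g
  growth : ModerateGrowth F

/-- The lattice `𝓢`, dual to `𝓞`:
the integral span of `1 - ij, -i - ij, -j - ij, 2ij`. -/
def latticeS : Set ℍ[ℝ] :=
  {β | ∃ a b c d : ℤ, β = quat (a : ℝ) (-b) (-c) (-a - b - c + 2 * d)}

/-- The set `𝓢^prim` of primitive elements of `𝓢`. -/
def primS : Set ℍ[ℝ] :=
  {β | β ∈ latticeS ∧ β ≠ 0 ∧ (∃ x ∈ hurwitz ℤ ℝ, β = varpi ℝ * x) ∧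
    (¬ ∃ x ∈ hurwitz ℤ ℝ, β = varpi ℝ ^ 2 * x) ∧
    ∀ n : ℕ, Odd n → n ≠ 1 → ¬ ∃ x ∈ hurwitz ℤ ℝ, β = n * x}

/-- The modified Bessel function `K_α(z)`, for `z > 0`. -/
def besselK (α : ℂ) (z : ℝ) : ℂ :=
  ∫ t in Set.Ioi (0 : ℝ), (Real.exp (-z * Real.cosh t) : ℂ) * Complex.cosh (α * t)

/-- `A` is the family of Fourier coefficients of `F` (and `u` its constant term). -/
def HasFourierExpansion (r : ℂ) (F : GLH ℝ → ℂ) (u : ℝ → ℂ) (A : ℍ[ℝ] → ℂ) : Prop :=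
  ∀ (x : ℍ[ℝ]) (y : ℝ) (hy : 0 < y),
    HasSum (fun β : {β : ℍ[ℝ] // β ∈ latticeS ∧ β ≠ 0} =>
        A β * (y : ℂ) ^ 2 * besselK (Complex.I * r) (2 * Real.pi * ‖(β : ℍ[ℝ])‖ * y) *
          Complex.exp (2 * Real.pi * Complex.I * ((((β : ℍ[ℝ]) * x).re : ℝ) : ℂ)))
      (F (nMat x * aMat y hy) - u y)

/-- The space `𝓜*(GL₂(𝓞), r)`, with the sign `ε` of the recurrence relation at two. Here `a K u n`
is the common value of the `A(β)` with `β = ϖ₂ ^ u n β₀`, `β₀` primitive, `n` odd and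
`|β|² = K`; it is zero for negative `u`. -/
def IsMaassSpace (r : ℂ) (ε : ℝ) (F : GLH ℝ → ℂ) : Prop :=
  IsMaassForm r F ∧ ∃ (u₀ : ℝ → ℂ) (A : ℍ[ℝ] → ℂ), HasFourierExpansion r F u₀ A ∧
    ∃ a : ℝ → ℤ → ℕ → ℂ, (∀ K u n, u < 0 → a K u n = 0) ∧
      ∀ (u n : ℕ) (β₀ : ℍ[ℝ]), Odd n → β₀ ∈ primS →
        ∀ (β : ℍ[ℝ]) (K : ℝ), β = varpi ℝ ^ u * n * β₀ → K = Quaternion.normSq β →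
          A β = a K u n ∧
          (1 ≤ u → a K u n = ((-3 * ε / √2 : ℝ) : ℂ) * a (K / 2) (u - 1) n - a (K / 4) (u - 2) n) ∧
          a K u n = ∑ d ∈ n.divisors, (d : ℂ) * a (K / d ^ 2) u 1

/-- Cuspidality: the constant term of `F` along the unipotent radical vanishes. The four
coordinates parametrize `ℍ[ℝ] / 𝓞` by means of the basis `1, i, j, (1 + i + j + ij) / 2`; since `𝓞`
has class number one, there are no other cusps. -/
def IsCuspidal (F : GLH ℝ → ℂ) : Prop :=
  ∀ g : GLH ℝ, ∫ t in Set.Icc (0 : Fin 4 → ℝ) 1,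
    F (nMat (quat (t 0 + t 3 / 2) (t 1 + t 3 / 2) (t 2 + t 3 / 2) (t 3 / 2)) * g) = 0

/-! ### Adelic groups, Hecke operators and the automorphic representation -/

/-- The prime number two. -/
def two : Nat.Primes := ⟨2, Nat.prime_two⟩

/-- The group `GL₂(B_p)`. -/
abbrev Gp (p : Nat.Primes) := GLH ℚ_[p]

/-- The subgroup `K_p = GL₂(𝓞_p)`. -/
def Kp (p : Nat.Primes) : Subgroup (Gp p) := glOrder ℤ_[p] ℚ_[p]

/-- The finite adelic group: the restricted product of the `GL₂(B_p)` with respect to `K_p`. -/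
abbrev Gfin := Πʳ p : Nat.Primes, [Gp p, Kp p]

/-- The group `GL₂(B_𝔸)`. -/
abbrev GA := GLH ℝ × Gfin

/-- The subgroup `GL₂(B_p)` of the finite adelic group. -/
def atPrime (p : Nat.Primes) (g : Gp p) : Gfin := RestrictedProduct.mulSingle Kp p g

/-- `g = γ x k` with `γ ∈ GL₂(B)` (embedded diagonally), `x ∈ GL₂(ℍ)` and `k ∈ ∏ K_p`. -/
def Decomposes (g : GA) (x : GLH ℝ) : Prop :=
  ∃ γ : GLH ℚ, g.1 = glMap (algebraMap ℚ ℝ) γ * x ∧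
    ∀ p : Nat.Primes, (glMap (algebraMap ℚ ℚ_[p]) γ)⁻¹ * g.2 p ∈ Kp p

/-- The function `Φ_F` on `GL₂(B_𝔸)` with `Φ_F(γ x k) = F(x)`. -/
def adelicLift (F : GLH ℝ → ℂ) (g : GA) : ℂ :=
  open Classical in if h : ∃ x, Decomposes g x then F h.choose else 0

/-- The Hecke operator of the double coset `K_p h K_p`: the sum of the right translates
by the elements of `K_p h K_p / K_p`. -/
def hecke (p : Nat.Primes) (h : Gp p) (Φ : GA → ℂ) (g : GA) : ℂ :=
  ∑ᶠ c ∈ {c : Gp p ⧸ Kp p | ∃ k ∈ Kp p, c = QuotientGroup.mk (k * h)},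
    Φ (g * (1, atPrime p c.out))

/-- `F` is a Hecke eigenform: it is nonzero and an eigenfunction of all Hecke operators at all
primes. -/
def IsHeckeEigenform (F : GLH ℝ → ℂ) : Prop :=
  F ≠ 0 ∧ ∀ (p : Nat.Primes) (h : Gp p), ∃ μ : ℂ,
    ∀ g, hecke p h (adelicLift F) g = μ * adelicLift F g

/-- Right translation of functions on a group. -/
def rightRegular (G : Type) [Group G] : Representation ℂ G (G → ℂ) where
  toFun h := LinearMap.funLeft ℂ ℂ (fun g => g * h)
  map_one' := by ext f g; simp [LinearMap.funLeft]
  map_mul' h h' := by ext f g; simp [LinearMap.funLeft, mul_assoc]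

lemma rightRegular_apply {G : Type} [Group G] (h : G) (f : G → ℂ) (g : G) :
    rightRegular G h f g = f (g * h) := rfl

/-- The action of the Lie algebra of `GL₂(ℍ)` on functions on the adelic group. -/
def lieDerivA (X : Matrix (Fin 2) (Fin 2) ℍ[ℝ]) (Φ : GA → ℂ) (g : GA) : ℂ :=
  lieDeriv X (fun x => Φ (x, g.2)) g.1

/-- The automorphic representation `Π_F`: the space of functions generated by `Φ_F` under right
translation by the finite adelic group and by `K`, and under the Lie algebra of `GL₂(ℍ)`. -/
def autRep (F : GLH ℝ → ℂ) : Submodule ℂ (GA → ℂ) :=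
  sInf {V | adelicLift F ∈ V ∧
    (∀ h : Gfin, ∀ f ∈ V, rightRegular GA (1, h) f ∈ V) ∧
    (∀ k ∈ maxCompact, ∀ f ∈ V, rightRegular GA (k, 1) f ∈ V) ∧
    ∀ X, ∀ f ∈ V, lieDerivA X f ∈ V}

/-- `(𝔤, K)`-modules for `GL₂(ℍ)`, with `𝔤 = M₂(ℍ)`. In the last condition, `c` is a curve in `K`
through `1` with velocity `X`, and the derivative of `c(t) v`, which stays in a space of finite
dimension, is taken weakly. -/
structure GKModule (V : Type*) [AddCommGroup V] [Module ℂ V] where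
  /-- the action of `K` -/
  act : Representation ℂ maxCompact V
  /-- the action of the Lie algebra -/
  lie : Matrix (Fin 2) (Fin 2) ℍ[ℝ] → Module.End ℂ V
  lie_add : ∀ X Y, lie (X + Y) = lie X + lie Y
  lie_smul : ∀ (c : ℝ) X, lie (c • X) = (c : ℂ) • lie X
  lie_bracket : ∀ X Y, lie (X * Y - Y * X) = lie X * lie Y - lie Y * lie X
  act_lie : ∀ (k : maxCompact) X, act k * lie X * act k⁻¹ =
    lie ((k : GLH ℝ).val * X * ((k : GLH ℝ)⁻¹).val)
  finite : ∀ v, Module.Finite ℂ (Submodule.span ℂ (Set.range fun k => act k v))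
  differential : ∀ (X : Matrix (Fin 2) (Fin 2) ℍ[ℝ]) (c : ℝ → maxCompact), c 0 = 1 →
    (∀ a b, HasDerivAt (fun t => (c t : GLH ℝ).val a b) (X a b) 0) →
    ∀ (v : V) (ℓ : V →ₗ[ℂ] ℂ), HasDerivAt (fun t => ℓ (act (c t) v)) (ℓ (lie X v)) 0

/-- Irreducibility of a `(𝔤, K)`-module. -/
def GKModule.IsIrreducible {V : Type*} [AddCommGroup V] [Module ℂ V] (π : GKModule V) : Prop :=
  Nontrivial V ∧ ∀ U : Submodule ℂ V, (∀ k, ∀ v ∈ U, π.act k v ∈ U) →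
    (∀ X, ∀ v ∈ U, π.lie X v ∈ U) → U = ⊥ ∨ U = ⊤

/-- `π` is the local component at the prime `p` of `Π_F ≅ ⊗' Π_{F,v}`: it is irreducible, and `Π_F`
is the tensor product of `π` with a representation of the adelic group away from `p`. (The tensor
product of the components at the other places is such a representation; and `π` is determined up
to isomorphism, because `Π_F` is a direct sum of copies of `π` as a representation of
`GL₂(B_p)`.) -/
def IsLocalComponent (F : GLH ℝ → ℂ) (p : Nat.Primes) {V : Type*} [AddCommGroup V] [Module ℂ V]
    (π : Representation ℂ (Gp p) V) : Prop :=
  π.IsIrreducible ∧ ∃ (W : Type) (_ : AddCommGroup W) (_ : Module ℂ W)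
    (e : (V ⊗[ℂ] W) ≃ₗ[ℂ] autRep F),
    (∀ g v w, (e (π g v ⊗ₜ w) : GA → ℂ) = rightRegular GA (1, atPrime p g) (e (v ⊗ₜ w))) ∧
    (∀ h : Gfin, h p = 1 → ∃ T : W →ₗ[ℂ] W, ∀ v w,
      (e (v ⊗ₜ T w) : GA → ℂ) = rightRegular GA (1, h) (e (v ⊗ₜ w))) ∧
    (∀ k ∈ maxCompact, ∃ T : W →ₗ[ℂ] W, ∀ v w,
      (e (v ⊗ₜ T w) : GA → ℂ) = rightRegular GA (k, 1) (e (v ⊗ₜ w))) ∧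
    ∀ X, ∃ T : W →ₗ[ℂ] W, ∀ v w, (e (v ⊗ₜ T w) : GA → ℂ) = lieDerivA X (e (v ⊗ₜ w))

/-- `π` is the archimedean component of `Π_F`: it is irreducible, and `Π_F` is the tensor product of
`π` with a representation of the finite adelic group. -/
def IsLocalComponentInfty (F : GLH ℝ → ℂ) {V : Type*} [AddCommGroup V] [Module ℂ V]
    (π : GKModule V) : Prop :=
  π.IsIrreducible ∧ ∃ (W : Type) (_ : AddCommGroup W) (_ : Module ℂ W)
    (e : (V ⊗[ℂ] W) ≃ₗ[ℂ] autRep F),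
    (∀ k v w, (e (π.act k v ⊗ₜ w) : GA → ℂ) = rightRegular GA (k, 1) (e (v ⊗ₜ w))) ∧
    (∀ X v w, (e (π.lie X v ⊗ₜ w) : GA → ℂ) = lieDerivA X (e (v ⊗ₜ w))) ∧
    ∀ h : Gfin, ∃ T : W →ₗ[ℂ] W, ∀ v w,
      (e (v ⊗ₜ T w) : GA → ℂ) = rightRegular GA (1, h) (e (v ⊗ₜ w))

/-! ### Principal series of `GL₂(B_p)` -/

/-- Unramified characters of `B_p^×`: those that are trivial on `𝓞_p^×`. -/
def IsUnramified (p : Nat.Primes) (χ : ℍ[ℚ_[p]]ˣ →* ℂˣ) : Prop :=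
  ∀ a ∈ (hurwitz ℤ_[p] ℚ_[p]).toSubmonoid.units, χ a = 1

/-- The principal congruence subgroup of level `p ^ n` in `GL₂(𝓞_p)`; these subgroups are a
neighbourhood basis of `1` in `GL₂(B_p)`. -/
def congruence (p : Nat.Primes) (n : ℕ) : Set (Gp p) :=
  {u | u ∈ Kp p ∧ ∃ m ∈ (hurwitz ℤ_[p] ℚ_[p]).matrix (n := Fin 2),
    u.val = 1 + ((p : ℕ) ^ n : ℕ) • m}

lemma congruence_anti (p : Nat.Primes) {m n : ℕ} (h : m ≤ n) :
    congruence p n ⊆ congruence p m := by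
  rintro u ⟨hu, x, hx, hux⟩
  refine ⟨hu, ((p : ℕ) ^ (n - m) : ℕ) • x, nsmul_mem hx _, ?_⟩
  rw [hux, smul_smul, ← pow_add, Nat.add_sub_cancel' h]

lemma exists_pow_smul_mem (p : Nat.Primes) (x : ℍ[ℚ_[p]]) :
    ∃ N : ℕ, ∀ n ≥ N, ((p : ℕ) ^ n : ℕ) • x ∈ hurwitz ℤ_[p] ℚ_[p] := by
  have key : ∀ c : ℚ_[p], ∃ N : ℕ, ∀ n ≥ N, ‖((p : ℕ) : ℚ_[p]) ^ n * c‖ ≤ 1 := by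
    intro c
    have h : Filter.Tendsto (fun n : ℕ => ((p : ℕ) : ℚ_[p]) ^ n * c) Filter.atTop (nhds 0) := by
      have := (tendsto_pow_atTop_nhds_zero_of_norm_lt_one
        (Padic.norm_p_lt_one (p := (p : ℕ)))).mul_const c
      simpa using this
    have h2 := h.norm.eventually (gt_mem_nhds (show ‖(0 : ℚ_[p])‖ < 1 by simp))
    obtain ⟨N, hN⟩ := Filter.eventually_atTop.1 h2
    exact ⟨N, fun n hn => (hN n hn).le⟩
  obtain ⟨N₀, h₀⟩ := key x.re
  obtain ⟨N₁, h₁⟩ := key x.imI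
  obtain ⟨N₂, h₂⟩ := key x.imJ
  obtain ⟨N₃, h₃⟩ := key x.imK
  refine ⟨N₀ + N₁ + N₂ + N₃, fun n hn => ?_⟩
  let a : ℤ_[p] := ⟨_, h₀ n (by omega)⟩
  let b : ℤ_[p] := ⟨_, h₁ n (by omega)⟩
  let c : ℤ_[p] := ⟨_, h₂ n (by omega)⟩
  let d : ℤ_[p] := ⟨_, h₃ n (by omega)⟩
  refine ⟨a - d, b - d, c - d, d + d, ?_⟩
  have e : ∀ z : ℤ_[p], algebraMap ℤ_[p] ℚ_[p] z = (z : ℚ_[p]) := fun _ => rfl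
  rw [← Nat.cast_smul_eq_nsmul ℚ_[p]]
  have ha : (a : ℚ_[p]) = ((p : ℕ) : ℚ_[p]) ^ n * x.re := rfl
  have hb : (b : ℚ_[p]) = ((p : ℕ) : ℚ_[p]) ^ n * x.imI := rfl
  have hc : (c : ℚ_[p]) = ((p : ℕ) : ℚ_[p]) ^ n * x.imJ := rfl
  have hd : (d : ℚ_[p]) = ((p : ℕ) : ℚ_[p]) ^ n * x.imK := rfl
  ext <;> simp [e, ← ha, ← hb, ← hc, ← hd]

lemma exists_pow_smul_mem_matrix (p : Nat.Primes) (x : Matrix (Fin 2) (Fin 2) ℍ[ℚ_[p]]) :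
    ∃ N : ℕ, ((p : ℕ) ^ N : ℕ) • x ∈ (hurwitz ℤ_[p] ℚ_[p]).matrix (n := Fin 2) := by
  choose N hN using fun (i j : Fin 2) => exists_pow_smul_mem p (x i j)
  refine ⟨N 0 0 + N 0 1 + N 1 0 + N 1 1, fun i j => hN i j _ ?_⟩
  fin_cases i <;> fin_cases j <;> simp <;> omega

lemma exists_conj_congruence (p : Nat.Primes) (h : Gp p) (n : ℕ) :
    ∃ m : ℕ, ∀ u ∈ congruence p m, h * u * h⁻¹ ∈ congruence p n := by
  obtain ⟨N, hN⟩ := exists_pow_smul_mem_matrix p h.val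
  obtain ⟨M, hM⟩ := exists_pow_smul_mem_matrix p (h⁻¹).val
  refine ⟨n + N + M, ?_⟩
  rintro u ⟨hu, x, hx, hux⟩
  set R := (hurwitz ℤ_[p] ℚ_[p]).matrix (n := Fin 2) with hR
  have hu' : (u⁻¹).val ∈ R := hu.2
  have hh : h.val * (h⁻¹).val = 1 := h.mul_inv
  have conj : ∀ (v : Gp p) (z : Matrix (Fin 2) (Fin 2) ℍ[ℚ_[p]]),
      v.val = 1 + ((p : ℕ) ^ (n + N + M) : ℕ) • z →
      (h * v * h⁻¹).val = 1 + ((p : ℕ) ^ n : ℕ) •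
        ((((p : ℕ) ^ N : ℕ) • h.val) * z * (((p : ℕ) ^ M : ℕ) • (h⁻¹).val)) := by
    intro v z hv
    rw [Units.val_mul, Units.val_mul, hv, mul_add, add_mul, mul_one, hh]
    simp only [smul_mul_assoc, mul_smul_comm, smul_smul, pow_add]
    congr 2
    ring
  have inv : (u⁻¹).val = 1 + ((p : ℕ) ^ (n + N + M) : ℕ) • (-(x * (u⁻¹).val)) := by
    have h1 : u.val * (u⁻¹).val = 1 := u.mul_inv
    rw [hux, add_mul, one_mul, smul_mul_assoc] at h1
    rw [smul_neg, ← sub_eq_add_neg]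
    exact eq_sub_of_add_eq h1
  have mem : ∀ z ∈ R, 1 + ((p : ℕ) ^ n : ℕ) •
        ((((p : ℕ) ^ N : ℕ) • h.val) * z * (((p : ℕ) ^ M : ℕ) • (h⁻¹).val)) ∈ R := fun z hz =>
    R.add_mem R.one_mem (nsmul_mem (R.mul_mem (R.mul_mem hN hz) hM) _)
  refine ⟨⟨?_, ?_⟩, _, R.mul_mem (R.mul_mem hN hx) hM, conj u x hux⟩
  · change (h * u * h⁻¹).val ∈ R
    rw [conj u x hux]
    exact mem x hx
  · have e : (h * u * h⁻¹)⁻¹ = h * u⁻¹ * h⁻¹ := by simp [mul_assoc]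
    change ((h * u * h⁻¹)⁻¹).val ∈ R
    rw [e, conj u⁻¹ _ inv]
    exact mem _ (R.neg_mem (R.mul_mem hx hu'))

/-- The (normalized) induced representation `Ind(χ₁ × χ₂)` from the upper triangular matrices to
`GL₂(B_p)`: the smooth functions `f` with `f(b g) = δ(b)^{1/2} χ₁(a) χ₂(d) f(g)` for `b` with rows
`(a, x)` and `(0, d)`, where `δ(b)^{1/2} = |ν(a d⁻¹)|_p`. The group acts by right translation. -/
def principalSeries (p : Nat.Primes) (χ₁ χ₂ : ℍ[ℚ_[p]]ˣ →* ℂˣ) :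
    Subrepresentation (rightRegular (Gp p)) where
  toSubmodule :=
    { carrier := {f | (∀ a d x g, f (upper a d x * g) =
        ((‖Quaternion.normSq (a : ℍ[ℚ_[p]])‖ / ‖Quaternion.normSq (d : ℍ[ℚ_[p]])‖ : ℝ) : ℂ) *
          (χ₁ a : ℂ) * (χ₂ d : ℂ) * f g) ∧
        ∃ n, ∀ u ∈ congruence p n, ∀ g, f (g * u) = f g}
      zero_mem' := ⟨by simp, 0, by simp⟩
      add_mem' := by
        rintro f f' ⟨hf, n, hn⟩ ⟨hf', n', hn'⟩
        refine ⟨fun a d x g => ?_, n + n', fun u hu g => ?_⟩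
        · simp only [Pi.add_apply, hf, hf']
          ring
        · simp only [Pi.add_apply, hn u (congruence_anti p (by omega) hu),
            hn' u (congruence_anti p (by omega) hu)]
      smul_mem' := by
        rintro c f ⟨hf, n, hn⟩
        refine ⟨fun a d x g => ?_, n, fun u hu g => ?_⟩
        · simp only [Pi.smul_apply, hf, smul_eq_mul]
          ring
        · simp only [Pi.smul_apply, hn u hu] }
  apply_mem_toSubmodule h f := by
    rintro ⟨hf, n, hn⟩
    obtain ⟨m, hm⟩ := exists_conj_congruence p h⁻¹ n
    refine ⟨fun a d x g => ?_, m, fun u hu g => ?_⟩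
    · rw [rightRegular_apply, rightRegular_apply, mul_assoc, hf]
    · rw [rightRegular_apply, rightRegular_apply, ← hn _ (hm u hu) (g * h)]
      simp only [mul_assoc, inv_inv, mul_inv_cancel_left]

/-- `π` is an irreducible constituent of `ρ`: an irreducible quotient of a subrepresentation. -/
def IsConstituent {G U V : Type*} [Group G] [AddCommGroup U] [Module ℂ U] [AddCommGroup V]
    [Module ℂ V] (ρ : Representation ℂ G U) (π : Representation ℂ G V) : Prop :=
  π.IsIrreducible ∧ ∃ (B : Subrepresentation ρ)
    (f : Representation.IntertwiningMap B.toRepresentation π), Function.Surjective f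

/-- `π` is, up to isomorphism, the unique irreducible constituent of `ρ`. -/
def IsUniqueConstituent {G U : Type} {V : Type*} [Group G] [AddCommGroup U] [Module ℂ U]
    [AddCommGroup V] [Module ℂ V] (ρ : Representation ℂ G U) (π : Representation ℂ G V) : Prop :=
  IsConstituent ρ π ∧ ∀ (V' : Type) [AddCommGroup V'] [Module ℂ V']
    (π' : Representation ℂ G V'), IsConstituent ρ π' → Nonempty (π'.Equiv π)

/-! ### Principal series of `GL₂(ℍ)` -/

lemma isSmooth_zero : IsSmooth 0 := by
  have : extend (0 : GLH ℝ → ℂ) = 0 := by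
    ext A
    simp [extend]
  rw [IsSmooth, this]
  exact contDiffOn_const

lemma IsSmooth.add {f f' : GLH ℝ → ℂ} (h : IsSmooth f) (h' : IsSmooth f') :
    IsSmooth (f + f') := by
  have : extend (f + f') = extend f + extend f' := by
    ext A
    by_cases hA : IsUnit (Matrix.of A) <;> simp [extend, hA]
  rw [IsSmooth, this]
  exact ContDiffOn.add h h'

lemma IsSmooth.smul {f : GLH ℝ → ℂ} (h : IsSmooth f) (c : ℂ) : IsSmooth (c • f) := by
  have : extend (c • f) = c • extend f := by
    ext A
    by_cases hA : IsUnit (Matrix.of A) <;> simp [extend, hA]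
  rw [IsSmooth, this]
  exact ContDiffOn.const_smul c h

/-- `f` is right `K`-finite: its right translates by `K` span a space of finite dimension. -/
def IsKFinite (f : GLH ℝ → ℂ) : Prop :=
  Module.Finite ℂ (Submodule.span ℂ
    (Set.range fun k : maxCompact => rightRegular (GLH ℝ) (k : GLH ℝ) f))

lemma isKFinite_of_le {f : GLH ℝ → ℂ} (U : Submodule ℂ (GLH ℝ → ℂ)) [Module.Finite ℂ U]
    (h : ∀ k : maxCompact, rightRegular (GLH ℝ) (k : GLH ℝ) f ∈ U) : IsKFinite f :=
  Submodule.finiteDimensional_of_le (Submodule.span_le.2 (by rintro _ ⟨k, rfl⟩; exact h k))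

/-- The space of `K`-finite vectors in the (normalized) induced representation `Ind(χ_s)` from the
upper triangular matrices to `GL₂(ℍ)`, where `χ_s(b) = ν(a d⁻¹) ^ s` for `b` with rows `(a, x)` and
`(0, d)`: the smooth `K`-finite functions `f` with `f(b g) = δ(b)^{1/2} χ_s(b) f(g)`, where
`δ(b)^{1/2} = ν(a d⁻¹)`. -/
def principalSeriesInfty (s : ℂ) : Submodule ℂ (GLH ℝ → ℂ) where
  carrier := {f | IsSmooth f ∧ IsKFinite f ∧ ∀ (a d : ℍ[ℝ]ˣ) x g, f (upper a d x * g) =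
    ((Quaternion.normSq ((a * d⁻¹ : ℍ[ℝ]ˣ) : ℍ[ℝ]) : ℝ) : ℂ) *
      ((Quaternion.normSq ((a * d⁻¹ : ℍ[ℝ]ˣ) : ℍ[ℝ]) : ℝ) : ℂ) ^ s * f g}
  zero_mem' := ⟨isSmooth_zero, isKFinite_of_le ⊥ (by simp), by simp⟩
  add_mem' := by
    rintro f f' ⟨hs, hk, hf⟩ ⟨hs', hk', hf'⟩
    refine ⟨hs.add hs', ?_, fun a d x g => ?_⟩
    · have : Module.Finite ℂ _ := hk
      have : Module.Finite ℂ _ := hk'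
      refine isKFinite_of_le (Submodule.span ℂ
        (Set.range fun k : maxCompact => rightRegular (GLH ℝ) (k : GLH ℝ) f) ⊔ Submodule.span ℂ
        (Set.range fun k : maxCompact => rightRegular (GLH ℝ) (k : GLH ℝ) f')) fun k => ?_
      rw [map_add]
      exact Submodule.add_mem_sup (Submodule.subset_span ⟨k, rfl⟩)
        (Submodule.subset_span ⟨k, rfl⟩)
    · simp only [Pi.add_apply, hf, hf']
      ring
  smul_mem' := by
    rintro c f ⟨hs, hk, hf⟩
    refine ⟨hs.smul c, ?_, fun a d x g => ?_⟩
    · have : Module.Finite ℂ _ := hk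
      refine isKFinite_of_le (Submodule.span ℂ
        (Set.range fun k : maxCompact => rightRegular (GLH ℝ) (k : GLH ℝ) f)) fun k => ?_
      rw [map_smul]
      exact Submodule.smul_mem _ _ (Submodule.subset_span ⟨k, rfl⟩)
    · simp only [Pi.smul_apply, hf, smul_eq_mul]
      ring

/-- The `(𝔤, K)`-module `π` is isomorphic to `Ind(χ_s)`, on which `K` acts by right translation and
the Lie algebra by differentiation. -/
def IsoPrincipalSeriesInfty {V : Type*} [AddCommGroup V] [Module ℂ V] (π : GKModule V)
    (s : ℂ) : Prop :=
  ∃ e : V ≃ₗ[ℂ] principalSeriesInfty s,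
    (∀ (k : maxCompact) v, (e (π.act k v) : GLH ℝ → ℂ) = rightRegular (GLH ℝ) k (e v)) ∧
    ∀ X v, (e (π.lie X v) : GLH ℝ → ℂ) = lieDeriv X (e v)

end QuatMaass

end

/-!
Both halves follow one pattern. Under the group at one place (or under `𝔤` and `K`) the function
`Φ_F` is a vector of class one: fixed by the maximal compact subgroup, with a known eigenvalue for
the one operator that matters. There is a model of the irreducible module with such a vector, and it
maps to every module with a vector of the same kind. The operators at the other places commute with
the group, so `Π_F`, which they generate from `Φ_F` together with the group, is a sum of images of
the model. Linear algebra for families of operators then writes `Π_F` as the model tensored with a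
multiplicity space on which the other operators act (`exists_tensor_decomposition`), and shows that
every local component is isomorphic to the model (`exists_equiv_of_opHom`). It needs only that the
model is simple and that its endomorphisms are scalars.

*At two.* The scalar `ϖ₂` acts trivially on `Φ_F`, since the coefficients `A(β)` and `A(ϖ₂⁻¹ β ϖ₂)`
agree. The Hecke operator of `diag(ϖ₂, 1)` is a sum over five cosets. On Fourier coefficients its
eigenvalue equation relates `A(β ϖ₂)`, `A(ϖ₂⁻¹ β)` and `A(β)` (`hecke_coefficient`), and the Maass
recurrence, which is of the same shape, gives the eigenvalue `6 α` with `α = -ε / √2`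
(`coefficient_recurrence`). Since `α² = 1 / 2`, the principal series consists of functions with `f
(b g) = α ^ (v(a) - v(d)) f g` (`IsTwist`). Translates of a spherical vector are indexed by the
vertices of the tree of `GL₂(B_2)`, that is, by the balls of `B_2`. Let `[b, k]` belong to the ball
`b + ϖ₂ ^ k 𝓞_2`. In the principal series `[b, k - 1] - 2 α [b, k]` is supported, on the boundary of
the tree, on this ball, and in every representation the Hecke relation makes it a combination of the
same vectors for the four balls of the next radius. So a vector of the representation generated by a
spherical vector is determined by its boundary values, which is the universal property
(`IsTwist.exists_intertwining`). For irreducibility (`IsTwist.spherVec_mem`), the sum of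
translations by four of the cosets contracts a nonzero function into the span of `[0, 0]` and `[0, -1]`.
It leaves a multiple of `4 α [0, 0] - [0, -1]`, and the Weyl element and `(4 α)² = 8 ≠ 1`
recover `[0, 0]`.

*At infinity.* Put `X_i = D (cliff i)`, where the five matrices `cliff i` are a basis of the
hermitian part of `𝔰𝔩₂(ℍ)` and satisfy the Clifford relations. On functions invariant under `K` and
`Z⁺` the Casimir operator is a multiple of `∑ X_i²`. The module generated by a class-one vector is
filtered by the length of words in the `X_i`. On the graded pieces, `∑ X_i²` has the eigenvalues
`lam - 4 n (n + 3)`, and by comparing neighbouring pieces every nonzero submodule contains the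
generator (`vec_mem`), except when `r² = -(n + 1)²` for some `n ≥ 1`. Simplicity and the universal
property follow (`IsSphericalInfty.exists_intertwining`). The spherical vector `sphFun s` of
`Ind(χ_s)` has the eigenvalue `16 s² - 16`, which is even in `s`, whence both signs in the
conclusion. It generates the functions `p(ω) * sphFun s` with `p` a polynomial in the coordinates
`ω` of the sphere `S⁴`. By the Stone–Weierstrass theorem and the orthogonality of the eigenspaces of
the Casimir operator of `K`, these exhaust the `K`-finite vectors (`mem_sphSpan`).

The exceptional values do not occur for cusp forms (`spectralParameter_ne`): `F` would be bounded,
decay at the cusp, and have a nonnegative eigenvalue under the Laplacian of hyperbolic space,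
against the maximum principle.
-/

noncomputable section

namespace QuatMaass

open Quaternion Module
open Finset (sum_congr sum_add_distrib mul_sum sum_sub_distrib sum_eq_zero smul_sum sum_mul
  mem_univ sum_neg_distrib sum_ite_eq sum_ite_eq' sum_comm)
open Submodule (span span_le subset_span smul_mem mem_span_singleton mem_comap mem_sInf
  mem_sup_right mem_sup_left coe_sum span_induction mem_iSup_of_mem map_span span_mono mem_top
  mem_map_of_mem)
open Matrix (single mul_apply star_apply of_apply cons_val' cons_val_zero cons_val_one
  cons_val_fin_one one_apply_eq)

/-! ### Isotypic decompositions for families of operators -/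

section Isotypic

variable {J : Type*} {V M V' : Type*} [AddCommGroup V] [Module ℂ V] [AddCommGroup M] [Module ℂ M]
  [AddCommGroup V'] [Module ℂ V']

/-- Simplicity of a vector space with respect to a family of operators. -/
def OpSimple (ρ : J → End ℂ V) : Prop :=
  Nontrivial V ∧ ∀ U : Submodule ℂ V, (∀ j, ∀ v ∈ U, ρ j v ∈ U) → U = ⊥ ∨ U = ⊤

/-- The space of linear maps which intertwine two families of operators. -/
def opHom (ρ : J → End ℂ V) (τ : J → End ℂ M) : Submodule ℂ (V →ₗ[ℂ] M) where
  carrier := {φ | ∀ j v, φ (ρ j v) = τ j (φ v)}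
  zero_mem' := by simp
  add_mem' := by intro φ ψ hφ hψ j v; simp [hφ j v, hψ j v]
  smul_mem' := by intro c φ hφ j v; simp [hφ j v]

/-- A form of the density theorem: intertwining maps out of a simple space with scalar
endomorphisms which are linearly independent have independent ranges. -/
lemma opHom_sum_eq_zero {ρ : J → End ℂ V} {τ : J → End ℂ M} (hρ : OpSimple ρ)
    (schur : ∀ φ ∈ opHom ρ ρ, ∃ c : ℂ, φ = c • LinearMap.id) {n : ℕ} (φ : Fin n → opHom ρ τ)
    (hφ : LinearIndependent ℂ φ) (v : Fin n → V) (h : ∑ i, (φ i).1 (v i) = 0) : v = 0 := by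
  induction n with
  | zero => exact Subsingleton.elim _ _
  | succ n ih =>
    obtain ⟨hl, hn⟩ := linearIndependent_finSucc.1 hφ
    let L : (Fin n → V) →ₗ[ℂ] M := ∑ i, (φ i.succ).1 ∘ₗ LinearMap.proj i
    have hL : ∀ w, L w = ∑ i, (φ i.succ).1 (w i) := fun w => by simp [L]
    have hinj : Function.Injective L :=
      (injective_iff_map_eq_zero L).2 fun w hw => ih _ hl w (by rw [← hw, hL]; rfl)
    have hop : ∀ j w, L (fun i => ρ j (w i)) = τ j (L w) := fun j w => by
      simp only [hL, map_sum, (φ _).2 j _]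
    rw [Fin.sum_univ_succ] at h
    have hL0 := hL fun i => v i.succ
    rw [← hL0] at h
    rcases hρ.2 ((LinearMap.range L).comap (φ 0).1) (by
      rintro j u ⟨w, hw⟩
      exact ⟨_, (hop j w).trans (by rw [hw, (φ 0).2])⟩) with hU | hU
    · have h0 : v 0 ∈ (LinearMap.range L).comap (φ 0).1 :=
        ⟨-fun i => v i.succ, by rw [map_neg]; exact (eq_neg_of_add_eq_zero_left h).symm⟩
      rw [hU] at h0
      have h0 : v 0 = 0 := h0
      rw [h0, map_zero, zero_add] at h
      have := hinj (h.trans (map_zero L).symm)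
      exact funext fun i => Fin.cases h0 (fun i => congrFun this i) i
    · have hr : ∀ u, (φ 0).1 u ∈ LinearMap.range L := fun u =>
        (hU ▸ mem_top : u ∈ (LinearMap.range L).comap (φ 0).1)
      let κ : V →ₗ[ℂ] Fin n → V :=
        (LinearEquiv.ofInjective L hinj).symm.toLinearMap ∘ₗ (φ 0).1.codRestrict _ hr
      have hκ : ∀ u, L (κ u) = (φ 0).1 u := fun u =>
        congrArg Subtype.val ((LinearEquiv.ofInjective L hinj).apply_symm_apply ⟨_, hr u⟩)
      have hc : ∀ i, ∃ c : ℂ, LinearMap.proj i ∘ₗ κ = c • LinearMap.id := fun i =>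
        schur _ fun j u => congrFun (hinj (by rw [hκ, (φ 0).2, hop, hκ]) :
          κ (ρ j u) = fun i => ρ j (κ u i)) i
      choose c hc using hc
      refine absurd ?_ hn
      have : φ 0 = ∑ i, c i • φ i.succ := by
        ext u
        rw [← hκ, hL]
        simp only [coe_sum, LinearMap.sum_apply, Submodule.coe_smul, LinearMap.smul_apply]
        exact sum_congr rfl fun i _ => (congrArg _ (LinearMap.congr_fun (hc i) u)).trans (map_smul _ _ _)
      rw [this]
      exact sum_mem fun i _ => smul_mem _ _ (subset_span ⟨i, rfl⟩)

/-- The evaluation map `V ⊗ Hom(V, M) → M`. -/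
def opEval (ρ : J → End ℂ V) (τ : J → End ℂ M) : V ⊗[ℂ] opHom ρ τ →ₗ[ℂ] M :=
  TensorProduct.lift (LinearMap.flip (opHom ρ τ).subtype)

lemma opEval_bijective {ρ : J → End ℂ V} {τ : J → End ℂ M} (hρ : OpSimple ρ)
    (schur : ∀ φ ∈ opHom ρ ρ, ∃ c : ℂ, φ = c • LinearMap.id)
    (hM : ⨆ φ : opHom ρ τ, LinearMap.range φ.1 = ⊤) : Function.Bijective (opEval ρ τ) := by
  classical
  constructor
  · rw [← LinearMap.ker_eq_bot, LinearMap.ker_eq_bot']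
    intro x hx
    let B := Basis.ofVectorSpace ℂ (opHom ρ τ)
    let E := TensorProduct.equivFinsuppOfBasisRight (M := V) B
    have h1 : x = (E x).sum fun i v => v ⊗ₜ B i := by
      conv_lhs => rw [← E.symm_apply_apply x]
      rw [TensorProduct.equivFinsuppOfBasisRight_symm_apply]
    rw [h1, Finsupp.sum, map_sum] at hx
    let f := (E x).support.equivFin.symm
    have := opHom_sum_eq_zero hρ schur (fun k => B (f k)) (B.linearIndependent.comp _
      (Subtype.val_injective.comp f.injective)) (fun k => E x (f k)) (by
        rw [f.sum_comp fun i => (B i).1 (E x i),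
          Finset.sum_coe_sort _ fun i => (B i).1 (E x i)]
        exact hx)
    rw [h1, Finsupp.sum]
    exact sum_eq_zero fun i hi => by
      have h := congrFun this (f.symm ⟨i, hi⟩)
      rw [f.apply_symm_apply] at h
      rw [show E x i = 0 from h, TensorProduct.zero_tmul]
  · rw [← LinearMap.range_eq_top, eq_top_iff, ← hM, iSup_le_iff]
    rintro φ _ ⟨v, rfl⟩
    exact ⟨v ⊗ₜ φ, rfl⟩

/-- The tensor decomposition of an isotypic space, together with the factorization of the operators
which commute with the given family. -/
lemma exists_tensor_decomposition {V M : Type} [AddCommGroup V] [Module ℂ V] [AddCommGroup M]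
    [Module ℂ M] {ρ : J → End ℂ V} {τ : J → End ℂ M} (hρ : OpSimple ρ)
    (schur : ∀ φ ∈ opHom ρ ρ, ∃ c : ℂ, φ = c • LinearMap.id)
    (hM : ⨆ φ : opHom ρ τ, LinearMap.range φ.1 = ⊤) :
    ∃ (W : Type) (_ : AddCommGroup W) (_ : Module ℂ W) (e : (V ⊗[ℂ] W) ≃ₗ[ℂ] M),
      (∀ j v w, e (ρ j v ⊗ₜ w) = τ j (e (v ⊗ₜ w))) ∧
      ∀ T ∈ opHom τ τ, ∃ T' : W →ₗ[ℂ] W, ∀ v w, e (v ⊗ₜ T' w) = T (e (v ⊗ₜ w)) := by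
  refine ⟨opHom ρ τ, inferInstance, inferInstance,
    LinearEquiv.ofBijective _ (opEval_bijective hρ schur hM), fun j v w => ?_, fun T hT => ?_⟩
  · exact w.2 j v
  · refine ⟨LinearMap.restrict (LinearMap.compRight ℂ T) (fun φ hφ j v => ?_), fun v w => ?_⟩
    · simp [hφ j v, hT j]
    · rfl

/-- A simple space which maps to an isotypic space of type `V` is isomorphic to `V`. -/
lemma exists_equiv_of_opHom {ρ : J → End ℂ V} {τ : J → End ℂ M}
    {ρ' : J → End ℂ V'} (hρ : OpSimple ρ)
    (schur : ∀ φ ∈ opHom ρ ρ, ∃ c : ℂ, φ = c • LinearMap.id)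
    (hM : ⨆ φ : opHom ρ τ, LinearMap.range φ.1 = ⊤) (hρ' : OpSimple ρ')
    (ψ : opHom ρ' τ) (hψ : ψ ≠ 0) :
    ∃ e : V' ≃ₗ[ℂ] V, ∀ j v, e (ρ' j v) = ρ j (e v) := by
  classical
  obtain ⟨v₀, hv₀⟩ : ∃ v, ψ.1 v ≠ 0 := by
    by_contra! h
    exact hψ (Subtype.ext (LinearMap.ext h))
  let e := LinearEquiv.ofBijective _ (opEval_bijective hρ schur hM)
  have he : ∀ j x, e.symm (τ j (e x)) = TensorProduct.map (ρ j) LinearMap.id x := by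
    intro j x
    rw [LinearEquiv.symm_apply_eq]
    induction x using TensorProduct.induction_on with
    | zero => simp
    | tmul v w => exact (w.2 j v).symm
    | add x y hx hy => rw [map_add, map_add, hx, hy, map_add, map_add]
  let B := Basis.ofVectorSpace ℂ (opHom ρ τ)
  let E := TensorProduct.equivFinsuppOfBasisRight (M := V) B
  have hE : ∀ j x i, E (TensorProduct.map (ρ j) LinearMap.id x) i = ρ j (E x i) := by
    intro j x i
    induction x using TensorProduct.induction_on with
    | zero => simp
    | tmul v w => simp [E, TensorProduct.equivFinsuppOfBasisRight_apply_tmul]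
    | add x y hx hy => simp [hx, hy]
  obtain ⟨i, hi⟩ : ∃ i, E (e.symm (ψ.1 v₀)) i ≠ 0 := by
    by_contra! h
    apply hv₀
    have : E (e.symm (ψ.1 v₀)) = 0 := Finsupp.ext h
    simpa using this
  let κ : V' →ₗ[ℂ] V := Finsupp.lapply i ∘ₗ E.toLinearMap ∘ₗ e.symm.toLinearMap ∘ₗ ψ.1
  have hκ : ∀ j v, κ (ρ' j v) = ρ j (κ v) := by
    intro j v
    change E (e.symm (ψ.1 (ρ' j v))) i = ρ j (E (e.symm (ψ.1 v)) i)
    rw [ψ.2 j v, ← hE, ← he, LinearEquiv.apply_symm_apply]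
  have hk : LinearMap.ker κ = ⊥ := by
    refine (hρ'.2 (LinearMap.ker κ) fun j v hv => ?_).resolve_right fun h => hi ?_
    · rw [LinearMap.mem_ker] at hv ⊢
      rw [hκ, hv, map_zero]
    · have : v₀ ∈ LinearMap.ker κ := h ▸ mem_top
      exact this
  have hr : LinearMap.range κ = ⊤ := by
    refine (hρ.2 (LinearMap.range κ) ?_).resolve_left fun h => hi ?_
    · rintro j _ ⟨v, rfl⟩
      exact ⟨_, hκ j v⟩
    · have : κ v₀ ∈ LinearMap.range κ := ⟨_, rfl⟩
      rw [h] at this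
      exact (Submodule.mem_bot ℂ).1 this
  exact ⟨LinearEquiv.ofBijective κ ⟨LinearMap.ker_eq_bot.1 hk, LinearMap.range_eq_top.1 hr⟩, hκ⟩

end Isotypic

/-! ### The quaternion division algebra over `ℚ_2` -/

lemma normSq_isUnit_of_ne {K : Type} [Field K] {x : ℍ[K]} (h : normSq x ≠ 0) :
    ∃ u : ℍ[K]ˣ, (u : ℍ[K]) = x ∧ ((u⁻¹ : ℍ[K]ˣ) : ℍ[K]) = (normSq x)⁻¹ • star x := by
  refine ⟨⟨x, (normSq x)⁻¹ • star x, ?_, ?_⟩, rfl, rfl⟩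
  · rw [mul_smul_comm, self_mul_star, ← coe_mul_eq_smul,
      ← coe_mul, inv_mul_cancel₀ h, coe_one]
  · rw [smul_mul_assoc, star_mul_self, ← coe_mul_eq_smul,
      ← coe_mul, inv_mul_cancel₀ h, coe_one]

lemma normSq_ne_zero_of_mul {K : Type} [Field K] {x y : ℍ[K]} (h : x * y = 1) :
    normSq x ≠ 0 ∧ normSq y ≠ 0 := by
  have := congrArg normSq h
  rw [map_mul, map_one] at this
  exact ⟨left_ne_zero_of_mul_eq_one this, right_ne_zero_of_mul_eq_one this⟩

lemma normSq_unit_ne {K : Type} [Field K] (u : ℍ[K]ˣ) : normSq (u : ℍ[K]) ≠ 0 :=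
  (normSq_ne_zero_of_mul u.mul_inv).1

lemma normSq_eq {K : Type} [Field K] (x : ℍ[K]) :
    normSq x = x.re ^ 2 + x.imI ^ 2 + x.imJ ^ 2 + x.imK ^ 2 := normSq_def' x

lemma mem_hurwitz_padic_iff {p : Nat.Primes} (x : ℍ[ℚ_[p]]) :
    x ∈ hurwitz ℤ_[p] ℚ_[p] ↔ ‖2 * x.imK‖ ≤ 1 ∧ ‖x.re - x.imK‖ ≤ 1 ∧ ‖x.imI - x.imK‖ ≤ 1 ∧
      ‖x.imJ - x.imK‖ ≤ 1 := by
  constructor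
  · rintro ⟨a, b, c, d, rfl⟩
    have e : ∀ z : ℤ_[p], algebraMap ℤ_[p] ℚ_[p] z = (z : ℚ_[p]) := fun _ => rfl
    simp only [quat_re, quat_imI, quat_imJ, quat_imK, e, add_sub_cancel_right]
    refine ⟨?_, a.2, b.2, c.2⟩
    rw [mul_div_cancel₀ _ two_ne_zero]
    exact d.2
  · rintro ⟨hd, ha, hb, hc⟩
    have e : ∀ z : ℤ_[p], algebraMap ℤ_[p] ℚ_[p] z = (z : ℚ_[p]) := fun _ => rfl
    have lift : ∀ z : ℚ_[p], ‖z‖ ≤ 1 → ∃ w : ℤ_[p], (w : ℚ_[p]) = z := fun z hz => ⟨⟨z, hz⟩, rfl⟩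
    obtain ⟨a, ha⟩ := lift _ ha
    obtain ⟨b, hb⟩ := lift _ hb
    obtain ⟨c, hc⟩ := lift _ hc
    obtain ⟨d, hd⟩ := lift _ hd
    refine ⟨a, b, c, d, ?_⟩
    simp only [e, ha, hb, hc, hd]
    ext <;> simp

/-- The absolute value of the reduced norm on the quaternion division algebra at two. -/
def nrm (x : ℍ[ℚ_[two]]) : ℝ := ‖normSq x‖

lemma nrm_mul (x y : ℍ[ℚ_[two]]) : nrm (x * y) = nrm x * nrm y := by
  simp [nrm]

lemma nrm_one : nrm 1 = 1 := by simp [nrm]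

lemma nrm_zero : nrm 0 = 0 := by simp [nrm]

lemma nrm_neg (x : ℍ[ℚ_[two]]) : nrm (-x) = nrm x := by simp [nrm]

lemma nrm_nonneg (x : ℍ[ℚ_[two]]) : 0 ≤ nrm x := norm_nonneg _

lemma norm_two_padic : ‖(2 : ℚ_[two])‖ = 1 / 2 := by
  have := Padic.norm_p (p := (two : ℕ))
  have h2 : ((two : ℕ) : ℚ_[two]) = 2 := by
    change ((2 : ℕ) : ℚ_[two]) = 2
    norm_num
  rw [h2] at this
  rw [this]
  change ((2 : ℕ) : ℝ)⁻¹ = 1 / 2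
  norm_num

lemma nrm_varpi : nrm (varpi ℚ_[two]) = 1 / 2 := by
  rw [nrm, normSq_eq, ← norm_two_padic]
  simp [varpi]
  norm_num

/-- The maximal order at two, as a subring. -/
abbrev O2 : Subring ℍ[ℚ_[two]] := hurwitz ℤ_[two] ℚ_[two]

lemma z2_even_or_odd (z : ℤ_[two]) : (∃ w, z = 2 * w) ∨ ∃ w, z = 2 * w + 1 := by
  have h2 : ((two : ℕ) : ℤ_[two]) = 2 := by
    change ((2 : ℕ) : ℤ_[two]) = 2
    norm_num
  obtain ⟨n, hn, hmem⟩ := PadicInt.exists_mem_range z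
  rw [PadicInt.maximalIdeal_eq_span_p, Ideal.mem_span_singleton, h2] at hmem
  obtain ⟨w, hw⟩ := hmem
  have hn2 : n < 2 := hn
  interval_cases n
  · exact Or.inl ⟨w, by simpa using hw⟩
  · exact Or.inr ⟨w, by rw [← hw]; simp⟩

/-- An integral quaternion is divisible by `ϖ₂` or has a unit as its norm. -/
lemma O2_dvd_or_unit {x : ℍ[ℚ_[two]]} (hx : x ∈ O2) :
    (∃ y ∈ O2, x = varpi ℚ_[two] * y) ∨ nrm x = 1 := by
  obtain ⟨a, b, c, d, rfl⟩ := hx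
  have e : ∀ z : ℤ_[two], algebraMap ℤ_[two] ℚ_[two] z = (z : ℚ_[two]) := fun _ => rfl
  have odd : ∀ w : ℤ_[two], ‖((2 * w + 1 : ℤ_[two]) : ℚ_[two])‖ = 1 := by
    intro w
    have h1 : ‖((2 * w : ℤ_[two]) : ℚ_[two])‖ < 1 := by
      have h2 : ((2 * w : ℤ_[two]) : ℚ_[two]) = 2 * (w : ℚ_[two]) := by push_cast; rfl
      rw [h2, norm_mul, norm_two_padic]
      have : ‖(w : ℚ_[two])‖ ≤ 1 := w.2
      linarith
    rw [PadicInt.coe_add, PadicInt.coe_one, IsUltrametricDist.norm_add_eq_max_of_norm_ne_norm (by rw [norm_one]; exact h1.ne),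
      norm_one, max_eq_right h1.le]
  have hn : normSq (quat (algebraMap ℤ_[two] ℚ_[two] a + algebraMap ℤ_[two] ℚ_[two] d / 2)
    (algebraMap ℤ_[two] ℚ_[two] b + algebraMap ℤ_[two] ℚ_[two] d / 2)
    (algebraMap ℤ_[two] ℚ_[two] c + algebraMap ℤ_[two] ℚ_[two] d / 2)
    (algebraMap ℤ_[two] ℚ_[two] d / 2)) =
    ((a ^ 2 + b ^ 2 + c ^ 2 + d ^ 2 + d * (a + b + c) : ℤ_[two]) : ℚ_[two]) := by
    rw [normSq_eq]
    simp only [quat_re, quat_imI, quat_imJ, quat_imK, e]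
    push_cast
    ring
  rcases z2_even_or_odd d with ⟨d', hd⟩ | ⟨d', hd⟩
  · rcases z2_even_or_odd (a + b + c) with ⟨s, hs⟩ | ⟨s, hs⟩
    · left
      refine ⟨_, ⟨s + d', b - s + c, c + d', -c, rfl⟩, ?_⟩
      have hs' : (a : ℚ_[two]) = 2 * s - b - c := by
        have := congrArg (fun z : ℤ_[two] => (z : ℚ_[two])) hs
        have h2 : ((2 * s : ℤ_[two]) : ℚ_[two]) = 2 * (s : ℚ_[two]) := by push_cast; rfl
        simp only [h2, PadicInt.coe_add] at this
        linear_combination this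
      have hd' : (d : ℚ_[two]) = 2 * d' := by
        rw [hd]
        push_cast
        rfl
      simp only [e, PadicInt.coe_add, PadicInt.coe_sub, PadicInt.coe_neg, hs', hd']
      ext <;> simp [varpi] <;> ring
    · right
      have key : a ^ 2 + b ^ 2 + c ^ 2 + d ^ 2 + d * (a + b + c) =
          2 * (2 * s ^ 2 + 2 * s - (a * b + a * c + b * c) + 2 * d' ^ 2 + d' * (2 * s + 1)) + 1 := by
        rw [hd]
        linear_combination (a + b + c + 2 * s + 1 + 2 * d') * hs
      rw [nrm, hn, key, odd]
  · right
    rw [nrm, hn]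
    rcases z2_even_or_odd (a + b + c) with ⟨s, hs⟩ | ⟨s, hs⟩
    · have key : a ^ 2 + b ^ 2 + c ^ 2 + d ^ 2 + d * (a + b + c) =
          2 * (2 * s ^ 2 - (a * b + a * c + b * c) + 2 * d' ^ 2 + 2 * d' + (2 * d' + 1) * s) + 1 := by
        rw [hd]
        linear_combination (a + b + c + 2 * s + 2 * d' + 1) * hs
      rw [key, odd]
    · have key : a ^ 2 + b ^ 2 + c ^ 2 + d ^ 2 + d * (a + b + c) =
          2 * (2 * s ^ 2 + 2 * s - (a * b + a * c + b * c) + 2 * d' ^ 2 + 2 * d' + 1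
            + (2 * d' + 1) * s + d') + 1 := by
        rw [hd]
        linear_combination (a + b + c + 2 * s + 2 * d' + 2) * hs
      rw [key, odd]

lemma O2_nrm_le {x : ℍ[ℚ_[two]]} (hx : x ∈ O2) : nrm x ≤ 1 := by
  obtain ⟨a, b, c, d, rfl⟩ := hx
  have e : ∀ z : ℤ_[two], algebraMap ℤ_[two] ℚ_[two] z = (z : ℚ_[two]) := fun _ => rfl
  have hn : normSq (quat (algebraMap ℤ_[two] ℚ_[two] a + algebraMap ℤ_[two] ℚ_[two] d / 2)
    (algebraMap ℤ_[two] ℚ_[two] b + algebraMap ℤ_[two] ℚ_[two] d / 2)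
    (algebraMap ℤ_[two] ℚ_[two] c + algebraMap ℤ_[two] ℚ_[two] d / 2)
    (algebraMap ℤ_[two] ℚ_[two] d / 2)) =
    ((a ^ 2 + b ^ 2 + c ^ 2 + d ^ 2 + d * (a + b + c) : ℤ_[two]) : ℚ_[two]) := by
    rw [normSq_eq]
    simp only [quat_re, quat_imI, quat_imJ, quat_imK, e]
    push_cast
    ring
  rw [nrm, hn]
  exact PadicInt.norm_le_one _

lemma star_mem_hurwitz {Z K : Type} [CommRing Z] [Field K] [CharZero K] [Algebra Z K] {x : ℍ[K]}
    (hx : x ∈ hurwitz Z K) : star x ∈ hurwitz Z K := by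
  obtain ⟨a, b, c, d, rfl⟩ := hx
  refine ⟨a + d, -b, -c, -d, ?_⟩
  ext <;> simp <;> ring

lemma varpi_mem {Z K : Type} [CommRing Z] [Field K] [CharZero K] [Algebra Z K] :
    varpi K ∈ hurwitz Z K := ⟨1, 1, 0, 0, by ext <;> simp [varpi]⟩

lemma varpiUnit_val {K : Type} [Field K] [CharZero K] : (varpiUnit K : ℍ[K]) = varpi K := rfl

lemma varpiUnit_pow_two_mul (k : ℕ) : ((varpiUnit ℚ_[two] ^ (2 * k) : ℍ[ℚ_[two]]ˣ) : ℍ[ℚ_[two]]) =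
      (2 : ℚ_[two]) ^ k • ((quat 0 1 0 0 : ℍ[ℚ_[two]]) ^ k) := by
  have : ((varpiUnit ℚ_[two] ^ 2 : ℍ[ℚ_[two]]ˣ) : ℍ[ℚ_[two]]) = (2 : ℚ_[two]) • quat 0 1 0 0 := by
    rw [Units.val_pow_eq_pow_val, varpiUnit_val, pow_two]
    (ext <;> simp [varpi]); norm_num
  rw [pow_mul, Units.val_pow_eq_pow_val, this, smul_pow]

lemma exists_varpi_pow_mul_of_mem {z : ℍ[ℚ_[two]]} (hz : z ∈ O2) (hz0 : z ≠ 0) : ∃ k : ℕ, ∃ y ∈ O2, nrm y = 1 ∧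
    z = ((varpiUnit ℚ_[two] ^ k : ℍ[ℚ_[two]]ˣ) : ℍ[ℚ_[two]]) * y := by
  by_contra! hcon
  have all : ∀ k : ℕ, ∃ y ∈ O2, z = ((varpiUnit ℚ_[two] ^ k : ℍ[ℚ_[two]]ˣ) : ℍ[ℚ_[two]]) * y := by
    intro k
    induction k with
    | zero => exact ⟨z, hz, by simp⟩
    | succ k ih =>
      obtain ⟨y, hy, hzy⟩ := ih
      rcases O2_dvd_or_unit hy with ⟨w, hw, rfl⟩ | h1
      · exact ⟨w, hw, by rw [hzy, pow_succ, Units.val_mul, varpiUnit_val, mul_assoc]⟩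
      · exact absurd hzy (hcon k y hy h1)
  -- a quaternion which is divisible by all powers of two vanishes
  have small : ∀ k : ℕ, ∃ y ∈ O2, z = (2 : ℚ_[two]) ^ k • y := by
    intro k
    obtain ⟨y, hy, hzy⟩ := all (2 * k)
    refine ⟨_, O2.mul_mem (O2.pow_mem (⟨0, 1, 0, 0, by ext <;> simp⟩ : quat 0 1 0 0 ∈ O2) k) hy, ?_⟩
    rw [hzy, varpiUnit_pow_two_mul, smul_mul_assoc]
  apply hz0
  have lim : ∀ c : ℚ_[two], (∀ k : ℕ, ‖c‖ ≤ (1 / 2) ^ k) → c = 0 := by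
    intro c hc
    have ht : Filter.Tendsto (fun k : ℕ => ((1 : ℝ) / 2) ^ k) Filter.atTop (nhds 0) :=
      tendsto_pow_atTop_nhds_zero_of_lt_one (by norm_num) (by norm_num)
    have := ge_of_tendsto' ht hc
    exact norm_le_zero_iff.1 this
  have coord : ∀ (ℓ : ℍ[ℚ_[two]] → ℚ_[two]), (∀ (c : ℚ_[two]) y, ℓ (c • y) = c * ℓ y) →
      (∀ y ∈ O2, ‖ℓ y‖ ≤ 1) → ℓ z = 0 := by
    intro ℓ hℓ hb
    refine lim _ fun k => ?_
    obtain ⟨y, hy, hzy⟩ := small k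
    rw [hzy, hℓ, norm_mul, norm_pow, norm_two_padic]
    exact mul_le_of_le_one_right (by positivity) (hb y hy)
  have h0 := coord (fun y => 2 * y.imK) (fun c y => by simp; ring)
    fun y hy => ((mem_hurwitz_padic_iff y).1 hy).1
  have h1 := coord (fun y => y.re - y.imK) (fun c y => by simp; ring)
    fun y hy => ((mem_hurwitz_padic_iff y).1 hy).2.1
  have h2 := coord (fun y => y.imI - y.imK) (fun c y => by simp; ring)
    fun y hy => ((mem_hurwitz_padic_iff y).1 hy).2.2.1
  have h3 := coord (fun y => y.imJ - y.imK) (fun c y => by simp; ring)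
    fun y hy => ((mem_hurwitz_padic_iff y).1 hy).2.2.2
  have hK : z.imK = 0 := by simpa using h0
  rw [hK, sub_zero] at h1 h2 h3
  exact QuaternionAlgebra.ext h1 h2 h3 hK

/-- Every nonzero quaternion at two is a power of `ϖ₂` times an integral quaternion whose norm is
a unit. -/
lemma exists_varpi_pow_mul {x : ℍ[ℚ_[two]]} (hx : x ≠ 0) :
    ∃ k : ℤ, ∃ y ∈ O2, nrm y = 1 ∧ x = ((varpiUnit ℚ_[two] ^ k : ℍ[ℚ_[two]]ˣ) : ℍ[ℚ_[two]]) * y := by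
  obtain ⟨N, hN⟩ := exists_pow_smul_mem two x
  have h2 : ((two : ℕ) ^ N : ℕ) • x = (2 : ℚ_[two]) ^ N • x := by
    rw [← Nat.cast_smul_eq_nsmul ℚ_[two]]
    congr 1
    change (((2 : ℕ) ^ N : ℕ) : ℚ_[two]) = 2 ^ N
    push_cast
    rfl
  obtain ⟨k, y, hy, hy1, hxy⟩ := exists_varpi_pow_mul_of_mem (z := (2 : ℚ_[two]) ^ N • x) (by rw [← h2]; exact hN N le_rfl)
    (smul_ne_zero (pow_ne_zero _ two_ne_zero) hx)
  have hq : nrm (quat 0 1 0 0) = 1 := by simp [nrm, normSq_eq]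
  have hqO : star (quat 0 1 0 0) ∈ O2 := star_mem_hurwitz ⟨0, 1, 0, 0, by ext <;> simp⟩
  obtain ⟨w, hw1, hw2⟩ := normSq_isUnit_of_ne (x := (quat 0 1 0 0 : ℍ[ℚ_[two]]))
    (by simp [normSq_eq])
  have hcomm : ∀ m : ℕ, Commute w (varpiUnit ℚ_[two] ^ m) := by
    intro m
    apply Commute.pow_right
    apply Units.ext
    rw [Units.val_mul, Units.val_mul, hw1, varpiUnit_val]
    ext <;> simp [varpi]
  have hx2 : x = ((varpiUnit ℚ_[two] ^ (2 * N))⁻¹ * w ^ N : ℍ[ℚ_[two]]ˣ) * ((2 : ℚ_[two]) ^ N • x) := by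
    rw [mul_smul_comm, ← smul_mul_assoc, Units.val_mul, ← mul_smul_comm, Units.val_pow_eq_pow_val, hw1,
      ← varpiUnit_pow_two_mul, Units.inv_mul, one_mul]
  have hxN : x = ((varpiUnit ℚ_[two] ^ ((k : ℤ) - 2 * N) : ℍ[ℚ_[two]]ˣ) : ℍ[ℚ_[two]]) *
      ((w ^ N : ℍ[ℚ_[two]]ˣ) * y) := by
    conv_lhs => rw [hx2, hxy]
    rw [← mul_assoc, ← mul_assoc, ← Units.val_mul, ← Units.val_mul, mul_assoc _ (w ^ N),
      ((hcomm k).pow_left N).eq, ← mul_assoc, ← zpow_natCast, ← zpow_natCast, ← zpow_neg, ← zpow_add]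
    congr 4
    push_cast
    ring
  have hwO : ((w ^ N : ℍ[ℚ_[two]]ˣ) : ℍ[ℚ_[two]]) ∈ O2 := by
    rw [Units.val_pow_eq_pow_val, hw1]
    exact O2.pow_mem ⟨0, 1, 0, 0, by ext <;> simp⟩ _
  refine ⟨_, _, O2.mul_mem hwO hy, ?_, hxN⟩
  rw [nrm_mul, hy1, mul_one, Units.val_pow_eq_pow_val, hw1]
  induction N with
  | zero => simp [nrm_one]
  | succ n _ =>
    clear * - hq
    induction n + 1 with
    | zero => simp [nrm_one]
    | succ m ih => rw [pow_succ, nrm_mul, ih, hq, one_mul]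

lemma nrm_pow (x : ℍ[ℚ_[two]]) (n : ℕ) : nrm (x ^ n) = nrm x ^ n := by
  simp [nrm]

lemma nrm_unit_pos (u : ℍ[ℚ_[two]]ˣ) : 0 < nrm u := norm_pos_iff.2 (normSq_unit_ne u)

lemma nrm_inv (u : ℍ[ℚ_[two]]ˣ) : nrm (u⁻¹ : ℍ[ℚ_[two]]ˣ) = (nrm u)⁻¹ := by
  have := nrm_mul u (u⁻¹ : ℍ[ℚ_[two]]ˣ)
  rw [Units.mul_inv, nrm_one] at this
  exact eq_inv_of_mul_eq_one_right this.symm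

lemma nrm_varpi_zpow (k : ℤ) : nrm (varpiUnit ℚ_[two] ^ k : ℍ[ℚ_[two]]ˣ) = (2 : ℝ) ^ (-k) := by
  have h : ∀ n : ℕ, nrm (varpiUnit ℚ_[two] ^ n : ℍ[ℚ_[two]]ˣ) = (2 : ℝ) ^ (-(n : ℤ)) := by
    intro n
    rw [Units.val_pow_eq_pow_val, nrm_pow, varpiUnit_val, nrm_varpi]
    simp
  obtain ⟨n, rfl | rfl⟩ := k.eq_nat_or_neg
  · rw [zpow_natCast, h]
  · rw [zpow_neg, zpow_natCast, nrm_inv, h, ← zpow_neg]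

lemma nrm_eq_zero {x : ℍ[ℚ_[two]]} : nrm x = 0 ↔ x = 0 := by
  refine ⟨fun h => ?_, fun h => by rw [h, nrm_zero]⟩
  by_contra hx
  obtain ⟨k, y, -, hy, rfl⟩ := exists_varpi_pow_mul hx
  rw [nrm_mul, hy, mul_one] at h
  exact (nrm_unit_pos _).ne' h

lemma exists_unit_of_ne_zero {x : ℍ[ℚ_[two]]} (hx : x ≠ 0) : ∃ u : ℍ[ℚ_[two]]ˣ, (u : ℍ[ℚ_[two]]) = x := by
  obtain ⟨u, hu, -⟩ := normSq_isUnit_of_ne (x := x)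
    (fun h => hx (nrm_eq_zero.1 (by rw [nrm, h, norm_zero])))
  exact ⟨u, hu⟩

lemma exists_nrm_eq_zpow {x : ℍ[ℚ_[two]]} (hx : x ≠ 0) : ∃ k : ℤ, nrm x = (2 : ℝ) ^ (-k) := by
  obtain ⟨k, y, -, hy, rfl⟩ := exists_varpi_pow_mul hx
  exact ⟨k, by rw [nrm_mul, hy, mul_one, nrm_varpi_zpow]⟩

lemma mem_O2 {x : ℍ[ℚ_[two]]} : x ∈ O2 ↔ nrm x ≤ 1 := by
  refine ⟨O2_nrm_le, fun h => ?_⟩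
  by_cases hx : x = 0
  · rw [hx]
    exact O2.zero_mem
  obtain ⟨k, y, hyO, hy, rfl⟩ := exists_varpi_pow_mul hx
  rw [nrm_mul, hy, mul_one, nrm_varpi_zpow, zpow_le_one_iff_right₀ (by norm_num)] at h
  obtain ⟨n, rfl⟩ := Int.eq_ofNat_of_zero_le (show 0 ≤ k by omega)
  refine O2.mul_mem ?_ hyO
  rw [zpow_natCast, Units.val_pow_eq_pow_val]
  exact O2.pow_mem varpi_mem _

lemma nrm_add_le (x y : ℍ[ℚ_[two]]) : nrm (x + y) ≤ max (nrm x) (nrm y) := by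
  wlog h : nrm y ≤ nrm x generalizing x y
  · rw [add_comm, max_comm]
    exact this y x (le_of_not_ge h)
  rw [max_eq_left h]
  by_cases hx : x = 0
  · subst hx
    rw [nrm_zero] at h
    rw [nrm_eq_zero.1 (le_antisymm h (nrm_nonneg y))]
    simp
  obtain ⟨u, rfl⟩ := exists_unit_of_ne_zero hx
  have h1 : nrm ((u⁻¹ : ℍ[ℚ_[two]]ˣ) * y) ≤ 1 := by
    rw [nrm_mul, nrm_inv]
    exact inv_mul_le_one_of_le₀ h (nrm_nonneg _)
  have h2 := mem_O2.1 (O2.add_mem O2.one_mem (mem_O2.2 h1))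
  calc nrm (u + y) = nrm (u * (1 + (u⁻¹ : ℍ[ℚ_[two]]ˣ) * y)) := by
        rw [mul_add, mul_one, ← mul_assoc, Units.mul_inv, one_mul]
    _ ≤ nrm u := by
        rw [nrm_mul]
        exact mul_le_of_le_one_right (nrm_nonneg _) h2

lemma nrm_sub_le (x y : ℍ[ℚ_[two]]) : nrm (x - y) ≤ max (nrm x) (nrm y) := by
  rw [sub_eq_add_neg, ← nrm_neg y]
  exact nrm_add_le _ _

lemma nrm_sub_comm (x y : ℍ[ℚ_[two]]) : nrm (x - y) = nrm (y - x) := by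
  rw [← nrm_neg, neg_sub]

lemma nrm_add_le_of {x y : ℍ[ℚ_[two]]} {c : ℝ} (hx : nrm x ≤ c) (hy : nrm y ≤ c) :
    nrm (x + y) ≤ c := (nrm_add_le x y).trans (max_le hx hy)

lemma nrm_sub_le_of {x y : ℍ[ℚ_[two]]} {c : ℝ} (hx : nrm x ≤ c) (hy : nrm y ≤ c) :
    nrm (x - y) ≤ c := (nrm_sub_le x y).trans (max_le hx hy)

/-- The values of `nrm` are powers of two. -/
lemma nrm_le_of_lt {x : ℍ[ℚ_[two]]} {k : ℤ} (h : nrm x < (2 : ℝ) ^ (-k)) :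
    nrm x ≤ (2 : ℝ) ^ (-(k + 1)) := by
  by_cases hx : x = 0
  · rw [hx, nrm_zero]
    positivity
  obtain ⟨m, hm⟩ := exists_nrm_eq_zpow hx
  rw [hm] at h ⊢
  have := (zpow_lt_zpow_iff_right₀ (by norm_num : (1 : ℝ) < 2)).1 h
  exact zpow_le_zpow_right₀ (by norm_num) (by omega)

lemma mem_Kp_two {g : Gp two} : g ∈ Kp two ↔
    (∀ i j, nrm (g.val i j) ≤ 1) ∧ ∀ i j, nrm ((g⁻¹).val i j) ≤ 1 := by
  constructor
  · rintro ⟨h1, h2⟩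
    exact ⟨fun i j => mem_O2.1 (h1 i j), fun i j => mem_O2.1 (h2 i j)⟩
  · rintro ⟨h1, h2⟩
    exact ⟨fun i j => mem_O2.2 (h1 i j), fun i j => mem_O2.2 (h2 i j)⟩

/-! ### The group `GL₂(B_2)` -/

section Upper
variable {K : Type} [Field K]

lemma upper_mul (a d a' d' : ℍ[K]ˣ) (x x' : ℍ[K]) :
    upper a d x * upper a' d' x' = upper (a * a') (d * d') (a * x' + x * d') := by
  apply Units.ext
  ext i j : 1
  fin_cases i <;> fin_cases j <;> simp [upper, mul_apply]

lemma upper_one : upper (1 : ℍ[K]ˣ) 1 0 = 1 := by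
  apply Units.ext
  ext i j : 1
  fin_cases i <;> fin_cases j <;> simp [upper]

lemma upper_inv (a d : ℍ[K]ˣ) (x : ℍ[K]) :
    (upper a d x)⁻¹ = upper a⁻¹ d⁻¹ (-(((a⁻¹ : ℍ[K]ˣ) : ℍ[K]) * x * ((d⁻¹ : ℍ[K]ˣ) : ℍ[K]))) := by
  rw [inv_eq_iff_mul_eq_one, upper_mul]
  simp [← mul_assoc, upper_one]

/-- The Weyl element of `GL₂`. -/
def weyl (K : Type) [Field K] : GLH K where
  val := !![0, 1; 1, 0]
  inv := !![0, 1; 1, 0]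
  val_inv := by
    ext i j : 1
    fin_cases i <;> fin_cases j <;> simp [mul_apply]
  inv_val := by
    ext i j : 1
    fin_cases i <;> fin_cases j <;> simp [mul_apply]

/-- The lower triangular unipotent matrices. -/
def lower (z : ℍ[K]) : GLH K where
  val := !![1, 0; z, 1]
  inv := !![1, 0; -z, 1]
  val_inv := by
    ext i j : 1
    fin_cases i <;> fin_cases j <;> simp [mul_apply]
  inv_val := by
    ext i j : 1
    fin_cases i <;> fin_cases j <;> simp [mul_apply]

lemma weyl_inv : (weyl K)⁻¹ = weyl K := Units.ext rfl

lemma lower_inv (z : ℍ[K]) : (lower z)⁻¹ = lower (-z) := by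
  apply Units.ext
  rfl

/-- An invertible matrix whose lower left entry vanishes is upper triangular. -/
lemma exists_upper_of_apply_eq_zero (g : GLH K) (h : g.val 1 0 = 0) :
    ∃ a d x, g = upper a d x := by
  have h1 := congrFun (congrFun g.mul_inv 1) 1
  have h2 := congrFun (congrFun g.inv_mul 0) 0
  simp only [mul_apply, Fin.sum_univ_two, h, zero_mul, mul_zero, zero_add, add_zero,
    one_apply_eq] at h1 h2
  obtain ⟨a, ha, -⟩ := normSq_isUnit_of_ne (normSq_ne_zero_of_mul h2).2
  obtain ⟨d, hd, -⟩ := normSq_isUnit_of_ne (normSq_ne_zero_of_mul h1).1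
  refine ⟨a, d, g.val 0 1, ?_⟩
  apply Units.ext
  ext i j : 1
  fin_cases i <;> fin_cases j <;> simp [upper, ha, hd, h]

end Upper

local notation "D₂" => ℍ[ℚ_[two]]
local notation "ϖ" => varpiUnit ℚ_[two]

/-- The valuation of the reduced norm on the unit group of the quaternion algebra at two. -/
def val2 (a : D₂ˣ) : ℤ := (normSq (a : D₂)).valuation

lemma nrm_eq_zpow (a : D₂ˣ) : nrm a = (2 : ℝ) ^ (-val2 a) :=
  Padic.norm_eq_zpow_neg_valuation (normSq_unit_ne a)

lemma val2_mul (a b : D₂ˣ) : val2 (a * b) = val2 a + val2 b := by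
  rw [val2, Units.val_mul, map_mul, Padic.valuation_mul (normSq_unit_ne a) (normSq_unit_ne b)]
  rfl

lemma val2_eq_iff {a : D₂ˣ} {k : ℤ} : val2 a = k ↔ nrm a = (2 : ℝ) ^ (-k) := by
  rw [nrm_eq_zpow]
  constructor
  · rintro rfl
    rfl
  · intro h
    have := zpow_right_injective₀ (by norm_num : (0 : ℝ) < 2) (by norm_num) h
    simpa using this

lemma val2_one : val2 1 = 0 := val2_eq_iff.2 (by simp [nrm_one])

lemma val2_inv (a : D₂ˣ) : val2 a⁻¹ = -val2 a := by
  have := val2_mul a a⁻¹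
  rw [mul_inv_cancel, val2_one] at this
  omega

lemma val2_varpi_zpow (k : ℤ) : val2 (ϖ ^ k) = k := val2_eq_iff.2 (nrm_varpi_zpow k)

lemma val2_varpi : val2 ϖ = 1 := by simpa using val2_varpi_zpow 1

lemma val2_neg (a : D₂ˣ) : val2 (-a) = val2 a := by
  rw [val2_eq_iff, Units.val_neg, nrm_neg, nrm_eq_zpow]

lemma val2_eq_zero_of_mem {a : D₂ˣ} (h : nrm a ≤ 1) (h' : nrm (a⁻¹ : D₂ˣ) ≤ 1) : val2 a = 0 := by
  rw [nrm_eq_zpow, zpow_le_one_iff_right₀ (by norm_num)] at h h'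
  rw [val2_inv] at h'
  omega

lemma upper_mem_Kp {a d : D₂ˣ} {x : D₂} :
    upper a d x ∈ Kp two ↔ val2 a = 0 ∧ val2 d = 0 ∧ nrm x ≤ 1 := by
  rw [mem_Kp_two, upper_inv]
  constructor
  · rintro ⟨h1, h2⟩
    exact ⟨val2_eq_zero_of_mem (h1 0 0) (h2 0 0), val2_eq_zero_of_mem (h1 1 1) (h2 1 1), h1 0 1⟩
  · rintro ⟨ha, hd, hx⟩
    have ha' := nrm_eq_zpow a
    have hd' := nrm_eq_zpow d
    rw [ha, neg_zero, zpow_zero] at ha'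
    rw [hd, neg_zero, zpow_zero] at hd'
    constructor <;> intro i j <;> fin_cases i <;> fin_cases j <;>
      simp [upper, ha', hd', hx, nrm_zero, nrm_neg, nrm_mul, nrm_inv]

lemma weyl_mem_Kp : weyl ℚ_[two] ∈ Kp two := by
  rw [mem_Kp_two, weyl_inv]
  constructor <;> intro i j <;> fin_cases i <;> fin_cases j <;>
    simp [weyl, nrm_zero, nrm_one]

lemma lower_mem_Kp {z : D₂} (hz : nrm z ≤ 1) : lower z ∈ Kp two := by
  rw [mem_Kp_two, lower_inv]
  constructor <;> intro i j <;> fin_cases i <;> fin_cases j <;>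
    simp [lower, nrm_zero, nrm_one, nrm_neg, hz]

/-- The Iwasawa decomposition of `GL₂(B_2)`. -/
lemma exists_iwasawa_two (g : Gp two) : ∃ a d x, ∃ k ∈ Kp two, g = upper a d x * k := by
  have main : ∀ g : Gp two, nrm (g.val 1 0) ≤ nrm (g.val 1 1) →
      ∃ a d x, ∃ k ∈ Kp two, g = upper a d x * k := by
    intro g hg
    have hne : g.val 1 1 ≠ 0 := by
      intro h0
      rw [h0, nrm_zero] at hg
      have h1 := congrFun (congrFun g.mul_inv 1) 1
      simp [mul_apply, h0, nrm_eq_zero.1 (le_antisymm hg (nrm_nonneg _))] at h1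
    obtain ⟨u, hu⟩ := exists_unit_of_ne_zero hne
    have hz : nrm ((u⁻¹ : D₂ˣ) * g.val 1 0) ≤ 1 := by
      rw [nrm_mul, nrm_inv, hu]
      exact inv_mul_le_one_of_le₀ hg (nrm_nonneg _)
    obtain ⟨a, d, x, h⟩ := exists_upper_of_apply_eq_zero (g * lower (-(((u⁻¹ : D₂ˣ) : D₂) * g.val 1 0))) (by
      simp only [Units.val_mul, mul_apply, Fin.sum_univ_two, lower]
      simp [← hu])
    refine ⟨a, d, x, _, (Kp two).inv_mem (lower_mem_Kp (by rwa [nrm_neg])), ?_⟩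
    rw [← h, mul_inv_cancel_right]
  rcases le_total (nrm (g.val 1 0)) (nrm (g.val 1 1)) with h | h
  · exact main g h
  · obtain ⟨a, d, x, k, hk, hg⟩ := main (g * weyl _) (by
      simpa [mul_apply, weyl] using h)
    refine ⟨a, d, x, k * (weyl _)⁻¹, (Kp two).mul_mem hk ((Kp two).inv_mem weyl_mem_Kp), ?_⟩
    rw [← mul_assoc, ← hg, mul_inv_cancel_right]

/-- The generator `(1 + i + j + ij) / 2` of the residue field of the Hurwitz order. -/
def rho (K : Type) [Field K] : ℍ[K] := quat (1 / 2) (1 / 2) (1 / 2) (1 / 2)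

/-- Representatives of the residue field `𝓞 / ϖ₂ 𝓞` with four elements. -/
def resRep (K : Type) [Field K] : Fin 4 → ℍ[K] := ![0, 1, rho K, 1 + rho K]

lemma resRep_mem {Z K : Type} [CommRing Z] [Field K] [CharZero K] [Algebra Z K] (i : Fin 4) :
    resRep K i ∈ hurwitz Z K := by
  have h : rho K ∈ hurwitz Z K := ⟨0, 0, 0, 1, by ext <;> simp [rho]⟩
  fin_cases i
  · exact zero_mem _
  · exact one_mem _
  · exact h
  · exact add_mem (one_mem _) h

lemma nrm_resRep_le (i : Fin 4) : nrm (resRep ℚ_[two] i) ≤ 1 := mem_O2.1 (resRep_mem i)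

lemma nrm_resRep_sub {i j : Fin 4} (h : i ≠ j) : nrm (resRep ℚ_[two] i - resRep ℚ_[two] j) = 1 := by
  have h3 : ‖(3 : ℚ_[two])‖ = 1 := by
    have h21 : ‖(2 : ℚ_[two])‖ ≠ ‖(1 : ℚ_[two])‖ := by rw [norm_two_padic]; norm_num
    have : (3 : ℚ_[two]) = 2 + 1 := by norm_num
    rw [this, IsUltrametricDist.norm_add_eq_max_of_norm_ne_norm h21, norm_two_padic]
    norm_num
  fin_cases i <;> fin_cases j <;>
    first | exact absurd rfl h | (simp only [nrm, resRep, rho, normSq_eq]; simp <;> norm_num [h3])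

/-- The four representatives exhaust the residue field. -/
lemma exists_resRep {x : D₂} (hx : nrm x ≤ 1) : ∃ i, nrm (x - resRep ℚ_[two] i) ≤ 1 / 2 := by
  have key : ∀ y : D₂, nrm y ≤ 1 → nrm y ≤ 1 / 2 ∨ nrm y = 1 := by
    intro y hy
    rcases hy.lt_or_eq with h | h
    · left
      simpa using nrm_le_of_lt (k := 0) (by simpa using h)
    · exact Or.inr h
  obtain ⟨a, b, c, d, rfl⟩ := mem_O2.2 hx
  have e : ∀ z : ℤ_[two], algebraMap ℤ_[two] ℚ_[two] z = (z : ℚ_[two]) := fun _ => rfl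
  have half : ∀ w : ℤ_[two], ‖((2 * w : ℤ_[two]) : ℚ_[two])‖ ≤ 1 / 2 := by
    intro w
    have h2 : ((2 * w : ℤ_[two]) : ℚ_[two]) = 2 * (w : ℚ_[two]) := by push_cast; rfl
    rw [h2, norm_mul, norm_two_padic]
    have : ‖(w : ℚ_[two])‖ ≤ 1 := w.2
    linarith
  -- if both invariants are even, the norm is even
  have ev : ∀ a b c d : ℤ_[two], (∃ w, a + b + c = 2 * w) → (∃ w, d = 2 * w) →
      nrm (quat ((a : ℚ_[two]) + d / 2) (b + d / 2) (c + d / 2) (d / 2)) ≤ 1 / 2 := by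
    rintro a b c d ⟨s, hs⟩ ⟨t, ht⟩
    have hn : normSq (quat ((a : ℚ_[two]) + d / 2) (b + d / 2) (c + d / 2) (d / 2)) =
      ((a ^ 2 + b ^ 2 + c ^ 2 + d ^ 2 + d * (a + b + c) : ℤ_[two]) : ℚ_[two]) := by
      rw [normSq_eq]
      simp only [quat_re, quat_imI, quat_imJ, quat_imK]
      push_cast
      ring
    have key : a ^ 2 + b ^ 2 + c ^ 2 + d ^ 2 + d * (a + b + c) =
        2 * (2 * s ^ 2 - (a * b + a * c + b * c) + 2 * t ^ 2 + 2 * t * s) := by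
      rw [ht]
      linear_combination (a + b + c + 2 * s + 2 * t) * hs
    rw [nrm, hn, key]
    exact half _
  simp only [e]
  rcases z2_even_or_odd d with ⟨t, ht⟩ | ⟨t, ht⟩ <;>
    rcases z2_even_or_odd (a + b + c) with ⟨s, hs⟩ | ⟨s, hs⟩
  · refine ⟨0, ?_⟩
    simpa [resRep] using ev a b c d ⟨s, hs⟩ ⟨t, ht⟩
  · refine ⟨1, ?_⟩
    convert ev (a - 1) b c d ⟨s, by linear_combination hs⟩ ⟨t, ht⟩ using 2
    ext <;> simp [resRep]
    ring
  · refine ⟨2, ?_⟩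
    convert ev a b c (d - 1) ⟨s, hs⟩ ⟨t, by linear_combination ht⟩ using 2
    ext <;> simp [resRep, rho] <;> ring
  · refine ⟨3, ?_⟩
    convert ev (a - 1) b c (d - 1) ⟨s, by linear_combination hs⟩ ⟨t, by linear_combination ht⟩ using 2
    ext <;> simp [resRep, rho] <;> ring

/-- The matrix with rows `(ϖ₂ ^ k, b)` and `(0, 1)`. -/
def pMat (b : D₂) (k : ℤ) : Gp two := upper (ϖ ^ k) 1 b

lemma pMat_mul (b b' : D₂) (k k' : ℤ) :
    pMat b k * pMat b' k' = pMat (b + (ϖ ^ k : D₂ˣ) * b') (k + k') := by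
  rw [pMat, pMat, upper_mul, pMat, zpow_add]
  simp [add_comm]

/-! ### The Hecke operators at two -/

lemma weyl_mul_upper_mul_weyl {K : Type} [Field K] (a d : ℍ[K]ˣ) :
    weyl K * upper a d 0 * weyl K = upper d a 0 := by
  apply Units.ext
  ext i j : 1
  fin_cases i <;> fin_cases j <;> simp [upper, weyl, mul_apply]

/-- Representatives of the right cosets in `K_2 diag(ϖ₂, 1) K_2`. -/
def heckeRep : Option (Fin 4) → Gp two
  | some i => pMat (resRep ℚ_[two] i) 1
  | none => upper 1 ϖ 0

lemma nrm_varpi_unit : nrm (ϖ : D₂) = 1 / 2 := nrm_varpi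

lemma nrm_conj_varpi (x : D₂) : nrm ((ϖ⁻¹ : D₂ˣ) * x * ϖ) = nrm x := by
  rw [nrm_mul, nrm_mul, nrm_inv, nrm_varpi_unit]
  ring

lemma nrm_inv_varpi_mul {x : D₂} (hx : nrm x ≤ 1 / 2) : nrm ((ϖ⁻¹ : D₂ˣ) * x) ≤ 1 := by
  rw [nrm_mul, nrm_inv, nrm_varpi_unit]
  linarith

lemma nrm_mul_varpi {x : D₂} (hx : nrm x ≤ 1) : nrm (x * ϖ) ≤ 1 := by
  rw [nrm_mul, nrm_varpi_unit]
  linarith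

lemma ring_aux₁ {R : Type*} [Ring R] (a b c d e : R) :
    a * (c * e) + -(a * b) * (d * e) = a * (c - b * d) * e := by noncomm_ring

lemma ring_aux₂ {R : Type*} [Ring R] (a b c d : R) :
    a * c + -(a * b) * d = a * (c - b * d) := by noncomm_ring

lemma heckeRep_coset {k : Gp two} (hk : k ∈ Kp two) :
    ∃ o, (heckeRep o)⁻¹ * (k * upper ϖ 1 0) ∈ Kp two := by
  have hk' := hk
  rw [mem_Kp_two] at hk'
  obtain ⟨h1, h2⟩ := hk'
  have e1 : ∀ i j, (k.val * (k⁻¹).val) i j = (1 : Matrix (Fin 2) (Fin 2) D₂) i j := fun i j => by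
    rw [k.mul_inv]
  have e2 : ∀ i j, ((k⁻¹).val * k.val) i j = (1 : Matrix (Fin 2) (Fin 2) D₂) i j := fun i j => by
    rw [k.inv_mul]
  simp only [mul_apply, Fin.sum_univ_two] at e1 e2
  have dich : nrm (k.val 1 1) ≤ 1 / 2 ∨ nrm (k.val 1 1) = 1 := by
    rcases (h1 1 1).lt_or_eq with h | h
    · left
      simpa using nrm_le_of_lt (k := 0) (by simpa using h)
    · exact Or.inr h
  rcases dich with hs | hs
  · refine ⟨none, ?_⟩
    have hr : nrm (k.val 1 0) = 1 := by
      have h := e1 1 1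
      have h3 : nrm (k.val 1 0 * (k⁻¹).val 0 1) = 1 := by
        have h4 : nrm (k.val 1 1 * (k⁻¹).val 1 1) ≤ 1 / 2 := by
          rw [nrm_mul]
          nlinarith [h2 1 1, nrm_nonneg ((k⁻¹).val 1 1), nrm_nonneg (k.val 1 1)]
        by_contra hne
        have h5 : nrm (k.val 1 0 * (k⁻¹).val 0 1) ≤ 1 / 2 := by
          have h6 : nrm (k.val 1 0 * (k⁻¹).val 0 1) ≤ 1 := by
            rw [nrm_mul]
            exact mul_le_one₀ (h1 _ _) (nrm_nonneg _) (h2 _ _)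
          simpa using nrm_le_of_lt (k := 0) (by simpa using lt_of_le_of_ne h6 hne)
        have h7 := nrm_add_le_of h5 h4
        rw [h, one_apply_eq, nrm_one] at h7
        norm_num at h7
      rw [nrm_mul] at h3
      nlinarith [h1 1 0, h2 0 1, nrm_nonneg (k.val 1 0), nrm_nonneg ((k⁻¹).val 0 1)]
    have hp : nrm ((k⁻¹).val 0 0) ≤ 1 / 2 := by
      have h : k.val 1 0 * (k⁻¹).val 0 0 = -(k.val 1 1 * (k⁻¹).val 1 0) := by
        have := e1 1 0
        simp only [ne_eq, one_ne_zero, not_false_eq_true, Matrix.one_apply_ne] at this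
        exact eq_neg_of_add_eq_zero_left this
      have h3 := congrArg nrm h
      rw [nrm_neg, nrm_mul, nrm_mul, hr, one_mul] at h3
      rw [h3]
      nlinarith [h2 1 0, nrm_nonneg ((k⁻¹).val 1 0), nrm_nonneg (k.val 1 1)]
    rw [mem_Kp_two]
    constructor
    · intro i j
      rw [heckeRep, upper_inv]
      fin_cases i <;> fin_cases j <;>
        simp only [upper, Units.val_mul, mul_apply, Fin.sum_univ_two] <;>
        simp [← mul_assoc]
      · exact nrm_mul_varpi (h1 _ _)
      · exact h1 _ _
      · rw [nrm_conj_varpi]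
        exact h1 _ _
      · exact nrm_inv_varpi_mul hs
    · intro i j
      rw [heckeRep, mul_inv_rev, inv_inv, mul_inv_rev, upper_inv]
      fin_cases i <;> fin_cases j <;>
        simp only [upper, Units.val_mul, mul_apply, Fin.sum_univ_two] <;>
        simp only [of_apply, cons_val', cons_val_zero, cons_val_one,
          cons_val_fin_one, Fin.zero_eta, Fin.mk_one, Fin.isValue, mul_zero, zero_mul, add_zero,
          zero_add, mul_one, neg_zero, inv_one, Units.val_one, one_mul]
      · exact nrm_inv_varpi_mul hp
      · rw [nrm_conj_varpi]
        exact h2 _ _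
      · exact h2 _ _
      · exact nrm_mul_varpi (h2 _ _)
  · obtain ⟨u, hu⟩ := exists_unit_of_ne_zero (x := k.val 1 1) (fun h => by
      rw [h, nrm_zero] at hs
      norm_num at hs)
    have hu1 : nrm (u⁻¹ : D₂ˣ) = 1 := by rw [nrm_inv, hu, hs, inv_one]
    obtain ⟨i₀, hi₀⟩ := exists_resRep (x := k.val 0 1 * (u⁻¹ : D₂ˣ)) (by
      rw [nrm_mul, hu1, mul_one]
      exact h1 _ _)
    set b := resRep ℚ_[two] i₀ with hb
    have hb1 : nrm b ≤ 1 := nrm_resRep_le i₀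
    have hq : nrm (k.val 0 1 - b * k.val 1 1) ≤ 1 / 2 := by
      have : k.val 0 1 - b * k.val 1 1 = (k.val 0 1 * (u⁻¹ : D₂ˣ) - b) * k.val 1 1 := by
        rw [sub_mul, ← hu, mul_assoc, Units.inv_mul, mul_one]
      rw [this, nrm_mul, hs, mul_one]
      exact hi₀
    have hq' : nrm ((k⁻¹).val 0 0 * b + (k⁻¹).val 0 1) ≤ 1 / 2 := by
      have h3 : ((k⁻¹).val 0 0 * b + (k⁻¹).val 0 1) * k.val 1 1 =
          -((k⁻¹).val 0 0 * (k.val 0 1 - b * k.val 1 1)) := by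
        have h4 := e2 0 1
        simp only [ne_eq, zero_ne_one, not_false_eq_true, Matrix.one_apply_ne] at h4
        have h5 : (k⁻¹).val 0 1 * k.val 1 1 = -((k⁻¹).val 0 0 * k.val 0 1) :=
          eq_neg_of_add_eq_zero_right h4
        rw [add_mul, h5]
        noncomm_ring
      have h6 := congrArg nrm h3
      rw [nrm_mul, hs, mul_one, nrm_neg, nrm_mul] at h6
      rw [h6]
      nlinarith [h2 0 0, nrm_nonneg ((k⁻¹).val 0 0), nrm_nonneg (k.val 0 1 - b * k.val 1 1)]
    refine ⟨some i₀, ?_⟩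
    rw [mem_Kp_two]
    constructor
    · intro i j
      rw [heckeRep, pMat, upper_inv, ← hb, zpow_one]
      fin_cases i <;> fin_cases j <;>
        simp only [upper, Units.val_mul, mul_apply, Fin.sum_univ_two] <;>
        simp only [of_apply, cons_val', cons_val_zero, cons_val_one,
          cons_val_fin_one, Fin.zero_eta, Fin.mk_one, Fin.isValue, mul_zero, zero_mul, add_zero,
          zero_add, mul_one, inv_one, Units.val_one, one_mul]
      · have : ((ϖ⁻¹ : D₂ˣ) : D₂) * (k.val 0 0 * ϖ) + -((ϖ⁻¹ : D₂ˣ) * b) * (k.val 1 0 * ϖ) =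
            (ϖ⁻¹ : D₂ˣ) * (k.val 0 0 - b * k.val 1 0) * ϖ :=
          ring_aux₁ _ _ _ _ _
        rw [this, nrm_conj_varpi]
        refine nrm_sub_le_of (h1 _ _) ?_
        rw [nrm_mul]
        exact mul_le_one₀ hb1 (nrm_nonneg _) (h1 _ _)
      · have : ((ϖ⁻¹ : D₂ˣ) : D₂) * k.val 0 1 + -((ϖ⁻¹ : D₂ˣ) * b) * k.val 1 1 =
            (ϖ⁻¹ : D₂ˣ) * (k.val 0 1 - b * k.val 1 1) :=
          ring_aux₂ _ _ _ _
        rw [this]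
        exact nrm_inv_varpi_mul hq
      · exact nrm_mul_varpi (h1 _ _)
      · exact h1 _ _
    · intro i j
      rw [heckeRep, pMat, mul_inv_rev, inv_inv, mul_inv_rev, upper_inv, ← hb, zpow_one]
      fin_cases i <;> fin_cases j <;>
        simp only [upper, Units.val_mul, mul_apply, Fin.sum_univ_two] <;>
        simp only [of_apply, cons_val', cons_val_zero, cons_val_one,
          cons_val_fin_one, Fin.zero_eta, Fin.mk_one, Fin.isValue, mul_zero, zero_mul, add_zero,
          zero_add, mul_one, neg_zero, inv_one, Units.val_one, one_mul]
      · rw [nrm_conj_varpi]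
        exact h2 _ _
      · have : ((ϖ⁻¹ : D₂ˣ) : D₂) * (k⁻¹).val 0 0 * b + (ϖ⁻¹ : D₂ˣ) * (k⁻¹).val 0 1 =
            (ϖ⁻¹ : D₂ˣ) * ((k⁻¹).val 0 0 * b + (k⁻¹).val 0 1) := by noncomm_ring
        rw [this]
        exact nrm_inv_varpi_mul hq'
      · exact nrm_mul_varpi (h2 _ _)
      · refine nrm_add_le_of ?_ (h2 _ _)
        rw [nrm_mul]
        exact mul_le_one₀ (h2 _ _) (nrm_nonneg _) hb1

lemma heckeRep_injective :
    Function.Injective fun o => (QuotientGroup.mk (heckeRep o) : Gp two ⧸ Kp two) := by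
  have key : ∀ i, (heckeRep (some i))⁻¹ * heckeRep none ∉ Kp two := by
    intro i h
    rw [heckeRep, heckeRep, pMat, upper_inv, upper_mul, upper_mem_Kp, val2_mul, val2_inv,
      val2_varpi_zpow, val2_one] at h
    omega
  intro o o' h
  have h' : (heckeRep o)⁻¹ * heckeRep o' ∈ Kp two := QuotientGroup.eq.1 h
  have h'' : (heckeRep o')⁻¹ * heckeRep o ∈ Kp two := QuotientGroup.eq.1 h.symm
  match o, o' with
  | none, none => rfl
  | some i, none => exact absurd h' (key i)
  | none, some i => exact absurd h'' (key i)
  | some i, some j =>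
    by_contra hne
    have hij : i ≠ j := fun hij => hne (by rw [hij])
    rw [heckeRep, heckeRep, pMat, pMat, upper_inv, upper_mul, upper_mem_Kp] at h'
    have h3 := h'.2.2
    rw [zpow_one, inv_one, Units.val_one, mul_one, mul_one, ← sub_eq_add_neg, ← mul_sub, nrm_mul,
      nrm_inv, nrm_varpi_unit, nrm_resRep_sub hij.symm] at h3
    norm_num at h3

/-- The double coset of `diag(ϖ₂, 1)` is the union of five right cosets. -/
lemma hecke_set_eq : {c : Gp two ⧸ Kp two | ∃ k ∈ Kp two, c = QuotientGroup.mk (k * upper ϖ 1 0)} =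
    Set.range fun o => (QuotientGroup.mk (heckeRep o) : Gp two ⧸ Kp two) := by
  ext c
  constructor
  · rintro ⟨k, hk, rfl⟩
    obtain ⟨o, ho⟩ := heckeRep_coset hk
    exact ⟨o, QuotientGroup.eq.2 ho⟩
  · rintro ⟨o, rfl⟩
    match o with
    | some i =>
      refine ⟨upper 1 1 (resRep _ i), ?_, ?_⟩
      · rw [upper_mem_Kp]
        exact ⟨val2_one, val2_one, nrm_resRep_le i⟩
      · simp [heckeRep, pMat, upper_mul]
    | none =>
      refine ⟨weyl _, weyl_mem_Kp, ?_⟩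
      refine QuotientGroup.eq.2 ?_
      rw [heckeRep, ← weyl_mul_upper_mul_weyl, mul_inv_rev, weyl_inv, mul_assoc, inv_mul_cancel,
        mul_one]
      exact weyl_mem_Kp

lemma hecke_two_eq (Φ : GA → ℂ) (hΦ : ∀ g, ∀ k ∈ Kp two, Φ (g * (1, atPrime two k)) = Φ g) (g : GA) :
    hecke two (upper ϖ 1 0) Φ g = ∑ o, Φ (g * (1, atPrime two (heckeRep o))) := by
  rw [hecke, hecke_set_eq, finsum_mem_range heckeRep_injective, finsum_eq_sum_of_fintype]
  refine sum_congr rfl fun o _ => ?_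
  obtain ⟨k, hk⟩ := QuotientGroup.mk_out_eq_mul (Kp two) (heckeRep o)
  rw [hk, atPrime, atPrime, RestrictedProduct.mulSingle_mul,
    show ((1, RestrictedProduct.mulSingle Kp two (heckeRep o) * RestrictedProduct.mulSingle Kp two k) : GA) =
      (1, atPrime two (heckeRep o)) * (1, atPrime two k) by simp [atPrime], ← mul_assoc, hΦ _ _ k.2]
  rfl

lemma upper_varpi_conj {k : Gp two} (hk : k ∈ Kp two) :
    (upper ϖ ϖ 0)⁻¹ * (k * upper ϖ ϖ 0) ∈ Kp two := by
  have main : ∀ k : Gp two, (∀ i j, nrm (k.val i j) ≤ 1) →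
      ∀ i j, nrm (((upper ϖ ϖ 0)⁻¹ * (k * upper ϖ ϖ 0)).val i j) ≤ 1 := by
    intro k h1 i j
    rw [upper_inv]
    fin_cases i <;> fin_cases j <;>
      simp only [upper, Units.val_mul, mul_apply, Fin.sum_univ_two] <;>
      simp [← mul_assoc, nrm_conj_varpi, h1]
  rw [mem_Kp_two] at hk ⊢
  refine ⟨main k hk.1, ?_⟩
  have h := main k⁻¹ hk.2
  rwa [show (upper ϖ ϖ 0)⁻¹ * (k⁻¹ * upper ϖ ϖ 0) = ((upper ϖ ϖ 0)⁻¹ * (k * upper ϖ ϖ 0))⁻¹ by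
    simp [mul_assoc]] at h

lemma hecke_two_scalar_eq (Φ : GA → ℂ) (hΦ : ∀ g, ∀ k ∈ Kp two, Φ (g * (1, atPrime two k)) = Φ g)
    (g : GA) : hecke two (upper ϖ ϖ 0) Φ g = Φ (g * (1, atPrime two (upper ϖ ϖ 0))) := by
  have hset : {c : Gp two ⧸ Kp two | ∃ k ∈ Kp two, c = QuotientGroup.mk (k * upper ϖ ϖ 0)} =
      {(QuotientGroup.mk (upper ϖ ϖ 0) : Gp two ⧸ Kp two)} := by
    ext c
    constructor
    · rintro ⟨k, hk, rfl⟩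
      exact (QuotientGroup.eq.2 (upper_varpi_conj hk)).symm
    · rintro rfl
      exact ⟨1, one_mem _, by rw [one_mul]⟩
  rw [hecke, hset, finsum_mem_singleton]
  obtain ⟨k, hk⟩ := QuotientGroup.mk_out_eq_mul (Kp two) (upper ϖ ϖ 0)
  rw [hk, atPrime, atPrime, RestrictedProduct.mulSingle_mul,
    show ((1, RestrictedProduct.mulSingle Kp two (upper ϖ ϖ 0) * RestrictedProduct.mulSingle Kp two k) : GA) =
      (1, atPrime two (upper ϖ ϖ 0)) * (1, atPrime two k) by simp [atPrime], ← mul_assoc, hΦ _ _ k.2]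
  rfl

/-! ### Spherical vectors in representations of `GL₂(B_2)` -/

/-- A vector fixed by `K_2` and by the scalar `ϖ₂`, which is an eigenvector with eigenvalue `6 α` of
the Hecke operator of `diag(ϖ₂, 1)`. -/
structure IsSpherical (α : ℂ) {V : Type*} [AddCommGroup V] [Module ℂ V]
    (ρ : Representation ℂ (Gp two) V) (v : V) : Prop where
  fixed : ∀ k ∈ Kp two, ρ k v = v
  scalar : ρ (upper ϖ ϖ 0) v = v
  hecke : ∑ o, ρ (heckeRep o) v = (6 * α) • v

section Spherical

variable {V : Type*} [AddCommGroup V] [Module ℂ V] (ρ : Representation ℂ (Gp two) V) (v : V)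

/-- The translate of a spherical vector attached to the ball `b + ϖ₂ ^ k 𝓞_2`, that is, to a vertex of
the tree of `GL₂(B_2)`. -/
def vertex (b : D₂) (k : ℤ) : V := ρ (pMat b k) v

/-- The combination `[b, k - 1] - 2 α [b, k]` attached to an edge of the tree. -/
def edge (α : ℂ) (b : D₂) (k : ℤ) : V := vertex ρ v b (k - 1) - (2 * α) • vertex ρ v b k

variable {ρ v} {α : ℂ}

lemma apply_vertex (c b : D₂) (l k : ℤ) :
    ρ (pMat c l) (vertex ρ v b k) = vertex ρ v (c + (ϖ ^ l : D₂ˣ) * b) (l + k) := by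
  rw [vertex, vertex, ← pMat_mul, map_mul]
  rfl

lemma apply_edge (c b : D₂) (l k : ℤ) :
    ρ (pMat c l) (edge ρ v α b k) = edge ρ v α (c + (ϖ ^ l : D₂ˣ) * b) (l + k) := by
  rw [edge, map_sub, map_smul, apply_vertex, apply_vertex, edge, add_sub_assoc]

lemma vertex_zero : vertex ρ v 0 0 = v := by
  rw [vertex, pMat, zpow_zero, upper_one, map_one]
  rfl

variable (hv : IsSpherical α ρ v)
include hv

lemma IsSpherical.apply_mul (g : Gp two) {k : Gp two} (hk : k ∈ Kp two) : ρ (g * k) v = ρ g v := by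
  rw [map_mul, End.mul_apply, hv.fixed k hk]

lemma IsSpherical.apply_eq {g g' : Gp two} (h : g⁻¹ * g' ∈ Kp two) : ρ g' v = ρ g v := by
  rw [← hv.apply_mul g h, mul_inv_cancel_left]

lemma IsSpherical.vertex_congr {b b' : D₂} {k : ℤ} (h : nrm (b - b') ≤ 2 ^ (-k)) :
    vertex ρ v b k = vertex ρ v b' k := by
  refine hv.apply_eq ?_
  rw [pMat, pMat, upper_inv, upper_mul, upper_mem_Kp]
  refine ⟨by simp [val2_one], by simp [val2_one], ?_⟩
  rw [inv_one, Units.val_one, mul_one, mul_one, ← sub_eq_add_neg, ← mul_sub, nrm_mul, nrm_inv,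
    nrm_varpi_zpow]
  exact inv_mul_le_one_of_le₀ h (by positivity)

lemma IsSpherical.edge_congr {b b' : D₂} {k : ℤ} (h : nrm (b - b') ≤ 2 ^ (-k)) :
    edge ρ v α b k = edge ρ v α b' k := by
  rw [edge, edge, hv.vertex_congr h, hv.vertex_congr (k := k - 1) (h.trans ?_)]
  exact zpow_le_zpow_right₀ (by norm_num) (by omega)

lemma IsSpherical.scalar_zpow (n : ℤ) : ρ (upper (ϖ ^ n) (ϖ ^ n) 0) v = v := by
  have h : ∀ m : ℕ, ρ (upper (ϖ ^ m) (ϖ ^ m) 0) v = v := by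
    intro m
    induction m with
    | zero => rw [pow_zero, upper_one, map_one]; rfl
    | succ m ih =>
      have : upper (ϖ ^ (m + 1)) (ϖ ^ (m + 1)) 0 = upper (ϖ ^ m) (ϖ ^ m) 0 * upper ϖ ϖ 0 := by
        rw [upper_mul]
        simp [pow_succ]
      rw [this, map_mul, End.mul_apply, hv.scalar, ih]
  obtain ⟨m, rfl | rfl⟩ := n.eq_nat_or_neg
  · simpa using h m
  · conv_lhs => rw [← h m]
    rw [← End.mul_apply, ← map_mul, upper_mul]
    simp [upper_one]

/-- Every translate of a spherical vector is attached to a ball. -/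
lemma IsSpherical.exists_vertex (g : Gp two) : ∃ b k, ρ g v = vertex ρ v b k := by
  obtain ⟨a, d, x, k, hk, rfl⟩ := exists_iwasawa_two g
  refine ⟨x * (d⁻¹ : D₂ˣ), val2 a - val2 d, ?_⟩
  rw [hv.apply_mul _ hk, vertex]
  conv_rhs => rw [← hv.scalar_zpow (val2 d)]
  rw [← End.mul_apply, ← map_mul]
  refine hv.apply_eq ?_
  rw [pMat, upper_mul, upper_inv, upper_mul, upper_mem_Kp]
  refine ⟨by simp only [val2_mul, val2_inv, val2_varpi_zpow]; ring,
    by simp only [val2_mul, val2_inv, val2_varpi_zpow, val2_one]; ring, ?_⟩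
  have h0 : ∀ y : D₂, y = 0 → nrm y ≤ 1 := fun y hy => by rw [hy, nrm_zero]; exact zero_le_one
  refine h0 _ ?_
  simp [mul_assoc]

lemma IsSpherical.sum_vertex (b : D₂) (k : ℤ) :
    ∑ i, vertex ρ v (b + (ϖ ^ k : D₂ˣ) * resRep ℚ_[two] i) (k + 1) =
      (6 * α) • vertex ρ v b k - vertex ρ v b (k - 1) := by
  have h := congrArg (ρ (pMat b k)) hv.hecke
  rw [Fintype.sum_option, map_add, map_sum, map_smul] at h
  have h1 : ∀ i, ρ (pMat b k) (ρ (heckeRep (some i)) v) =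
      vertex ρ v (b + (ϖ ^ k : D₂ˣ) * resRep ℚ_[two] i) (k + 1) := fun i => apply_vertex _ _ _ _
  have h2 : ρ (pMat b k) (ρ (heckeRep none) v) = vertex ρ v b (k - 1) := by
    have : ρ (heckeRep none) v = vertex ρ v 0 (-1) := by
      rw [vertex]
      conv_rhs => rw [← hv.scalar]
      rw [← End.mul_apply, ← map_mul, heckeRep, pMat, upper_mul]
      simp
    rw [this, apply_vertex, mul_zero, add_zero, ← sub_eq_add_neg]
  rw [h2] at h
  simp only [h1] at h
  exact eq_sub_of_add_eq' h

lemma IsSpherical.sum_edge (hα : α ^ 2 = 1 / 2) (b : D₂) (k : ℤ) :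
    ∑ i, edge ρ v α (b + (ϖ ^ k : D₂ˣ) * resRep ℚ_[two] i) (k + 1) = (2 * α) • edge ρ v α b k := by
  have h1 : ∀ i, vertex ρ v (b + (ϖ ^ k : D₂ˣ) * resRep ℚ_[two] i) (k + 1 - 1) = vertex ρ v b k := by
    intro i
    rw [add_sub_cancel_right]
    refine hv.vertex_congr ?_
    rw [add_sub_cancel_left, nrm_mul, nrm_varpi_zpow]
    exact mul_le_of_le_one_right (by positivity) (nrm_resRep_le i)
  simp only [edge, sum_sub_distrib, h1, ← smul_sum, hv.sum_vertex, Finset.sum_const,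
    Finset.card_univ, Fintype.card_fin]
  rw [← Nat.cast_smul_eq_nsmul ℂ]
  have hα4 : α * α = 1 / 2 := by rw [← pow_two, hα]
  match_scalars
  · linear_combination -8 * hα4
  · ring

lemma IsSpherical.edge_mem_span (hα : α ^ 2 = 1 / 2) (b : D₂) (k : ℤ) (j : ℕ) :
    edge ρ v α b k ∈ span ℂ (Set.range fun b' => edge ρ v α b' (k + j)) := by
  have hα0 : (2 * α) ≠ 0 := by
    rintro h
    have : α = 0 := by simpa using h
    rw [this] at hα
    norm_num at hα
  induction j generalizing b k with
  | zero => exact subset_span ⟨b, by simp⟩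
  | succ j ih =>
    have h : edge ρ v α b k = (2 * α)⁻¹ •
        ∑ i, edge ρ v α (b + (ϖ ^ k : D₂ˣ) * resRep ℚ_[two] i) (k + 1) := by
      rw [hv.sum_edge hα, smul_smul, inv_mul_cancel₀ hα0, one_smul]
    rw [h]
    refine smul_mem _ _ (sum_mem fun i _ => ?_)
    have := ih (b + (ϖ ^ k : D₂ˣ) * resRep ℚ_[two] i) (k + 1)
    rwa [show k + ((j + 1 : ℕ) : ℤ) = k + 1 + j by push_cast; ring]

/-- Each vertex vector is a combination of the vector of one large ball and of edge vectors of small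
balls. -/
lemma IsSpherical.vertex_mem_span (hα : α ^ 2 = 1 / 2) (b : D₂) {m k n : ℤ} (hmk : m ≤ k) (hkn : k ≤ n)
    (hb : nrm b ≤ 2 ^ (-m)) :
    vertex ρ v b k ∈ span ℂ {vertex ρ v 0 m} ⊔
      span ℂ (Set.range fun b' => edge ρ v α b' n) := by
  have hα0 : (2 * α) ≠ 0 := by
    rintro h
    have : α = 0 := by simpa using h
    rw [this] at hα
    norm_num at hα
  obtain ⟨j, rfl⟩ := Int.le.dest hmk
  clear hmk
  induction j with
  | zero =>
    refine mem_sup_left (subset_span ?_)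
    rw [Set.mem_singleton_iff]
    simp only [Nat.cast_zero, add_zero]
    exact hv.vertex_congr (by simpa using hb)
  | succ j ih =>
    have h : vertex ρ v b (m + (j + 1 : ℕ)) =
        (2 * α)⁻¹ • (vertex ρ v b (m + j) - edge ρ v α b (m + (j + 1 : ℕ))) := by
      rw [edge, show m + ((j + 1 : ℕ) : ℤ) - 1 = m + j by push_cast; ring, sub_sub_cancel, smul_smul,
        inv_mul_cancel₀ hα0, one_smul]
    rw [h]
    refine smul_mem _ _ (sub_mem (ih (by push_cast at hkn; omega)) ?_)
    refine mem_sup_right ?_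
    obtain ⟨i, hi⟩ := Int.le.dest hkn
    rw [← hi]
    exact hv.edge_mem_span hα _ _ _

end Spherical

/-! ### The unramified principal series at two -/

lemma unramified_apply {χ : D₂ˣ →* ℂˣ} (hχ : IsUnramified two χ) (a : D₂ˣ) :
    χ a = χ ϖ ^ val2 a := by
  have h0 : val2 (ϖ ^ (-val2 a) * a) = 0 := by rw [val2_mul, val2_varpi_zpow]; ring
  have h1 : χ (ϖ ^ (-val2 a) * a) = 1 := by
    apply hχ
    have e := nrm_eq_zpow (ϖ ^ (-val2 a) * a)
    rw [h0, neg_zero, zpow_zero] at e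
    refine ⟨mem_O2.2 e.le, mem_O2.2 ?_⟩
    change nrm ((ϖ ^ (-val2 a) * a)⁻¹ : D₂ˣ) ≤ 1
    rw [nrm_inv, e, inv_one]
  rw [map_mul, map_zpow, zpow_neg, inv_mul_eq_one] at h1
  exact h1.symm

/-- The unramified character of `B_2^×` with a given value at `ϖ₂`. -/
def unramifiedChar (t : ℂˣ) : D₂ˣ →* ℂˣ where
  toFun a := t ^ val2 a
  map_one' := by rw [val2_one, zpow_zero]
  map_mul' a b := by rw [val2_mul, zpow_add]

lemma unramifiedChar_isUnramified (t : ℂˣ) : IsUnramified two (unramifiedChar t) := by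
  intro a ha
  change t ^ val2 a = 1
  rw [val2_eq_zero_of_mem (mem_O2.1 ha.1) (mem_O2.1 ha.2), zpow_zero]

lemma unramifiedChar_varpi (t : ℂˣ) : unramifiedChar t ϖ = t := by
  change t ^ val2 ϖ = t
  rw [val2_varpi, zpow_one]

/-- The condition that `δ^{1/2} χ₁ χ₂` is the character `α ^ (val a - val d)`, where `α ^ 2 = 1 / 2`.
It holds for the pair of characters of the theorem, with `α = -ε / √2`. -/
structure IsTwist (χ₁ χ₂ : D₂ˣ →* ℂˣ) (α : ℂ) : Prop where
  sq : α ^ 2 = 1 / 2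
  eq : ∀ a d : D₂ˣ, ((‖normSq (a : D₂)‖ / ‖normSq (d : D₂)‖ : ℝ) : ℂ) *
    (χ₁ a : ℂ) * (χ₂ d : ℂ) = α ^ (val2 a - val2 d)

lemma isTwist_of_unramified {χ₁ χ₂ : D₂ˣ →* ℂˣ} {α : ℂ} (h₁ : IsUnramified two χ₁)
    (h₂ : IsUnramified two χ₂) (hα : α ^ 2 = 1 / 2) (e₁ : (χ₁ ϖ : ℂ) = 2 * α)
    (e₂ : (χ₂ ϖ : ℂ) = α) : IsTwist χ₁ χ₂ α := by
  refine ⟨hα, fun a d => ?_⟩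
  have hα0 : α ≠ 0 := by
    rintro rfl
    norm_num at hα
  have e : α⁻¹ = 2 * α := by
    apply inv_eq_of_mul_eq_one_right
    linear_combination 2 * hα
  have n1 := nrm_eq_zpow a
  have n2 := nrm_eq_zpow d
  rw [nrm] at n1 n2
  rw [n1, n2, unramified_apply h₁ a, unramified_apply h₂ d, Units.val_zpow_eq_zpow_val,
    Units.val_zpow_eq_zpow_val, e₁, e₂, zpow_sub₀ hα0, div_eq_mul_inv (α ^ val2 a), ← inv_zpow, e,
    mul_zpow, mul_zpow]
  push_cast
  rw [zpow_neg, zpow_neg]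
  have h2 : ∀ n : ℤ, (2 : ℂ) ^ n ≠ 0 := fun n => zpow_ne_zero _ two_ne_zero
  field_simp

/-- The spherical function in the principal series, by means of the Iwasawa decomposition. -/
def spherFun (α : ℂ) (g : Gp two) : ℂ :=
  α ^ (val2 (exists_iwasawa_two g).choose - val2 (exists_iwasawa_two g).choose_spec.choose)

lemma spherFun_apply (α : ℂ) (a d : D₂ˣ) (x : D₂) {k : Gp two} (hk : k ∈ Kp two) :
    spherFun α (upper a d x * k) = α ^ (val2 a - val2 d) := by
  set g := upper a d x * k with hg
  obtain ⟨x', k', hk', h⟩ := (exists_iwasawa_two g).choose_spec.choose_spec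
  rw [spherFun]
  generalize (exists_iwasawa_two g).choose_spec.choose = d' at h ⊢
  generalize (exists_iwasawa_two g).choose = a' at h ⊢
  have h1 : (upper a' d' x')⁻¹ * upper a d x ∈ Kp two := by
    have : (upper a' d' x')⁻¹ * upper a d x = k' * k⁻¹ := by
      rw [inv_mul_eq_iff_eq_mul, ← mul_assoc, eq_mul_inv_iff_mul_eq, ← hg, h]
    rw [this]
    exact (Kp two).mul_mem hk' ((Kp two).inv_mem hk)
  rw [upper_inv, upper_mul, upper_mem_Kp, val2_mul, val2_mul, val2_inv, val2_inv] at h1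
  congr 1
  omega

lemma spherFun_upper_mul {α : ℂ} (hα : α ≠ 0) (a d : D₂ˣ) (x : D₂) (g : Gp two) :
    spherFun α (upper a d x * g) = α ^ (val2 a - val2 d) * spherFun α g := by
  obtain ⟨a', d', x', k, hk, rfl⟩ := exists_iwasawa_two g
  rw [← mul_assoc, upper_mul, spherFun_apply _ _ _ _ hk, spherFun_apply _ _ _ _ hk, val2_mul, val2_mul,
    ← zpow_add₀ hα]
  congr 1
  ring

lemma spherFun_mul {α : ℂ} (g : Gp two) {k : Gp two} (hk : k ∈ Kp two) :
    spherFun α (g * k) = spherFun α g := by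
  obtain ⟨a', d', x', k', hk', rfl⟩ := exists_iwasawa_two g
  rw [mul_assoc, spherFun_apply _ _ _ _ ((Kp two).mul_mem hk' hk), spherFun_apply _ _ _ _ hk']

lemma spherFun_mul_scalar {α : ℂ} (g : Gp two) : spherFun α (g * upper ϖ ϖ 0) = spherFun α g := by
  obtain ⟨a, d, x, k, hk, rfl⟩ := exists_iwasawa_two g
  have : upper a d x * k * upper ϖ ϖ 0 =
      upper (a * ϖ) (d * ϖ) (x * ϖ) * ((upper ϖ ϖ 0)⁻¹ * (k * upper ϖ ϖ 0)) := by
    have h : upper (a * ϖ) (d * ϖ) (x * ϖ) = upper a d x * upper ϖ ϖ 0 := by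
      rw [upper_mul]
      simp
    rw [h]
    simp only [mul_assoc, mul_inv_cancel_left]
  rw [this, spherFun_apply _ _ _ _ (upper_varpi_conj hk), spherFun_apply _ _ _ _ hk, val2_mul, val2_mul]
  congr 1
  ring

/-- In an ultrametric sum of elements of different norm, the larger norm wins. -/
lemma nrm_add_eq {x y : D₂} (h : nrm y < nrm x) : nrm (x + y) = nrm x := by
  refine le_antisymm ((nrm_add_le x y).trans_eq (max_eq_left h.le)) ?_
  have := nrm_sub_le (x + y) y
  rw [add_sub_cancel_right] at this
  exact (le_max_iff.1 this).resolve_right (not_le.2 h)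

lemma spherFun_one (α : ℂ) : spherFun α 1 = 1 := by
  have := spherFun_apply α 1 1 0 (Kp two).one_mem
  rwa [upper_one, mul_one, sub_self, zpow_zero] at this

lemma spherFun_pMat (α : ℂ) (b : D₂) (k : ℤ) : spherFun α (pMat b k) = α ^ k := by
  have := spherFun_apply α (ϖ ^ k) 1 b (Kp two).one_mem
  rwa [mul_one, val2_varpi_zpow, val2_one, sub_zero] at this

/-- The matrix with rows `(0, 1)` and `(1, -x)`, which represents the point `x` of the boundary. -/
def gMat (x : D₂) : Gp two := weyl ℚ_[two] * upper 1 1 (-x)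

lemma weyl_mul_upper {K : Type} [Field K] (A : ℍ[K]ˣ) (y : ℍ[K]) :
    weyl K * upper A 1 y = upper 1 A 0 * (weyl K * upper 1 1 (((A⁻¹ : ℍ[K]ˣ) : ℍ[K]) * y)) := by
  apply Units.ext
  ext i j : 1
  fin_cases i <;> fin_cases j <;> simp [upper, weyl, mul_apply]

lemma weyl_mul_upper' {K : Type} [Field K] (A u : ℍ[K]ˣ) :
    weyl K * upper A 1 u = upper (-(u⁻¹ * A)) u 1 * lower ((u⁻¹ * A : ℍ[K]ˣ) : ℍ[K]) := by
  apply Units.ext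
  ext i j : 1
  fin_cases i <;> fin_cases j <;> simp [upper, lower, weyl, mul_apply]

lemma gMat_mul_pMat (x b : D₂) (k : ℤ) : gMat x * pMat b k = weyl _ * upper (ϖ ^ k) 1 (b - x) := by
  rw [gMat, pMat, mul_assoc, upper_mul]
  simp [sub_eq_add_neg]

lemma spherFun_gMat_of_le (α : ℂ) {x b : D₂} {k : ℤ} (h : nrm (b - x) ≤ 2 ^ (-k)) :
    spherFun α (gMat x * pMat b k) = α ^ (-k) := by
  rw [gMat_mul_pMat, weyl_mul_upper, spherFun_apply, val2_varpi_zpow, val2_one, zero_sub]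
  refine (Kp two).mul_mem weyl_mem_Kp (upper_mem_Kp.2 ⟨val2_one, val2_one, ?_⟩)
  rw [nrm_mul, nrm_inv, nrm_varpi_zpow]
  exact inv_mul_le_one_of_le₀ h (by positivity)

lemma spherFun_gMat_of_eq (α : ℂ) {x b : D₂} {k : ℤ} {u : D₂ˣ} (hu : (u : D₂) = b - x)
    (h : val2 u ≤ k) : spherFun α (gMat x * pMat b k) = α ^ (k - 2 * val2 u) := by
  rw [gMat_mul_pMat, ← hu, weyl_mul_upper', spherFun_apply, val2_neg, val2_mul, val2_inv,
    val2_varpi_zpow]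
  · congr 1
    ring
  · apply lower_mem_Kp
    rw [nrm_eq_zpow, val2_mul, val2_inv, val2_varpi_zpow]
    exact zpow_le_one_of_nonpos₀ (by norm_num) (by omega)

lemma ring_aux₃ {R : Type*} [Ring R] (u : Rˣ) (z : R) : (u : R) * -((u⁻¹ : Rˣ) * z) = -z := by
  simp

/-- The Bruhat decomposition of `GL₂(B_2)`. -/
lemma exists_bruhat_two (g : Gp two) :
    (∃ a d x, g = upper a d x) ∨ ∃ a d x y, g = upper a d x * gMat y := by
  by_cases h : g.val 1 0 = 0
  · exact Or.inl (exists_upper_of_apply_eq_zero g h)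
  · right
    obtain ⟨u, hu⟩ := exists_unit_of_ne_zero h
    set y : D₂ := -((u⁻¹ : D₂ˣ) * g.val 1 1) with hy
    have hinv : (gMat y)⁻¹ = upper 1 1 y * weyl _ := by
      rw [gMat, mul_inv_rev, weyl_inv, upper_inv]
      simp
    obtain ⟨a, d, x, hg⟩ := exists_upper_of_apply_eq_zero (g * (gMat y)⁻¹) (by
      have : (u : D₂) * y = -g.val 1 1 := by
        rw [hy]
        exact ring_aux₃ _ _
      rw [hinv]
      simp [Units.val_mul, mul_apply, Fin.sum_univ_two, upper, weyl, ← hu, this])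
    exact ⟨a, d, x, y, by rw [← hg, inv_mul_cancel_right]⟩

variable {χ₁ χ₂ : D₂ˣ →* ℂˣ} {α : ℂ}

lemma IsTwist.ne_zero (h : IsTwist χ₁ χ₂ α) : α ≠ 0 := by
  rintro rfl
  have := h.sq
  norm_num at this

lemma IsTwist.apply_upper (h : IsTwist χ₁ χ₂ α) (f : (principalSeries two χ₁ χ₂).toSubmodule)
    (a d : D₂ˣ) (x : D₂) (g : Gp two) :
    f.1 (upper a d x * g) = α ^ (val2 a - val2 d) * f.1 g := by
  rw [f.2.1, h.eq]

lemma principalSeries_apply (g x : Gp two) (f : (principalSeries two χ₁ χ₂).toSubmodule) :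
    ((principalSeries two χ₁ χ₂).toRepresentation g f).1 x = f.1 (x * g) := rfl

/-- The spherical vector of the principal series. -/
def spherVec (h : IsTwist χ₁ χ₂ α) : (principalSeries two χ₁ χ₂).toSubmodule :=
  ⟨spherFun α, fun a d x g => by rw [spherFun_upper_mul h.ne_zero, h.eq],
    0, fun _ hu g => spherFun_mul g hu.1⟩

/-- Functions in the principal series agree if they agree at the boundary points. -/
lemma IsTwist.ext (h : IsTwist χ₁ χ₂ α) {f f' : (principalSeries two χ₁ χ₂).toSubmodule}
    (h1 : f.1 1 = f'.1 1) (h2 : ∀ x, f.1 (gMat x) = f'.1 (gMat x)) : f = f' := by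
  apply Subtype.ext
  funext g
  rcases exists_bruhat_two g with ⟨a, d, x, rfl⟩ | ⟨a, d, x, y, rfl⟩
  · rw [← mul_one (upper a d x), h.apply_upper, h.apply_upper, h1]
  · rw [h.apply_upper, h.apply_upper, h2]

lemma vertex_apply (h : IsTwist χ₁ χ₂ α) (b : D₂) (k : ℤ) (g : Gp two) :
    (vertex (principalSeries two χ₁ χ₂).toRepresentation (spherVec h) b k).1 g =
      spherFun α (g * pMat b k) := rfl

lemma IsTwist.inv_eq (h : IsTwist χ₁ χ₂ α) : α⁻¹ = 2 * α := by
  apply inv_eq_of_mul_eq_one_right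
  linear_combination 2 * h.sq

/-- The values of the translates of the spherical function at the finite boundary points. -/
lemma spherFun_gMat (α : ℂ) {x b : D₂} {m : ℤ} (hm : nrm (b - x) = 2 ^ (-m)) (k : ℤ) :
    spherFun α (gMat x * pMat b k) = α ^ (k - 2 * min k m) := by
  rcases le_total k m with hk | hk
  · rw [min_eq_left hk, spherFun_gMat_of_le]
    · congr 1
      ring
    · rw [hm]
      exact zpow_le_zpow_right₀ (by norm_num) (by omega)
  · obtain ⟨u, hu⟩ := exists_unit_of_ne_zero (x := b - x) (fun h0 => by
      rw [h0, nrm_zero] at hm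
      exact (zpow_ne_zero _ two_ne_zero) hm.symm)
    have hum : val2 u = m := val2_eq_iff.2 (hu ▸ hm)
    rw [min_eq_right hk, spherFun_gMat_of_eq α hu (hum.le.trans hk), hum]

lemma spherVec_isSpherical (h : IsTwist χ₁ χ₂ α) :
    IsSpherical α (principalSeries two χ₁ χ₂).toRepresentation (spherVec h) where
  fixed k hk := Subtype.ext (funext fun g => spherFun_mul g hk)
  scalar := Subtype.ext (funext fun g => spherFun_mul_scalar g)
  hecke := by
    have hα0 := h.ne_zero
    have hinv := h.inv_eq
    have hsq := h.sq
    have hnone : ∀ g : Gp two, spherFun α (g * heckeRep none) = spherFun α (g * pMat 0 (-1)) := by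
      intro g
      have : heckeRep none = pMat 0 (-1) * upper ϖ ϖ 0 := by
        rw [heckeRep, pMat, upper_mul]
        simp
      rw [this, ← mul_assoc, spherFun_mul_scalar]
    have eval : ∀ g : Gp two, (∑ o, (principalSeries two χ₁ χ₂).toRepresentation (heckeRep o)
        (spherVec h)).1 g = ∑ i, spherFun α (g * pMat (resRep _ i) 1) + spherFun α (g * pMat 0 (-1)) := by
      intro g
      rw [← hnone, Fintype.sum_option, add_comm]
      simp only [Submodule.coe_add, coe_sum, Pi.add_apply, Finset.sum_apply]
      rfl
    refine h.ext ?_ fun x => ?_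
    · rw [eval]
      change _ = 6 * α * spherFun α 1
      simp only [one_mul, spherFun_pMat, spherFun_one, zpow_one, zpow_neg_one, hinv, Finset.sum_const,
        Finset.card_univ, Fintype.card_fin]
      simp
      ring
    · rw [eval]
      change _ = 6 * α * spherFun α (gMat x)
      have e0 : spherFun α (gMat x) = spherFun α (gMat x * pMat 0 0) := by
        rw [pMat, zpow_zero, upper_one, mul_one]
      rw [e0]
      rcases le_or_gt (nrm x) 1 with hx | hx
      · obtain ⟨i₀, hi₀⟩ := exists_resRep hx
        have hx0 : nrm (0 - x) ≤ 1 := by rwa [zero_sub, nrm_neg]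
        rw [spherFun_gMat_of_le α (k := 0) (by simpa using hx0),
          spherFun_gMat_of_le α (k := -1) (hx0.trans (by norm_num)),
          ← Finset.add_sum_erase _ _ (mem_univ i₀),
          spherFun_gMat_of_le α (k := 1) (by rw [nrm_sub_comm]; simpa using hi₀)]
        have hrest : ∀ i ∈ Finset.univ.erase i₀, spherFun α (gMat x * pMat (resRep _ i) 1) = α := by
          intro i hi
          have hne := Finset.ne_of_mem_erase hi
          rw [spherFun_gMat α (m := 0)]
          · simp
          · have : resRep ℚ_[two] i - x =
                (resRep ℚ_[two] i - resRep ℚ_[two] i₀) + -(x - resRep ℚ_[two] i₀) := by abel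
            rw [this, nrm_add_eq, nrm_resRep_sub hne]
            · simp
            · rw [nrm_neg, nrm_resRep_sub hne]
              linarith
        rw [sum_congr rfl hrest]
        simp [hinv]
        ring
      · obtain ⟨m, hm⟩ := exists_nrm_eq_zpow (x := x) (fun h0 => by
          rw [h0, nrm_zero] at hx
          linarith)
        have hm0 : m < 0 := by
          rw [hm, one_lt_zpow_iff_right₀ (by norm_num)] at hx
          omega
        have hb : ∀ b : D₂, nrm b ≤ 1 → nrm (b - x) = 2 ^ (-m) := by
          intro b hb
          rw [nrm_sub_comm, sub_eq_add_neg, nrm_add_eq, hm]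
          rw [nrm_neg]
          linarith
        rw [spherFun_gMat α (hb 0 (by rw [nrm_zero]; norm_num)),
          spherFun_gMat α (hb 0 (by rw [nrm_zero]; norm_num)),
          sum_congr rfl fun i _ => spherFun_gMat α (hb _ (nrm_resRep_le i)) 1,
          min_eq_right (by omega), min_eq_right (by omega), min_eq_right (by omega),
          sub_eq_add_neg, sub_eq_add_neg, sub_eq_add_neg, zpow_add₀ hα0, zpow_add₀ hα0, zpow_add₀ hα0]
        simp [hinv]
        ring

/-! ### Irreducibility and universality of the principal series at two -/

/-- The ball of radius `2 ^ (-n)` about zero. -/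
def ball (n : ℤ) : AddSubgroup D₂ where
  carrier := {x | nrm x ≤ 2 ^ (-n)}
  zero_mem' := by
    change nrm 0 ≤ _
    rw [nrm_zero]
    positivity
  add_mem' := fun hx hy => nrm_add_le_of hx hy
  neg_mem' := fun {x} hx => by
    change nrm (-x) ≤ _
    rwa [nrm_neg]

lemma mem_ball {n : ℤ} {x : D₂} : x ∈ ball n ↔ nrm x ≤ 2 ^ (-n) := Iff.rfl

lemma nrm_out_sub (n : ℤ) (x : D₂) : nrm ((QuotientAddGroup.mk x : D₂ ⧸ ball n).out - x) ≤ 2 ^ (-n) := by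
  obtain ⟨y, hy⟩ := QuotientAddGroup.mk_out_eq_add (ball n) x
  rw [hy, add_sub_cancel_left]
  exact y.2

/-- A ball is covered by finitely many balls of a given smaller radius. -/
lemma exists_finset_cover (m : ℤ) (j : ℕ) :
    ∃ t : Finset D₂, ∀ x, nrm x ≤ 2 ^ (-m) → ∃ b ∈ t, nrm (x - b) ≤ 2 ^ (-(m + j)) := by
  classical
  induction j with
  | zero => exact ⟨{0}, fun x hx => ⟨0, by simp, by simpa using hx⟩⟩
  | succ j ih =>
    obtain ⟨t, ht⟩ := ih
    refine ⟨(t ×ˢ (Finset.univ : Finset (Fin 4))).image fun p =>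
      p.1 + (ϖ ^ (m + j) : D₂ˣ) * resRep ℚ_[two] p.2, fun x hx => ?_⟩
    obtain ⟨b, hb, hxb⟩ := ht x hx
    obtain ⟨i, hi⟩ := exists_resRep (x := (ϖ ^ (-(m + j)) : D₂ˣ) * (x - b)) (by
      rw [nrm_mul, nrm_varpi_zpow, neg_neg]
      calc (2 : ℝ) ^ (m + j) * nrm (x - b) ≤ 2 ^ (m + j) * 2 ^ (-(m + j)) := by gcongr
        _ = 1 := by rw [← zpow_add₀ (by norm_num), add_neg_cancel, zpow_zero])
    refine ⟨_, Finset.mem_image.2 ⟨(b, i), by simp [hb], rfl⟩, ?_⟩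
    have : x - (b + (ϖ ^ (m + j) : D₂ˣ) * resRep ℚ_[two] i) =
        (ϖ ^ (m + j) : D₂ˣ) * ((ϖ ^ (-(m + j)) : D₂ˣ) * (x - b) - resRep ℚ_[two] i) := by
      rw [mul_sub, ← mul_assoc, ← Units.val_mul, ← zpow_add, add_neg_cancel, zpow_zero, Units.val_one,
        one_mul]
      abel
    rw [this, nrm_mul, nrm_varpi_zpow]
    calc (2 : ℝ) ^ (-(m + j)) * _ ≤ 2 ^ (-(m + j)) * (1 / 2) := by gcongr
      _ = 2 ^ (-(m + (j + 1 : ℕ))) := by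
        rw [show -(m + ((j + 1 : ℕ) : ℤ)) = -(m + j) + -1 by push_cast; ring,
          zpow_add₀ (by norm_num)]
        norm_num

variable {χ₁ χ₂ : D₂ˣ →* ℂˣ} {α : ℂ}

lemma IsTwist.vertex_one (h : IsTwist χ₁ χ₂ α) (b : D₂) (k : ℤ) :
    (vertex (principalSeries two χ₁ χ₂).toRepresentation (spherVec h) b k).1 1 = α ^ k := by
  rw [vertex_apply, one_mul, spherFun_pMat]

lemma IsTwist.edge_one (h : IsTwist χ₁ χ₂ α) (b : D₂) (k : ℤ) :
    (edge (principalSeries two χ₁ χ₂).toRepresentation (spherVec h) α b k).1 1 = 0 := by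
  change (vertex (principalSeries two χ₁ χ₂).toRepresentation (spherVec h) b (k - 1)).1 1 - 2 * α *
    (vertex (principalSeries two χ₁ χ₂).toRepresentation (spherVec h) b k).1 1 = 0
  rw [h.vertex_one, h.vertex_one, zpow_sub_one₀ h.ne_zero, h.inv_eq]
  ring

open Classical in
lemma IsTwist.edge_gMat (h : IsTwist χ₁ χ₂ α) (b x : D₂) (n : ℤ) :
    (edge (principalSeries two χ₁ χ₂).toRepresentation (spherVec h) α b n).1 (gMat x) =
      if nrm (b - x) ≤ 2 ^ (-n) then -α ^ (1 - n) else 0 := by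
  change (vertex (principalSeries two χ₁ χ₂).toRepresentation (spherVec h) b (n - 1)).1 (gMat x) -
    2 * α * (vertex (principalSeries two χ₁ χ₂).toRepresentation (spherVec h) b n).1 (gMat x) = _
  rw [vertex_apply, vertex_apply]
  have hα0 := h.ne_zero
  have hsq := h.sq
  split_ifs with hn
  · rw [spherFun_gMat_of_le α hn, spherFun_gMat_of_le α (k := n - 1)
      (hn.trans (zpow_le_zpow_right₀ (by norm_num) (by omega))), show -(n - 1) = 1 + -n by ring,
      show 1 - n = 1 + -n by ring, zpow_add₀ hα0, zpow_one]
    ring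
  · obtain ⟨m, hm⟩ := exists_nrm_eq_zpow (x := b - x) (fun h0 => hn (by
      rw [h0, nrm_zero]
      positivity))
    have hmn : m < n := by
      rw [hm, zpow_le_zpow_iff_right₀ (by norm_num)] at hn
      omega
    rw [spherFun_gMat α hm, spherFun_gMat α hm, min_eq_right (by omega), min_eq_right (by omega),
      show n - 1 - 2 * m = -1 + (n - 2 * m) by ring, zpow_add₀ hα0, zpow_neg_one, h.inv_eq]
    ring

lemma nsmul_inv_mul_eq {R : Type*} [Ring R] {n : ℕ} {a : Rˣ} {b : R} (h : (a : R) = n • b) (z : R) :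
    n • (((a⁻¹ : Rˣ) : R) * (b * z)) = z := by
  rw [← mul_smul_comm, ← smul_mul_assoc, ← h, Units.inv_mul_cancel_left]

lemma exists_eq_nsmul {N : ℕ} {z : D₂} (hz : nrm z ≤ 2 ^ (-(2 * N : ℤ))) :
    ∃ w, nrm w ≤ 1 ∧ z = ((two : ℕ) ^ N : ℕ) • w := by
  refine ⟨((ϖ ^ (-(2 * N : ℤ)) : D₂ˣ) : D₂) * ((quat 0 1 0 0) ^ N * z), ?_, ?_⟩
  · have hq : nrm (quat 0 1 0 0) = 1 := by simp [nrm, normSq_eq]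
    rw [nrm_mul, nrm_mul, nrm_pow, hq, one_pow, one_mul, nrm_varpi_zpow, neg_neg]
    calc (2 : ℝ) ^ (2 * N : ℤ) * nrm z ≤ 2 ^ (2 * N : ℤ) * 2 ^ (-(2 * N : ℤ)) := by gcongr
      _ = 1 := by rw [← zpow_add₀ (by norm_num), add_neg_cancel, zpow_zero]
  · have h2 : ((ϖ ^ (2 * N) : D₂ˣ) : D₂) = ((two : ℕ) ^ N : ℕ) • (quat 0 1 0 0) ^ N := by
      rw [varpiUnit_pow_two_mul N, ← Nat.cast_smul_eq_nsmul ℚ_[two], Nat.cast_pow]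
      rfl
    rw [zpow_neg, show (2 * N : ℤ) = ((2 * N : ℕ) : ℤ) by push_cast; rfl, zpow_natCast]
    exact (nsmul_inv_mul_eq h2 z).symm

lemma lower_mem_congruence {N : ℕ} {z : D₂} (hz : nrm z ≤ 2 ^ (-(2 * N : ℤ))) :
    lower z ∈ congruence two N := by
  obtain ⟨w, hw, rfl⟩ := exists_eq_nsmul hz
  refine ⟨lower_mem_Kp (hz.trans (zpow_le_one_of_nonpos₀ (by norm_num) (by omega))),
    !![0, 0; w, 0], ?_, ?_⟩
  · intro i j
    fin_cases i <;> fin_cases j <;> first | exact O2.zero_mem | exact mem_O2.2 hw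
  · ext i j : 1
    fin_cases i <;> fin_cases j <;> simp [lower]

lemma upper_mem_congruence {N : ℕ} {z : D₂} (hz : nrm z ≤ 2 ^ (-(2 * N : ℤ))) :
    upper 1 1 z ∈ congruence two N := by
  obtain ⟨w, hw, rfl⟩ := exists_eq_nsmul hz
  refine ⟨upper_mem_Kp.2 ⟨val2_one, val2_one,
    hz.trans (zpow_le_one_of_nonpos₀ (by norm_num) (by omega))⟩, !![0, w; 0, 0], ?_, ?_⟩
  · intro i j
    fin_cases i <;> fin_cases j <;> first | exact O2.zero_mem | exact mem_O2.2 hw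
  · ext i j : 1
    fin_cases i <;> fin_cases j <;> simp [upper]

/-- A vector in the principal series which is fixed by the unipotent matrices `n(y)` with `y` in a ball
is a combination of the spherical vector and of edge vectors of balls of that radius. -/
lemma IsTwist.mem_span (h : IsTwist χ₁ χ₂ α) (f : (principalSeries two χ₁ χ₂).toSubmodule) (n : ℤ)
    (hf : ∀ y, nrm y ≤ 2 ^ (-n) → ∀ g, f.1 (g * upper 1 1 y) = f.1 g) (hn : 0 ≤ n) :
    f ∈ span ℂ {spherVec h} ⊔ span ℂ (Set.range fun b =>
      edge (principalSeries two χ₁ χ₂).toRepresentation (spherVec h) α b n) := by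
  classical
  set f' := f - f.1 1 • spherVec h with hf'
  suffices hmem : f' ∈ span ℂ (Set.range fun b =>
      edge (principalSeries two χ₁ χ₂).toRepresentation (spherVec h) α b n) by
    rw [show f = f.1 1 • spherVec h + f' by rw [hf']; abel]
    exact add_mem (mem_sup_left (smul_mem _ _
      (subset_span rfl))) (mem_sup_right hmem)
  have h1 : f'.1 1 = 0 := by
    change f.1 1 - f.1 1 * spherFun α 1 = 0
    rw [spherFun_one, mul_one, sub_self]
  have hinv : ∀ y, nrm y ≤ 2 ^ (-n) → ∀ g, f'.1 (g * upper 1 1 y) = f'.1 g := by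
    intro y hy g
    change f.1 _ - f.1 1 * spherFun α _ = f.1 g - f.1 1 * spherFun α g
    rw [hf y hy, spherFun_mul]
    exact upper_mem_Kp.2 ⟨val2_one, val2_one, hy.trans (zpow_le_one_of_nonpos₀ (by norm_num) (by omega))⟩
  obtain ⟨-, N, hN⟩ := f'.2
  have hcong : ∀ z : D₂, nrm z ≤ 2 ^ (-(2 * N : ℤ)) → f'.1 (lower z) = 0 := by
    intro z hz
    rw [← h1]
    conv_lhs => rw [← one_mul (lower z)]
    exact hN _ (lower_mem_congruence hz) 1
  -- the function `x ↦ f'(g_x)` has compact support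
  have hsupp : ∀ x, 2 ^ (2 * N : ℤ) ≤ nrm x → f'.1 (gMat x) = 0 := by
    intro x hx
    obtain ⟨u, hu⟩ := exists_unit_of_ne_zero (x := -x) (by
      intro h0
      rw [← nrm_neg, h0, nrm_zero] at hx
      have : (0 : ℝ) < 2 ^ (2 * N : ℤ) := by positivity
      linarith)
    have e := weyl_mul_upper' 1 u
    rw [hu, mul_one] at e
    rw [gMat, e, h.apply_upper, hcong, mul_zero]
    rw [nrm_inv, hu, nrm_neg, zpow_neg]
    exact inv_anti₀ (by positivity) hx
  obtain ⟨t, ht⟩ := exists_finset_cover (-(2 * N : ℤ)) (2 * N + n.toNat)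
  have e1 : -(2 * N : ℤ) + ((2 * N + n.toNat : ℕ) : ℤ) = n := by
    push_cast
    rw [Int.toNat_of_nonneg hn]
    ring
  rw [e1, neg_neg] at ht
  let Q := D₂ ⧸ ball n
  let T : Finset Q := t.image fun b => QuotientAddGroup.mk b
  have hsum : f' = ∑ q ∈ T, (-α ^ (n - 1) * f'.1 (gMat q.out)) •
      edge (principalSeries two χ₁ χ₂).toRepresentation (spherVec h) α q.out n := by
    refine h.ext ?_ fun x => ?_
    · rw [h1, coe_sum, Finset.sum_apply]
      symm
      refine sum_eq_zero fun q _ => ?_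
      rw [Submodule.coe_smul, Pi.smul_apply, h.edge_one, smul_zero]
    · rw [coe_sum, Finset.sum_apply]
      simp only [Submodule.coe_smul, Pi.smul_apply, h.edge_gMat, smul_eq_mul]
      set q₀ : Q := QuotientAddGroup.mk x with hq₀
      have hq : ∀ q : Q, nrm (q.out - x) ≤ 2 ^ (-n) ↔ q = q₀ := by
        intro q
        constructor
        · intro hq
          rw [hq₀, ← QuotientAddGroup.out_eq' q]
          refine QuotientAddGroup.eq.2 ?_
          rw [mem_ball, neg_add_eq_sub, nrm_sub_comm]
          exact hq
        · rintro rfl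
          exact nrm_out_sub n x
      have hval : f'.1 (gMat q₀.out) = f'.1 (gMat x) := by
        rw [← hinv (q₀.out - x) (nrm_out_sub n x) (gMat q₀.out), gMat, mul_assoc, upper_mul, gMat,
          one_mul, Units.val_one, one_mul, mul_one,
          show q₀.out - x + -q₀.out = -x by abel]
      have hα2 : -α ^ (n - 1) * -α ^ (1 - n) = 1 := by
        rw [neg_mul_neg, ← zpow_add₀ h.ne_zero]
        simp
      simp only [hq]
      by_cases hT : q₀ ∈ T
      · rw [Finset.sum_eq_single_of_mem q₀ hT (fun q _ hne => by rw [if_neg hne, mul_zero]),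
          if_pos rfl, hval]
        linear_combination (-f'.1 (gMat x)) * hα2
      · rw [sum_eq_zero (fun q hqT => by
          rw [if_neg (fun he : q = q₀ => hT (he ▸ hqT)), mul_zero])]
        apply hsupp
        by_contra! hlt
        obtain ⟨b, hb, hxb⟩ := ht x hlt.le
        refine hT (Finset.mem_image.2 ⟨b, hb, ?_⟩)
        refine QuotientAddGroup.eq.2 ?_
        rw [mem_ball, neg_add_eq_sub]
        exact hxb
  rw [hsum]
  exact sum_mem fun q _ => smul_mem _ _ (subset_span ⟨_, rfl⟩)

variable {χ₁ χ₂ : D₂ˣ →* ℂˣ} {α : ℂ}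

lemma IsTwist.exists_level (f : (principalSeries two χ₁ χ₂).toSubmodule) :
    ∃ n : ℕ, ∀ y, nrm y ≤ 2 ^ (-(n : ℤ)) → ∀ g, f.1 (g * upper 1 1 y) = f.1 g := by
  obtain ⟨-, N, hN⟩ := f.2
  exact ⟨2 * N, fun y hy g => hN _ (upper_mem_congruence (by simpa using hy)) g⟩

section Orbit

variable {V : Type*} [AddCommGroup V] [Module ℂ V]

/-- The subrepresentation generated by a vector. -/
def orbitSpan {G : Type*} [Group G] (ρ : Representation ℂ G V) (v : V) : Submodule ℂ V :=
  span ℂ (Set.range fun g => ρ g v)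

lemma apply_mem_orbitSpan {G : Type*} [Group G] {ρ : Representation ℂ G V} {v : V} (g : G) {x : V}
    (hx : x ∈ orbitSpan ρ v) : ρ g x ∈ orbitSpan ρ v := by
  have hx' : ρ g x ∈ Submodule.map (ρ g) (orbitSpan ρ v) := ⟨x, hx, rfl⟩
  rw [orbitSpan, map_span, ← Set.range_comp] at hx'
  refine span_mono ?_ hx'
  rintro _ ⟨g', rfl⟩
  exact ⟨g * g', by simp⟩

lemma self_mem_orbitSpan {G : Type*} [Group G] (ρ : Representation ℂ G V) (v : V) :
    v ∈ orbitSpan ρ v :=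
  subset_span ⟨1, by simp⟩

lemma span_edge_le_orbitSpan (ρ : Representation ℂ (Gp two) V) (v : V) (α : ℂ) (n : ℤ) :
    span ℂ {v} ⊔ span ℂ (Set.range fun b => edge ρ v α b n) ≤ orbitSpan ρ v := by
  refine sup_le ?_ ?_
  · rw [span_le, Set.singleton_subset_iff]
    exact self_mem_orbitSpan ρ v
  · rw [span_le]
    rintro _ ⟨b, rfl⟩
    exact sub_mem (subset_span ⟨_, rfl⟩)
      (smul_mem _ _ (subset_span ⟨_, rfl⟩))

end Orbit

/-- The spherical vector generates the principal series. -/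
lemma IsTwist.orbitSpan_spherVec (h : IsTwist χ₁ χ₂ α) :
    orbitSpan (principalSeries two χ₁ χ₂).toRepresentation (spherVec h) = ⊤ := by
  rw [eq_top_iff]
  intro f _
  obtain ⟨n, hn⟩ := IsTwist.exists_level f
  exact span_edge_le_orbitSpan _ _ α n (h.mem_span f n hn (by omega))

section Universal

variable {V : Type*} [AddCommGroup V] [Module ℂ V] {ρ : Representation ℂ (Gp two) V} {v : V}

lemma IsSpherical.prod {V' : Type*} [AddCommGroup V'] [Module ℂ V']
    {ρ' : Representation ℂ (Gp two) V'} {v' : V'} (hv : IsSpherical α ρ v)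
    (hv' : IsSpherical α ρ' v') : IsSpherical α (ρ.prod ρ') (v, v') where
  fixed k hk := Prod.ext (hv.fixed k hk) (hv'.fixed k hk)
  scalar := Prod.ext hv.scalar hv'.scalar
  hecke := by
    refine Prod.ext ?_ ?_
    · rw [Prod.fst_sum]
      exact hv.hecke
    · rw [Prod.snd_sum]
      exact hv'.hecke

lemma IsSpherical.weyl_vertex (hv : IsSpherical α ρ v) :
    ρ (weyl ℚ_[two]) (vertex ρ v 0 1) = vertex ρ v 0 (-1) := by
  have e : weyl ℚ_[two] * pMat 0 1 = pMat 0 (-1) * upper ϖ ϖ 0 * weyl ℚ_[two] := by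
    rw [pMat, weyl_mul_upper, mul_zero, upper_one, mul_one, pMat, upper_mul]
    simp
  rw [vertex, ← End.mul_apply, ← map_mul, e, hv.apply_mul _ weyl_mem_Kp, map_mul,
    End.mul_apply, hv.scalar, vertex]

/-- Every vector in the representation generated by a spherical vector is, for all large enough balls
and all small enough radii, a combination of one vertex vector and edge vectors of one radius. -/
lemma IsSpherical.exists_mem_span (hv : IsSpherical α ρ v) (hα : α ^ 2 = 1 / 2) {x : V}
    (hx : x ∈ orbitSpan ρ v) :
    ∃ m n : ℤ, ∀ m' ≤ m, ∀ n' ≥ n, x ∈ span ℂ {vertex ρ v 0 m'} ⊔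
      span ℂ (Set.range fun b' => edge ρ v α b' n') := by
  induction hx using span_induction with
  | mem x hx =>
    obtain ⟨g, rfl⟩ := hx
    obtain ⟨b, k, hbk⟩ := hv.exists_vertex g
    obtain ⟨l, hl⟩ : ∃ l : ℤ, nrm b ≤ 2 ^ (-l) := by
      by_cases hb : b = 0
      · exact ⟨0, by rw [hb, nrm_zero]; positivity⟩
      · obtain ⟨l, hl⟩ := exists_nrm_eq_zpow hb
        exact ⟨l, hl.le⟩
    refine ⟨min k l, k, fun m' hm n' hn => ?_⟩
    simp only [hbk]
    exact hv.vertex_mem_span hα b (hm.trans (min_le_left _ _)) hn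
      (hl.trans (zpow_le_zpow_right₀ (by norm_num) (neg_le_neg (hm.trans (min_le_right _ _)))))
  | zero => exact ⟨0, 0, fun _ _ _ _ => Submodule.zero_mem _⟩
  | add x y _ _ ihx ihy =>
    obtain ⟨m, n, h⟩ := ihx
    obtain ⟨m', n', h'⟩ := ihy
    exact ⟨min m m', max n n', fun a ha b hb => add_mem
      (h a (ha.trans (min_le_left _ _)) b ((le_max_left _ _).trans hb))
      (h' a (ha.trans (min_le_right _ _)) b ((le_max_right _ _).trans hb))⟩
  | smul c x _ ih =>
    obtain ⟨m, n, h⟩ := ih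
    exact ⟨m, n, fun a ha b hb => smul_mem _ _ (h a ha b hb)⟩

open Classical in
/-- The principal series is the universal representation with a spherical vector. The graph of the
intertwining map is the representation generated by the pair of spherical vectors; that it is a graph
follows from the independence of the boundary values of the edge vectors of a given radius. -/
lemma IsTwist.exists_intertwining (h : IsTwist χ₁ χ₂ α) (hv : IsSpherical α ρ v) :
    ∃ φ : (principalSeries two χ₁ χ₂).toSubmodule →ₗ[ℂ] V, φ (spherVec h) = v ∧
      ∀ g f, φ ((principalSeries two χ₁ χ₂).toRepresentation g f) = ρ g (φ f) := by
  set I := (principalSeries two χ₁ χ₂).toRepresentation with hI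
  have hw := (spherVec_isSpherical h).prod hv
  set w : (principalSeries two χ₁ χ₂).toSubmodule × V := (spherVec h, v) with hw'
  set L := orbitSpan (I.prod ρ) w with hL
  have hα0 := h.ne_zero
  have inj : ∀ x ∈ L, x.1 = 0 → x = 0 := by
    intro x hx hx0
    obtain ⟨m, n, hmn⟩ := hw.exists_mem_span h.sq hx
    obtain ⟨y, hy, z, hz, rfl⟩ := Submodule.mem_sup.1 (hmn m le_rfl n le_rfl)
    obtain ⟨c, rfl⟩ := Submodule.mem_span_singleton.1 hy
    have hz' : z ∈ span ℂ (Set.range fun q : D₂ ⧸ ball n => edge (I.prod ρ) w α q.out n) := by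
      refine span_mono ?_ hz
      rintro _ ⟨b, rfl⟩
      exact ⟨QuotientAddGroup.mk b, hw.edge_congr (nrm_out_sub n b)⟩
    obtain ⟨d, rfl⟩ := Finsupp.mem_span_range_iff_exists_finsupp.1 hz'
    have hval : ∀ g, c * (vertex I (spherVec h) 0 m).1 g +
        ∑ q ∈ d.support, d q * (edge I (spherVec h) α q.out n).1 g = 0 := by
      intro g
      have := congrFun (congrArg Subtype.val hx0) g
      rw [Prod.fst_add, Finsupp.sum, Prod.fst_sum] at this
      rw [Submodule.coe_add, coe_sum, Pi.add_apply, Finset.sum_apply] at this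
      exact this
    have hc : c = 0 := by
      have := hval 1
      rw [h.vertex_one, sum_eq_zero (fun q _ => by rw [h.edge_one, mul_zero]), add_zero] at this
      exact (mul_eq_zero.1 this).resolve_right (zpow_ne_zero _ hα0)
    have hd : d = 0 := by
      ext q
      have := hval (gMat q.out)
      rw [hc, zero_mul, zero_add] at this
      have hq : ∀ q' : D₂ ⧸ ball n, nrm (q'.out - q.out) ≤ 2 ^ (-n) ↔ q' = q := by
        intro q'
        constructor
        · intro hq
          rw [← QuotientAddGroup.out_eq' q, ← QuotientAddGroup.out_eq' q']
          refine QuotientAddGroup.eq.2 ?_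
          rw [mem_ball, neg_add_eq_sub, nrm_sub_comm]
          exact hq
        · rintro rfl
          rw [sub_self, nrm_zero]
          positivity
      simp only [hI, h.edge_gMat, hq] at this
      by_contra hne
      rw [Finset.sum_eq_single_of_mem q (Finsupp.mem_support_iff.2 hne)
        (fun q' _ hne' => by rw [if_neg hne', mul_zero]), if_pos rfl] at this
      exact (mul_ne_zero hne (neg_ne_zero.2 (zpow_ne_zero _ hα0))) this
    rw [hc, hd, zero_smul, zero_add, Finsupp.sum_zero_index]
  have surj : ∀ f, ∃ x ∈ L, x.1 = f := by
    intro f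
    have hf : f ∈ Submodule.map (LinearMap.fst ℂ _ V) L := by
      rw [hL, orbitSpan, map_span, ← Set.range_comp]
      have : f ∈ (⊤ : Submodule ℂ (principalSeries two χ₁ χ₂).toSubmodule) := trivial
      rw [← h.orbitSpan_spherVec] at this
      exact this
    obtain ⟨x, hx, rfl⟩ := hf
    exact ⟨x, hx, rfl⟩
  have stable : ∀ g, ∀ x ∈ L, I.prod ρ g x ∈ L := fun g x hx => apply_mem_orbitSpan g hx
  let e : L ≃ₗ[ℂ] (principalSeries two χ₁ χ₂).toSubmodule :=
    LinearEquiv.ofBijective ((LinearMap.fst ℂ _ V).comp L.subtype)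
      ⟨(injective_iff_map_eq_zero _).2 fun x hx => Subtype.ext (inj x x.2 hx), fun f => by
        obtain ⟨x, hx, rfl⟩ := surj f
        exact ⟨⟨x, hx⟩, rfl⟩⟩
  have he : ∀ x (hx : x ∈ L), e.symm x.1 = ⟨x, hx⟩ := fun x hx => (e.symm_apply_eq).2 rfl
  refine ⟨(LinearMap.snd ℂ _ V).comp (L.subtype.comp e.symm.toLinearMap), ?_, fun g f => ?_⟩
  · have hmem : w ∈ L := self_mem_orbitSpan _ _
    change (e.symm w.1).1.2 = v
    rw [he w hmem]
  · obtain ⟨x, hx, rfl⟩ := surj f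
    change (e.symm (I.prod ρ g x).1).1.2 = ρ g (e.symm x.1).1.2
    rw [he x hx, he _ (stable g x hx)]
    rfl

end Universal

/-- An endomorphism of the principal series which commutes with the group is a scalar. -/
lemma IsTwist.schur (h : IsTwist χ₁ χ₂ α)
    (φ : End ℂ (principalSeries two χ₁ χ₂).toSubmodule)
    (hφ : ∀ g f, φ ((principalSeries two χ₁ χ₂).toRepresentation g f) =
      (principalSeries two χ₁ χ₂).toRepresentation g (φ f)) : ∃ c : ℂ, φ = c • LinearMap.id := by
  refine ⟨(φ (spherVec h)).1 1, ?_⟩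
  have h0 : φ (spherVec h) = (φ (spherVec h)).1 1 • spherVec h := by
    refine Subtype.ext (funext fun g => ?_)
    obtain ⟨a, d, x, k, hk, rfl⟩ := exists_iwasawa_two g
    have hk' := congrFun (congrArg Subtype.val (hφ k (spherVec h))) (upper a d x)
    rw [(spherVec_isSpherical h).fixed k hk, principalSeries_apply] at hk'
    rw [← hk']
    change _ = (φ (spherVec h)).1 1 * spherFun α _
    rw [spherFun_apply _ _ _ _ hk, ← mul_one (upper a d x), h.apply_upper, mul_comm]
  refine LinearMap.ext_on_range h.orbitSpan_spherVec fun g => ?_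
  exact (hφ g _).trans ((congrArg _ h0).trans (map_smul _ _ _))

set_option maxHeartbeats 400000 in
/-- An invariant subspace which is not zero contains the spherical vector. -/
lemma IsTwist.spherVec_mem (h : IsTwist χ₁ χ₂ α)
    (U : Submodule ℂ (principalSeries two χ₁ χ₂).toSubmodule)
    (hU : ∀ g, ∀ f ∈ U, (principalSeries two χ₁ χ₂).toRepresentation g f ∈ U) (hne : U ≠ ⊥) :
    spherVec h ∈ U := by
  set I := (principalSeries two χ₁ χ₂).toRepresentation with hI
  have hv := spherVec_isSpherical h
  have hα0 := h.ne_zero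
  set E := edge I (spherVec h) α 0 0 with hE
  obtain ⟨f, hfU, hf0⟩ := (Submodule.ne_bot_iff U).1 hne
  obtain ⟨g, hg⟩ : ∃ g, f.1 g ≠ 0 := by
    by_contra! hall
    exact hf0 (Subtype.ext (funext hall))
  obtain ⟨n, hn⟩ := IsTwist.exists_level (I g f)
  -- contract, so that `f'` is fixed by the integral unipotent matrices
  set f' := I (pMat 0 (-(n : ℤ))) (I g f) with hf'
  have hf'U : f' ∈ U := hU _ _ (hU _ _ hfU)
  have hf'1 : f'.1 1 ≠ 0 := by
    change (I g f).1 (1 * pMat 0 (-(n : ℤ))) ≠ 0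
    rw [one_mul, pMat, ← mul_one (upper _ _ _), h.apply_upper]
    refine mul_ne_zero (zpow_ne_zero _ hα0) ?_
    change f.1 (1 * g) ≠ 0
    rwa [one_mul]
  have hlev : ∀ y, nrm y ≤ 2 ^ (-(0 : ℤ)) → ∀ g, f'.1 (g * upper 1 1 y) = f'.1 g := by
    intro y hy x
    change (I g f).1 (x * upper 1 1 y * pMat 0 (-(n : ℤ))) = (I g f).1 (x * pMat 0 (-(n : ℤ)))
    have e : upper 1 1 y * pMat 0 (-(n : ℤ)) =
        pMat 0 (-(n : ℤ)) * upper 1 1 (((ϖ ^ (n : ℤ) : D₂ˣ) : D₂) * y) := by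
      rw [pMat, upper_mul, upper_mul, zpow_neg, Units.inv_mul_cancel_left]
      simp
    rw [mul_assoc, e, ← mul_assoc]
    refine hn _ ?_ _
    rw [nrm_mul, nrm_varpi_zpow]
    exact mul_le_of_le_one_right (by positivity) (by simpa using hy)
  obtain ⟨y, hy, e, he, hye⟩ := Submodule.mem_sup.1 (h.mem_span f' 0 hlev le_rfl)
  obtain ⟨a, rfl⟩ := Submodule.mem_span_singleton.1 hy
  have ha : a ≠ 0 := by
    rintro rfl
    apply hf'1
    rw [← hye, zero_smul, zero_add]
    clear hye
    induction he using span_induction with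
    | mem x hx =>
      obtain ⟨b, rfl⟩ := hx
      exact h.edge_one b 0
    | zero => rfl
    | add x y _ _ hx hy =>
      change x.1 1 + y.1 1 = 0
      rw [hx, hy, add_zero]
    | smul c x _ hx =>
      change c * x.1 1 = 0
      rw [hx, mul_zero]
  let T : End ℂ (principalSeries two χ₁ χ₂).toSubmodule := ∑ i, I (pMat (resRep ℚ_[two] i) 1)
  have hTU : ∀ f ∈ U, T f ∈ U := by
    intro f hf
    rw [LinearMap.sum_apply]
    exact sum_mem fun i _ => hU _ _ hf
  have hTE : ∀ b, T (edge I (spherVec h) α b 0) = (2 * α) • edge I (spherVec h) α ((ϖ : D₂) * b) 0 := by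
    intro b
    rw [← hv.sum_edge h.sq, LinearMap.sum_apply]
    refine sum_congr rfl fun i _ => ?_
    rw [apply_edge, zpow_one, zpow_zero, Units.val_one, one_mul, add_comm, add_comm (1 : ℤ)]
  have hTE0 : T E = (2 * α) • E := by rw [hE, hTE, mul_zero]
  have hT0 : T (spherVec h) = (4 * α) • spherVec h - E := by
    have := hv.sum_vertex 0 0
    rw [vertex_zero] at this
    rw [hE, edge, vertex_zero, LinearMap.sum_apply]
    calc _ = (6 * α) • spherVec h - vertex I (spherVec h) 0 (0 - 1) := by
          rw [← this]
          refine sum_congr rfl fun i _ => ?_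
          rw [zpow_zero, Units.val_one, one_mul, zero_add, zero_add, vertex]
      _ = _ := by module
  have hpow : ∃ J : ℕ, ∀ j ≥ J, (T ^ j) e ∈ span ℂ {E} := by
    clear hye
    induction he using span_induction with
    | mem x hx =>
      obtain ⟨b, rfl⟩ := hx
      have hj : ∀ j : ℕ, (T ^ j) (edge I (spherVec h) α b 0) =
          (2 * α) ^ j • edge I (spherVec h) α ((ϖ ^ j : D₂ˣ) * b) 0 := by
        intro j
        induction j with
        | zero => simp
        | succ j ih =>
          rw [pow_succ', End.mul_apply, ih, map_smul, hTE, smul_smul, ← pow_succ, ← mul_assoc,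
            ← Units.val_mul, ← pow_succ']
      obtain ⟨J, hJ⟩ : ∃ J : ℕ, nrm b ≤ 2 ^ J := by
        obtain ⟨J, hJ⟩ := pow_unbounded_of_one_lt (nrm b) (one_lt_two : (1 : ℝ) < 2)
        exact ⟨J, hJ.le⟩
      refine ⟨J, fun j hjJ => ?_⟩
      rw [hj, hv.edge_congr (b' := 0) (by
        rw [sub_zero, nrm_mul, ← zpow_natCast, nrm_varpi_zpow, neg_zero, zpow_zero, zpow_neg,
          zpow_natCast, inv_mul_le_one₀ (by positivity)]
        exact hJ.trans (pow_le_pow_right₀ (by norm_num) hjJ))]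
      exact smul_mem _ _ (subset_span rfl)
    | zero => exact ⟨0, fun j _ => by rw [map_zero]; exact zero_mem _⟩
    | add x y _ _ hx hy =>
      obtain ⟨J, hJ⟩ := hx
      obtain ⟨J', hJ'⟩ := hy
      refine ⟨max J J', fun j hj => ?_⟩
      rw [map_add]
      exact add_mem (hJ j ((le_max_left _ _).trans hj)) (hJ' j ((le_max_right _ _).trans hj))
    | smul c x _ hx =>
      obtain ⟨J, hJ⟩ := hx
      refine ⟨J, fun j hj => ?_⟩
      rw [map_smul]
      exact smul_mem _ _ (hJ j hj)
  have hpow0 : ∀ j : ℕ, ∃ C : ℂ, (T ^ j) (spherVec h) = (4 * α) ^ j • spherVec h + C • E := by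
    intro j
    induction j with
    | zero => exact ⟨0, by simp⟩
    | succ j ih =>
      obtain ⟨C, hC⟩ := ih
      refine ⟨-(4 * α) ^ j + 2 * α * C, ?_⟩
      rw [pow_succ', End.mul_apply, hC, map_add, map_smul, map_smul, hT0, hTE0]
      module
  obtain ⟨J, hJ⟩ := hpow
  obtain ⟨C, hC⟩ := Submodule.mem_span_singleton.1 (hJ J le_rfl)
  obtain ⟨C', hC'⟩ := hpow0 J
  have hTJ : ∀ j : ℕ, (T ^ j) f' ∈ U := by
    intro j
    induction j with
    | zero => simpa using hf'U
    | succ j ih =>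
      rw [pow_succ', End.mul_apply]
      exact hTU _ ih
  have key : (4 * α) • spherVec h - vertex I (spherVec h) 0 (-1) ∈ U := by
    have hE' : E = vertex I (spherVec h) 0 (-1) - (2 * α) • spherVec h := by
      rw [hE, edge, vertex_zero, zero_sub]
    have h1 := sub_mem (hTU _ (hTJ J)) (smul_mem _ (2 * α) (hTJ J))
    have h2 : T ((T ^ J) f') - (2 * α) • (T ^ J) f' =
        (a * (4 * α) ^ J) • ((4 * α) • spherVec h - vertex I (spherVec h) 0 (-1)) := by
      rw [← hye, map_add, map_smul, hC', ← hC]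
      simp only [map_add, map_smul, hT0, hTE0]
      rw [hE']
      module
    rw [h2] at h1
    have hne : a * (4 * α) ^ J ≠ 0 := mul_ne_zero ha (pow_ne_zero _ (mul_ne_zero (by norm_num) hα0))
    exact (Submodule.smul_mem_iff _ hne).1 h1
  -- the Weyl element exchanges the two neighbours `[0, 1]` and `[0, -1]` of `[0, 0]`
  have hw := hv.weyl_vertex
  have h3 := hU (weyl ℚ_[two]) _ (hU (pMat 0 1) _ key)
  have h4 : I (pMat 0 1) (spherVec h) = vertex I (spherVec h) 0 1 := by rw [vertex]
  rw [map_sub, map_smul, map_sub, map_smul, h4, hw, apply_vertex, add_neg_cancel, mul_zero, add_zero,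
    vertex_zero, hv.fixed _ weyl_mem_Kp] at h3
  have h5 := add_mem (smul_mem _ (4 * α) key) h3
  have h6 : (4 * α) • ((4 * α) • spherVec h - vertex I (spherVec h) 0 (-1)) +
      ((4 * α) • vertex I (spherVec h) 0 (-1) - spherVec h) = (7 : ℂ) • spherVec h := by
    have : (4 * α) * (4 * α) = 8 := by linear_combination 16 * h.sq
    rw [smul_sub, smul_smul, this]
    module
  rw [h6] at h5
  have h7 := U.smul_mem (7 : ℂ)⁻¹ h5
  rwa [smul_smul, inv_mul_cancel₀ (by norm_num), one_smul] at h7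

lemma IsTwist.opSimple (h : IsTwist χ₁ χ₂ α) :
    OpSimple (fun g => (principalSeries two χ₁ χ₂).toRepresentation g) := by
  refine ⟨⟨⟨spherVec h, 0, fun h0 => ?_⟩⟩, fun U hU => or_iff_not_imp_left.2 fun hne => ?_⟩
  · have := congrFun (congrArg Subtype.val h0) 1
    change spherFun α 1 = 0 at this
    rw [spherFun_one] at this
    exact one_ne_zero this
  · rw [eq_top_iff, ← h.orbitSpan_spherVec, orbitSpan, span_le]
    rintro _ ⟨g, rfl⟩
    exact hU g _ (h.spherVec_mem U hU hne)

/-! ### The adelic lift -/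

lemma exists_int_of_padic_norm_le_one (t : ℚ) (h : ∀ p : Nat.Primes, ‖(t : ℚ_[p])‖ ≤ 1) :
    ∃ n : ℤ, t = n := by
  refine ⟨t.num, ?_⟩
  have hden : t.den = 1 := by
    by_contra hne
    obtain ⟨p, hp, hpd⟩ := Nat.exists_prime_and_dvd hne
    have : Fact p.Prime := ⟨hp⟩
    have hu := PadicInt.isUnit_den t (h ⟨p, hp⟩)
    have h1 := PadicInt.isUnit_iff.1 hu
    have h2 : ‖((t.den : ℤ) : ℤ_[p])‖ < 1 :=
      (PadicInt.norm_intCast_lt_one_iff).2 (by exact_mod_cast hpd)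
    rw [Int.cast_natCast, h1] at h2
    exact lt_irrefl _ h2
  conv_lhs => rw [← Rat.num_div_den t, hden]
  simp

lemma mem_hurwitz_real_of_padic (x : ℍ[ℚ])
    (h : ∀ p : Nat.Primes, quatMap (algebraMap ℚ ℚ_[p]) x ∈ hurwitz ℤ_[p] ℚ_[p]) :
    quatMap (algebraMap ℚ ℝ) x ∈ hurwitz ℤ ℝ := by
  have h' := fun p => (mem_hurwitz_padic_iff _).1 (h p)
  simp only [quatMap, RingHom.coe_mk, MonoidHom.coe_mk, OneHom.coe_mk, quat_re, quat_imI, quat_imJ,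
    quat_imK, eq_ratCast] at h'
  obtain ⟨d, hd⟩ := exists_int_of_padic_norm_le_one (2 * x.imK) fun p => by
    have := (h' p).1
    exact_mod_cast this
  obtain ⟨a, ha⟩ := exists_int_of_padic_norm_le_one (x.re - x.imK) fun p => by
    have := (h' p).2.1
    exact_mod_cast this
  obtain ⟨b, hb⟩ := exists_int_of_padic_norm_le_one (x.imI - x.imK) fun p => by
    have := (h' p).2.2.1
    exact_mod_cast this
  obtain ⟨c, hc⟩ := exists_int_of_padic_norm_le_one (x.imJ - x.imK) fun p => by
    have := (h' p).2.2.2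
    exact_mod_cast this
  have hd' : x.imK = d / 2 := by rw [← hd]; ring
  have ha' : x.re = a + d / 2 := by rw [← ha, ← hd']; ring
  have hb' : x.imI = b + d / 2 := by rw [← hb, ← hd']; ring
  have hc' : x.imJ = c + d / 2 := by rw [← hc, ← hd']; ring
  refine ⟨a, b, c, d, ?_⟩
  ext <;> simp [quatMap, ha', hb', hc', hd']

lemma glMap_val_apply {K L : Type} [Field K] [Field L] (f : K →+* L) (g : GLH K) (i j : Fin 2) :
    (glMap f g).val i j = quatMap f (g.val i j) := rfl

lemma glMap_mem_glOrder (γ : GLH ℚ) (h : ∀ p : Nat.Primes, glMap (algebraMap ℚ ℚ_[p]) γ ∈ Kp p) :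
    glMap (algebraMap ℚ ℝ) γ ∈ glOrder ℤ ℝ := by
  refine ⟨fun i j => mem_hurwitz_real_of_padic _ fun p => (h p).1 i j, fun i j => ?_⟩
  have : ((glMap (algebraMap ℚ ℝ) γ)⁻¹).val i j = quatMap (algebraMap ℚ ℝ) (γ⁻¹.val i j) := by
    rw [← map_inv, glMap_val_apply]
  change ((glMap (algebraMap ℚ ℝ) γ)⁻¹).val i j ∈ hurwitz ℤ ℝ
  rw [this]
  refine mem_hurwitz_real_of_padic _ fun p => ?_
  have h2 := (h p).2 i j
  have : ((glMap (algebraMap ℚ ℚ_[p]) γ)⁻¹).val i j = quatMap (algebraMap ℚ ℚ_[p]) (γ⁻¹.val i j) := by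
    rw [← map_inv, glMap_val_apply]
  exact this ▸ h2

variable {F : GLH ℝ → ℂ}

/-- The adelic lift is well defined: `GL₂(B)` meets the product of the `K_p` in `GL₂(𝓞)`. -/
lemma adelicLift_eq (hF : ∀ γ ∈ glOrder ℤ ℝ, ∀ g, F (γ * g) = F g) {g : GA} {x : GLH ℝ}
    (h : Decomposes g x) : adelicLift F g = F x := by
  have hex : ∃ x, Decomposes g x := ⟨x, h⟩
  rw [adelicLift, dif_pos hex]
  obtain ⟨γ', h1', h2'⟩ := hex.choose_spec
  generalize hex.choose = x' at h1' ⊢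
  obtain ⟨γ, h1, h2⟩ := h
  have e : x' = glMap (algebraMap ℚ ℝ) (γ'⁻¹ * γ) * x := by
    rw [map_mul, mul_assoc, ← h1, h1', map_inv, inv_mul_cancel_left]
  rw [e]
  refine hF _ (glMap_mem_glOrder _ fun p => ?_) x
  have := (Kp p).mul_mem (h2' p) ((Kp p).inv_mem (h2 p))
  rwa [mul_inv_rev, inv_inv, mul_assoc, mul_inv_cancel_left, ← map_inv, ← map_mul] at this

lemma Decomposes.mul {g : GA} {x : GLH ℝ} (h : Decomposes g x) (y : GLH ℝ) {u : Gfin}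
    (hu : ∀ p, u p ∈ Kp p) : Decomposes (g * (y, u)) (x * y) := by
  obtain ⟨γ, h1, h2⟩ := h
  refine ⟨γ, ?_, fun p => ?_⟩
  · rw [Prod.fst_mul, h1, mul_assoc]
  · rw [Prod.snd_mul, RestrictedProduct.mul_apply, ← mul_assoc]
    exact (Kp p).mul_mem (h2 p) (hu p)

lemma exists_decomposes_mul_iff {g : GA} {y : GLH ℝ} {u : Gfin} (hu : ∀ p, u p ∈ Kp p) :
    (∃ x, Decomposes (g * (y, u)) x) ↔ ∃ x, Decomposes g x := by
  refine ⟨fun ⟨x, hx⟩ => ⟨x * y⁻¹, ?_⟩, fun ⟨x, hx⟩ => ⟨_, hx.mul y hu⟩⟩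
  · have := hx.mul y⁻¹ (u := u⁻¹) fun p => (Kp p).inv_mem (hu p)
    have e : g * (y, u) * (y⁻¹, u⁻¹) = g := mul_inv_cancel_right g (y, u)
    rwa [e] at this

lemma adelicLift_of_not {g : GA} (h : ¬ ∃ x, Decomposes g x) : adelicLift F g = 0 := by
  rw [adelicLift, dif_neg h]

lemma adelicLift_mul_fin (hF : ∀ γ ∈ glOrder ℤ ℝ, ∀ g, F (γ * g) = F g) (g : GA) {u : Gfin}
    (hu : ∀ p, u p ∈ Kp p) : adelicLift F (g * (1, u)) = adelicLift F g := by
  by_cases h : ∃ x, Decomposes g x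
  · obtain ⟨x, hx⟩ := h
    rw [adelicLift_eq hF hx, adelicLift_eq hF (hx.mul 1 hu), mul_one]
  · rw [adelicLift_of_not h, adelicLift_of_not (mt (exists_decomposes_mul_iff hu).1 h)]

lemma atPrime_mem {p : Nat.Primes} {k : Gp p} (hk : k ∈ Kp p) (q : Nat.Primes) :
    atPrime p k q ∈ Kp q := by
  by_cases h : q = p
  · subst h
    rwa [atPrime, RestrictedProduct.mulSingle_eq_same]
  · rw [atPrime, RestrictedProduct.mulSingle_eq_of_ne _ _ h]
    exact one_mem _

lemma adelicLift_mul_atPrime (hF : ∀ γ ∈ glOrder ℤ ℝ, ∀ g, F (γ * g) = F g) (p : Nat.Primes) (g : GA)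
    {k : Gp p} (hk : k ∈ Kp p) : adelicLift F (g * (1, atPrime p k)) = adelicLift F g :=
  adelicLift_mul_fin hF g (atPrime_mem hk)

lemma decomposes_one (x : GLH ℝ) : Decomposes (x, 1) x :=
  ⟨1, by simp, fun p => by
    rw [map_one, inv_one, one_mul]
    exact one_mem _⟩

/-- As a function of the archimedean variable, the adelic lift is zero or a left translate of `F`. -/
lemma adelicLift_slice (hF : ∀ γ ∈ glOrder ℤ ℝ, ∀ g, F (γ * g) = F g) (h : Gfin) :
    (∀ x, adelicLift F (x, h) = 0) ∨ ∃ γ : GLH ℝ, ∀ x, adelicLift F (x, h) = F (γ * x) := by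
  by_cases hex : ∃ x, Decomposes (1, h) x
  · right
    obtain ⟨x₀, hx₀⟩ := hex
    refine ⟨x₀, fun x => ?_⟩
    have := hx₀.mul x (u := 1) fun p => one_mem _
    rw [Prod.mk_mul_mk, one_mul, mul_one] at this
    exact adelicLift_eq hF this
  · left
    intro x
    apply adelicLift_of_not
    intro hx
    apply hex
    rw [← exists_decomposes_mul_iff (y := x) (u := 1) fun p => one_mem _]
    simpa using hx

lemma adelicLift_atTwo (hF : ∀ γ ∈ glOrder ℤ ℝ, ∀ g, F (γ * g) = F g) (γ : GLH ℚ)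
    (hγ : ∀ p : Nat.Primes, p ≠ two → glMap (algebraMap ℚ ℚ_[p]) γ ∈ Kp p) (x : GLH ℝ) :
    adelicLift F (x, atPrime two (glMap (algebraMap ℚ ℚ_[two]) γ)) =
      F ((glMap (algebraMap ℚ ℝ) γ)⁻¹ * x) := by
  refine adelicLift_eq hF ⟨γ, by rw [mul_inv_cancel_left], fun p => ?_⟩
  by_cases h : p = two
  · subst h
    rw [atPrime, RestrictedProduct.mulSingle_eq_same, inv_mul_cancel]
    exact one_mem _
  · rw [atPrime, RestrictedProduct.mulSingle_eq_of_ne _ _ h, mul_one]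
    exact (Kp p).inv_mem (hγ p h)

lemma quatMap_varpi {K L : Type} [Field K] [Field L] (f : K →+* L) :
    quatMap f (varpi K) = varpi L := by
  ext <;> simp [quatMap, varpi]

lemma quatMap_resRep {K L : Type} [Field K] [Field L] (f : K →+* L) (i : Fin 4) :
    quatMap f (resRep K i) = resRep L i := by
  fin_cases i <;> ext <;> simp [quatMap, resRep, rho, map_ofNat]

lemma glMap_upper {K L : Type} [Field K] [Field L] (f : K →+* L) (a d : ℍ[K]ˣ) (x : ℍ[K]) :
    glMap f (upper a d x) = upper (Units.map (quatMap f).toMonoidHom a)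
      (Units.map (quatMap f).toMonoidHom d) (quatMap f x) := by
  apply Units.ext
  ext i j : 1
  rw [glMap_val_apply]
  fin_cases i <;> fin_cases j <;> simp [upper]

lemma map_varpiUnit {K L : Type} [Field K] [Field L] [CharZero K] [CharZero L] (f : K →+* L) :
    Units.map (quatMap f).toMonoidHom (varpiUnit K) = varpiUnit L :=
  Units.ext (quatMap_varpi f)

/-- A rational upper triangular matrix whose determinant is a power of two lies in `K_p` at the odd
primes. -/
lemma upper_mem_Kp_odd {p : Nat.Primes} (hp : p ≠ two) {a d : ℍ[ℚ_[p]]ˣ}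
    (ha : a = 1 ∨ a = varpiUnit _) (hd : d = 1 ∨ d = varpiUnit _) {x : ℍ[ℚ_[p]]}
    (hx : x ∈ hurwitz ℤ_[p] ℚ_[p]) : upper a d x ∈ Kp p := by
  have h2 : ‖(2 : ℚ_[p])‖ = 1 := by
    have := (Padic.norm_natCast_eq_one_iff (p := (p : ℕ)) (n := 2)).2 (by
      rw [Nat.Prime.coprime_iff_not_dvd p.2, Nat.prime_dvd_prime_iff_eq p.2 Nat.prime_two]
      exact fun h => hp (Subtype.ext h))
    exact_mod_cast this
  have key : ∀ u : ℍ[ℚ_[p]]ˣ, u = 1 ∨ u = varpiUnit _ →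
      (u : ℍ[ℚ_[p]]) ∈ hurwitz ℤ_[p] ℚ_[p] ∧ ((u⁻¹ : ℍ[ℚ_[p]]ˣ) : ℍ[ℚ_[p]]) ∈ hurwitz ℤ_[p] ℚ_[p] := by
    rintro u (rfl | rfl)
    · exact ⟨by simp [one_mem], by simp [one_mem]⟩
    · constructor
      · exact ⟨1, 1, 0, 0, by ext <;> simp [varpiUnit, varpi]⟩
      · change quat (1 / 2) (-(1 / 2)) 0 0 ∈ _
        rw [mem_hurwitz_padic_iff]
        simp [h2]
  refine ⟨fun i j => ?_, fun i j => ?_⟩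
  · fin_cases i <;> fin_cases j
    · exact (key a ha).1
    · exact hx
    · exact zero_mem _
    · exact (key d hd).1
  · fin_cases i <;> fin_cases j
    · exact (key a ha).2
    · exact (hurwitz ℤ_[p] ℚ_[p]).neg_mem ((hurwitz ℤ_[p] ℚ_[p]).mul_mem
        ((hurwitz ℤ_[p] ℚ_[p]).mul_mem (key a ha).2 hx) (key d hd).2)
    · exact zero_mem _
    · exact (key d hd).2

lemma adelicLift_upper (hF : ∀ γ ∈ glOrder ℤ ℝ, ∀ g, F (γ * g) = F g) {a d : ℍ[ℚ]ˣ}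
    (ha : a = 1 ∨ a = varpiUnit _) (hd : d = 1 ∨ d = varpiUnit _) (b : ℍ[ℚ])
    (hb : ∀ p : Nat.Primes, quatMap (algebraMap ℚ ℚ_[p]) b ∈ hurwitz ℤ_[p] ℚ_[p]) (x : GLH ℝ) :
    adelicLift F (x, atPrime two (upper (Units.map (quatMap (algebraMap ℚ ℚ_[two])).toMonoidHom a)
      (Units.map (quatMap (algebraMap ℚ ℚ_[two])).toMonoidHom d) (quatMap (algebraMap ℚ ℚ_[two]) b))) =
      F ((upper (Units.map (quatMap (algebraMap ℚ ℝ)).toMonoidHom a)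
      (Units.map (quatMap (algebraMap ℚ ℝ)).toMonoidHom d) (quatMap (algebraMap ℚ ℝ) b))⁻¹ * x) := by
  rw [← glMap_upper, ← glMap_upper]
  refine adelicLift_atTwo hF _ (fun p hp => ?_) x
  rw [glMap_upper]
  refine upper_mem_Kp_odd hp ?_ ?_ (hb p)
  · rcases ha with rfl | rfl
    · exact Or.inl (map_one _)
    · exact Or.inr (map_varpiUnit _)
  · rcases hd with rfl | rfl
    · exact Or.inl (map_one _)
    · exact Or.inr (map_varpiUnit _)

lemma adelicLift_heckeRep_some (hF : ∀ γ ∈ glOrder ℤ ℝ, ∀ g, F (γ * g) = F g) (i : Fin 4) (x : GLH ℝ) :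
    adelicLift F (x, atPrime two (heckeRep (some i))) =
      F ((upper (varpiUnit ℝ) 1 (resRep ℝ i))⁻¹ * x) := by
  have := adelicLift_upper hF (Or.inr rfl) (Or.inl rfl) (resRep ℚ i)
    (fun p => by rw [quatMap_resRep]; exact resRep_mem i) x
  rw [map_varpiUnit, map_varpiUnit, map_one, map_one, quatMap_resRep, quatMap_resRep] at this
  rw [← this, heckeRep, pMat, zpow_one]

lemma adelicLift_heckeRep_none (hF : ∀ γ ∈ glOrder ℤ ℝ, ∀ g, F (γ * g) = F g) (x : GLH ℝ) :
    adelicLift F (x, atPrime two (heckeRep none)) = F ((upper 1 (varpiUnit ℝ) 0)⁻¹ * x) := by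
  have := adelicLift_upper hF (Or.inl rfl) (Or.inr rfl) 0
    (fun p => by rw [map_zero]; exact zero_mem _) x
  rw [map_varpiUnit, map_varpiUnit, map_one, map_one, map_zero, map_zero] at this
  rw [← this, heckeRep]

lemma adelicLift_scalar (hF : ∀ γ ∈ glOrder ℤ ℝ, ∀ g, F (γ * g) = F g) (x : GLH ℝ) :
    adelicLift F (x, atPrime two (upper ϖ ϖ 0)) =
      F ((upper (varpiUnit ℝ) (varpiUnit ℝ) 0)⁻¹ * x) := by
  have := adelicLift_upper hF (Or.inr rfl) (Or.inr rfl) 0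
    (fun p => by rw [map_zero]; exact zero_mem _) x
  rwa [map_varpiUnit, map_varpiUnit, map_zero, map_zero] at this

/-! ### The Iwasawa decomposition of `GL₂(ℍ)` -/

/-- The upper left entry of `g g*`. -/
def herA (g : GLH ℝ) : ℝ := normSq (g.val 0 0) + normSq (g.val 0 1)

/-- The upper right entry of `g g*`. -/
def herB (g : GLH ℝ) : ℍ[ℝ] := g.val 0 0 * star (g.val 1 0) + g.val 0 1 * star (g.val 1 1)

/-- The lower right entry of `g g*`. -/
def herC (g : GLH ℝ) : ℝ := normSq (g.val 1 0) + normSq (g.val 1 1)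

/-- The (reduced) determinant of `g g*`. -/
def herN (g : GLH ℝ) : ℝ := herA g * herC g - normSq (herB g)

lemma herC_pos (g : GLH ℝ) : 0 < herC g := by
  rw [herC]
  have h0 := normSq_nonneg (a := g.val 1 0)
  have h1 := normSq_nonneg (a := g.val 1 1)
  rcases h0.lt_or_eq with h | h
  · linarith
  rcases h1.lt_or_eq with h' | h'
  · linarith
  exfalso
  have e0 := normSq_eq_zero.1 h.symm
  have e1 := normSq_eq_zero.1 h'.symm
  have := congrFun (congrFun g.mul_inv 1) 1
  rw [mul_apply, Fin.sum_univ_two, e0, e1] at this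
  simp at this

lemma herN_eq (g : GLH ℝ) : herN g = herC g *
    (normSq (g.val 0 0 - (herC g)⁻¹ • (herB g * g.val 1 0)) +
      normSq (g.val 0 1 - (herC g)⁻¹ • (herB g * g.val 1 1))) := by
  have hC := (herC_pos g).ne'
  have e : ∀ a c : ℍ[ℝ], normSq (a - (herC g)⁻¹ • (herB g * c)) = normSq a +
      (herC g)⁻¹ ^ 2 * (normSq (herB g) * normSq c) -
        2 * (herC g)⁻¹ * (a * star c * star (herB g)).re := by
    intro a c
    rw [sub_eq_add_neg, normSq_add, ← neg_smul, normSq_smul, map_mul, Quaternion.star_smul,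
      star_mul, mul_smul_comm, re_smul, smul_eq_mul, neg_sq, mul_assoc a]
    ring
  have e2 : (g.val 0 0 * star (g.val 1 0) * star (herB g)).re +
      (g.val 0 1 * star (g.val 1 1) * star (herB g)).re = normSq (herB g) := by
    rw [← re_add, ← add_mul]
    exact (congrArg QuaternionAlgebra.re (self_mul_star (herB g))).trans
      (re_coe _)
  rw [e, e, herN]
  have e3 : herC g = normSq (g.val 1 0) + normSq (g.val 1 1) := rfl
  have e4 : herA g = normSq (g.val 0 0) + normSq (g.val 0 1) := rfl
  have e5 : herC g * (herC g)⁻¹ = 1 := mul_inv_cancel₀ hC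
  rw [e4]
  linear_combination (herC g * (herC g)⁻¹ ^ 2 * normSq (herB g)) * e3 + 2 * e2 +
    (-normSq (herB g) * (herC g * (herC g)⁻¹ + 1) + 2 * (
      (g.val 0 0 * star (g.val 1 0) * star (herB g)).re +
      (g.val 0 1 * star (g.val 1 1) * star (herB g)).re)) * e5

lemma herN_pos (g : GLH ℝ) : 0 < herN g := by
  rw [herN_eq]
  refine mul_pos (herC_pos g) ?_
  have h0 := normSq_nonneg (a := g.val 0 0 - (herC g)⁻¹ • (herB g * g.val 1 0))
  have h1 := normSq_nonneg (a := g.val 0 1 - (herC g)⁻¹ • (herB g * g.val 1 1))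
  rcases h0.lt_or_eq with h | h
  · linarith
  rcases h1.lt_or_eq with h' | h'
  · linarith
  exfalso
  have e0 := sub_eq_zero.1 (normSq_eq_zero.1 h.symm)
  have e1 := sub_eq_zero.1 (normSq_eq_zero.1 h'.symm)
  have key : ∀ j, g.val 0 j = ((herC g)⁻¹ • herB g) * g.val 1 j := by
    intro j
    rw [smul_mul_assoc]
    fin_cases j
    · exact e0
    · exact e1
  have h00 := congrFun (congrFun g.mul_inv 0) 0
  have h10 := congrFun (congrFun g.mul_inv 1) 0
  rw [mul_apply, Fin.sum_univ_two] at h00 h10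
  rw [key, key, mul_assoc, mul_assoc, ← mul_add, h10] at h00
  simp at h00

lemma mem_maxCompact_of_mul_star {k : GLH ℝ} (h : k.val * star k.val = 1) : k ∈ maxCompact := by
  have h1 : star k.val = (k⁻¹).val := by
    rw [← one_mul (star k.val), ← k.inv_mul, mul_assoc, h, mul_one]
  have h2 : star k.val * k.val = 1 := by rw [h1, k.inv_mul]
  have hk : k.val ∈ unitary (Matrix (Fin 2) (Fin 2) ℍ[ℝ]) := Unitary.mem_iff.2 ⟨h2, h⟩
  refine ⟨hk, ?_⟩
  have h3 := Unitary.star_mem hk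
  rw [h1] at h3
  exact h3

lemma mul_star_of_mem {k : GLH ℝ} (h : k ∈ maxCompact) : k.val * star k.val = 1 :=
  (Unitary.mem_iff.1 h.1).2

lemma star_mul_of_mem {k : GLH ℝ} (h : k ∈ maxCompact) : star k.val * k.val = 1 :=
  (Unitary.mem_iff.1 h.1).1

lemma mul_star_eq (g : GLH ℝ) :
    g.val * star g.val = !![(herA g : ℍ[ℝ]), herB g; star (herB g), (herC g : ℍ[ℝ])] := by
  ext i j : 1
  rw [mul_apply, Fin.sum_univ_two]
  fin_cases i <;> fin_cases j
  · simp [star_apply, self_mul_star, herA]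
  · simp [star_apply, herB]
  · simp [star_apply, herB]
  · simp [star_apply, self_mul_star, herC]

/-- An explicit Iwasawa decomposition of `g`, read off from the Hermitian matrix `g g*`. -/
lemma exists_iwasawa_real (g : GLH ℝ) : ∃ k ∈ maxCompact,
    g = upper (realUnit √(herN g / herC g) (Real.sqrt_pos.2 (div_pos (herN_pos g) (herC_pos g))).ne')
      (realUnit √(herC g) (Real.sqrt_pos.2 (herC_pos g)).ne') ((√(herC g))⁻¹ • herB g) * k := by
  have hC := herC_pos g
  have hN := herN_pos g
  have hD := div_pos hN hC
  set b := upper (realUnit √(herN g / herC g) (Real.sqrt_pos.2 hD).ne')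
      (realUnit √(herC g) (Real.sqrt_pos.2 hC).ne') ((√(herC g))⁻¹ • herB g) with hb
  have hbb : b.val * star b.val = g.val * star g.val := by
    have s3 := (Real.sqrt_pos.2 hC).ne'
    have hA' : herA b = herA g := by
      change normSq ((√(herN g / herC g) : ℝ) : ℍ[ℝ]) +
        normSq ((√(herC g))⁻¹ • herB g) = _
      rw [normSq_coe, normSq_smul, inv_pow, Real.sq_sqrt hC.le, Real.sq_sqrt hD.le,
        herN]
      field_simp
      ring
    have hB' : herB b = herB g := by
      change ((√(herN g / herC g) : ℝ) : ℍ[ℝ]) * star 0 +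
        (√(herC g))⁻¹ • herB g * star ((√(herC g) : ℝ) : ℍ[ℝ]) = _
      rw [star_zero, mul_zero, zero_add, star_coe, mul_coe_eq_smul, smul_smul,
        mul_inv_cancel₀ s3, one_smul]
    have hC' : herC b = herC g := by
      change normSq 0 + normSq ((√(herC g) : ℝ) : ℍ[ℝ]) = _
      rw [map_zero, zero_add, normSq_coe, Real.sq_sqrt hC.le]
    rw [mul_star_eq, mul_star_eq, hA', hB', hC']
  refine ⟨b⁻¹ * g, mem_maxCompact_of_mul_star ?_, by rw [mul_inv_cancel_left]⟩
  rw [Units.val_mul, star_mul, mul_assoc, ← mul_assoc g.val, ← hbb, mul_assoc b.val, ← star_mul,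
    b.inv_mul, star_one, mul_one, b.inv_mul]

lemma diag_mem_maxCompact {a d : ℍ[ℝ]ˣ} (ha : ‖(a : ℍ[ℝ])‖ = 1) (hd : ‖(d : ℍ[ℝ])‖ = 1) :
    upper a d 0 ∈ maxCompact := by
  have key : ∀ u : ℍ[ℝ], ‖u‖ = 1 → u * star u = 1 := by
    intro u hu
    rw [self_mul_star, normSq_eq_norm_mul_self, hu]
    simp
  apply mem_maxCompact_of_mul_star
  ext i j : 1
  rw [mul_apply, Fin.sum_univ_two]
  fin_cases i <;> fin_cases j <;> simp [upper, star_apply, key _ ha, key _ hd]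

section MaassForm

variable {r : ℂ} {F : GLH ℝ → ℂ}

lemma IsMaassForm.left_invariant (hF : IsMaassForm r F) : ∀ γ ∈ glOrder ℤ ℝ, ∀ g, F (γ * g) = F g := by
  intro γ hγ g
  have := hF.invariant 1 one_pos γ hγ g 1 (one_mem _)
  have e : zMat 1 one_pos = 1 := by
    have : realUnit 1 one_ne_zero = 1 := Units.ext (by simp [realUnit])
    rw [zMat, this, upper_one]
  rwa [e, one_mul, mul_one] at this

lemma IsMaassForm.right_invariant (hF : IsMaassForm r F) (g : GLH ℝ) {k : GLH ℝ}
    (hk : k ∈ maxCompact) : F (g * k) = F g := by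
  have := hF.invariant 1 one_pos 1 (one_mem _) g k hk
  have e : zMat 1 one_pos = 1 := by
    have : realUnit 1 one_ne_zero = 1 := Units.ext (by simp [realUnit])
    rw [zMat, this, upper_one]
  rwa [e, one_mul, one_mul] at this

lemma IsMaassForm.zMat_mul (hF : IsMaassForm r F) (c : ℝ) (hc : 0 < c) (g : GLH ℝ) :
    F (zMat c hc * g) = F g := by
  have := hF.invariant c hc 1 (one_mem _) g 1 (one_mem _)
  rwa [mul_one, mul_one] at this

lemma norm_unit_pos (a : ℍ[ℝ]ˣ) : 0 < ‖(a : ℍ[ℝ])‖ := norm_pos_iff.2 a.ne_zero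

/-- The values of a form on upper triangular matrices, in terms of the upper half space. -/
lemma IsMaassForm.apply_upper (hF : IsMaassForm r F) (a d : ℍ[ℝ]ˣ) (x : ℍ[ℝ]) :
    F (upper a d x) = F (nMat (x * ((d⁻¹ : ℍ[ℝ]ˣ) : ℍ[ℝ])) *
      aMat (‖(a : ℍ[ℝ])‖ / ‖(d : ℍ[ℝ])‖) (div_pos (norm_unit_pos a) (norm_unit_pos d))) := by
  have ha := norm_unit_pos a
  have hd := norm_unit_pos d
  set α := realUnit ‖(a : ℍ[ℝ])‖ ha.ne' with hα
  set δ := realUnit ‖(d : ℍ[ℝ])‖ hd.ne' with hδ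
  have hk : upper (α⁻¹ * a) (δ⁻¹ * d) 0 ∈ maxCompact := by
    apply diag_mem_maxCompact
    · rw [Units.val_mul, norm_mul, hα]
      change ‖((‖(a : ℍ[ℝ])‖⁻¹ : ℝ) : ℍ[ℝ])‖ * _ = 1
      rw [norm_coe, norm_inv, norm_norm, inv_mul_cancel₀ ha.ne']
    · rw [Units.val_mul, norm_mul, hδ]
      change ‖((‖(d : ℍ[ℝ])‖⁻¹ : ℝ) : ℍ[ℝ])‖ * _ = 1
      rw [norm_coe, norm_inv, norm_norm, inv_mul_cancel₀ hd.ne']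
  have hc : 0 < √(‖(a : ℍ[ℝ])‖ * ‖(d : ℍ[ℝ])‖) := Real.sqrt_pos.2 (mul_pos ha hd)
  rw [← hF.zMat_mul _ hc (nMat _ * _), ← hF.right_invariant (zMat _ hc * _) hk]
  congr 1
  rw [zMat, nMat, aMat, upper_mul, upper_mul, upper_mul]
  have s1 : √(‖(a : ℍ[ℝ])‖ * ‖(d : ℍ[ℝ])‖) * √(‖(a : ℍ[ℝ])‖ / ‖(d : ℍ[ℝ])‖) = ‖(a : ℍ[ℝ])‖ := by
    rw [← Real.sqrt_mul (by positivity), mul_assoc, mul_div_cancel₀ _ hd.ne', Real.sqrt_mul_self ha.le]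
  have s2 : √(‖(a : ℍ[ℝ])‖ * ‖(d : ℍ[ℝ])‖) * (√(‖(a : ℍ[ℝ])‖ / ‖(d : ℍ[ℝ])‖))⁻¹ = ‖(d : ℍ[ℝ])‖ := by
    rw [← Real.sqrt_inv, inv_div, ← Real.sqrt_mul (by positivity), mul_comm ‖(a : ℍ[ℝ])‖, mul_assoc,
      mul_div_cancel₀ _ ha.ne', Real.sqrt_mul_self hd.le]
  have u1 : realUnit _ hc.ne' * realUnit _ (Real.sqrt_pos.2 (div_pos ha hd)).ne' = α := by
    refine Units.ext ?_
    change ((_ : ℝ) : ℍ[ℝ]) * ((_ : ℝ) : ℍ[ℝ]) = ((_ : ℝ) : ℍ[ℝ])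
    rw [← coe_mul, s1]
  have u2 : realUnit _ hc.ne' * (realUnit _ (Real.sqrt_pos.2 (div_pos ha hd)).ne')⁻¹ = δ := by
    refine Units.ext ?_
    change ((_ : ℝ) : ℍ[ℝ]) * ((_ : ℝ) : ℍ[ℝ]) = ((_ : ℝ) : ℍ[ℝ])
    rw [← coe_mul, s2]
  have h1 : ∀ y : ℍ[ℝ], (((realUnit _ hc.ne' : ℍ[ℝ]ˣ) : ℍ[ℝ]) * y) =
      y * ((realUnit _ hc.ne' : ℍ[ℝ]ˣ) : ℍ[ℝ]) := fun y => coe_commutes _ _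
  congr 1
  · rw [one_mul, u1, mul_inv_cancel_left]
  · rw [one_mul, u2, mul_inv_cancel_left]
  · simp only [mul_zero, zero_mul, add_zero, zero_add, one_mul, Units.val_one, Units.val_mul]
    have u3 : (realUnit _ (Real.sqrt_pos.2 (div_pos ha hd)).ne')⁻¹ * realUnit _ hc.ne' = δ := by
      rw [← u2]
      exact Units.ext (h1 _).symm
    rw [h1, mul_assoc, mul_assoc, ← mul_assoc _ _ (((δ⁻¹ : ℍ[ℝ]ˣ) : ℍ[ℝ]) * _), ← Units.val_mul, u3,
      Units.mul_inv_cancel_left, Units.inv_mul_cancel_right]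

/-- A nonzero form does not vanish on the upper half space. -/
lemma IsMaassForm.exists_ne_zero (hF : IsMaassForm r F) (h : F ≠ 0) :
    ∃ (x : ℍ[ℝ]) (y : ℝ) (hy : 0 < y), F (nMat x * aMat y hy) ≠ 0 := by
  obtain ⟨g, hg⟩ := Function.ne_iff.1 h
  obtain ⟨k, hk, e⟩ := exists_iwasawa_real g
  rw [e, hF.right_invariant _ hk, hF.apply_upper] at hg
  exact ⟨_, _, _, hg⟩

end MaassForm

/-! ### Fourier coefficients -/

/-- The point of `ℍ` with given coordinates for the basis `1, i, j, (1 + i + j + ij) / 2` of `𝓞`. -/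
def cubePt (t : Fin 4 → ℝ) : ℍ[ℝ] := quat (t 0 + t 3 / 2) (t 1 + t 3 / 2) (t 2 + t 3 / 2) (t 3 / 2)

/-- The additive character `x ↦ exp(2πi Re(βx))`. -/
def fchar (β x : ℍ[ℝ]) : ℂ := Complex.exp (2 * Real.pi * Complex.I * (((β * x).re : ℝ) : ℂ))

lemma fchar_add (β β' x : ℍ[ℝ]) : fchar (β + β') x = fchar β x * fchar β' x := by
  rw [fchar, fchar, fchar, ← Complex.exp_add, add_mul, re_add]
  push_cast
  ring_nf

lemma fchar_add_right (β x x' : ℍ[ℝ]) : fchar β (x + x') = fchar β x * fchar β x' := by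
  rw [fchar, fchar, fchar, ← Complex.exp_add, mul_add, re_add]
  push_cast
  ring_nf

lemma norm_fchar (β x : ℍ[ℝ]) : ‖fchar β x‖ = 1 := by
  rw [fchar, show 2 * (Real.pi : ℂ) * Complex.I * (((β * x).re : ℝ) : ℂ) =
    ((2 * Real.pi * (β * x).re : ℝ) : ℂ) * Complex.I by push_cast; ring]
  exact Complex.norm_exp_ofReal_mul_I _

lemma fchar_zero (x : ℍ[ℝ]) : fchar 0 x = 1 := by simp [fchar]

lemma fchar_zero_right (β : ℍ[ℝ]) : fchar β 0 = 1 := by simp [fchar]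

lemma re_mul_eq (x y : ℍ[ℝ]) :
    (x * y).re = x.re * y.re - x.imI * y.imI - x.imJ * y.imJ - x.imK * y.imK := re_mul x y

lemma continuous_cubePt : Continuous cubePt := by
  have : cubePt = fun t => (t 0) • (1 : ℍ[ℝ]) + (t 1) • quat 0 1 0 0 + (t 2) • quat 0 0 1 0 +
      (t 3) • quat (1 / 2) (1 / 2) (1 / 2) (1 / 2) := by
    funext t
    ext <;> simp [cubePt] <;> ring
  rw [this]
  fun_prop

lemma continuous_fchar (β : ℍ[ℝ]) : Continuous (fchar β) := by
  unfold fchar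
  have : Continuous fun x : ℍ[ℝ] => (β * x).re := continuous_re.comp (by fun_prop)
  fun_prop

lemma integral_exp_int (m : ℤ) : ∫ t in Set.Icc (0 : ℝ) 1,
    Complex.exp (2 * Real.pi * Complex.I * ((m * t : ℝ) : ℂ)) = if m = 0 then 1 else 0 := by
  split_ifs with h
  · simp [h]
  · rw [MeasureTheory.integral_Icc_eq_integral_Ioc, ← intervalIntegral.integral_of_le zero_le_one]
    have hc : (2 * Real.pi * Complex.I * m : ℂ) ≠ 0 := by
      have := Real.pi_ne_zero
      simp [h, this, Complex.I_ne_zero]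
    have := integral_exp_mul_complex (a := 0) (b := 1) hc
    simp only [Complex.ofReal_mul, Complex.ofReal_intCast, ← mul_assoc]
    rw [this]
    have e : (2 * Real.pi * Complex.I * m : ℂ) * (1 : ℝ) = m * (2 * Real.pi * Complex.I) := by
      push_cast
      ring
    rw [e, Complex.exp_int_mul_two_pi_mul_I]
    simp

/-- Orthogonality of characters. -/
lemma integral_fchar {β : ℍ[ℝ]} (hβ : β ∈ latticeS) [Decidable (β = 0)] :
    ∫ t in Set.Icc (0 : Fin 4 → ℝ) 1, fchar β (cubePt t) = if β = 0 then 1 else 0 := by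
  obtain ⟨a, b, c, d, rfl⟩ := hβ
  let m : Fin 4 → ℤ := ![a, b, c, a + b + c - d]
  have h1 : ∀ t, fchar (quat (a : ℝ) (-b) (-c) (-a - b - c + 2 * d)) (cubePt t) =
      ∏ i, Complex.exp (2 * Real.pi * Complex.I * ((m i * t i : ℝ) : ℂ)) := by
    intro t
    rw [← Complex.exp_sum, fchar, ← mul_sum, ← Complex.ofReal_sum]
    congr 3
    rw [re_mul_eq, Fin.sum_univ_four]
    simp [cubePt, m]
    ring
  have h2 : MeasureTheory.volume.restrict (Set.Icc (0 : Fin 4 → ℝ) 1) =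
      MeasureTheory.Measure.pi fun _ : Fin 4 => MeasureTheory.volume.restrict (Set.Icc (0 : ℝ) 1) := by
    rw [← Set.pi_univ_Icc, MeasureTheory.volume_pi, MeasureTheory.Measure.restrict_pi_pi]
    rfl
  simp only [h1]
  rw [h2, MeasureTheory.integral_fintype_prod_eq_prod (fun i (t : ℝ) =>
    Complex.exp (2 * Real.pi * Complex.I * ((m i * t : ℝ) : ℂ)))]
  simp only [integral_exp_int]
  rw [Fin.prod_univ_four]
  have h3 : quat (a : ℝ) (-b) (-c) (-a - b - c + 2 * d) = 0 ↔
      m 0 = 0 ∧ m 1 = 0 ∧ m 2 = 0 ∧ m 3 = 0 := by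
    constructor
    · intro h
      have e0 := congrArg QuaternionAlgebra.re h
      have e1 := congrArg QuaternionAlgebra.imI h
      have e2 := congrArg QuaternionAlgebra.imJ h
      have e3 := congrArg QuaternionAlgebra.imK h
      change (a : ℝ) = 0 at e0
      change -(b : ℝ) = 0 at e1
      change -(c : ℝ) = 0 at e2
      change -(a : ℝ) - b - c + 2 * d = 0 at e3
      norm_cast at e0 e1 e2 e3
      simp only [m, Matrix.cons_val]
      omega
    · rintro ⟨e0, e1, e2, e3⟩
      simp only [m, Matrix.cons_val] at e0 e1 e2 e3
      have : d = 0 := by omega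
      subst e0 e1 e2 this
      ext <;> simp
  by_cases h : quat (a : ℝ) (-b) (-c) (-a - b - c + 2 * d) = 0
  · rw [if_pos h]
    obtain ⟨e0, e1, e2, e3⟩ := h3.1 h
    simp [e0, e1, e2, e3]
  · rw [if_neg h]
    rw [h3] at h
    by_contra hne
    apply h
    have h4 : m 3 = 0 ∧ m 2 = 0 ∧ m 1 = 0 ∧ m 0 = 0 := by simpa [and_assoc] using hne
    exact ⟨h4.2.2.2, h4.2.2.1, h4.2.1, h4.1⟩

lemma latticeS_neg {β : ℍ[ℝ]} (h : β ∈ latticeS) : -β ∈ latticeS := by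
  obtain ⟨a, b, c, d, rfl⟩ := h
  refine ⟨-a, -b, -c, -d, ?_⟩
  ext <;> simp
  ring

lemma latticeS_add {β β' : ℍ[ℝ]} (h : β ∈ latticeS) (h' : β' ∈ latticeS) : β + β' ∈ latticeS := by
  obtain ⟨a, b, c, d, rfl⟩ := h
  obtain ⟨a', b', c', d', rfl⟩ := h'
  refine ⟨a + a', b + b', c + c', d + d', ?_⟩
  ext <;> simp <;> ring

lemma countable_latticeS : latticeS.Countable := by
  have : latticeS = Set.range fun p : ℤ × ℤ × ℤ × ℤ =>
      quat (p.1 : ℝ) (-p.2.1) (-p.2.2.1) (-p.1 - p.2.1 - p.2.2.1 + 2 * p.2.2.2) := by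
    ext β
    constructor
    · rintro ⟨a, b, c, d, rfl⟩
      exact ⟨(a, b, c, d), rfl⟩
    · rintro ⟨p, rfl⟩
      exact ⟨_, _, _, _, rfl⟩
  rw [this]
  exact Set.countable_range _

/-- Termwise computation of the Fourier coefficients of an absolutely convergent series. -/
lemma hasSum_coef {ι : Type*} [Countable ι] (φ : ι → ℍ[ℝ]) (c : ι → ℂ) (f : ℍ[ℝ] → ℂ)
    (hf : ∀ x, HasSum (fun i => c i * fchar (φ i) x) (f x)) (hφ : ∀ i, c i ≠ 0 → φ i ∈ latticeS)
    {γ : ℍ[ℝ]} (hγ : γ ∈ latticeS) [DecidableEq ℍ[ℝ]] :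
    HasSum (fun i => if φ i = γ then c i else 0)
      (∫ t in Set.Icc (0 : Fin 4 → ℝ) 1, f (cubePt t) * fchar (-γ) (cubePt t)) := by
  have hs : Summable fun i => ‖c i‖ := by
    have := (hf 0).summable.norm
    simpa [fchar_zero_right] using this
  have hcont : ∀ i, Continuous fun t => c i * fchar (φ i) (cubePt t) * fchar (-γ) (cubePt t) := fun i =>
    (continuous_const.mul ((continuous_fchar _).comp continuous_cubePt)).mul
      ((continuous_fchar _).comp continuous_cubePt)
  have key := MeasureTheory.hasSum_integral_of_summable_integral_norm
    (μ := MeasureTheory.volume.restrict (Set.Icc (0 : Fin 4 → ℝ) 1))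
    (F := fun i t => c i * fchar (φ i) (cubePt t) * fchar (-γ) (cubePt t))
    (fun i => (hcont i).integrableOn_Icc) (by
      simp only [norm_mul, norm_fchar, mul_one]
      simpa using hs.mul_left _)
  have e1 : ∀ i, ∫ t in Set.Icc (0 : Fin 4 → ℝ) 1, c i * fchar (φ i) (cubePt t) * fchar (-γ) (cubePt t) =
      if φ i = γ then c i else 0 := by
    intro i
    by_cases hc : c i = 0
    · simp [hc]
    · simp only [mul_assoc, ← fchar_add]
      rw [MeasureTheory.integral_const_mul, integral_fchar (latticeS_add (hφ i hc) (latticeS_neg hγ))]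
      simp [← sub_eq_add_neg, sub_eq_zero]
  have e2 : ∀ t, ∑' i, c i * fchar (φ i) (cubePt t) * fchar (-γ) (cubePt t) =
      f (cubePt t) * fchar (-γ) (cubePt t) := fun t => ((hf (cubePt t)).mul_right _).tsum_eq
  simp only [e1, e2] at key
  exact key

lemma IsSmooth.continuous_comp {f : GLH ℝ → ℂ} (hf : IsSmooth f) {X : Type*} [TopologicalSpace X]
    (c : X → GLH ℝ) (hc : ∀ a b, Continuous fun x => (c x).val a b) : Continuous fun x => f (c x) := by
  have e : (fun x => f (c x)) = fun x => extend f (Matrix.of.symm (c x).val) := by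
    funext x
    have h : IsUnit (Matrix.of (Matrix.of.symm (c x).val)) := (c x).isUnit
    rw [extend, dif_pos h]
    congr 1
    exact Units.ext rfl
  rw [e]
  exact hf.continuousOn.comp_continuous (continuous_pi fun a => continuous_pi fun b => hc a b)
    fun x => (c x).isUnit

lemma IsMaassForm.continuous_nMat {r : ℂ} {F : GLH ℝ → ℂ} (hF : IsMaassForm r F) (y : ℝ) (hy : 0 < y) :
    Continuous fun x => F (nMat x * aMat y hy) := by
  refine hF.smooth.continuous_comp _ fun a b => ?_
  simp only [nMat, aMat, upper_mul]
  fin_cases a <;> fin_cases b <;> simp only [upper] <;>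
    simp <;> try exact continuous_const
  exact continuous_id.mul continuous_const

/-- The constant term of a cuspidal form vanishes. -/
lemma constantTerm_eq_zero {r : ℂ} {F : GLH ℝ → ℂ} (hF : IsMaassForm r F) {u : ℝ → ℂ} {A : ℍ[ℝ] → ℂ}
    (hA : HasFourierExpansion r F u A) (hc : IsCuspidal F) (y : ℝ) (hy : 0 < y) : u y = 0 := by
  classical
  have : Countable {β : ℍ[ℝ] // β ∈ latticeS ∧ β ≠ 0} :=
    (countable_latticeS.mono (s₁ := {β | β ∈ latticeS ∧ β ≠ 0}) fun _ h => h.1).to_subtype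
  have h := hasSum_coef (fun β : {β : ℍ[ℝ] // β ∈ latticeS ∧ β ≠ 0} => (β : ℍ[ℝ])) _ _
    (fun x => hA x y hy) (fun β _ => β.2.1) (γ := 0) ⟨0, 0, 0, 0, by ext <;> simp⟩
  have h0 : (fun β : {β : ℍ[ℝ] // β ∈ latticeS ∧ β ≠ 0} => if (β : ℍ[ℝ]) = 0 then A β * (y : ℂ) ^ 2 *
      besselK (Complex.I * r) (2 * Real.pi * ‖(β : ℍ[ℝ])‖ * y) else 0) = 0 := by
    funext β
    exact if_neg β.2.2
  rw [h0] at h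
  have h1 := h.unique hasSum_zero
  simp only [neg_zero, fchar_zero, mul_one] at h1
  have hsub := MeasureTheory.integral_sub ((hF.continuous_nMat y hy).comp continuous_cubePt).integrableOn_Icc
    (continuous_const.integrableOn_Icc (μ := MeasureTheory.volume)
      (a := (0 : Fin 4 → ℝ)) (b := 1) (f := fun _ => u y))
  have h1 := hsub.symm.trans h1
  have h2 := hc (aMat y hy)
  change ∫ t in Set.Icc (0 : Fin 4 → ℝ) 1, F (nMat (cubePt t) * aMat y hy) = 0 at h2
  change _ - _ = _ at h1
  simp only [Function.comp_def] at h1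
  rw [h2] at h1
  have h3 : MeasureTheory.volume.real (Set.Icc (0 : Fin 4 → ℝ) 1) ≠ 0 := by
    rw [MeasureTheory.measureReal_def, Real.volume_Icc_pi]
    simp
  simpa [h3] using h1

/-! ### The lattice `𝓢` and primitive elements -/

local notation "ϖᵣ" => ((varpiUnit ℝ : ℍ[ℝ]ˣ) : ℍ[ℝ])
local notation "ϖᵢ" => (((varpiUnit ℝ)⁻¹ : ℍ[ℝ]ˣ) : ℍ[ℝ])
local notation "𝓞ᵣ" => hurwitz ℤ ℝ

lemma varpi_inv_eq : ϖᵢ = quat (1 / 2) (-(1 / 2)) 0 0 := rfl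

lemma varpi_eq : ϖᵣ = quat 1 1 0 0 := rfl

lemma varpi_inv_mul (x : ℍ[ℝ]) : ϖᵢ * x =
    quat ((x.re + x.imI) / 2) ((x.imI - x.re) / 2) ((x.imJ + x.imK) / 2) ((x.imK - x.imJ) / 2) := by
  rw [varpi_inv_eq]
  ext <;> simp <;> ring

lemma varpi_conj (x : ℍ[ℝ]) : ϖᵣ * x * ϖᵢ = quat x.re x.imI (-x.imK) x.imJ := by
  rw [varpi_inv_eq, varpi_eq]
  ext <;> simp <;> ring

lemma varpi_inv_conj (x : ℍ[ℝ]) : ϖᵢ * x * ϖᵣ = quat x.re x.imI x.imK (-x.imJ) := by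
  rw [varpi_inv_eq, varpi_eq]
  ext <;> simp <;> ring

/-- The dual lattice `𝓢` is `ϖ₂ 𝓞`. -/
lemma mem_latticeS_iff {β : ℍ[ℝ]} : β ∈ latticeS ↔ ϖᵢ * β ∈ 𝓞ᵣ := by
  rw [varpi_inv_mul]
  constructor
  · rintro ⟨a, b, c, d, rfl⟩
    refine ⟨a - d, -d, -c, -a - b + 2 * d, ?_⟩
    ext <;> simp <;> ring
  · rintro ⟨a, b, c, d, h⟩
    have h0 := congrArg QuaternionAlgebra.re h
    have h1 := congrArg QuaternionAlgebra.imI h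
    have h2 := congrArg QuaternionAlgebra.imJ h
    have h3 := congrArg QuaternionAlgebra.imK h
    simp only [quat_re, quat_imI, quat_imJ, quat_imK, eq_intCast] at h0 h1 h2 h3
    refine ⟨a - b, -(a + b + d), -c, -b, ?_⟩
    ext <;> simp <;> linarith

lemma varpi_conj_mem {x : ℍ[ℝ]} (h : x ∈ 𝓞ᵣ) : ϖᵣ * x * ϖᵢ ∈ 𝓞ᵣ := by
  obtain ⟨a, b, c, d, rfl⟩ := h
  rw [varpi_conj]
  refine ⟨a - c, b - c, -c - d, d + 2 * c, ?_⟩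
  ext <;> simp <;> ring

lemma varpi_inv_conj_mem {x : ℍ[ℝ]} (h : x ∈ 𝓞ᵣ) : ϖᵢ * x * ϖᵣ ∈ 𝓞ᵣ := by
  obtain ⟨a, b, c, d, rfl⟩ := h
  rw [varpi_inv_conj]
  refine ⟨a + c + d, b + c + d, d + c, -d - 2 * c, ?_⟩
  ext <;> simp <;> ring

lemma varpi_mem_real : ϖᵣ ∈ 𝓞ᵣ := ⟨1, 1, 0, 0, by ext <;> simp [varpi_eq]⟩

lemma latticeS_sub_hurwitz {β : ℍ[ℝ]} (h : β ∈ latticeS) : β ∈ 𝓞ᵣ := by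
  have := mul_mem varpi_mem_real (mem_latticeS_iff.1 h)
  rwa [Units.mul_inv_cancel_left] at this

lemma varpi_mul_mem {x : ℍ[ℝ]} (h : x ∈ 𝓞ᵣ) : ϖᵣ * x ∈ latticeS := by
  rw [mem_latticeS_iff, Units.inv_mul_cancel_left]
  exact h

lemma latticeS_conj {β : ℍ[ℝ]} (h : β ∈ latticeS) : ϖᵢ * β * ϖᵣ ∈ latticeS := by
  rw [mem_latticeS_iff, ← mul_assoc ϖᵢ (ϖᵢ * β) ϖᵣ]
  exact varpi_inv_conj_mem (mem_latticeS_iff.1 h)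

lemma latticeS_mul_varpi {β : ℍ[ℝ]} (h : β ∈ latticeS) : β * ϖᵣ ∈ latticeS := by
  have := varpi_mul_mem (latticeS_sub_hurwitz (latticeS_conj h))
  rwa [mul_assoc, Units.mul_inv_cancel_left] at this

lemma latticeS_mul_varpi_inv {β : ℍ[ℝ]} (h : β ∈ latticeS) : β * ϖᵢ ∈ 𝓞ᵣ := by
  have := varpi_conj_mem (mem_latticeS_iff.1 h)
  rwa [Units.mul_inv_cancel_left] at this

lemma normSq_varpi : normSq ϖᵣ = 2 := by
  rw [varpi_eq, normSq_def']
  norm_num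

lemma normSq_varpi_inv : normSq ϖᵢ = 1 / 2 := by
  rw [varpi_inv_eq, normSq_def']
  norm_num

lemma quat_i_mem : quat 0 1 0 0 ∈ 𝓞ᵣ := ⟨0, 1, 0, 0, by ext <;> simp⟩

lemma two_mul_eq (x : ℍ[ℝ]) : (2 : ℍ[ℝ]) * x = ϖᵣ ^ 2 * -(quat 0 1 0 0 * x) := by
  have : ϖᵣ ^ 2 * -quat 0 1 0 0 = 2 := by
    rw [varpi_eq, pow_two]
    have e : (2 : ℍ[ℝ]) = ((2 : ℝ) : ℍ[ℝ]) := by norm_cast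
    rw [e]
    ext <;> simp
    norm_num
  rw [neg_mul_eq_neg_mul, ← mul_assoc, this]

lemma odd_cancel {n : ℕ} (hn : Odd n) {β x : ℍ[ℝ]} (hβ : β ∈ 𝓞ᵣ) (h : (n : ℍ[ℝ]) * β = ϖᵣ ^ 2 * x)
    (hx : x ∈ 𝓞ᵣ) : ∃ z ∈ 𝓞ᵣ, β = ϖᵣ ^ 2 * z := by
  obtain ⟨m, rfl⟩ := hn
  refine ⟨x - -(quat 0 1 0 0 * ((m : ℍ[ℝ]) * β)),
    sub_mem hx (neg_mem (mul_mem quat_i_mem (mul_mem (natCast_mem _ m) hβ))), ?_⟩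
  rw [mul_sub, ← h, ← two_mul_eq]
  push_cast
  noncomm_ring

lemma latticeS_of_odd_mul {n : ℕ} (hn : Odd n) {x : ℍ[ℝ]} (hx : x ∈ 𝓞ᵣ)
    (h : (n : ℍ[ℝ]) * x ∈ latticeS) : x ∈ latticeS := by
  obtain ⟨m, rfl⟩ := hn
  have h2 : (2 : ℍ[ℝ]) * ((m : ℍ[ℝ]) * x) ∈ latticeS := by
    rw [two_mul_eq, pow_two, mul_assoc]
    exact varpi_mul_mem (mul_mem varpi_mem_real
      (neg_mem (mul_mem quat_i_mem (mul_mem (natCast_mem _ m) hx))))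
  have h3 := latticeS_add h (latticeS_neg h2)
  have e : ((2 * m + 1 : ℕ) : ℍ[ℝ]) * x + -(2 * ((m : ℍ[ℝ]) * x)) = x := by
    push_cast
    noncomm_ring
  rwa [e] at h3

lemma primS_conj {β : ℍ[ℝ]} (h : β ∈ primS) : ϖᵢ * β * ϖᵣ ∈ primS := by
  obtain ⟨h1, h2, -, h4, h5⟩ := h
  have e : ∀ x, ϖᵣ * (ϖᵢ * x * ϖᵣ) * ϖᵢ = x := fun x => by
    rw [mul_assoc ϖᵢ, Units.mul_inv_cancel_left, Units.mul_inv_cancel_right]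
  refine ⟨latticeS_conj h1, ?_, ⟨_, mem_latticeS_iff.1 (latticeS_conj h1), ?_⟩, ?_, ?_⟩
  · exact mul_ne_zero (mul_ne_zero (Units.ne_zero _) h2) (Units.ne_zero _)
  · exact (Units.mul_inv_cancel_left (varpiUnit ℝ) _).symm
  · rintro ⟨x, hx, hxe⟩
    refine h4 ⟨_, varpi_conj_mem hx, ?_⟩
    rw [← e β, hxe]
    change ϖᵣ * (ϖᵣ ^ 2 * x) * ϖᵢ = ϖᵣ ^ 2 * _
    noncomm_ring
  · rintro n hn hn1 ⟨x, hx, hxe⟩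
    refine h5 n hn hn1 ⟨_, varpi_conj_mem hx, ?_⟩
    rw [← e β, hxe, ← mul_assoc, ← (Nat.cast_commute n ϖᵣ).eq, mul_assoc, mul_assoc, mul_assoc]

lemma one_le_normSq {β : ℍ[ℝ]} (h : β ∈ latticeS) (h0 : β ≠ 0) : 1 ≤ normSq β := by
  obtain ⟨a, b, c, d, rfl⟩ := h
  have hne : (0 : ℝ) < normSq (quat (a : ℝ) (-b) (-c) (-a - b - c + 2 * d)) :=
    lt_of_le_of_ne normSq_nonneg fun h => h0 (normSq_eq_zero.1 h.symm)
  rw [normSq_def'] at hne ⊢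
  simp only [quat_re, quat_imI, quat_imJ, quat_imK] at hne ⊢
  have hz : (0 : ℤ) < a ^ 2 + (-b) ^ 2 + (-c) ^ 2 + (-a - b - c + 2 * d) ^ 2 := by exact_mod_cast hne
  have hz' : (1 : ℤ) ≤ a ^ 2 + (-b) ^ 2 + (-c) ^ 2 + (-a - b - c + 2 * d) ^ 2 := hz
  exact_mod_cast hz'

lemma exists_primitive {β : ℍ[ℝ]} (h : β ∈ latticeS) (h0 : β ≠ 0) :
    ∃ (u n : ℕ) (β₀ : ℍ[ℝ]), Odd n ∧ β₀ ∈ primS ∧ β = ϖᵣ ^ u * n * β₀ := by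
  obtain ⟨k, hk⟩ := pow_unbounded_of_one_lt (normSq β) (one_lt_two : (1 : ℝ) < 2)
  induction k generalizing β with
  | zero =>
    rw [pow_zero] at hk
    exact absurd (one_le_normSq h h0) (not_le.2 hk)
  | succ k ih =>
    by_cases h2 : ∃ x ∈ 𝓞ᵣ, β = varpi ℝ ^ 2 * x
    · obtain ⟨x, hx, rfl⟩ := h2
      have hne : ϖᵣ * x ≠ 0 := by
        intro hz
        apply h0
        change ϖᵣ ^ 2 * x = 0
        rw [pow_two, mul_assoc, hz, mul_zero]
      obtain ⟨u, n, β₀, hn, hβ₀, he⟩ := ih (varpi_mul_mem hx) hne (by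
        change normSq (ϖᵣ ^ 2 * x) < _ at hk
        have e : (2 : ℝ) ^ (k + 1) = 2 * 2 ^ k := pow_succ' _ _
        rw [map_mul, map_pow, normSq_varpi] at hk
        rw [map_mul, normSq_varpi]
        linarith)
      refine ⟨u + 1, n, β₀, hn, hβ₀, ?_⟩
      change ϖᵣ ^ 2 * x = _
      rw [pow_two, mul_assoc, he, pow_succ']
      simp only [mul_assoc]
    by_cases h3 : ∀ n : ℕ, Odd n → n ≠ 1 → ¬ ∃ x ∈ 𝓞ᵣ, β = n * x
    · exact ⟨0, 1, β, odd_one, ⟨h, h0, ⟨_, mem_latticeS_iff.1 h,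
        (Units.mul_inv_cancel_left (varpiUnit ℝ) _).symm⟩, h2, h3⟩, by simp⟩
    · push Not at h3
      obtain ⟨n, hn, hn1, x, hx, rfl⟩ := h3
      have hx0 : x ≠ 0 := right_ne_zero_of_mul h0
      have hn3 : 3 ≤ n := by
        rcases hn with ⟨m, rfl⟩
        omega
      obtain ⟨u, n', β₀, hn', hβ₀, he⟩ := ih (latticeS_of_odd_mul hn hx h) hx0 (by
        have e : normSq (n : ℍ[ℝ]) = (n : ℝ) ^ 2 := by
          rw [← coe_natCast, normSq_coe]
        have e2 : (2 : ℝ) ^ (k + 1) = 2 * 2 ^ k := pow_succ' _ _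
        rw [map_mul, e, e2] at hk
        have h3 : (3 : ℝ) ≤ n := by exact_mod_cast hn3
        have h9 : (9 : ℝ) ≤ n ^ 2 := by nlinarith
        have := mul_le_mul_of_nonneg_right h9 (normSq_nonneg (a := x))
        have := normSq_nonneg (a := x)
        linarith)
      refine ⟨u, n * n', β₀, hn.mul hn', hβ₀, ?_⟩
      rw [he, Nat.cast_mul, ← mul_assoc, ← mul_assoc, (Nat.cast_commute n (ϖᵣ ^ u)).eq]
      simp only [mul_assoc]

lemma fchar_of_half {δ x : ℍ[ℝ]} {n : ℤ} (h : (δ * x).re = n / 2) :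
    fchar δ x = if Even n then 1 else -1 := by
  rw [fchar, h]
  have e : 2 * (Real.pi : ℂ) * Complex.I * (((n : ℝ) / 2 : ℝ) : ℂ) = n * (Real.pi * Complex.I) := by
    push_cast
    ring
  rw [e, Complex.exp_int_mul, Complex.exp_pi_mul_I]
  split_ifs with hn
  · exact hn.neg_one_zpow
  · exact (Int.not_even_iff_odd.1 hn).neg_one_zpow

open Classical in
/-- The sum of the values of a character of `𝓞 / ϖ₂ 𝓞`. -/
lemma sum_fchar_resRep {δ : ℍ[ℝ]} (hδ : δ ∈ 𝓞ᵣ) :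
    ∑ i, fchar δ (-resRep ℝ i) = if δ ∈ latticeS then 4 else 0 := by
  have h4 : ∑ i, fchar δ (-resRep ℝ i) = (1 + fchar δ (-1)) * (1 + fchar δ (-rho ℝ)) := by
    rw [Fin.sum_univ_four]
    simp only [resRep, Matrix.cons_val]
    rw [neg_zero, fchar_zero_right, neg_add, fchar_add_right]
    ring
  rw [h4]
  have hmem : δ ∈ latticeS ↔ ∃ a b c d : ℤ, δ = quat (a : ℝ) (-b) (-c) (-a - b - c + 2 * d) := Iff.rfl
  obtain ⟨a, b, c, d, rfl⟩ := hδ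
  rw [fchar_of_half (n := -(2 * a + d)) (by rw [re_mul_eq]; simp; ring),
    fchar_of_half (n := -(a - b - c - d)) (by rw [re_mul_eq]; simp [rho]; ring)]
  by_cases hd : Even d
  · by_cases hs : Even (a - b - c)
    · rw [if_pos, if_pos, if_pos]
      · norm_num
      · rw [hmem]
        obtain ⟨d, rfl⟩ := hd
        obtain ⟨s, hs⟩ := hs
        refine ⟨a + d, -(b + d), -(c + d), s, ?_⟩
        have hs' : (a : ℝ) - b - c = s + s := by exact_mod_cast hs
        (ext <;> simp); linarith
      · exact (hs.sub hd).neg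
      · exact ((even_two_mul a).add hd).neg
    · have h1 : ¬ Even (-(a - b - c - d)) := by
        rw [even_neg]
        intro h
        apply hs
        have := h.add hd
        rwa [sub_add_cancel] at this
      have h0 : Even (-(2 * a + d)) := ((even_two_mul a).add hd).neg
      have hS := hmem.not.mpr (by
        rintro ⟨a', b', c', d', h⟩
        apply hs
        have e0 := congrArg QuaternionAlgebra.re h
        have e1 := congrArg QuaternionAlgebra.imI h
        have e2 := congrArg QuaternionAlgebra.imJ h
        have e3 := congrArg QuaternionAlgebra.imK h
        simp only [quat_re, quat_imI, quat_imJ, quat_imK, eq_intCast] at e0 e1 e2 e3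
        obtain ⟨d, rfl⟩ := hd
        push_cast at e0 e1 e2 e3
        have f0 : (a : ℝ) + d = a' := by linarith
        have f1 : (b : ℝ) + d = -b' := by linarith
        have f2 : (c : ℝ) + d = -c' := by linarith
        have f3 : (d : ℝ) = -a' - b' - c' + 2 * d' := by linarith
        norm_cast at f0 f1 f2 f3
        rw [Int.even_iff]
        omega)
      rw [if_pos h0, if_neg h1, if_neg hS]
      norm_num
  · have h1 : ¬ Even (-(2 * a + d)) := by
      rw [even_neg]
      intro h
      apply hd
      have := h.sub (even_two_mul a)
      rwa [add_sub_cancel_left] at this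
    have hS := hmem.not.mpr (by
      rintro ⟨a', b', c', d', h⟩
      apply hd
      have e0 := congrArg QuaternionAlgebra.re h
      simp only [quat_re, eq_intCast] at e0
      have f0 : (d : ℝ) = 2 * (a' - a) := by linarith
      norm_cast at f0
      rw [f0]
      exact even_two_mul _)
    rw [if_neg h1, if_neg hS]
    norm_num

/-! ### The Hecke eigenvalue at two -/

lemma norm_varpi : ‖ϖᵣ‖ = √2 := by
  rw [← normSq_varpi, normSq_eq_norm_mul_self, Real.sqrt_mul_self (norm_nonneg _)]

lemma norm_varpi_inv : ‖ϖᵢ‖ = (√2)⁻¹ := by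
  have h : ‖ϖᵣ‖ * ‖ϖᵢ‖ = 1 := by rw [← norm_mul, Units.mul_inv, norm_one]
  rw [norm_varpi] at h
  exact eq_inv_of_mul_eq_one_right h

lemma re_mul_comm (x y : ℍ[ℝ]) : (x * y).re = (y * x).re := by
  rw [re_mul_eq, re_mul_eq]
  ring

lemma fchar_mul_right (β z x : ℍ[ℝ]) : fchar β (x * z) = fchar (z * β) x := by
  rw [fchar, fchar, ← mul_assoc β, re_mul_comm (β * x) z, mul_assoc z]

lemma fchar_mul_left (β z x : ℍ[ℝ]) : fchar β (z * x) = fchar (β * z) x := by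
  rw [fchar, fchar, mul_assoc β]

lemma aMat_congr {y y' : ℝ} (h : y = y') (hy : 0 < y) : aMat y hy = aMat y' (h ▸ hy) := by
  subst h
  rfl

section

variable {r : ℂ} {F : GLH ℝ → ℂ} (hF : IsMaassForm r F)
include hF

/-- The action on the upper half space of an upper triangular matrix. -/
lemma IsMaassForm.apply_upper_mul (a d : ℍ[ℝ]ˣ) (b x : ℍ[ℝ]) (y : ℝ) (hy : 0 < y) :
    F (upper a d b * (nMat x * aMat y hy)) =
      F (nMat ((a * x + b) * ((d⁻¹ : ℍ[ℝ]ˣ) : ℍ[ℝ])) * aMat (‖(a : ℍ[ℝ])‖ / ‖(d : ℍ[ℝ])‖ * y)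
        (mul_pos (div_pos (norm_unit_pos a) (norm_unit_pos d)) hy)) := by
  have hs := Real.sqrt_pos.2 hy
  have hn : ‖((realUnit √y hs.ne' : ℍ[ℝ]ˣ) : ℍ[ℝ])‖ = √y := by
    change ‖((√y : ℝ) : ℍ[ℝ])‖ = √y
    rw [norm_coe, Real.norm_of_nonneg hs.le]
  have hn' : ‖(((realUnit √y hs.ne')⁻¹ : ℍ[ℝ]ˣ) : ℍ[ℝ])‖ = (√y)⁻¹ := by
    change ‖(((√y)⁻¹ : ℝ) : ℍ[ℝ])‖ = (√y)⁻¹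
    rw [norm_coe, Real.norm_of_nonneg (by positivity)]
  rw [nMat, aMat, upper_mul, upper_mul, hF.apply_upper]
  have e : ‖((a * (1 * realUnit √y hs.ne') : ℍ[ℝ]ˣ) : ℍ[ℝ])‖ /
      ‖((d * (1 * (realUnit √y hs.ne')⁻¹) : ℍ[ℝ]ˣ) : ℍ[ℝ])‖ = ‖(a : ℍ[ℝ])‖ / ‖(d : ℍ[ℝ])‖ * y := by
    rw [one_mul, one_mul, Units.val_mul, Units.val_mul, norm_mul, norm_mul, hn, hn']
    have := norm_unit_pos d
    field_simp
    rw [Real.sq_sqrt hy.le]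
  rw [aMat_congr e]
  congr 3
  simp only [mul_zero, zero_add, one_mul, Units.val_one, mul_inv_rev, inv_inv, Units.val_mul]
  rw [← mul_assoc, ← mul_assoc (a : ℍ[ℝ]), ← add_mul, Units.inv_mul_cancel_right]

lemma IsMaassForm.heckeRep_some (b x : ℍ[ℝ]) (y : ℝ) (hy : 0 < y) :
    F ((upper (varpiUnit ℝ) 1 b)⁻¹ * (nMat x * aMat y hy)) =
      F (nMat (ϖᵢ * (x - b)) * aMat ((√2)⁻¹ * y) (by positivity)) := by
  rw [upper_inv, hF.apply_upper_mul, aMat_congr (y' := (√2)⁻¹ * y) (by simp [norm_varpi])]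
  congr 3
  simp [mul_add, sub_eq_add_neg]

lemma IsMaassForm.heckeRep_none (x : ℍ[ℝ]) (y : ℝ) (hy : 0 < y) :
    F ((upper 1 (varpiUnit ℝ) 0)⁻¹ * (nMat x * aMat y hy)) =
      F (nMat (x * ϖᵣ) * aMat (√2 * y) (by positivity)) := by
  rw [upper_inv, hF.apply_upper_mul, aMat_congr (y' := √2 * y) (by simp [norm_varpi])]
  congr 3
  simp

lemma IsMaassForm.heckeRep_scalar (x : ℍ[ℝ]) (y : ℝ) (hy : 0 < y) :
    F ((upper (varpiUnit ℝ) (varpiUnit ℝ) 0)⁻¹ * (nMat x * aMat y hy)) =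
      F (nMat (ϖᵢ * x * ϖᵣ) * aMat y hy) := by
  rw [upper_inv, hF.apply_upper_mul, aMat_congr (y' := y) (by
    rw [div_self (norm_unit_pos _).ne', one_mul])]
  congr 3
  simp

end

section Coefficients

variable {r : ℂ} {F : GLH ℝ → ℂ} {A : ℍ[ℝ] → ℂ}

/-- Index set of the Fourier expansion. -/
abbrev FourierIndex := {β : ℍ[ℝ] // β ∈ latticeS ∧ β ≠ 0}

instance : Countable FourierIndex :=
  (countable_latticeS.mono (s₁ := {β | β ∈ latticeS ∧ β ≠ 0}) fun _ h => h.1).to_subtype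

/-- The factor of `A(β)` in the Fourier expansion, which depends on `|β|` and `y` only. -/
def whittaker (r : ℂ) (n y : ℝ) : ℂ := (y : ℂ) ^ 2 * besselK (Complex.I * r) (2 * Real.pi * n * y)

/-- The Fourier expansion of a cusp form. -/
def HasCuspExpansion (r : ℂ) (F : GLH ℝ → ℂ) (A : ℍ[ℝ] → ℂ) : Prop :=
  ∀ (x : ℍ[ℝ]) (y : ℝ) (hy : 0 < y), HasSum (fun β : FourierIndex =>
    A β * whittaker r ‖(β : ℍ[ℝ])‖ y * fchar β x) (F (nMat x * aMat y hy))

lemma hasCuspExpansion (hF : IsMaassForm r F) {u : ℝ → ℂ} (hA : HasFourierExpansion r F u A)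
    (hc : IsCuspidal F) : HasCuspExpansion r F A := by
  intro x y hy
  have := hA x y hy
  rw [constantTerm_eq_zero hF hA hc y hy, sub_zero] at this
  simpa only [whittaker, fchar, mul_assoc] using this

lemma HasCuspExpansion.exists_ne_zero (hA : HasCuspExpansion r F A) (hF : IsMaassForm r F) (h0 : F ≠ 0) :
    ∃ β : FourierIndex, A β ≠ 0 ∧ ∃ y : ℝ, 0 < y ∧ whittaker r ‖(β : ℍ[ℝ])‖ y ≠ 0 := by
  obtain ⟨x, y, hy, h⟩ := hF.exists_ne_zero h0
  by_contra! hall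
  apply h
  have e : (fun β : FourierIndex => A β * whittaker r ‖(β : ℍ[ℝ])‖ y * fchar β x) = fun _ => 0 := by
    funext β
    by_cases hβ : A β = 0
    · rw [hβ, zero_mul, zero_mul]
    · rw [hall β hβ y hy, mul_zero, zero_mul]
  have := hA x y hy
  rw [e] at this
  exact this.unique hasSum_zero

lemma whittaker_scale (r : ℂ) {s : ℝ} (hs : s ≠ 0) (n y : ℝ) :
    whittaker r (s * n) (s⁻¹ * y) = (s : ℂ)⁻¹ ^ 2 * whittaker r n y := by
  rw [whittaker, whittaker, show 2 * Real.pi * (s * n) * (s⁻¹ * y) = 2 * Real.pi * n * y by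
    field_simp]
  push_cast
  ring

open Classical in
/-- The scalar `ϖ₂` at two acts trivially. -/
lemma scalar_eigenvalue (hA : HasCuspExpansion r F A)
    (hconj : ∀ β : FourierIndex, A (ϖᵢ * β * ϖᵣ) = A β) (x : ℍ[ℝ]) (y : ℝ) (hy : 0 < y) :
    F (nMat (ϖᵢ * x * ϖᵣ) * aMat y hy) = F (nMat x * aMat y hy) := by
  let e : FourierIndex ≃ FourierIndex :=
    { toFun := fun β => ⟨ϖᵢ * β * ϖᵣ, latticeS_conj β.2.1,
        mul_ne_zero (mul_ne_zero (Units.ne_zero _) β.2.2) (Units.ne_zero _)⟩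
      invFun := fun β => ⟨ϖᵣ * β * ϖᵢ, by
        rw [mul_assoc]
        exact varpi_mul_mem (latticeS_mul_varpi_inv β.2.1),
        mul_ne_zero (mul_ne_zero (Units.ne_zero _) β.2.2) (Units.ne_zero _)⟩
      left_inv := fun β => Subtype.ext (by
        change ϖᵣ * (ϖᵢ * β * ϖᵣ) * ϖᵢ = β
        rw [mul_assoc ϖᵢ, Units.mul_inv_cancel_left, Units.mul_inv_cancel_right])
      right_inv := fun β => Subtype.ext (by
        change ϖᵢ * (ϖᵣ * β * ϖᵢ) * ϖᵣ = β
        rw [mul_assoc ϖᵣ, Units.inv_mul_cancel_left, Units.inv_mul_cancel_right]) }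
  have h1 := (e.hasSum_iff).2 (hA (ϖᵢ * x * ϖᵣ) y hy)
  refine h1.unique ?_
  convert hA x y hy using 2 with β
  have hn : ‖ϖᵢ * (β : ℍ[ℝ]) * ϖᵣ‖ = ‖(β : ℍ[ℝ])‖ := by
    rw [norm_mul, norm_mul, norm_varpi, norm_varpi_inv]
    field_simp
  change A (ϖᵢ * β * ϖᵣ) * whittaker r ‖ϖᵢ * (β : ℍ[ℝ]) * ϖᵣ‖ y * fchar (ϖᵢ * β * ϖᵣ) (ϖᵢ * x * ϖᵣ) = _
  rw [hconj, hn, fchar_mul_right, mul_assoc ϖᵢ, Units.mul_inv_cancel_left, fchar_mul_left,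
    Units.mul_inv_cancel_right]

open Classical in
/-- The relation between Fourier coefficients given by the Hecke operator at two. -/
lemma hecke_coefficient (hF : IsMaassForm r F) (hA : HasCuspExpansion r F A) {μ : ℂ}
    (hμ : ∀ (x : ℍ[ℝ]) (y : ℝ) (hy : 0 < y),
      ∑ i, F (nMat (ϖᵢ * (x - resRep ℝ i)) * aMat ((√2)⁻¹ * y) (by positivity)) +
        F (nMat (x * ϖᵣ) * aMat (√2 * y) (by positivity)) = μ * F (nMat x * aMat y hy))
    (γ : FourierIndex) (hγ : ∃ y : ℝ, 0 < y ∧ whittaker r ‖(γ : ℍ[ℝ])‖ y ≠ 0) :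
    2 * A (γ * ϖᵣ) + 2 * (if ϖᵢ * γ ∈ latticeS then A (ϖᵢ * γ) else 0) = μ * A γ := by
  obtain ⟨y, hy, hW⟩ := hγ
  have hs2 : (√2 : ℝ) ≠ 0 := by positivity
  have hs2c : ((√2 : ℝ) : ℂ) ^ 2 = 2 := by
    rw [← Complex.ofReal_pow, Real.sq_sqrt (by norm_num)]
    norm_num
  let f₁ : ℍ[ℝ] → ℂ := fun x => ∑ i, F (nMat (ϖᵢ * (x - resRep ℝ i)) * aMat ((√2)⁻¹ * y) (by positivity))
  let f₂ : ℍ[ℝ] → ℂ := fun x => F (nMat (x * ϖᵣ) * aMat (√2 * y) (by positivity))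
  let f₃ : ℍ[ℝ] → ℂ := fun x => F (nMat x * aMat y hy)
  have s₁ : ∀ x, HasSum (fun β : FourierIndex => A β * whittaker r ‖(β : ℍ[ℝ])‖ ((√2)⁻¹ * y) *
      (if (β : ℍ[ℝ]) * ϖᵢ ∈ latticeS then 4 else 0) * fchar (β * ϖᵢ) x) (f₁ x) := by
    intro x
    have := hasSum_sum (s := Finset.univ) fun i _ =>
      hA (ϖᵢ * (x - resRep ℝ i)) ((√2)⁻¹ * y) (by positivity)
    convert this using 2 with β
    rw [← sum_fchar_resRep (latticeS_mul_varpi_inv β.2.1), mul_sum, sum_mul]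
    refine sum_congr rfl fun i _ => ?_
    rw [fchar_mul_left, sub_eq_add_neg, fchar_add_right]
    ring
  have s₂ : ∀ x, HasSum (fun β : FourierIndex => A β * whittaker r ‖(β : ℍ[ℝ])‖ (√2 * y) *
      fchar (ϖᵣ * β) x) (f₂ x) := by
    intro x
    convert hA (x * ϖᵣ) (√2 * y) (by positivity) using 2 with β
    rw [fchar_mul_right]
  have c₁ := hasSum_coef _ _ f₁ s₁ (fun β h => by
    by_contra hn
    rw [if_neg hn, mul_zero] at h
    exact h rfl) γ.2.1
  have c₂ := hasSum_coef _ _ f₂ s₂ (fun β _ => varpi_mul_mem (latticeS_sub_hurwitz β.2.1)) γ.2.1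
  have c₃ := hasSum_coef _ _ f₃ (fun x => hA x y hy) (fun β _ => β.2.1) γ.2.1
  -- the Fourier coefficients of the three functions at `γ`
  have v₁ : ∫ t in Set.Icc (0 : Fin 4 → ℝ) 1, f₁ (cubePt t) * fchar (-γ) (cubePt t) =
      2 * A (γ * ϖᵣ) * whittaker r ‖(γ : ℍ[ℝ])‖ y := by
    let β₁ : FourierIndex := ⟨γ * ϖᵣ, latticeS_mul_varpi γ.2.1, mul_ne_zero γ.2.2 (Units.ne_zero _)⟩
    refine c₁.unique ?_
    convert hasSum_ite_eq β₁ (2 * A (γ * ϖᵣ) * whittaker r ‖(γ : ℍ[ℝ])‖ y) using 2 with β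
    have hiff : (β : ℍ[ℝ]) * ϖᵢ = γ ↔ β = β₁ := by
      rw [Subtype.ext_iff, Units.mul_inv_eq_iff_eq_mul]
    simp only [hiff]
    split_ifs with h1 h2
    · subst h1
      change A (γ * ϖᵣ) * whittaker r ‖(γ : ℍ[ℝ]) * ϖᵣ‖ ((√2)⁻¹ * y) * 4 = _
      rw [norm_mul, norm_varpi, mul_comm ‖_‖, whittaker_scale r hs2, inv_pow, hs2c]
      ring
    · exfalso
      apply h2
      rw [hiff.2 h1]
      exact γ.2.1
    · rfl
  have v₂ : ∫ t in Set.Icc (0 : Fin 4 → ℝ) 1, f₂ (cubePt t) * fchar (-γ) (cubePt t) =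
      2 * (if ϖᵢ * (γ : ℍ[ℝ]) ∈ latticeS then A (ϖᵢ * γ) else 0) * whittaker r ‖(γ : ℍ[ℝ])‖ y := by
    refine c₂.unique ?_
    by_cases hm : ϖᵢ * (γ : ℍ[ℝ]) ∈ latticeS
    · rw [if_pos hm]
      let β₂ : FourierIndex := ⟨ϖᵢ * γ, hm, mul_ne_zero (Units.ne_zero _) γ.2.2⟩
      convert hasSum_ite_eq β₂ (2 * A (ϖᵢ * γ) * whittaker r ‖(γ : ℍ[ℝ])‖ y) using 2 with β
      have hiff : ϖᵣ * (β : ℍ[ℝ]) = γ ↔ β = β₂ := by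
        rw [Subtype.ext_iff, ← Units.eq_inv_mul_iff_mul_eq]
      simp only [hiff]
      split_ifs with h1
      · subst h1
        change A (ϖᵢ * γ) * whittaker r ‖ϖᵢ * (γ : ℍ[ℝ])‖ (√2 * y) = _
        have := whittaker_scale r (inv_ne_zero hs2) ‖(γ : ℍ[ℝ])‖ y
        rw [inv_inv, Complex.ofReal_inv, inv_inv, hs2c] at this
        rw [norm_mul, norm_varpi_inv, this]
        ring
      · rfl
    · rw [if_neg hm, mul_zero, zero_mul]
      convert hasSum_zero using 2 with β
      refine if_neg fun h => hm ?_
      rw [← h, Units.inv_mul_cancel_left]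
      exact β.2.1
  have v₃ : ∫ t in Set.Icc (0 : Fin 4 → ℝ) 1, f₃ (cubePt t) * fchar (-γ) (cubePt t) =
      A γ * whittaker r ‖(γ : ℍ[ℝ])‖ y := by
    refine c₃.unique ?_
    convert hasSum_ite_eq γ (A γ * whittaker r ‖(γ : ℍ[ℝ])‖ y) using 2 with β
    simp only [← Subtype.ext_iff]
    split_ifs with h
    · rw [h]
    · rfl
  have cont₁ : Continuous f₁ := continuous_finsetSum _ fun i _ =>
    (hF.continuous_nMat _ _).comp (continuous_const.mul (continuous_id.sub continuous_const))
  have cont₂ : Continuous f₂ := (hF.continuous_nMat _ _).comp (continuous_id.mul continuous_const)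
  have cont : ∀ f : ℍ[ℝ] → ℂ, Continuous f → MeasureTheory.IntegrableOn (fun t => f (cubePt t) *
      fchar (-γ) (cubePt t)) (Set.Icc (0 : Fin 4 → ℝ) 1) := fun f hf =>
    ((hf.comp continuous_cubePt).mul ((continuous_fchar _).comp continuous_cubePt)).integrableOn_Icc
  have total : ∫ t in Set.Icc (0 : Fin 4 → ℝ) 1, (f₁ (cubePt t) * fchar (-γ) (cubePt t) +
      f₂ (cubePt t) * fchar (-γ) (cubePt t)) =
      ∫ t in Set.Icc (0 : Fin 4 → ℝ) 1, μ * (f₃ (cubePt t) * fchar (-γ) (cubePt t)) := by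
    congr 1
    funext t
    rw [← add_mul, hμ, mul_assoc]
  rw [MeasureTheory.integral_add (cont f₁ cont₁) (cont f₂ cont₂), MeasureTheory.integral_const_mul, v₁,
    v₂, v₃] at total
  refine mul_right_cancel₀ hW ?_
  linear_combination total

end Coefficients

section Recurrence

variable {ε : ℝ} {A : ℍ[ℝ] → ℂ} {a : ℝ → ℤ → ℕ → ℂ}

lemma normSq_mul_varpi (β : ℍ[ℝ]) : normSq (β * ϖᵣ) = 2 * normSq β := by
  rw [map_mul, normSq_varpi, mul_comm]

/-- The coefficients are invariant under conjugation by `ϖ₂`, since this preserves primitivity. -/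
lemma coefficient_conj
    (hA : ∀ (u n : ℕ) (β₀ : ℍ[ℝ]), Odd n → β₀ ∈ primS →
      A (ϖᵣ ^ u * n * β₀) = a (normSq (ϖᵣ ^ u * n * β₀)) u n)
    (β : FourierIndex) : A (ϖᵢ * β * ϖᵣ) = A β := by
  obtain ⟨u, n, β₀, hn, hβ₀, h⟩ := exists_primitive β.2.1 β.2.2
  have e : ϖᵢ * (β : ℍ[ℝ]) * ϖᵣ = ϖᵣ ^ u * n * (ϖᵢ * β₀ * ϖᵣ) := by
    have h1 : ϖᵢ * ϖᵣ ^ u = ϖᵣ ^ u * ϖᵢ := by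
      rw [← Units.val_pow_eq_pow_val, ← Units.val_mul, ← Units.val_mul]
      congr 1
      group
    rw [h, mul_assoc (ϖᵣ ^ u), ← mul_assoc ϖᵢ, h1, mul_assoc (ϖᵣ ^ u), ← mul_assoc ϖᵢ,
      ← (Nat.cast_commute n ϖᵢ).eq]
    simp only [mul_assoc]
  rw [e, hA u n _ hn (primS_conj hβ₀), h, hA u n _ hn hβ₀]
  congr 1
  rw [← e, ← h, map_mul, map_mul, normSq_varpi, normSq_varpi_inv]
  ring

open Classical in
/-- The recurrence relation at two makes the coefficients an eigenvector for the Hecke relation. -/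
lemma coefficient_recurrence (ha : ∀ K u n, u < 0 → a K u n = 0)
    (hA : ∀ (u n : ℕ) (β₀ : ℍ[ℝ]), Odd n → β₀ ∈ primS →
      A (ϖᵣ ^ u * n * β₀) = a (normSq (ϖᵣ ^ u * n * β₀)) u n)
    (hrec : ∀ (u n : ℕ) (β₀ : ℍ[ℝ]), Odd n → β₀ ∈ primS → ∀ K : ℝ, K = normSq (ϖᵣ ^ u * (n : ℍ[ℝ]) * β₀) →
      1 ≤ u → a K u n = ((-3 * ε / √2 : ℝ) : ℂ) * a (K / 2) (u - 1) n - a (K / 4) (u - 2) n)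
    (β : FourierIndex) :
    2 * A (β * ϖᵣ) + 2 * (if ϖᵢ * β ∈ latticeS then A (ϖᵢ * β) else 0) =
      (6 * ((-ε / √2 : ℝ) : ℂ)) * A β := by
  obtain ⟨u, n, β₀, hn, hβ₀, h⟩ := exists_primitive β.2.1 β.2.2
  have e : (β : ℍ[ℝ]) * ϖᵣ = ϖᵣ ^ (u + 1) * n * (ϖᵢ * β₀ * ϖᵣ) := by
    rw [h, pow_succ, mul_assoc _ ϖᵣ, ← (Nat.cast_commute n ϖᵣ).eq]
    simp only [mul_assoc, Units.mul_inv_cancel_left]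
  have hK : normSq ((β : ℍ[ℝ]) * ϖᵣ) = 2 * normSq (β : ℍ[ℝ]) := normSq_mul_varpi _
  have h1 : A (β * ϖᵣ) = a (2 * normSq (β : ℍ[ℝ])) ((u + 1 : ℕ) : ℤ) n := by
    rw [← hK, e]
    exact hA _ _ _ hn (primS_conj hβ₀)
  have h2 : A β = a (normSq (β : ℍ[ℝ])) u n := by
    rw [h]
    exact hA _ _ _ hn hβ₀
  have h3 := hrec (u + 1) n _ hn (primS_conj hβ₀) (2 * normSq (β : ℍ[ℝ]))
    (by rw [← e, hK]) (by omega)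
  have h4 : (if ϖᵢ * (β : ℍ[ℝ]) ∈ latticeS then A (ϖᵢ * β) else 0) =
      a (2 * normSq (β : ℍ[ℝ]) / 4) (((u + 1 : ℕ) : ℤ) - 2) n := by
    rcases u with _ | u
    · rw [if_neg, ha _ _ _ (by simp)]
      intro hmem
      refine hβ₀.2.2.2.1 ?_
      refine odd_cancel hn (latticeS_sub_hurwitz hβ₀.1) (x := ϖᵢ * (ϖᵢ * β)) ?_ (mem_latticeS_iff.1 hmem)
      rw [pow_two, mul_assoc, Units.mul_inv_cancel_left, Units.mul_inv_cancel_left, h, pow_zero, one_mul]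
    · have e' : ϖᵢ * (β : ℍ[ℝ]) = ϖᵣ ^ u * n * β₀ := by
        rw [h, pow_succ']
        simp only [mul_assoc, Units.inv_mul_cancel_left]
      rw [if_pos]
      · rw [e', hA _ _ _ hn hβ₀, ← e', map_mul, normSq_varpi_inv]
        congr 1
        · ring
        · push_cast
          ring
      · rw [e', mul_assoc, (Nat.cast_commute n β₀).eq, ← mul_assoc]
        have hb : ϖᵣ ^ u * β₀ ∈ latticeS := by
          clear h e h1 h2 h3 e'
          induction u with
          | zero => simpa using hβ₀.1
          | succ u ih =>
            rw [pow_succ', mul_assoc]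
            exact varpi_mul_mem (latticeS_sub_hurwitz ih)
        rw [mem_latticeS_iff, ← mul_assoc]
        exact mul_mem (mem_latticeS_iff.1 hb) (natCast_mem _ n)
  rw [h4, h1, h2, h3]
  have e5 : 2 * normSq (β : ℍ[ℝ]) / 2 = normSq (β : ℍ[ℝ]) := by ring
  have e6 : (((u + 1 : ℕ) : ℤ) - 1) = u := by push_cast; ring
  rw [e5, e6]
  push_cast
  ring

end Recurrence

/-- The action of `GL₂(B_p)` on functions on the adelic group. -/
def primeRep (p : Nat.Primes) : Representation ℂ (Gp p) (GA → ℂ) :=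
  (rightRegular GA).comp
    { toFun := fun g => (1, atPrime p g)
      map_one' := by
        rw [atPrime, RestrictedProduct.mulSingle_one]
        rfl
      map_mul' := fun g h => by
        rw [atPrime, RestrictedProduct.mulSingle_mul, Prod.mk_mul_mk, one_mul]
        rfl }

lemma primeRep_apply (p : Nat.Primes) (g : Gp p) (Φ : GA → ℂ) (x : GA) :
    primeRep p g Φ x = Φ (x * (1, atPrime p g)) := rfl

/-- The adelic lift of a form in the Maass space which is a Hecke eigenform is a spherical vector at
two, with the eigenvalue determined by the sign. -/
lemma adelicLift_isSpherical {r : ℂ} {ε : ℝ} {F : GLH ℝ → ℂ} (hF : IsMaassSpace r ε F)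
    (hc : IsCuspidal F) (hH : IsHeckeEigenform F) :
    IsSpherical ((-ε / √2 : ℝ) : ℂ) (primeRep two) (adelicLift F) := by
  obtain ⟨hM, u₀, A, hE, a, ha, hrel⟩ := hF
  obtain ⟨h0, hH⟩ := hH
  have hinv := hM.left_invariant
  have hcusp := hasCuspExpansion hM hE hc
  obtain ⟨γ, hγ, hγ'⟩ := hcusp.exists_ne_zero hM h0
  have hA : ∀ (u n : ℕ) (β₀ : ℍ[ℝ]), Odd n → β₀ ∈ primS →
      A (ϖᵣ ^ u * n * β₀) = a (normSq (ϖᵣ ^ u * n * β₀)) u n := fun u n β₀ hn hβ₀ =>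
    (hrel u n β₀ hn hβ₀ _ _ rfl rfl).1
  have hone : ∀ x, adelicLift F (x, 1) = F x := fun x => adelicLift_eq hinv (decomposes_one x)
  have hmul : ∀ (x : GLH ℝ) (g : Gp two), ((x, 1) : GA) * (1, atPrime two g) = (x, atPrime two g) := by
    intro x g
    rw [Prod.mk_mul_mk, mul_one, one_mul]
  refine ⟨fun k hk => funext fun g => adelicLift_mul_atPrime hinv two g hk, ?_, ?_⟩
  · obtain ⟨μ, hμ⟩ := hH two (upper ϖ ϖ 0)
    simp only [hecke_two_scalar_eq _ (fun g k hk => adelicLift_mul_atPrime hinv two g hk)] at hμ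
    obtain ⟨x, y, hy, hne⟩ := hM.exists_ne_zero h0
    have h1 := hμ (nMat x * aMat y hy, 1)
    rw [hmul, adelicLift_scalar hinv, hone, hM.heckeRep_scalar,
      scalar_eigenvalue hcusp (coefficient_conj hA)] at h1
    have h2 : μ = 1 := mul_right_cancel₀ hne (by rw [one_mul, ← h1])
    funext g
    rw [primeRep_apply, hμ g, h2, one_mul]
  · obtain ⟨μ, hμ⟩ := hH two (upper ϖ 1 0)
    simp only [hecke_two_eq _ (fun g k hk => adelicLift_mul_atPrime hinv two g hk)] at hμ
    have hμ' : ∀ (x : ℍ[ℝ]) (y : ℝ) (hy : 0 < y),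
        ∑ i, F (nMat (ϖᵢ * (x - resRep ℝ i)) * aMat ((√2)⁻¹ * y) (by positivity)) +
          F (nMat (x * ϖᵣ) * aMat (√2 * y) (by positivity)) = μ * F (nMat x * aMat y hy) := by
      intro x y hy
      have h1 := hμ (nMat x * aMat y hy, 1)
      simp only [Fintype.sum_option, hmul, adelicLift_heckeRep_none hinv, adelicLift_heckeRep_some hinv,
        hone, hM.heckeRep_some, hM.heckeRep_none] at h1
      rw [← h1, add_comm]
    have h1 := hecke_coefficient hM hcusp hμ' γ hγ'
    rw [coefficient_recurrence ha hA (fun u n β₀ hn hβ₀ K hK => (hrel u n β₀ hn hβ₀ _ K rfl hK).2.1)] at h1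
    have h2 := mul_right_cancel₀ hγ h1
    funext g
    rw [Finset.sum_apply, Pi.smul_apply, smul_eq_mul, h2, ← hμ g]
    rfl

/-! ### Differential calculus on `GL₂(ℍ)` -/

/-- The Lie algebra of `GL₂(ℍ)`. -/
abbrev gl2 := Matrix (Fin 2) (Fin 2) ℍ[ℝ]

/-- The open set of invertible matrices, in the normed space used for derivatives. -/
abbrev unitSet : Set (Fin 2 → Fin 2 → ℍ[ℝ]) := {A | IsUnit (Matrix.of A)}

/-- The matrix of an element of `GL₂(ℍ)`, in the normed space used for derivatives. -/
def arr (g : GLH ℝ) : Fin 2 → Fin 2 → ℍ[ℝ] := Matrix.of.symm g.val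

lemma arr_mem (g : GLH ℝ) : arr g ∈ unitSet := g.isUnit

lemma extend_arr (f : GLH ℝ → ℂ) (g : GLH ℝ) : extend f (arr g) = f g := by
  rw [extend, dif_pos (show IsUnit (Matrix.of (arr g)) from arr_mem g)]
  congr 1
  exact Units.ext rfl

lemma exists_arr {A : Fin 2 → Fin 2 → ℍ[ℝ]} (h : A ∈ unitSet) : ∃ g : GLH ℝ, arr g = A := ⟨h.unit, rfl⟩

/-- The polynomial function which extends `herN` to all matrices. -/
def arrN (A : Fin 2 → Fin 2 → ℍ[ℝ]) : ℝ :=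
  (normSq (A 0 0) + normSq (A 0 1)) *
    (normSq (A 1 0) + normSq (A 1 1)) -
    normSq (A 0 0 * star (A 1 0) + A 0 1 * star (A 1 1))

lemma arrN_arr (g : GLH ℝ) : arrN (arr g) = herN g := rfl

lemma mem_unitSet_iff {A : Fin 2 → Fin 2 → ℍ[ℝ]} : A ∈ unitSet ↔ arrN A ≠ 0 := by
  constructor
  · intro h
    obtain ⟨g, rfl⟩ := exists_arr h
    exact (herN_pos g).ne'
  · intro h
    set a := normSq (A 0 0) + normSq (A 0 1) with ha
    set c := normSq (A 1 0) + normSq (A 1 1) with hc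
    set b := A 0 0 * star (A 1 0) + A 0 1 * star (A 1 1) with hb
    have hN : arrN A = a * c - normSq b := rfl
    have hmul : Matrix.of A * star (Matrix.of A) = !![(a : ℍ[ℝ]), b; star b, (c : ℍ[ℝ])] := by
      ext i j : 1
      rw [mul_apply, Fin.sum_univ_two]
      fin_cases i <;> fin_cases j
      · simp [star_apply, self_mul_star, ha]
      · simp [star_apply, hb]
      · simp [star_apply, hb]
      · simp [star_apply, self_mul_star, hc]
    have hinv : !![(a : ℍ[ℝ]), b; star b, (c : ℍ[ℝ])] *
        ((arrN A)⁻¹ • !![(c : ℍ[ℝ]), -b; -star b, (a : ℍ[ℝ])]) = 1 := by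
      have hN' : (arrN A)⁻¹ * (a * c - normSq b) = 1 := by rw [← hN, inv_mul_cancel₀ h]
      rw [Matrix.mul_smul]
      ext i j : 1
      rw [Matrix.smul_apply, mul_apply, Fin.sum_univ_two]
      fin_cases i <;> fin_cases j
      · simp only [Fin.zero_eta, of_apply, cons_val', cons_val_zero,
          cons_val_fin_one, cons_val_one, mul_neg, self_mul_star,
          one_apply_eq]
        rw [← coe_mul, ← sub_eq_add_neg, ← coe_sub, ← coe_smul,
          smul_eq_mul, hN', coe_one]
      · simp [coe_commutes a b]
      · simp [coe_commutes c (star b)]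
      · simp only [Fin.mk_one, of_apply, cons_val', cons_val_zero,
          cons_val_fin_one, cons_val_one, mul_neg, star_mul_self,
          one_apply_eq]
        rw [← coe_mul, ← coe_neg, ← coe_add, ← coe_smul,
          smul_eq_mul, show -normSq b + c * a = a * c - normSq b by ring, hN',
          coe_one]
    rw [← hmul, mul_assoc] at hinv
    exact ⟨⟨_, _, hinv, mul_eq_one_comm.1 hinv⟩, rfl⟩

/-- Evaluation of a matrix entry. -/
def entryL (a b : Fin 2) : (Fin 2 → Fin 2 → ℍ[ℝ]) →L[ℝ] ℍ[ℝ] :=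
  (ContinuousLinearMap.proj (R := ℝ) (φ := fun _ : Fin 2 => ℍ[ℝ]) b).comp
    (ContinuousLinearMap.proj (R := ℝ) (φ := fun _ : Fin 2 => Fin 2 → ℍ[ℝ]) a)

lemma contDiff_entry (a b : Fin 2) : ContDiff ℝ (⊤ : ℕ∞) fun A : Fin 2 → Fin 2 → ℍ[ℝ] => A a b :=
  (entryL a b).contDiff

/-- Conjugation of quaternions, as a continuous linear map. -/
def starQuatL : ℍ[ℝ] →L[ℝ] ℍ[ℝ] :=
  LinearMap.toContinuousLinearMap
    { toFun := fun x => star x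
      map_add' := fun x y => star_add x y
      map_smul' := fun c x => by simp [Quaternion.star_smul] }

lemma contDiff_star : ContDiff ℝ (⊤ : ℕ∞) fun x : ℍ[ℝ] => star x :=
  starQuatL.contDiff

lemma contDiff_normSq : ContDiff ℝ (⊤ : ℕ∞) fun x : ℍ[ℝ] => normSq x := by
  have : (fun x : ℍ[ℝ] => normSq x) = fun x => ‖x‖ ^ 2 := by
    funext x
    rw [normSq_eq_norm_mul_self, pow_two]
  rw [this]
  exact contDiff_norm_sq ℝ

lemma contDiff_arrN : ContDiff ℝ (⊤ : ℕ∞) arrN := by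
  unfold arrN
  refine ContDiff.sub (ContDiff.mul (ContDiff.add ?_ ?_) (ContDiff.add ?_ ?_)) ?_
  · exact contDiff_normSq.comp (contDiff_entry 0 0)
  · exact contDiff_normSq.comp (contDiff_entry 0 1)
  · exact contDiff_normSq.comp (contDiff_entry 1 0)
  · exact contDiff_normSq.comp (contDiff_entry 1 1)
  · refine contDiff_normSq.comp (ContDiff.add ?_ ?_)
    · exact (contDiff_entry 0 0).mul (contDiff_star.comp (contDiff_entry 1 0))
    · exact (contDiff_entry 0 1).mul (contDiff_star.comp (contDiff_entry 1 1))

lemma isOpen_unitSet : IsOpen unitSet := by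
  have : unitSet = arrN ⁻¹' {0}ᶜ := by
    ext A
    exact mem_unitSet_iff
  rw [this]
  exact isOpen_compl_singleton.preimage contDiff_arrN.continuous

variable {f f' : GLH ℝ → ℂ}

lemma IsSmooth.differentiableAt (hf : IsSmooth f) (g : GLH ℝ) :
    DifferentiableAt ℝ (extend f) (arr g) :=
  (hf.contDiffAt (isOpen_unitSet.mem_nhds (arr_mem g))).differentiableAt (by simp)

/-- Smoothness may be checked on any function on matrices with the same values on `GL₂(ℍ)`. -/
lemma isSmooth_of_eqOn {φ : (Fin 2 → Fin 2 → ℍ[ℝ]) → ℂ} (hφ : ContDiffOn ℝ (⊤ : ℕ∞) φ unitSet)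
    (h : ∀ g, φ (arr g) = f g) : IsSmooth f := by
  refine hφ.congr fun A hA => ?_
  obtain ⟨g, rfl⟩ := exists_arr hA
  rw [extend_arr, h]

/-- The derivative of a smooth function along a curve in `GL₂(ℍ)`. -/
lemma IsSmooth.hasDerivAt (hf : IsSmooth f) {c : ℝ → GLH ℝ} {t : ℝ} {X : gl2}
    (hc : ∀ a b, HasDerivAt (fun u => (c u).val a b) (((c t).val * X) a b) t) :
    HasDerivAt (fun u => f (c u)) (lieDeriv X f (c t)) t := by
  have h1 : HasDerivAt (fun u => arr (c u)) (Matrix.of.symm ((c t).val * X)) t :=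
    hasDerivAt_pi.2 fun a => hasDerivAt_pi.2 fun b => hc a b
  have h2 := (hf.differentiableAt (c t)).hasFDerivAt.comp_hasDerivAt t h1
  have e : (extend f ∘ fun u => arr (c u)) = fun u => f (c u) := funext fun u => extend_arr f (c u)
  rw [e] at h2
  exact h2

lemma lieDeriv_eq (X : gl2) (f : GLH ℝ → ℂ) (g : GLH ℝ) :
    lieDeriv X f g = fderiv ℝ (extend f) (arr g) (Matrix.of.symm (g.val * X)) := rfl

lemma lieDeriv_of_eqOn {φ : (Fin 2 → Fin 2 → ℍ[ℝ]) → ℂ} (h : ∀ g, φ (arr g) = f g)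
    (X : gl2) (g : GLH ℝ) :
    lieDeriv X f g = fderiv ℝ φ (arr g) (Matrix.of.symm (g.val * X)) := by
  rw [lieDeriv_eq]
  congr 1
  refine Filter.EventuallyEq.fderiv_eq ?_
  filter_upwards [isOpen_unitSet.mem_nhds (arr_mem g)] with A hA
  obtain ⟨g', rfl⟩ := exists_arr hA
  rw [extend_arr, h]

/-! ### Algebraic properties of Lie derivatives -/

lemma lieDeriv_add (hf : IsSmooth f) (hf' : IsSmooth f') (X : gl2) :
    lieDeriv X (f + f') = lieDeriv X f + lieDeriv X f' := by
  funext g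
  rw [lieDeriv_of_eqOn (φ := extend f + extend f') (fun g => by simp [extend_arr]),
    fderiv_add (hf.differentiableAt g) (hf'.differentiableAt g)]
  rfl

lemma lieDeriv_smul (hf : IsSmooth f) (c : ℂ) (X : gl2) :
    lieDeriv X (c • f) = c • lieDeriv X f := by
  funext g
  rw [lieDeriv_of_eqOn (φ := c • extend f) (fun g => by simp [extend_arr]),
    fderiv_const_smul (hf.differentiableAt g)]
  rfl

lemma lieDeriv_zero (X : gl2) : lieDeriv X 0 = 0 := by
  have := lieDeriv_smul isSmooth_zero 0 X
  simpa using this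

lemma lieDeriv_const (c : ℂ) (X : gl2) : lieDeriv X (fun _ => c) = 0 := by
  funext g
  rw [lieDeriv_of_eqOn (φ := fun _ => c) (fun g => rfl)]
  simp

lemma isSmooth_const (c : ℂ) : IsSmooth fun _ => c :=
  isSmooth_of_eqOn (φ := fun _ => c) contDiffOn_const fun _ => rfl

lemma IsSmooth.mul (hf : IsSmooth f) (hf' : IsSmooth f') : IsSmooth (f * f') :=
  isSmooth_of_eqOn (φ := extend f * extend f') (ContDiffOn.mul hf hf') fun g => by simp [extend_arr]

lemma lieDeriv_mul (hf : IsSmooth f) (hf' : IsSmooth f') (X : gl2) :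
    lieDeriv X (f * f') = lieDeriv X f * f' + f * lieDeriv X f' := by
  funext g
  rw [lieDeriv_of_eqOn (φ := extend f * extend f') (fun g => by simp [extend_arr]),
    fderiv_mul (hf.differentiableAt g) (hf'.differentiableAt g)]
  simp only [add_apply, smul_apply, smul_eq_mul,
    extend_arr, Pi.add_apply, Pi.mul_apply, lieDeriv_eq]
  ring

lemma lieDeriv_add_left (X Y : gl2) (f : GLH ℝ → ℂ) :
    lieDeriv (X + Y) f = lieDeriv X f + lieDeriv Y f := by
  funext g
  rw [Pi.add_apply, lieDeriv_eq, lieDeriv_eq, lieDeriv_eq, mul_add, ← map_add]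
  rfl

lemma lieDeriv_smul_left (c : ℝ) (X : gl2) (f : GLH ℝ → ℂ) :
    lieDeriv (c • X) f = (c : ℂ) • lieDeriv X f := by
  funext g
  rw [Pi.smul_apply, lieDeriv_eq, lieDeriv_eq, Matrix.mul_smul]
  change fderiv ℝ (extend f) (arr g) (c • Matrix.of.symm (g.val * X)) = _
  rw [map_smul]
  simp

lemma lieDeriv_sub_left (X Y : gl2) (f : GLH ℝ → ℂ) :
    lieDeriv (X - Y) f = lieDeriv X f - lieDeriv Y f := by
  have h : lieDeriv (-Y) f = -lieDeriv Y f := by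
    have := lieDeriv_smul_left (-1) Y f
    simpa using this
  rw [sub_eq_add_neg, lieDeriv_add_left, h, sub_eq_add_neg]

/-- Right multiplication by a matrix, as a continuous linear map. -/
def mulRightL (X : gl2) :
    (Fin 2 → Fin 2 → ℍ[ℝ]) →L[ℝ] (Fin 2 → Fin 2 → ℍ[ℝ]) :=
  LinearMap.toContinuousLinearMap
    { toFun := fun A => Matrix.of.symm (Matrix.of A * X)
      map_add' := fun A B => by
        change Matrix.of.symm ((Matrix.of A + Matrix.of B) * X) = _
        rw [add_mul]
        rfl
      map_smul' := fun c A => by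
        change Matrix.of.symm ((c • Matrix.of A) * X) = _
        rw [Matrix.smul_mul]
        rfl }

/-- Left multiplication by a matrix, as a continuous linear map. -/
def mulLeftL (X : gl2) :
    (Fin 2 → Fin 2 → ℍ[ℝ]) →L[ℝ] (Fin 2 → Fin 2 → ℍ[ℝ]) :=
  LinearMap.toContinuousLinearMap
    { toFun := fun A => Matrix.of.symm (X * Matrix.of A)
      map_add' := fun A B => by
        change Matrix.of.symm (X * (Matrix.of A + Matrix.of B)) = _
        rw [mul_add]
        rfl
      map_smul' := fun c A => by
        change Matrix.of.symm (X * (c • Matrix.of A)) = _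
        rw [Matrix.mul_smul]
        rfl }

lemma mulRightL_arr (g h : GLH ℝ) : mulRightL h.val (arr g) = arr (g * h) := rfl

lemma mulLeftL_arr (g h : GLH ℝ) : mulLeftL h.val (arr g) = arr (h * g) := rfl

lemma IsSmooth.lieDeriv (hf : IsSmooth f) (X : gl2) : IsSmooth (lieDeriv X f) := by
  refine isSmooth_of_eqOn (φ := fun A => fderiv ℝ (extend f) A (mulRightL X A)) ?_ fun g => rfl
  exact (hf.fderiv_of_isOpen isOpen_unitSet (m := (⊤ : ℕ∞)) (by simp)).clm_apply
    (mulRightL X).contDiff.contDiffOn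

lemma IsSmooth.translate_right (hf : IsSmooth f) (h : GLH ℝ) : IsSmooth fun g => f (g * h) := by
  refine isSmooth_of_eqOn (φ := fun A => extend f (mulRightL h.val A)) ?_ fun g => by
    rw [mulRightL_arr, extend_arr]
  refine ContDiffOn.comp hf (mulRightL h.val).contDiff.contDiffOn fun A hA => ?_
  obtain ⟨g, rfl⟩ := exists_arr hA
  exact arr_mem (g * h)

lemma IsSmooth.translate_left (hf : IsSmooth f) (h : GLH ℝ) : IsSmooth fun g => f (h * g) := by
  refine isSmooth_of_eqOn (φ := fun A => extend f (mulLeftL h.val A)) ?_ fun g => by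
    rw [mulLeftL_arr, extend_arr]
  refine ContDiffOn.comp hf (mulLeftL h.val).contDiff.contDiffOn fun A hA => ?_
  obtain ⟨g, rfl⟩ := exists_arr hA
  exact arr_mem (h * g)

lemma lieDeriv_translate_left (hf : IsSmooth f) (h : GLH ℝ) (X : gl2) (g : GLH ℝ) :
    lieDeriv X (fun g => f (h * g)) g = lieDeriv X f (h * g) := by
  rw [lieDeriv_of_eqOn (φ := fun A => extend f (mulLeftL h.val A)) (fun g => by
    rw [mulLeftL_arr, extend_arr])]
  have h1 : HasFDerivAt (fun A => extend f (mulLeftL h.val A))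
      ((fderiv ℝ (extend f) (arr (h * g))).comp (mulLeftL h.val)) (arr g) :=
    HasFDerivAt.comp (g := extend f) (arr g)
      (show HasFDerivAt (extend f) _ (mulLeftL h.val (arr g)) from
        (hf.differentiableAt (h * g)).hasFDerivAt) (mulLeftL h.val).hasFDerivAt
  rw [h1.fderiv, lieDeriv_eq, ContinuousLinearMap.comp_apply]
  congr 1
  change Matrix.of.symm (h.val * (g.val * X)) = Matrix.of.symm ((h * g).val * X)
  rw [Units.val_mul, mul_assoc]

lemma lieDeriv_translate_right (hf : IsSmooth f) (h : GLH ℝ) (X : gl2) (g : GLH ℝ) :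
    lieDeriv X (fun g => f (g * h)) g = lieDeriv ((h⁻¹).val * X * h.val) f (g * h) := by
  rw [lieDeriv_of_eqOn (φ := fun A => extend f (mulRightL h.val A)) (fun g => by
    rw [mulRightL_arr, extend_arr])]
  have h1 : HasFDerivAt (fun A => extend f (mulRightL h.val A))
      ((fderiv ℝ (extend f) (arr (g * h))).comp (mulRightL h.val)) (arr g) :=
    HasFDerivAt.comp (g := extend f) (arr g)
      (show HasFDerivAt (extend f) _ (mulRightL h.val (arr g)) from
        (hf.differentiableAt (g * h)).hasFDerivAt) (mulRightL h.val).hasFDerivAt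
  rw [h1.fderiv, lieDeriv_eq, ContinuousLinearMap.comp_apply]
  congr 1
  change Matrix.of.symm (g.val * X * h.val) = Matrix.of.symm ((g * h).val * ((h⁻¹).val * X * h.val))
  rw [Units.val_mul, mul_assoc g.val h.val, mul_assoc (h⁻¹).val, ← mul_assoc h.val, h.mul_inv, one_mul,
    mul_assoc]

/-- The action of the Lie algebra is compatible with brackets. -/
lemma lieDeriv_bracket (hf : IsSmooth f) (X Y : gl2) :
    lieDeriv (X * Y - Y * X) f = lieDeriv X (lieDeriv Y f) - lieDeriv Y (lieDeriv X f) := by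
  funext g
  have hd : DifferentiableAt ℝ (fderiv ℝ (extend f)) (arr g) :=
    ((hf.fderiv_of_isOpen isOpen_unitSet (m := (⊤ : ℕ∞)) (by simp)).contDiffAt
      (isOpen_unitSet.mem_nhds (arr_mem g))).differentiableAt (by simp)
  have key : ∀ X Y : gl2, lieDeriv X (lieDeriv Y f) g =
      fderiv ℝ (fderiv ℝ (extend f)) (arr g) (mulRightL X (arr g)) (mulRightL Y (arr g)) +
        lieDeriv (X * Y) f g := by
    intro X Y
    rw [lieDeriv_of_eqOn (f := QuatMaass.lieDeriv Y f)
      (φ := fun A => fderiv ℝ (extend f) A (mulRightL Y A)) (fun g => rfl)]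
    have h1 := hd.hasFDerivAt.clm_apply (mulRightL Y).hasFDerivAt
    rw [h1.fderiv]
    simp only [add_apply, ContinuousLinearMap.comp_apply, ContinuousLinearMap.flip_apply]
    rw [add_comm, lieDeriv_eq]
    congr 2
    change Matrix.of.symm (g.val * X * Y) = Matrix.of.symm (g.val * (X * Y))
    rw [mul_assoc]
  have hsymm : IsSymmSndFDerivAt ℝ (extend f) (arr g) :=
    (hf.contDiffAt (isOpen_unitSet.mem_nhds (arr_mem g))).isSymmSndFDerivAt
      (by rw [minSmoothness_of_isRCLikeNormedField]; exact WithTop.coe_le_coe.2 (show (2 : ℕ∞) ≤ ⊤ from le_top))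
  rw [Pi.sub_apply, key, key, hsymm.eq, lieDeriv_sub_left]
  simp

/-! ### Modules generated by a spherical vector -/

section ClassOne

variable {V : Type*} [AddCommGroup V] [Module ℂ V]

/-- The commutator `[X_i, X_j]`. -/
def commY (X : Fin 5 → End ℂ V) (i j : Fin 5) : End ℂ V := X i * X j - X j * X i

/-- The operator `∑ X_i²`. -/
def sumQ (X : Fin 5 → End ℂ V) : End ℂ V := ∑ i, X i * X i

/-- The operator `∑ [X_i, X_j]²`. -/
def sumC (X : Fin 5 → End ℂ V) : End ℂ V := ∑ i, ∑ j, commY X i j * commY X i j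

/-- The operator `∑_i X_i [X_i, X_k]`. -/
def sumG (X : Fin 5 → End ℂ V) (k : Fin 5) : End ℂ V := ∑ i, X i * commY X i k

/-- The Kronecker symbol. -/
def kron (i j : Fin 5) : ℂ := if i = j then 1 else 0

lemma kron_comm (i j : Fin 5) : kron i j = kron j i := by
  simp [kron, eq_comm]

/-- The operators `X_i` satisfy the relations of the noncompact part of `𝔰𝔬(5,1) = 𝔰𝔩₂(ℍ)`, the
compact part being spanned by the `[X_i, X_j]`, and `v` is annihilated by the compact part and an
eigenvector of `∑ X_i²` with eigenvalue `lam`. -/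
structure IsClassOne (X : Fin 5 → End ℂ V) (v : V) (lam : ℂ) : Prop where
  comm_comm : ∀ i j k, commY X i j * X k - X k * commY X i j =
    (4 * kron j k) • X i - (4 * kron i k) • X j
  comm_vec : ∀ i j, commY X i j v = 0
  eigen : sumQ X v = lam • v

/-- The subspaces spanned by the products of at most `n` of the `X_i`, applied to `v`. -/
def cyclicFilt (X : Fin 5 → End ℂ V) (v : V) : ℕ → Submodule ℂ V
  | 0 => ℂ ∙ v
  | n + 1 => cyclicFilt X v n ⊔ ⨆ i, (cyclicFilt X v n).map (X i)

/-- The subspace generated by `v` under the `X_i`. -/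
def cyclicSpan (X : Fin 5 → End ℂ V) (v : V) : Submodule ℂ V := ⨆ n, cyclicFilt X v n

section Filt

variable (X : Fin 5 → End ℂ V) (v : V)

lemma cyclicFilt_le_succ (n : ℕ) : cyclicFilt X v n ≤ cyclicFilt X v (n + 1) := le_sup_left

lemma cyclicFilt_mono : Monotone (cyclicFilt X v) := monotone_nat_of_le_succ (cyclicFilt_le_succ X v)

lemma apply_mem_cyclicFilt {n : ℕ} {w : V} (hw : w ∈ cyclicFilt X v n) (i : Fin 5) :
    X i w ∈ cyclicFilt X v (n + 1) :=
  (le_sup_of_le_right (le_iSup (fun i => (cyclicFilt X v n).map (X i)) i))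
    (mem_map_of_mem hw)

lemma self_mem_cyclicFilt (n : ℕ) : v ∈ cyclicFilt X v n :=
  cyclicFilt_mono X v (Nat.zero_le n) (Submodule.mem_span_singleton_self v)

lemma mem_cyclicSpan {w : V} : w ∈ cyclicSpan X v ↔ ∃ n, w ∈ cyclicFilt X v n :=
  Submodule.mem_iSup_of_directed _ (cyclicFilt_mono X v).directed_le

lemma cyclicFilt_le_cyclicSpan (n : ℕ) : cyclicFilt X v n ≤ cyclicSpan X v :=
  le_iSup (cyclicFilt X v) n

lemma apply_mem_cyclicSpan {w : V} (hw : w ∈ cyclicSpan X v) (i : Fin 5) : X i w ∈ cyclicSpan X v := by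
  obtain ⟨n, hn⟩ := (mem_cyclicSpan X v).1 hw
  exact (mem_cyclicSpan X v).2 ⟨n + 1, apply_mem_cyclicFilt X v hn i⟩

lemma self_mem_cyclicSpan : v ∈ cyclicSpan X v := cyclicFilt_le_cyclicSpan X v 0 (self_mem_cyclicFilt X v 0)

lemma cyclicFilt_succ_le {n : ℕ} {P : Submodule ℂ V} (h : cyclicFilt X v n ≤ P)
    (h' : ∀ i, ∀ w ∈ cyclicFilt X v n, X i w ∈ P) : cyclicFilt X v (n + 1) ≤ P := by
  refine sup_le h (iSup_le fun i => ?_)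
  rintro _ ⟨w, hw, rfl⟩
  exact h' i w hw

lemma cyclicSpan_le {P : Submodule ℂ V} (h : v ∈ P) (h' : ∀ i, ∀ w ∈ P, X i w ∈ P) :
    cyclicSpan X v ≤ P := by
  refine iSup_le fun n => ?_
  induction n with
  | zero => exact (Submodule.span_singleton_le_iff_mem _ _).2 h
  | succ n ih => exact cyclicFilt_succ_le X v ih fun i w hw => h' i w (ih hw)

lemma finite_cyclicFilt (n : ℕ) : Module.Finite ℂ (cyclicFilt X v n) := by
  induction n with
  | zero => exact inferInstanceAs (Module.Finite ℂ (ℂ ∙ v : Submodule ℂ V))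
  | succ n ih =>
    change Module.Finite ℂ (cyclicFilt X v n ⊔ ⨆ i, (cyclicFilt X v n).map (X i) : Submodule ℂ V)
    infer_instance

end Filt

variable {X : Fin 5 → End ℂ V} {v : V} {lam : ℂ}

lemma commY_swap (i j : Fin 5) : commY X j i = -commY X i j := by
  simp [commY]

lemma commY_self (i : Fin 5) : commY X i i = 0 := by
  simp [commY]

namespace IsClassOne

variable (h : IsClassOne X v lam)
include h

lemma comm_mul (i j k : Fin 5) : commY X i j * X k =
    X k * commY X i j + ((4 * kron j k) • X i - (4 * kron i k) • X j) := by
  rw [← h.comm_comm, add_sub_cancel]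

/-- The relations of the compact part. -/
lemma comm_mul_comm (i j k l : Fin 5) : commY X i j * commY X k l = commY X k l * commY X i j +
    ((4 * kron j k) • commY X i l - (4 * kron i k) • commY X j l +
      ((4 * kron j l) • commY X k i - (4 * kron i l) • commY X k j)) := by
  have e : ∀ a b, commY X i j * (X a * X b) = X a * X b * commY X i j +
      (X a * ((4 * kron j b) • X i - (4 * kron i b) • X j) +
        ((4 * kron j a) • X i - (4 * kron i a) • X j) * X b) := by
    intro a b
    rw [← mul_assoc, h.comm_mul, add_mul, mul_assoc, h.comm_mul, mul_add, ← mul_assoc]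
    abel
  have e2 : commY X i j * commY X k l = commY X i j * (X k * X l) - commY X i j * (X l * X k) := by
    rw [← mul_sub]
    rfl
  rw [e2, e, e]
  simp only [commY, mul_sub, sub_mul, mul_smul_comm, smul_mul_assoc, mul_assoc]
  module

lemma sum_comm_mul (k : Fin 5) : ∑ i, commY X i k * X i = sumG X k - (16 : ℂ) • X k := by
  have : ∀ i, commY X i k * X i = X i * commY X i k + ((4 * kron k i) • X i - (4 : ℂ) • X k) := by
    intro i
    rw [h.comm_mul]
    simp [kron]
  rw [sum_congr rfl fun i _ => this i, sum_add_distrib, sum_sub_distrib]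
  simp only [kron, mul_ite, mul_one, mul_zero, ite_smul, zero_smul, sum_ite_eq,
    mem_univ, if_true, Finset.sum_const, Finset.card_univ, Fintype.card_fin, sumG]
  module

lemma sumQ_mul (k : Fin 5) : sumQ X * X k = X k * sumQ X + ((2 : ℂ) • sumG X k - (16 : ℂ) • X k) := by
  have : sumQ X * X k - X k * sumQ X = ∑ i, (X i * commY X i k + commY X i k * X i) := by
    rw [sumQ, sum_mul, mul_sum, ← sum_sub_distrib]
    refine sum_congr rfl fun i _ => ?_
    rw [commY]
    noncomm_ring
  rw [sum_add_distrib, h.sum_comm_mul] at this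
  rw [sub_eq_iff_eq_add'.1 this]
  change X k * sumQ X + (sumG X k + (sumG X k - (16 : ℂ) • X k)) = _
  module

lemma sumC_mul (k : Fin 5) : sumC X * X k = X k * sumC X +
    (8 : ℂ) • ((2 : ℂ) • sumG X k - (16 : ℂ) • X k) := by
  have e : ∀ i j, commY X i j * commY X i j * X k = X k * (commY X i j * commY X i j) +
      ((4 * kron j k) • (commY X i j * X i + X i * commY X i j) -
        (4 * kron i k) • (commY X i j * X j + X j * commY X i j)) := by
    intro i j
    rw [mul_assoc, h.comm_mul, mul_add, ← mul_assoc, h.comm_mul, add_mul]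
    simp only [mul_sub, sub_mul, mul_smul_comm, smul_mul_assoc, mul_assoc]
    module
  rw [sumC, sum_mul, mul_sum, ← sub_eq_iff_eq_add', ← sum_sub_distrib]
  have e2 : ∀ i, (∑ j, commY X i j * commY X i j) * X k - X k * ∑ j, commY X i j * commY X i j =
      (4 : ℂ) • (commY X i k * X i + X i * commY X i k) -
        (4 * kron i k) • ∑ j, (commY X i j * X j + X j * commY X i j) := by
    intro i
    rw [sum_mul, mul_sum, ← sum_sub_distrib, smul_sum]
    have : ∀ j, commY X i j * commY X i j * X k - X k * (commY X i j * commY X i j) =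
        (4 * kron j k) • (commY X i j * X i + X i * commY X i j) -
        (4 * kron i k) • (commY X i j * X j + X j * commY X i j) := fun j => by rw [e]; abel
    rw [sum_congr rfl fun j _ => this j, sum_sub_distrib]
    congr 1
    simp only [kron, mul_ite, mul_one, mul_zero, ite_smul, zero_smul, sum_ite_eq',
      mem_univ, if_true]
  rw [sum_congr rfl fun i _ => e2 i, sum_sub_distrib, ← smul_sum,
    sum_add_distrib, h.sum_comm_mul]
  have e3 : ∑ i, (4 * kron i k) • ∑ j, (commY X i j * X j + X j * commY X i j) =
      (4 : ℂ) • ∑ j, (commY X k j * X j + X j * commY X k j) := by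
    simp only [kron, mul_ite, mul_one, mul_zero, ite_smul, zero_smul, sum_ite_eq',
      mem_univ, if_true]
  have e4 : ∑ j, (commY X k j * X j + X j * commY X k j) =
      -(sumG X k - (16 : ℂ) • X k + sumG X k) := by
    rw [← h.sum_comm_mul]
    simp only [sumG]
    rw [← sum_add_distrib, ← sum_neg_distrib]
    refine sum_congr rfl fun j _ => ?_
    rw [commY_swap j k]
    noncomm_ring
  rw [e3, e4]
  change (4 : ℂ) • (sumG X k - (16 : ℂ) • X k + sumG X k) - _ = _
  module

lemma sumQ_mul_comm (a b : Fin 5) : sumQ X * commY X a b = commY X a b * sumQ X := by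
  have e : ∀ i, commY X a b * (X i * X i) = X i * X i * commY X a b +
      ((4 * kron b i) • (X i * X a + X a * X i) - (4 * kron a i) • (X i * X b + X b * X i)) := by
    intro i
    rw [← mul_assoc, h.comm_mul, add_mul, mul_assoc, h.comm_mul]
    simp only [mul_sub, sub_mul, mul_add, mul_smul_comm, smul_mul_assoc, mul_assoc]
    module
  rw [sumQ, sum_mul, mul_sum, sum_congr rfl fun i _ => e i,
    sum_add_distrib, sum_sub_distrib]
  simp only [kron, mul_ite, mul_one, mul_zero, ite_smul, zero_smul, sum_ite_eq,
    mem_univ, if_true]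
  module

lemma comm_mem {n : ℕ} {w : V} (hw : w ∈ cyclicFilt X v n) (i j : Fin 5) :
    commY X i j w ∈ cyclicFilt X v n := by
  induction n generalizing w with
  | zero =>
    obtain ⟨c, rfl⟩ := Submodule.mem_span_singleton.1 hw
    rw [map_smul, h.comm_vec, smul_zero]
    exact zero_mem _
  | succ n ih =>
    suffices cyclicFilt X v (n + 1) ≤ (cyclicFilt X v (n + 1)).comap (commY X i j) from this hw
    refine cyclicFilt_succ_le X v (fun w hw => cyclicFilt_le_succ X v n (ih hw)) fun k w hw => ?_
    rw [mem_comap, ← End.mul_apply, h.comm_mul]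
    refine add_mem (apply_mem_cyclicFilt X v (ih hw) k) ?_
    exact sub_mem (smul_mem _ _ (apply_mem_cyclicFilt X v hw i))
      (smul_mem _ _ (apply_mem_cyclicFilt X v hw j))

lemma sumC_mem {n : ℕ} {w : V} (hw : w ∈ cyclicFilt X v n) : sumC X w ∈ cyclicFilt X v n := by
  simp only [sumC, LinearMap.sum_apply]
  exact sum_mem fun i _ => sum_mem fun j _ => h.comm_mem (h.comm_mem hw i j) i j

/-- The Casimir operator of the whole algebra acts by a scalar on the space generated by `v`. -/
lemma sumQ_eq {w : V} (hw : w ∈ cyclicSpan X v) : (8 : ℂ) • sumQ X w = (8 * lam) • w + sumC X w := by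
  suffices cyclicSpan X v ≤ LinearMap.ker ((8 : ℂ) • sumQ X - (8 * lam) • 1 - sumC X) by
    have := this hw
    rw [LinearMap.mem_ker] at this
    simp only [LinearMap.sub_apply, LinearMap.smul_apply, End.one_apply] at this
    rw [sub_sub, sub_eq_zero] at this
    exact this
  refine cyclicSpan_le X v ?_ fun k w hw => ?_
  · have : sumC X v = 0 := by
      simp only [sumC, LinearMap.sum_apply]
      exact sum_eq_zero fun i _ => sum_eq_zero fun j _ => by
        rw [End.mul_apply, h.comm_vec, map_zero]
    simp only [LinearMap.mem_ker, LinearMap.sub_apply, LinearMap.smul_apply, End.one_apply,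
      h.eigen, this]
    module
  · rw [LinearMap.mem_ker] at hw ⊢
    have e : ((8 : ℂ) • sumQ X - (8 * lam) • 1 - sumC X) * X k =
        X k * ((8 : ℂ) • sumQ X - (8 * lam) • 1 - sumC X) := by
      simp only [sub_mul, mul_sub, smul_mul_assoc, mul_smul_comm, h.sumQ_mul, h.sumC_mul, one_mul,
        mul_one]
      module
    rw [← End.mul_apply, e, End.mul_apply, hw, map_zero]

lemma sumQ_mem {n : ℕ} {w : V} (hw : w ∈ cyclicFilt X v n) : sumQ X w ∈ cyclicFilt X v n := by
  have := h.sumQ_eq (cyclicFilt_le_cyclicSpan X v n hw)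
  have e : sumQ X w = (8 : ℂ)⁻¹ • ((8 * lam) • w + sumC X w) := by
    rw [← this, smul_smul, inv_mul_cancel₀ (by norm_num), one_smul]
  rw [e]
  exact smul_mem _ _ (add_mem (smul_mem _ _ hw) (h.sumC_mem hw))

lemma sumG_add_mem {n : ℕ} {w : V} (hw : w ∈ cyclicFilt X v n) (k : Fin 5) :
    sumG X k w + (4 * n : ℂ) • X k w ∈ cyclicFilt X v n := by
  induction n generalizing w with
  | zero =>
    obtain ⟨c, rfl⟩ := Submodule.mem_span_singleton.1 hw
    have : sumG X k v = 0 := by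
      simp only [sumG, LinearMap.sum_apply]
      exact sum_eq_zero fun i _ => by rw [End.mul_apply, h.comm_vec, map_zero]
    simp [this]
  | succ n ih =>
    suffices cyclicFilt X v (n + 1) ≤
        (cyclicFilt X v (n + 1)).comap (sumG X k + (4 * (n + 1 : ℕ) : ℂ) • X k) from this hw
    have hle := cyclicFilt_le_succ X v n
    refine cyclicFilt_succ_le X v (fun w hw => ?_) fun m w hw => ?_
    · rw [mem_comap]
      have e : (sumG X k + (4 * (n + 1 : ℕ) : ℂ) • X k) w =
          (sumG X k w + (4 * n : ℂ) • X k w) + (4 : ℂ) • X k w := by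
        simp only [LinearMap.add_apply, LinearMap.smul_apply]
        push_cast
        module
      rw [e]
      exact add_mem (hle (ih hw))
        (smul_mem _ _ (apply_mem_cyclicFilt X v hw k))
    · rw [mem_comap]
      have e1 : sumG X k * X m = X m * sumG X k + ∑ i, commY X i m * commY X i k +
          (4 * kron k m) • sumQ X - (4 : ℂ) • (X m * X k) := by
        have : ∀ i, X i * commY X i k * X m = X m * (X i * commY X i k) +
            commY X i m * commY X i k + (4 * kron k m) • (X i * X i) -
              (4 * kron i m) • (X i * X k) := by
          intro i
          rw [mul_assoc, h.comm_mul]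
          simp only [commY, mul_sub, sub_mul, mul_add, mul_smul_comm, mul_assoc]
          module
        rw [sumG, sum_mul, sum_congr rfl fun i _ => this i, sum_sub_distrib,
          sum_add_distrib, sum_add_distrib, ← mul_sum, ← smul_sum]
        simp only [kron, mul_ite, mul_one, mul_zero, ite_smul, zero_smul, sum_ite_eq',
          mem_univ, if_true, sumQ]
      have e2 : (sumG X k + (4 * (n + 1 : ℕ) : ℂ) • X k) (X m w) =
          X m (sumG X k w + (4 * n : ℂ) • X k w) + (∑ i, commY X i m * commY X i k) w +
            (4 * kron k m) • sumQ X w + (4 * (n + 1) : ℂ) • commY X k m w := by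
        rw [LinearMap.add_apply, ← End.mul_apply (sumG X k), e1]
        simp only [LinearMap.add_apply, LinearMap.sub_apply, LinearMap.smul_apply,
          End.mul_apply, map_add, map_smul, commY]
        push_cast
        module
      rw [e2]
      refine add_mem (add_mem (add_mem
        (apply_mem_cyclicFilt X v (ih hw) m) (hle ?_)) (smul_mem _ _ (hle (h.sumQ_mem hw))))
        (smul_mem _ _ (hle (h.comm_mem hw k m)))
      simp only [LinearMap.sum_apply]
      exact sum_mem fun i _ => h.comm_mem (h.comm_mem hw i k) i m

omit h in
/-- The eigenvalue of `∑ X_i²` on the `n`-th graded piece of the filtration. -/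
def _root_.QuatMaass.gradedEigenvalue (lam : ℂ) (n : ℕ) : ℂ := lam - 4 * n * (n + 3)

lemma sumQ_sub_mem {n : ℕ} {w : V} (hw : w ∈ cyclicFilt X v (n + 1)) :
    sumQ X w - gradedEigenvalue lam (n + 1) • w ∈ cyclicFilt X v n := by
  have step : ∀ (n : ℕ) (w : V), w ∈ cyclicFilt X v n → ∀ k,
      X k (sumQ X w - gradedEigenvalue lam n • w) ∈ cyclicFilt X v n →
      sumQ X (X k w) - gradedEigenvalue lam (n + 1) • X k w ∈ cyclicFilt X v n := by
    intro n w hw k hk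
    have e : sumQ X (X k w) - gradedEigenvalue lam (n + 1) • X k w =
        X k (sumQ X w - gradedEigenvalue lam n • w) +
          (2 : ℂ) • (sumG X k w + (4 * n : ℂ) • X k w) := by
      rw [← End.mul_apply, h.sumQ_mul]
      simp only [LinearMap.add_apply, LinearMap.sub_apply, LinearMap.smul_apply,
        End.mul_apply, map_sub, map_smul, gradedEigenvalue]
      push_cast
      module
    rw [e]
    exact add_mem hk (smul_mem _ _ (h.sumG_add_mem hw k))
  induction n generalizing w with
  | zero =>
    suffices cyclicFilt X v 1 ≤
        (cyclicFilt X v 0).comap (sumQ X - gradedEigenvalue lam 1 • 1) from this hw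
    refine cyclicFilt_succ_le X v (fun w hw => ?_) fun k w hw => ?_
    · exact sub_mem (h.sumQ_mem hw) (smul_mem _ _ hw)
    · refine step 0 w hw k ?_
      obtain ⟨c, rfl⟩ := Submodule.mem_span_singleton.1 hw
      have : sumQ X (c • v) - gradedEigenvalue lam 0 • (c • v) = 0 := by
        rw [map_smul, h.eigen]
        simp only [gradedEigenvalue]
        push_cast
        module
      rw [this, map_zero]
      exact zero_mem _
  | succ n ih =>
    suffices cyclicFilt X v (n + 1 + 1) ≤
        (cyclicFilt X v (n + 1)).comap (sumQ X - gradedEigenvalue lam (n + 1 + 1) • 1) from this hw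
    refine cyclicFilt_succ_le X v (fun w hw => ?_) fun k w hw => ?_
    · exact sub_mem (h.sumQ_mem hw) (smul_mem _ _ hw)
    · exact step (n + 1) w hw k (apply_mem_cyclicFilt X v (ih hw) k)

/-- The two kinds of relations that hold on the space generated by `v` because they hold at `v`:
the cyclic sums of `X_i [X_j, X_k]` vanish, as do their commutators with the `X_l`. -/
lemma cyclic_relations {w : V} (hw : w ∈ cyclicSpan X v) :
    (∀ i j k, (X i * commY X j k + X j * commY X k i + X k * commY X i j) w = 0) ∧
    ∀ l i j k, (commY X l i * commY X j k + commY X l j * commY X k i + commY X l k * commY X i j -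
      ((4 * kron k l) • commY X i j + (4 * kron j l) • commY X k i +
        (4 * kron i l) • commY X j k)) w = 0 := by
  let P : Submodule ℂ V :=
    (⨅ i, ⨅ j, ⨅ k, LinearMap.ker (X i * commY X j k + X j * commY X k i + X k * commY X i j)) ⊓
    ⨅ l, ⨅ i, ⨅ j, ⨅ k, LinearMap.ker (commY X l i * commY X j k + commY X l j * commY X k i +
      commY X l k * commY X i j - ((4 * kron k l) • commY X i j + (4 * kron j l) • commY X k i +
        (4 * kron i l) • commY X j k))
  have hP : ∀ w, w ∈ P ↔ (∀ i j k, (X i * commY X j k + X j * commY X k i + X k * commY X i j) w = 0) ∧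
      ∀ l i j k, (commY X l i * commY X j k + commY X l j * commY X k i + commY X l k * commY X i j -
      ((4 * kron k l) • commY X i j + (4 * kron j l) • commY X k i +
        (4 * kron i l) • commY X j k)) w = 0 := by
    intro w
    simp only [P, Submodule.mem_inf, Submodule.mem_iInf, LinearMap.mem_ker]
  rw [← hP]
  refine cyclicSpan_le X v ?_ (fun m w hw => ?_) hw
  · rw [hP]
    simp [h.comm_vec]
  · rw [hP] at hw ⊢
    obtain ⟨hT, hS⟩ := hw
    constructor
    · intro i j k
      have e : (X i * commY X j k + X j * commY X k i + X k * commY X i j) * X m =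
          X m * (X i * commY X j k + X j * commY X k i + X k * commY X i j) -
          (commY X m i * commY X j k + commY X m j * commY X k i + commY X m k * commY X i j -
            ((4 * kron k m) • commY X i j + (4 * kron j m) • commY X k i +
              (4 * kron i m) • commY X j k)) := by
        simp only [add_mul, mul_add, mul_assoc, h.comm_mul]
        simp only [commY, mul_sub, sub_mul, mul_smul_comm, mul_assoc]
        module
      rw [← End.mul_apply, e, LinearMap.sub_apply, End.mul_apply, hT, hS, map_zero,
        sub_zero]
    · intro l i j k
      have e : (commY X l i * commY X j k + commY X l j * commY X k i + commY X l k * commY X i j -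
            ((4 * kron k l) • commY X i j + (4 * kron j l) • commY X k i +
              (4 * kron i l) • commY X j k)) * X m =
          X m * (commY X l i * commY X j k + commY X l j * commY X k i + commY X l k * commY X i j -
            ((4 * kron k l) • commY X i j + (4 * kron j l) • commY X k i +
              (4 * kron i l) • commY X j k)) +
          ((4 * kron k m) • (X l * commY X i j + X i * commY X j l + X j * commY X l i) +
           (4 * kron i m) • (X l * commY X j k + X j * commY X k l + X k * commY X l j) +
           (4 * kron j m) • (X l * commY X k i + X k * commY X i l + X i * commY X l k) -
           (4 * kron l m) • (X i * commY X j k + X j * commY X k i + X k * commY X i j)) := by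
        have c : ∀ a b c d : Fin 5, commY X a b * (commY X c d * X m) =
            X m * (commY X a b * commY X c d) +
            ((4 * kron b m) • X a - (4 * kron a m) • X b) * commY X c d +
            (4 * kron d m) • (X c * commY X a b + ((4 * kron b c) • X a - (4 * kron a c) • X b)) -
            (4 * kron c m) • (X d * commY X a b +
              ((4 * kron b d) • X a - (4 * kron a d) • X b)) := by
          intro a b c d
          rw [h.comm_mul c d m, mul_add, ← mul_assoc, h.comm_mul a b m, mul_sub, mul_smul_comm,
            mul_smul_comm, h.comm_mul a b c, h.comm_mul a b d, add_mul, mul_assoc]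
          abel
        simp only [add_mul, sub_mul, mul_add, mul_sub, smul_mul_assoc, mul_smul_comm, mul_assoc, c]
        simp only [h.comm_mul]
        simp only [kron_comm j i, kron_comm k i, kron_comm k j, kron_comm l i, kron_comm l j,
          kron_comm l k]
        simp only [commY, mul_sub, sub_mul, mul_assoc]
        module
      have hz : ∀ (c : ℂ) (i j k : Fin 5),
          (c • (X i * commY X j k + X j * commY X k i + X k * commY X i j)) w = 0 :=
        fun c i j k => by rw [LinearMap.smul_apply, hT, smul_zero]
      rw [← End.mul_apply, e, LinearMap.add_apply, End.mul_apply, hS, map_zero,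
        LinearMap.sub_apply, LinearMap.add_apply, LinearMap.add_apply, hz, hz, hz, hz]
      simp

/-- The double commutator of `∑ X_i²` with `X_k`. -/
lemma double_comm {w : V} (hw : w ∈ cyclicSpan X v) (k : Fin 5) :
    sumQ X (sumQ X (X k w)) - (2 : ℂ) • sumQ X (X k (sumQ X w)) + X k (sumQ X (sumQ X w)) =
      (128 : ℂ) • X k w - (8 : ℂ) • (sumQ X (X k w) + X k (sumQ X w) - (2 * lam) • X k w) := by
  -- `U` is the operator `∑ X_i Y_ij Y_ik`, up to the order of the factors.
  set U : End ℂ V := ∑ i, ∑ j, X j * (commY X i k * commY X i j) with hU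
  have hUC : (2 : ℂ) • U w = X k (sumC X w) := by
    have ht : ∑ i, ∑ j, (X j * commY X i k + X i * commY X k j + X k * commY X j i)
        (commY X i j w) = 0 := by
      refine sum_eq_zero fun i _ => sum_eq_zero fun j _ => ?_
      obtain ⟨n, hn⟩ := (mem_cyclicSpan X v).1 hw
      exact (h.cyclic_relations (cyclicFilt_le_cyclicSpan X v n (h.comm_mem hn i j))).1 j i k
    have hU2 : ∑ i, ∑ j, X i (commY X k j (commY X i j w)) = U w := by
      rw [sum_comm, hU]
      simp only [LinearMap.sum_apply, End.mul_apply]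
      refine sum_congr rfl fun i _ => sum_congr rfl fun j _ => ?_
      rw [commY_swap i k, commY_swap i j]
      simp
    have hU1 : ∑ i, ∑ j, X j (commY X i k (commY X i j w)) = U w := by
      simp [hU, LinearMap.sum_apply]
    have hC : ∑ i, ∑ j, X k (commY X j i (commY X i j w)) = -X k (sumC X w) := by
      rw [sumC]
      simp only [LinearMap.sum_apply, map_sum, End.mul_apply, ← sum_neg_distrib]
      refine sum_congr rfl fun i _ => sum_congr rfl fun j _ => ?_
      rw [commY_swap i j]
      simp
    simp only [LinearMap.add_apply, End.mul_apply, sum_add_distrib, hU1, hU2, hC] at ht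
    rw [two_smul, ← sub_eq_zero, ← ht]
    abel
  have hG : ∑ i, sumG X i * commY X i k = (12 : ℂ) • sumG X k - U := by
    have e : ∀ j, ∑ i, commY X j i * commY X i k =
        (12 : ℂ) • commY X j k - ∑ i, commY X i k * commY X i j := by
      intro j
      have : ∀ i, commY X j i * commY X i k = -(commY X i k * commY X i j) +
          ((4 * kron i i) • commY X j k - (4 * kron i j) • commY X i k -
            (4 * kron j k) • commY X i i + (4 * kron i k) • commY X i j) := by
        intro i
        rw [commY_swap i j, neg_mul, h.comm_mul_comm i j i k, kron_comm j i]
        module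
      rw [sum_congr rfl fun i _ => this i, sum_add_distrib, sum_add_distrib,
        sum_sub_distrib, sum_sub_distrib]
      simp only [commY_self, smul_zero, Finset.sum_const_zero, kron, mul_ite, mul_one, mul_zero,
        ite_smul, zero_smul, sum_ite_eq', mem_univ, if_true, Finset.sum_const,
        Finset.card_univ, Fintype.card_fin, sum_neg_distrib]
      rw [commY_swap j k]
      module
    have e1 : ∑ i, sumG X i * commY X i k = ∑ j, X j * ∑ i, commY X j i * commY X i k := by
      simp only [sumG, sum_mul, mul_sum, mul_assoc]
      exact sum_comm
    rw [e1]
    simp only [e, mul_sub, mul_smul_comm, sum_sub_distrib, ← smul_sum, mul_sum]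
    rw [hU, sum_comm]
    rfl
  have hQG : sumQ X * sumG X k = sumG X k * sumQ X + ((8 : ℂ) • sumG X k - (2 : ℂ) • U) := by
    have : ∀ i, sumQ X * (X i * commY X i k) = X i * commY X i k * sumQ X +
        ((2 : ℂ) • (sumG X i * commY X i k) - (16 : ℂ) • (X i * commY X i k)) := by
      intro i
      rw [← mul_assoc, h.sumQ_mul, add_mul, mul_assoc, h.sumQ_mul_comm, sub_mul, smul_mul_assoc,
        smul_mul_assoc, mul_assoc]
    have e : sumQ X * sumG X k = sumQ X * ∑ i, X i * commY X i k := rfl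
    rw [e, mul_sum, sum_congr rfl fun i _ => this i, sum_add_distrib,
      sum_sub_distrib, ← smul_sum, ← smul_sum, hG, ← sum_mul]
    change sumG X k * sumQ X + ((2 : ℂ) • ((12 : ℂ) • sumG X k - U) - (16 : ℂ) • sumG X k) = _
    module
  have hQX : ∀ u, sumQ X (X k u) = X k (sumQ X u) + ((2 : ℂ) • sumG X k u - (16 : ℂ) • X k u) := by
    intro u
    have := congrArg (fun T : End ℂ V => T u) (h.sumQ_mul k)
    simpa using this
  have hQGw : sumQ X (sumG X k w) =
      sumG X k (sumQ X w) + ((8 : ℂ) • sumG X k w - (2 : ℂ) • U w) := by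
    have := congrArg (fun T : End ℂ V => T w) hQG
    simpa using this
  have hC : X k (sumC X w) = (8 : ℂ) • X k (sumQ X w) - (8 * lam) • X k w := by
    rw [← map_smul, h.sumQ_eq hw, map_add, map_smul]
    abel
  rw [hUC, hC] at hQGw
  simp only [hQX, map_add, map_sub, map_smul, hQGw]
  module

/-- Away from the reducibility points, every nonzero submodule of the module generated by `v`
contains `v`. -/
theorem vec_mem (hlam : ∀ n : ℕ, 1 ≤ n → lam ≠ 4 * (n + 3) * (n - 1)) {N : Submodule ℂ V}
    (hN : N ≤ cyclicSpan X v) (hX : ∀ i, ∀ w ∈ N, X i w ∈ N) (hne : N ≠ ⊥) : v ∈ N := by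
  classical
  have hQN : ∀ w ∈ N, sumQ X w ∈ N := fun w hw => by
    simp only [sumQ, LinearMap.sum_apply]
    exact sum_mem fun i _ => hX i _ (hX i w hw)
  have hex : ∃ n, ∃ x ∈ N, x ∈ cyclicFilt X v n ∧ x ≠ 0 := by
    obtain ⟨x, hx, hx0⟩ := Submodule.exists_mem_ne_zero_of_ne_bot hne
    obtain ⟨n, hn⟩ := (mem_cyclicSpan X v).1 (hN hx)
    exact ⟨n, x, hx, hn, hx0⟩
  obtain ⟨x, hxN, hxL, hx0⟩ := Nat.find_spec hex
  have hmin : ∀ m < Nat.find hex, ∀ y ∈ N, y ∈ cyclicFilt X v m → y = 0 := by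
    intro m hm y hy hy'
    by_contra h0
    exact Nat.find_min hex hm ⟨y, hy, hy', h0⟩
  generalize Nat.find hex = n at hxL hmin
  obtain _ | n := n
  · obtain ⟨c, rfl⟩ := Submodule.mem_span_singleton.1 hxL
    have hc : c ≠ 0 := fun h0 => hx0 (by rw [h0, zero_smul])
    have := smul_mem N c⁻¹ hxN
    rwa [smul_smul, inv_mul_cancel₀ hc, one_smul] at this
  exfalso
  set q : ℕ → ℂ := gradedEigenvalue lam with hq
  -- minimality makes `∑ X_i²` act by a scalar on the bottom layer of `N`
  have hbot : ∀ y ∈ N, y ∈ cyclicFilt X v (n + 1) → sumQ X y = q (n + 1) • y := fun y hy hy' =>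
    sub_eq_zero.1 (hmin n (Nat.lt_succ_self n) _
      (N.sub_mem (hQN y hy) (N.smul_mem _ hy)) (h.sumQ_sub_mem hy'))
  have hQx := hbot x hxN hxL
  have hz : ∀ k, sumQ X (X k x) - q (n + 1 + 1) • X k x = 0 := by
    intro k
    set z := sumQ X (X k x) - q (n + 1 + 1) • X k x with hz
    have hzN : z ∈ N := N.sub_mem (hQN _ (hX k x hxN)) (N.smul_mem _ (hX k x hxN))
    have hzL : z ∈ cyclicFilt X v (n + 1) := h.sumQ_sub_mem (apply_mem_cyclicFilt X v hxL k)
    have h1 := hbot z hzN hzL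
    have h2 := h.double_comm (hN hxN) k
    have h3 : sumQ X z = q n • z := by
      simp only [hQx, map_smul] at h2
      have e : sumQ X z - q n • z = (sumQ X (sumQ X (X k x)) -
          (2 : ℂ) • q (n + 1) • sumQ X (X k x) + X k (q (n + 1) • q (n + 1) • x)) -
          ((128 : ℂ) • X k x - (8 : ℂ) • (sumQ X (X k x) + q (n + 1) • X k x -
            (2 * lam) • X k x)) := by
        rw [hz, map_sub, map_smul, map_smul, map_smul]
        simp only [hq, gradedEigenvalue]
        push_cast
        module
      rw [← sub_eq_zero, e]
      simp only [map_smul]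
      rw [h2, sub_self]
    have h4 : (q n - q (n + 1)) • z = 0 := by rw [sub_smul, ← h1, ← h3, sub_self]
    refine (smul_eq_zero.1 h4).resolve_left ?_
    have : q n - q (n + 1) = ((8 * (n + 2) : ℕ) : ℂ) := by
      simp only [hq, gradedEigenvalue]
      push_cast
      ring
    rw [this]
    exact_mod_cast (by positivity : 8 * (n + 2) ≠ 0)
  have hz' : ∀ k, (2 : ℂ) • sumG X k x + (8 * (n + 1) : ℂ) • X k x = 0 := by
    intro k
    have e := hz k
    have := congrArg (fun T : End ℂ V => T x) (h.sumQ_mul k)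
    simp only [End.mul_apply, LinearMap.add_apply, LinearMap.sub_apply,
      LinearMap.smul_apply] at this
    rw [this, hQx, map_smul] at e
    rw [← e]
    simp only [hq, gradedEigenvalue]
    push_cast
    module
  have hsum : ∑ k, X k ((2 : ℂ) • sumG X k x + (8 * (n + 1) : ℂ) • X k x) =
      (8 * (n + 1) : ℂ) • sumQ X x - sumC X x := by
    have e : (2 : ℂ) • ∑ k, X k * sumG X k = -sumC X := by
      have e1 : ∑ k, X k * sumG X k = ∑ k, ∑ i, X k * (X i * commY X i k) := by
        simp only [sumG, mul_sum]
      have e2 : ∑ k, X k * sumG X k = ∑ k, ∑ i, X i * (X k * commY X k i) := by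
        rw [e1, sum_comm]
      rw [two_smul]
      nth_rewrite 1 [e1]
      rw [e2, ← sum_add_distrib, sumC, ← sum_neg_distrib]
      refine sum_congr rfl fun k _ => ?_
      rw [← sum_add_distrib, ← sum_neg_distrib]
      refine sum_congr rfl fun i _ => ?_
      rw [commY_swap k i]
      simp only [commY]
      noncomm_ring
    have e' := congrArg (fun T : End ℂ V => T x) e
    simp only [LinearMap.smul_apply, LinearMap.sum_apply, End.mul_apply,
      LinearMap.neg_apply] at e'
    simp only [map_add, map_smul, sum_add_distrib, ← smul_sum]
    rw [e', sumQ, LinearMap.sum_apply]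
    simp only [End.mul_apply]
    abel
  rw [sum_eq_zero fun k _ => by rw [hz' k, map_zero]] at hsum
  have hC : sumC X x = (8 * (q (n + 1) - lam)) • x := by
    have := h.sumQ_eq (hN hxN)
    rw [hQx] at this
    rw [← sub_eq_iff_eq_add'.2 this]
    module
  rw [hC, hQx] at hsum
  have h5 : (8 * (n + 1) * q (n + 1) - 8 * (q (n + 1) - lam) : ℂ) • x = 0 := by
    rw [hsum]
    module
  have h6 := (smul_eq_zero.1 h5).resolve_right hx0
  apply hlam (n + 1) (by omega)
  have h7 : (8 * (n + 1) : ℂ) * (lam - 4 * ((n + 1 : ℕ) + 3) * ((n + 1 : ℕ) - 1)) = 0 := by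
    rw [← h6]
    simp only [hq, gradedEigenvalue]
    push_cast
    ring
  have h8 : (8 * (n + 1) : ℂ) ≠ 0 := by exact_mod_cast (by positivity : 8 * (n + 1) ≠ 0)
  exact sub_eq_zero.1 ((mul_eq_zero.1 h7).resolve_left h8)

end IsClassOne
end ClassOne

/-! ### Isotypic spaces and irreducibility -/

section Isotypic

variable {J : Type*} {V M V' : Type*} [AddCommGroup V] [Module ℂ V] [AddCommGroup M] [Module ℂ M]
  [AddCommGroup V'] [Module ℂ V']

/-- The sum of the images of all intertwining maps is stable under operators which commute with the
given family. -/
lemma apply_mem_iSup_range {ρ : J → End ℂ V} {τ : J → End ℂ M} {T : End ℂ M}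
    (hT : T ∈ opHom τ τ) {w : M} (hw : w ∈ ⨆ φ : opHom ρ τ, LinearMap.range φ.1) :
    T w ∈ ⨆ φ : opHom ρ τ, LinearMap.range φ.1 := by
  suffices (⨆ φ : opHom ρ τ, LinearMap.range φ.1) ≤
    (⨆ φ : opHom ρ τ, LinearMap.range φ.1).comap T from this hw
  refine iSup_le ?_
  rintro φ _ ⟨v, rfl⟩
  refine mem_iSup_of_mem ⟨T ∘ₗ φ.1, fun j v => ?_⟩ ⟨v, rfl⟩
  simp [φ.2 j v, hT j]

/-- The sum of the images of all intertwining maps is stable under the given family of operators. -/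
lemma apply_mem_iSup_range_self {ρ : J → End ℂ V} {τ : J → End ℂ M} (j : J) {w : M}
    (hw : w ∈ ⨆ φ : opHom ρ τ, LinearMap.range φ.1) :
    τ j w ∈ ⨆ φ : opHom ρ τ, LinearMap.range φ.1 := by
  suffices (⨆ φ : opHom ρ τ, LinearMap.range φ.1) ≤
    (⨆ φ : opHom ρ τ, LinearMap.range φ.1).comap (τ j) from this hw
  refine iSup_le ?_
  rintro φ _ ⟨v, rfl⟩
  exact mem_iSup_of_mem φ ⟨ρ j v, φ.2 j v⟩

/-- A tensor decomposition yields a nonzero intertwining map. -/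
lemma exists_opHom_ne_zero {W : Type*} [AddCommGroup W] [Module ℂ W] {ρ : J → End ℂ V}
    {τ : J → End ℂ M} [Nontrivial M] (e : (V ⊗[ℂ] W) ≃ₗ[ℂ] M)
    (he : ∀ j v w, e (ρ j v ⊗ₜ w) = τ j (e (v ⊗ₜ w))) : ∃ ψ : opHom ρ τ, ψ ≠ 0 := by
  by_contra! h
  have h0 : ∀ v w, e (v ⊗ₜ w) = 0 := by
    intro v w
    have := h ⟨e.toLinearMap ∘ₗ (TensorProduct.mk ℂ V W).flip w, fun j v => he j v w⟩
    exact LinearMap.congr_fun (congrArg Subtype.val this) v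
  obtain ⟨m, hm⟩ := exists_ne (0 : M)
  apply hm
  rw [← e.apply_symm_apply m]
  induction e.symm m using TensorProduct.induction_on with
  | zero => exact map_zero e
  | tmul v w => exact h0 v w
  | add x y hx hy => rw [map_add, hx, hy, add_zero]

lemma OpSimple.of_equiv {ρ : J → End ℂ V} {ρ' : J → End ℂ V'} (h : OpSimple ρ)
    (e : V' ≃ₗ[ℂ] V) (he : ∀ j v, e (ρ' j v) = ρ j (e v)) : OpSimple ρ' := by
  refine ⟨e.toEquiv.nontrivial_congr.2 h.1, fun U hU => ?_⟩
  have := h.2 (U.map e.toLinearMap) (by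
    rintro j _ ⟨v, hv, rfl⟩
    exact ⟨ρ' j v, hU j v hv, he j v⟩)
  refine this.imp (fun h0 => ?_) (fun h0 => ?_)
  · exact (Submodule.map_eq_bot_iff (e := e)).1 h0
  · rw [eq_top_iff]
    intro v _
    have hv : e v ∈ U.map e.toLinearMap := by rw [h0]; trivial
    obtain ⟨w, hw, hwv⟩ := hv
    rwa [← e.injective hwv]

variable {G : Type*} [Group G]

lemma isIrreducible_iff_opSimple (ρ : Representation ℂ G V) :
    ρ.IsIrreducible ↔ OpSimple (fun g => ρ g) := by
  constructor
  · intro h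
    refine ⟨?_, fun U hU => ?_⟩
    · by_contra hn
      rw [not_nontrivial_iff_subsingleton] at hn
      obtain ⟨a, b, hab⟩ := h.exists_pair_ne
      exact hab (Subrepresentation.toSubmodule_injective (Subsingleton.elim _ _))
    · refine (h.eq_bot_or_eq_top ⟨U, fun g v hv => hU g v hv⟩).imp (fun h0 => ?_) fun h0 => ?_
      · exact congrArg Subrepresentation.toSubmodule h0
      · exact congrArg Subrepresentation.toSubmodule h0
  · intro h
    have := h.1
    refine { exists_pair_ne := ⟨⊥, ⊤, fun h0 => ?_⟩, eq_bot_or_eq_top := fun U => ?_ }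
    · exact bot_ne_top (congrArg Subrepresentation.toSubmodule h0)
    · refine (h.2 U.toSubmodule fun g v hv => U.apply_mem_toSubmodule g hv).imp (fun h0 => ?_) fun h0 => ?_
      · exact Subrepresentation.toSubmodule_injective h0
      · exact Subrepresentation.toSubmodule_injective h0

/-- An irreducible representation is its own unique constituent. -/
lemma isUniqueConstituent_of_equiv {G U : Type} {V : Type*} [Group G] [AddCommGroup U] [Module ℂ U]
    [AddCommGroup V] [Module ℂ V] {ρ : Representation ℂ G U} {π : Representation ℂ G V}
    (hρ : OpSimple (fun g => ρ g)) (e : V ≃ₗ[ℂ] U) (he : ∀ g v, e (π g v) = ρ g (e v)) :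
    IsUniqueConstituent ρ π := by
  have he' : ∀ g u, e.symm (ρ g u) = π g (e.symm u) := by
    intro g u
    rw [e.symm_apply_eq, he, e.apply_symm_apply]
  refine ⟨⟨(isIrreducible_iff_opSimple π).2 (hρ.of_equiv e he), ⊤, ?_⟩, ?_⟩
  · let f : (⊤ : Subrepresentation ρ).toSubmodule →ₗ[ℂ] V :=
      e.symm.toLinearMap ∘ₗ (⊤ : Subrepresentation ρ).toSubmodule.subtype
    refine ⟨f.intertwiningMap_of_isIntertwiningMap _ _ fun g v => he' g v, fun v => ?_⟩
    exact ⟨⟨e v, trivial⟩, e.symm_apply_apply v⟩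
  · intro V' _ _ π' ⟨hπ', B, f, hf⟩
    rw [isIrreducible_iff_opSimple] at hπ'
    have := hπ'.1
    have hB : B.toSubmodule = ⊤ := by
      refine (hρ.2 B.toSubmodule fun g v hv => B.apply_mem_toSubmodule g hv).resolve_left fun h0 => ?_
      obtain ⟨a, b, hab⟩ := exists_pair_ne V'
      obtain ⟨x, rfl⟩ := hf a
      obtain ⟨y, rfl⟩ := hf b
      have hs : Subsingleton B.toSubmodule := by
        rw [h0]
        infer_instance
      exact hab (by rw [Subsingleton.elim x y])
    -- the constituent, as a quotient of the whole space
    let q : U →ₗ[ℂ] V' := f.toLinearMap ∘ₗ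
      (LinearMap.id.codRestrict B.toSubmodule fun u => by rw [hB]; trivial)
    have hq : ∀ g u, q (ρ g u) = π' g (q u) := fun g u =>
      Representation.IntertwiningMap.isIntertwining (ρ := B.toRepresentation) (σ := π') f g
        ⟨u, by rw [hB]; trivial⟩
    have hqs : Function.Surjective q := by
      intro v
      obtain ⟨x, hx⟩ := hf v
      exact ⟨x.1, hx⟩
    have hqi : LinearMap.ker q = ⊥ := by
      refine (hρ.2 (LinearMap.ker q) fun g u hu => ?_).resolve_right fun h0 => ?_
      · rw [LinearMap.mem_ker] at hu ⊢
        rw [hq, hu, map_zero]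
      · obtain ⟨v, hv⟩ := exists_ne (0 : V')
        obtain ⟨u, rfl⟩ := hqs v
        apply hv
        rw [← LinearMap.mem_ker, h0]
        trivial
    let E : U ≃ₗ[ℂ] V' := LinearEquiv.ofBijective q ⟨LinearMap.ker_eq_bot.1 hqi, hqs⟩
    refine ⟨(Representation.Equiv.mk (e.trans E) fun g => LinearMap.ext fun v => ?_).symm⟩
    change q (e (π g v)) = π' g (q (e v))
    rw [he, hq]

end Isotypic

/-! ### The automorphic representation as a module -/

variable {F : GLH ℝ → ℂ}

lemma adelicLift_mem_autRep (F : GLH ℝ → ℂ) : adelicLift F ∈ autRep F :=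
  Submodule.mem_sInf.2 fun _ hV => hV.1

lemma autRep_le {P : Submodule ℂ (GA → ℂ)} (h0 : adelicLift F ∈ P)
    (h1 : ∀ h : Gfin, ∀ f ∈ P, rightRegular GA (1, h) f ∈ P)
    (h2 : ∀ k ∈ maxCompact, ∀ f ∈ P, rightRegular GA (k, 1) f ∈ P)
    (h3 : ∀ X, ∀ f ∈ P, lieDerivA X f ∈ P) : autRep F ≤ P :=
  sInf_le ⟨h0, h1, h2, h3⟩

lemma fin_mem_autRep (h : Gfin) {f : GA → ℂ} (hf : f ∈ autRep F) :
    rightRegular GA (1, h) f ∈ autRep F :=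
  Submodule.mem_sInf.2 fun V hV => hV.2.1 h f (Submodule.mem_sInf.1 hf V hV)

lemma compact_mem_autRep {k : GLH ℝ} (hk : k ∈ maxCompact) {f : GA → ℂ} (hf : f ∈ autRep F) :
    rightRegular GA (k, 1) f ∈ autRep F :=
  Submodule.mem_sInf.2 fun V hV => hV.2.2.1 k hk f (Submodule.mem_sInf.1 hf V hV)

lemma lie_mem_autRep (X : gl2) {f : GA → ℂ} (hf : f ∈ autRep F) :
    lieDerivA X f ∈ autRep F :=
  Submodule.mem_sInf.2 fun V hV => hV.2.2.2 X f (Submodule.mem_sInf.1 hf V hV)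

/-- The functions on `GL₂(B_𝔸)` which are smooth in the archimedean variable. -/
def smoothSlices : Submodule ℂ (GA → ℂ) where
  carrier := {Φ | ∀ h, IsSmooth fun x => Φ (x, h)}
  zero_mem' := fun _ => isSmooth_zero
  add_mem' := fun hf hf' h => (hf h).add (hf' h)
  smul_mem' := fun c _ hf h => (hf h).smul c

lemma lieDerivA_slice (X : gl2) (Φ : GA → ℂ) (h : Gfin) :
    (fun x => lieDerivA X Φ (x, h)) = lieDeriv X fun x => Φ (x, h) := rfl

lemma autRep_le_smoothSlices (hs : IsSmooth F) (hinv : ∀ γ ∈ glOrder ℤ ℝ, ∀ g, F (γ * g) = F g) :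
    autRep F ≤ smoothSlices := by
  refine autRep_le (fun h => ?_) (fun h f hf h' => ?_) (fun k _ f hf h => ?_) fun X f hf h => ?_
  · rcases adelicLift_slice hinv h with h0 | ⟨γ, hγ⟩
    · rw [funext h0]
      exact isSmooth_zero
    · rw [funext hγ]
      exact hs.translate_left γ
  · have := hf (h' * h)
    have e : (fun x => rightRegular GA (1, h) f (x, h')) = fun x => f (x, h' * h) := by
      funext x
      rw [rightRegular_apply, Prod.mk_mul_mk, mul_one]
    rw [e]
    exact this
  · have e : (fun x => rightRegular GA (k, 1) f (x, h)) = fun x => f (x * k, h) := by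
      funext x
      rw [rightRegular_apply, Prod.mk_mul_mk, mul_one]
    rw [e]
    exact (hf h).translate_right k
  · rw [lieDerivA_slice]
    exact (hf h).lieDeriv X

lemma lieDerivA_add {f f' : GA → ℂ} (hf : f ∈ smoothSlices) (hf' : f' ∈ smoothSlices)
    (X : gl2) : lieDerivA X (f + f') = lieDerivA X f + lieDerivA X f' :=
  funext fun g => congrFun (lieDeriv_add (hf g.2) (hf' g.2) X) g.1

lemma lieDerivA_smul {f : GA → ℂ} (hf : f ∈ smoothSlices) (c : ℂ)
    (X : gl2) : lieDerivA X (c • f) = c • lieDerivA X f :=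
  funext fun g => congrFun (lieDeriv_smul (hf g.2) c X) g.1

/-- Right translation of `Π_F` by the finite adelic group. -/
def finOp (F : GLH ℝ → ℂ) (h : Gfin) : End ℂ (autRep F) :=
  (rightRegular GA (1, h)).restrict fun _ hf => fin_mem_autRep h hf

/-- Right translation of `Π_F` by `K`. -/
def compactOp (F : GLH ℝ → ℂ) (k : maxCompact) : End ℂ (autRep F) :=
  (rightRegular GA ((k : GLH ℝ), 1)).restrict fun _ hf => compact_mem_autRep k.2 hf

/-- The action of the Lie algebra on `Π_F`. -/
def lieOp (hle : autRep F ≤ smoothSlices) (X : gl2) :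
    End ℂ (autRep F) where
  toFun f := ⟨lieDerivA X f, lie_mem_autRep X f.2⟩
  map_add' f f' := Subtype.ext (lieDerivA_add (hle f.2) (hle f'.2) X)
  map_smul' c f := Subtype.ext (lieDerivA_smul (hle f.2) c X)

lemma finOp_apply (h : Gfin) (f : autRep F) (g : GA) : (finOp F h f).1 g = f.1 (g * (1, h)) := rfl

lemma compactOp_apply (k : maxCompact) (f : autRep F) (g : GA) :
    (compactOp F k f).1 g = f.1 (g * ((k : GLH ℝ), 1)) := rfl

/-- `Φ_F`, as a vector of `Π_F`. -/
def autVec (F : GLH ℝ → ℂ) : autRep F := ⟨adelicLift F, adelicLift_mem_autRep F⟩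

/-- `Π_F` is generated by `Φ_F`. -/
lemma autRep_eq_top (hle : autRep F ≤ smoothSlices) {P : Submodule ℂ (autRep F)} (h0 : autVec F ∈ P)
    (h1 : ∀ h, ∀ f ∈ P, finOp F h f ∈ P) (h2 : ∀ k, ∀ f ∈ P, compactOp F k f ∈ P)
    (h3 : ∀ X, ∀ f ∈ P, lieOp hle X f ∈ P) : P = ⊤ := by
  have : autRep F ≤ P.map (autRep F).subtype := by
    refine autRep_le ⟨_, h0, rfl⟩ ?_ ?_ ?_
    · rintro h _ ⟨f, hf, rfl⟩
      exact ⟨_, h1 h f hf, rfl⟩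
    · rintro k hk _ ⟨f, hf, rfl⟩
      exact ⟨_, h2 ⟨k, hk⟩ f hf, rfl⟩
    · rintro X _ ⟨f, hf, rfl⟩
      exact ⟨_, h3 X f hf, rfl⟩
  rw [eq_top_iff]
  intro f _
  obtain ⟨f', hf', e⟩ := this f.2
  rwa [← Subtype.ext e]

lemma autVec_ne_zero (hinv : ∀ γ ∈ glOrder ℤ ℝ, ∀ g, F (γ * g) = F g) (h0 : F ≠ 0) : autVec F ≠ 0 := by
  intro h
  apply h0
  funext x
  have := congrFun (congrArg Subtype.val h) (x, 1)
  change adelicLift F (x, 1) = 0 at this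
  rwa [adelicLift_eq hinv (decomposes_one x)] at this

lemma finOp_comp (h h' : Gfin) (f : autRep F) : finOp F h (finOp F h' f) = finOp F (h * h') f :=
  Subtype.ext (by
    change rightRegular GA (1, h) (rightRegular GA (1, h') f.1) = rightRegular GA (1, h * h') f.1
    rw [← End.mul_apply, ← map_mul, Prod.mk_mul_mk, one_mul])

lemma finOp_comm_compactOp (h : Gfin) (k : maxCompact) (f : autRep F) :
    finOp F h (compactOp F k f) = compactOp F k (finOp F h f) := by
  refine Subtype.ext (funext fun g => ?_)
  rw [finOp_apply, compactOp_apply, compactOp_apply, finOp_apply]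
  rw [mul_assoc, mul_assoc]
  simp

lemma finOp_comm_lieOp (hle : autRep F ≤ smoothSlices) (h : Gfin) (X : gl2)
    (f : autRep F) : finOp F h (lieOp hle X f) = lieOp hle X (finOp F h f) := by
  refine Subtype.ext (funext fun g => ?_)
  change lieDeriv X (fun x => f.1 (x, (g * (1, h)).2)) (g * (1, h)).1 =
    lieDeriv X (fun x => f.1 ((x, g.2) * (1, h))) g.1
  simp only [Prod.mk_mul_mk, Prod.fst_mul, Prod.snd_mul, mul_one]

lemma atPrime_apply_self (p : Nat.Primes) (g : Gp p) : atPrime p g p = g :=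
  RestrictedProduct.mulSingle_eq_same _ p g

lemma atPrime_mul (p : Nat.Primes) (g h : Gp p) : atPrime p (g * h) = atPrime p g * atPrime p h :=
  RestrictedProduct.mulSingle_mul ..

lemma atPrime_one (p : Nat.Primes) : atPrime p 1 = 1 := RestrictedProduct.mulSingle_one ..

lemma atPrime_comm {p : Nat.Primes} (g : Gp p) {h : Gfin} (hp : h p = 1) :
    atPrime p g * h = h * atPrime p g := by
  refine RestrictedProduct.ext _ _ fun q => ?_
  rw [RestrictedProduct.mul_apply, RestrictedProduct.mul_apply]
  by_cases hq : q = p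
  · subst hq
    rw [hp, mul_one, one_mul]
  · rw [atPrime, RestrictedProduct.mulSingle_eq_of_ne _ _ hq, mul_one, one_mul]

/-- The action of `GL₂(B_p)` on `Π_F`. -/
def primeOp (F : GLH ℝ → ℂ) (p : Nat.Primes) : Representation ℂ (Gp p) (autRep F) where
  toFun g := finOp F (atPrime p g)
  map_one' := by
    refine LinearMap.ext fun f => Subtype.ext (funext fun x => ?_)
    rw [finOp_apply, atPrime_one]
    change f.1 (x * 1) = f.1 x
    rw [mul_one]
  map_mul' g h := by
    refine LinearMap.ext fun f => ?_
    rw [End.mul_apply, finOp_comp, atPrime_mul]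

lemma finOp_comm_primeOp {p : Nat.Primes} {h : Gfin} (hp : h p = 1) (g : Gp p) (f : autRep F) :
    finOp F h (primeOp F p g f) = primeOp F p g (finOp F h f) := by
  change finOp F h (finOp F (atPrime p g) f) = finOp F (atPrime p g) (finOp F h f)
  rw [finOp_comp, finOp_comp, atPrime_comm g hp]

/-- The representation of `GL₂(B_p)` on `Π_F` is isotypic as soon as `Φ_F` lies in a sum of copies of
one representation. -/
lemma iSup_range_primeOp (hle : autRep F ≤ smoothSlices) {p : Nat.Primes} {V : Type*}
    [AddCommGroup V] [Module ℂ V] {ρ : Representation ℂ (Gp p) V}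
    (φ : opHom (fun g => ρ g) (fun g => primeOp F p g)) {v : V} (hφ : φ.1 v = autVec F) :
    ⨆ φ : opHom (fun g => ρ g) (fun g => primeOp F p g), LinearMap.range φ.1 = ⊤ := by
  refine autRep_eq_top hle (mem_iSup_of_mem φ ⟨v, hφ⟩) (fun h f hf => ?_)
    (fun k f hf => ?_) fun X f hf => ?_
  · have e : finOp F h f = primeOp F p (h p) (finOp F ((atPrime p (h p))⁻¹ * h) f) := by
      change _ = finOp F (atPrime p (h p)) _
      rw [finOp_comp, mul_inv_cancel_left]
    rw [e]
    refine apply_mem_iSup_range_self (τ := fun g => primeOp F p g) (h p) (apply_mem_iSup_range ?_ hf)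
    intro g f
    refine finOp_comm_primeOp ?_ g f
    rw [RestrictedProduct.mul_apply, RestrictedProduct.inv_apply, atPrime_apply_self, inv_mul_cancel]
  · exact apply_mem_iSup_range (fun g f => (finOp_comm_compactOp _ k f).symm) hf
  · exact apply_mem_iSup_range (fun g f => (finOp_comm_lieOp hle _ X f).symm) hf

lemma isSpherical_autVec {α : ℂ} (h : IsSpherical α (primeRep two) (adelicLift F)) :
    IsSpherical α (primeOp F two) (autVec F) := by
  refine ⟨fun k hk => Subtype.ext (h.fixed k hk), Subtype.ext h.scalar, Subtype.ext ?_⟩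
  refine Eq.trans ?_ h.hecke
  exact map_sum (autRep F).subtype (fun o => primeOp F two (heckeRep o) (autVec F)) Finset.univ

/-- The local component at two: `Φ_F` is a spherical vector with the Satake parameters of an
irreducible unramified principal series, which is universal among representations generated by such
a vector. -/
theorem localComponent_two {r : ℂ} {ε : ℝ} (hε : ε = 1 ∨ ε = -1) (hF : IsMaassSpace r ε F)
    (hc : IsCuspidal F) (hH : IsHeckeEigenform F) :
    (∃ (V : Type) (_ : AddCommGroup V) (_ : Module ℂ V) (π : Representation ℂ (Gp two) V),
        IsLocalComponent F two π) ∧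
      ∀ (V : Type*) [AddCommGroup V] [Module ℂ V] (π : Representation ℂ (Gp two) V),
        IsLocalComponent F two π → ∀ χ₁ χ₂ : D₂ˣ →* ℂˣ,
          IsUnramified two χ₁ → IsUnramified two χ₂ →
          (χ₁ ϖ : ℂ) = ((-√2 * ε : ℝ) : ℂ) → (χ₂ ϖ : ℂ) = ((-ε / √2 : ℝ) : ℂ) →
          IsUniqueConstituent (principalSeries two χ₁ χ₂).toRepresentation π := by
  set α : ℂ := ((-ε / √2 : ℝ) : ℂ) with hα
  have h2 : √2 * √2 = (2 : ℝ) := Real.mul_self_sqrt (by norm_num)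
  have hs : √2 ≠ 0 := by positivity
  have hε2 : ε ^ 2 = 1 := by rcases hε with rfl | rfl <;> norm_num
  have hα2 : α ^ 2 = 1 / 2 := by
    rw [hα, ← Complex.ofReal_pow, div_pow, neg_sq, hε2, pow_two, h2]
    norm_num
  have hα1 : ((-√2 * ε : ℝ) : ℂ) = 2 * α := by
    rw [hα, ← Complex.ofReal_ofNat, ← Complex.ofReal_mul]
    congr 1
    rw [mul_div_assoc', eq_div_iff hs]
    linear_combination -ε * h2
  have hinv := hF.1.left_invariant
  have hle := autRep_le_smoothSlices hF.1.smooth hinv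
  have hsph := isSpherical_autVec (adelicLift_isSpherical hF hc hH)
  have hne : Nontrivial (autRep F) := ⟨⟨autVec F, 0, autVec_ne_zero hinv hH.1⟩⟩
  have htop : ∀ {χ₁ χ₂ : D₂ˣ →* ℂˣ}, IsTwist χ₁ χ₂ α →
      ⨆ φ : opHom (fun g => (principalSeries two χ₁ χ₂).toRepresentation g)
        (fun g => primeOp F two g), LinearMap.range φ.1 = ⊤ := by
    intro χ₁ χ₂ h
    obtain ⟨φ, hφ, hφ'⟩ := h.exists_intertwining hsph
    exact iSup_range_primeOp hle ⟨φ, hφ'⟩ hφ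
  constructor
  · have hα0 : α ≠ 0 := by
      intro h0
      rw [h0] at hα2
      norm_num at hα2
    have ht := isTwist_of_unramified (α := α)
      (unramifiedChar_isUnramified (Units.mk0 (2 * α) (mul_ne_zero two_ne_zero hα0)))
      (unramifiedChar_isUnramified (Units.mk0 α hα0)) hα2 (by rw [unramifiedChar_varpi]; rfl)
      (by rw [unramifiedChar_varpi]; rfl)
    obtain ⟨W, i1, i2, e, he, hT⟩ := exists_tensor_decomposition ht.opSimple
      (fun φ hφ => ht.schur φ hφ) (htop ht)
    refine ⟨_, _, _, (principalSeries two _ _).toRepresentation,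
      (isIrreducible_iff_opSimple _).2 ht.opSimple, W, i1, i2, e, fun g v w => ?_, fun h hh => ?_,
      fun k hk => ?_, fun X => ?_⟩
    · exact congrArg Subtype.val (he g v w)
    · obtain ⟨T, hT⟩ := hT (finOp F h) fun g f => finOp_comm_primeOp hh g f
      exact ⟨T, fun v w => congrArg Subtype.val (hT v w)⟩
    · obtain ⟨T, hT⟩ := hT (compactOp F ⟨k, hk⟩) fun g f => (finOp_comm_compactOp _ _ f).symm
      exact ⟨T, fun v w => congrArg Subtype.val (hT v w)⟩
    · obtain ⟨T, hT⟩ := hT (lieOp hle X) fun g f => (finOp_comm_lieOp hle _ X f).symm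
      exact ⟨T, fun v w => congrArg Subtype.val (hT v w)⟩
  · rintro V _ _ π ⟨hπ, W, i1, i2, e, he, -⟩ χ₁ χ₂ u₁ u₂ e₁ e₂
    have ht := isTwist_of_unramified u₁ u₂ hα2 (e₁.trans hα1) e₂
    obtain ⟨ψ, hψ⟩ := exists_opHom_ne_zero (ρ := fun g => π g) (τ := fun g => primeOp F two g) e
      fun g v w => Subtype.ext (he g v w)
    obtain ⟨e', he'⟩ := exists_equiv_of_opHom ht.opSimple (fun φ hφ => ht.schur φ hφ) (htop ht)
      ((isIrreducible_iff_opSimple π).1 hπ) ψ hψ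
    exact isUniqueConstituent_of_equiv ht.opSimple e' he'

/-! ### The Lie algebra of `GL₂(ℍ)` -/

/-- An orthogonal basis of the traceless hermitian matrices, satisfying the Clifford relations. -/
def cliff : Fin 5 → gl2 :=
  Fin.cons !![1, 0; 0, -1] fun q => !![0, quatBasis q; star (quatBasis q), 0]

lemma cliff_zero : cliff 0 = !![1, 0; 0, -1] := rfl

lemma cliff_succ (q : Fin 4) : cliff q.succ = !![0, quatBasis q; star (quatBasis q), 0] := rfl

/-- The real Kronecker symbol. -/
def kronR (i j : Fin 5) : ℝ := if i = j then 1 else 0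

lemma kron_eq (i j : Fin 5) : kron i j = (kronR i j : ℂ) := by
  unfold kron kronR
  split_ifs <;> simp

lemma quatBasis_mul_star (p q : Fin 4) : quatBasis p * star (quatBasis q) +
    quatBasis q * star (quatBasis p) = ((if p = q then 2 else 0 : ℝ) : ℍ[ℝ]) := by
  fin_cases p <;> fin_cases q <;> ext <;> simp [quatBasis] <;> norm_num

lemma star_quatBasis_mul (p q : Fin 4) : star (quatBasis p) * quatBasis q +
    star (quatBasis q) * quatBasis p = ((if p = q then 2 else 0 : ℝ) : ℍ[ℝ]) := by
  fin_cases p <;> fin_cases q <;> ext <;> simp [quatBasis] <;> norm_num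

lemma cliff_mul_add (i j : Fin 5) :
    cliff i * cliff j + cliff j * cliff i = (2 * kronR i j) • (1 : gl2) := by
  refine Fin.cases ?_ (fun p => ?_) i <;> refine Fin.cases ?_ (fun q => ?_) j
  · rw [cliff_zero, kronR, if_pos rfl]
    ext a b : 1
    fin_cases a <;> fin_cases b <;> simp <;> ext <;> simp <;> norm_num
  · rw [cliff_zero, cliff_succ, kronR, if_neg (Fin.succ_ne_zero q).symm]
    ext a b : 1
    fin_cases a <;> fin_cases b <;> simp
  · rw [cliff_zero, cliff_succ, kronR, if_neg (Fin.succ_ne_zero p)]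
    ext a b : 1
    fin_cases a <;> fin_cases b <;> simp
  · rw [cliff_succ, cliff_succ, kronR]
    have h1 := quatBasis_mul_star p q
    have h2 := star_quatBasis_mul p q
    have e : (if p.succ = q.succ then (1 : ℝ) else 0) * 2 = if p = q then 2 else 0 := by
      by_cases h : p = q <;> simp [h]
    ext a b : 1
    rw [mul_comm, e]
    fin_cases a <;> fin_cases b
    · simpa [mul_apply, Fin.sum_univ_two, coe_mul_eq_smul] using h1.trans (by by_cases h : p = q <;> ext <;> simp [h])
    · simp
    · simp
    · simpa [mul_apply, Fin.sum_univ_two] using h2.trans (by by_cases h : p = q <;> ext <;> simp [h])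

lemma cliff_bracket (i j k : Fin 5) :
    (cliff i * cliff j - cliff j * cliff i) * cliff k -
      cliff k * (cliff i * cliff j - cliff j * cliff i) =
      (4 * kronR j k) • cliff i - (4 * kronR i k) • cliff j := by
  have h : ∀ a b, cliff a * cliff b = (2 * kronR a b) • (1 : gl2) - cliff b * cliff a := fun a b =>
    eq_sub_of_add_eq (cliff_mul_add a b)
  have h1 : cliff i * cliff j * cliff k = (2 * kronR j k) • cliff i - (2 * kronR i k) • cliff j +
      cliff k * cliff i * cliff j := by
    rw [mul_assoc, h j k, mul_sub, ← mul_assoc, h i k, sub_mul]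
    simp only [mul_smul_comm, smul_mul_assoc, mul_one, one_mul]
    abel
  have h2 : cliff j * cliff i * cliff k = (2 * kronR i k) • cliff j - (2 * kronR j k) • cliff i +
      cliff k * cliff j * cliff i := by
    rw [mul_assoc, h i k, mul_sub, ← mul_assoc, h j k, sub_mul]
    simp only [mul_smul_comm, smul_mul_assoc, mul_one, one_mul]
    abel
  rw [sub_mul, mul_sub, h1, h2, ← mul_assoc, ← mul_assoc]
  module

lemma star_cliff (i : Fin 5) : star (cliff i) = cliff i := by
  refine Fin.cases ?_ (fun p => ?_) i
  · rw [cliff_zero]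
    ext a b : 1
    fin_cases a <;> fin_cases b <;> simp [star_apply]
  · rw [cliff_succ]
    ext a b : 1
    fin_cases a <;> fin_cases b <;> simp [star_apply]

/-- The real part of the trace. -/
def reTr (M : gl2) : ℝ := (M 0 0).re + (M 1 1).re

lemma reTr_mul_comm (M N : gl2) : reTr (M * N) = reTr (N * M) := by
  simp only [reTr, mul_apply, Fin.sum_univ_two, re_add, re_mul]
  ring

lemma reTr_add (M N : gl2) : reTr (M + N) = reTr M + reTr N := by
  simp [reTr]
  ring

lemma reTr_smul (c : ℝ) (M : gl2) : reTr (c • M) = c * reTr M := by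
  simp [reTr]
  ring

lemma reTr_sub (M N : gl2) : reTr (M - N) = reTr M - reTr N := by
  simp [reTr]
  ring

lemma reTr_cliff (i : Fin 5) : reTr (cliff i) = 0 := by
  refine Fin.cases ?_ (fun p => ?_) i
  · simp [cliff_zero, reTr]
  · simp [cliff_succ, reTr]

/-- The decomposition of a matrix into a scalar, a traceless hermitian and a skew-hermitian part. -/
lemma exists_cartan (M : gl2) : ∃ (c : ℝ) (a : Fin 5 → ℝ) (S : gl2), star S = -S ∧
    M = c • (1 : gl2) + ∑ i, a i • cliff i + S := by
  set w : ℍ[ℝ] := (2⁻¹ : ℝ) • (M 0 1 + star (M 1 0)) with hw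
  refine ⟨((M 0 0).re + (M 1 1).re) / 2,
    ![((M 0 0).re - (M 1 1).re) / 2, w.re, w.imI, w.imJ, w.imK],
    !![(M 0 0).im, M 0 1 - w; M 1 0 - star w, (M 1 1).im], ?_, ?_⟩
  · ext a b : 1
    fin_cases a <;> fin_cases b <;> ext <;> simp [star_apply, hw] <;> ring
  · ext a b : 1
    rw [Fin.sum_univ_five]
    have e1 : cliff 1 = !![0, quatBasis 0; star (quatBasis 0), 0] := rfl
    have e2 : cliff 2 = !![0, quatBasis 1; star (quatBasis 1), 0] := rfl
    have e3 : cliff 3 = !![0, quatBasis 2; star (quatBasis 2), 0] := rfl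
    have e4 : cliff 4 = !![0, quatBasis 3; star (quatBasis 3), 0] := rfl
    rw [cliff_zero, e1, e2, e3, e4]
    fin_cases a <;> fin_cases b <;> ext <;> simp [quatBasis, Matrix.add_apply, Matrix.smul_apply] <;>
      ring

/-- A traceless hermitian matrix is a combination of the basis elements. -/
lemma exists_cliff_sum {M : gl2} (hM : star M = M) (ht : reTr M = 0) :
    ∃ a : Fin 5 → ℝ, M = ∑ i, a i • cliff i := by
  obtain ⟨c, a, S, hS, e⟩ := exists_cartan M
  have hsum : star (∑ i, a i • cliff i) = ∑ i, a i • cliff i := by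
    rw [star_sum]
    refine sum_congr rfl fun i _ => ?_
    ext p q : 1
    have := congrFun (congrFun (star_cliff i) p) q
    rw [star_apply] at this
    rw [star_apply, Matrix.smul_apply, Matrix.smul_apply, Quaternion.star_smul, this]
  have hone : star (c • (1 : gl2)) = c • (1 : gl2) := by
    ext p q : 1
    rw [star_apply, Matrix.smul_apply, Matrix.smul_apply, Quaternion.star_smul]
    congr 1
    fin_cases p <;> fin_cases q <;> simp
  have hS0 : S = 0 := by
    have h1 := hM
    rw [e, star_add, star_add, hS, hsum, hone] at h1
    have h2 : (2 : ℝ) • S = 0 := by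
      rw [two_smul]
      nth_rewrite 1 [← add_left_cancel h1]
      simp
    exact (smul_eq_zero.1 h2).resolve_left two_ne_zero
  have hc : c = 0 := by
    have h1 : reTr M = 2 * c := by
      have h2 : ∀ s : Finset (Fin 5), reTr (∑ i ∈ s, a i • cliff i) = 0 := by
        intro s
        induction s using Finset.induction_on with
        | empty => simp [reTr]
        | insert i s hi ih => rw [Finset.sum_insert hi, reTr_add, ih, reTr_smul, reTr_cliff]; simp
      rw [e, hS0, add_zero, reTr_add, h2, reTr_smul]
      simp [reTr]
      ring
    linarith
  exact ⟨a, by rw [e, hS0, hc]; simp⟩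

/-- `K` acts on the traceless hermitian matrices by conjugation. -/
lemma exists_conj_cliff {k : GLH ℝ} (hk : k ∈ maxCompact) (i : Fin 5) :
    ∃ a : Fin 5 → ℝ, k.val * cliff i * (k⁻¹).val = ∑ j, a j • cliff j := by
  have hinv : (k⁻¹).val = star k.val := by
    have h1 := star_mul_of_mem hk
    calc (k⁻¹).val = star k.val * k.val * (k⁻¹).val := by rw [h1, one_mul]
      _ = star k.val := by rw [mul_assoc, k.mul_inv, mul_one]
  refine exists_cliff_sum ?_ ?_
  · rw [hinv, star_mul, star_mul, star_star, star_cliff, mul_assoc]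
  · rw [reTr_mul_comm, ← mul_assoc, k.inv_mul, one_mul, reTr_cliff]

lemma exists_bracket_cliff {S : gl2} (hS : star S = -S) (i : Fin 5) :
    ∃ a : Fin 5 → ℝ, S * cliff i - cliff i * S = ∑ j, a j • cliff j := by
  refine exists_cliff_sum ?_ ?_
  · rw [star_sub, star_mul, star_mul, star_cliff, hS]
    noncomm_ring
  · rw [reTr_sub, reTr_mul_comm, sub_self]

lemma star_bracket_cliff (i j : Fin 5) : star (cliff i * cliff j - cliff j * cliff i) =
    -(cliff i * cliff j - cliff j * cliff i) := by
  rw [star_sub, star_mul, star_mul, star_cliff, star_cliff]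
  abel

/-! ### Modules over the Lie algebra with a spherical vector -/

section LieAction

variable {V : Type*} [AddCommGroup V] [Module ℂ V]

/-- The operators `D X` define an action of the real Lie algebra `M₂(ℍ)`. -/
structure IsLieAction (D : gl2 → End ℂ V) : Prop where
  add : ∀ X Y, D (X + Y) = D X + D Y
  smul : ∀ (c : ℝ) X, D (c • X) = (c : ℂ) • D X
  bracket : ∀ X Y, D (X * Y - Y * X) = D X * D Y - D Y * D X

/-- A vector annihilated by the Lie algebras of `K` and of `Z⁺` and an eigenvector of the operator
`∑ X_i²`, which is a multiple of the Casimir operator modulo these Lie algebras. -/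
structure IsSphericalInfty (D : gl2 → End ℂ V) (v : V) (lam : ℂ) : Prop where
  skew : ∀ S, star S = -S → D S v = 0
  one : D 1 v = 0
  eigen : ∑ i, D (cliff i) (D (cliff i) v) = lam • v

variable {D : gl2 → End ℂ V} {v : V} {lam : ℂ}

lemma IsLieAction.sum {ι : Type*} [Fintype ι] (hD : IsLieAction D) (a : ι → ℝ) (E : ι → gl2) :
    D (∑ i, a i • E i) = ∑ i, (a i : ℂ) • D (E i) := by
  have h0 : D 0 = 0 := by
    have := hD.smul 0 0
    simpa using this
  let φ : gl2 →+ End ℂ V := ⟨⟨D, h0⟩, hD.add⟩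
  have := map_sum φ (fun i => a i • E i) Finset.univ
  refine this.trans (sum_congr rfl fun i _ => hD.smul _ _)

lemma IsSphericalInfty.isClassOne (hD : IsLieAction D) (h : IsSphericalInfty D v lam) :
    IsClassOne (fun i => D (cliff i)) v lam := by
  have hY : ∀ i j, commY (fun i => D (cliff i)) i j = D (cliff i * cliff j - cliff j * cliff i) :=
    fun i j => (hD.bracket _ _).symm
  refine ⟨fun i j k => ?_, fun i j => ?_, ?_⟩
  · rw [hY, ← hD.bracket, cliff_bracket]
    have hs : ∀ X Y, D (X - Y) = D X - D Y := by
      intro X Y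
      have : D (X + (-1 : ℝ) • Y) = D X - D Y := by
        rw [hD.add, hD.smul]
        simp [sub_eq_add_neg]
      rw [← this]
      simp [sub_eq_add_neg]
    rw [hs, hD.smul, hD.smul, kron_eq, kron_eq]
    push_cast
    rfl
  · rw [hY]
    exact h.skew _ (star_bracket_cliff i j)
  · rw [← h.eigen, sumQ, LinearMap.sum_apply]
    rfl

lemma IsSphericalInfty.lie_mem (hD : IsLieAction D) (h : IsSphericalInfty D v lam) (M : gl2) {w : V}
    (hw : w ∈ cyclicSpan (fun i => D (cliff i)) v) : D M w ∈ cyclicSpan (fun i => D (cliff i)) v := by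
  set L := cyclicSpan (fun i => D (cliff i)) v with hL
  have hX : ∀ i, ∀ w ∈ L, D (cliff i) w ∈ L := fun i w hw =>
    apply_mem_cyclicSpan (fun i => D (cliff i)) v hw i
  have hsum : ∀ (a : Fin 5 → ℝ), ∀ w ∈ L, D (∑ i, a i • cliff i) w ∈ L := by
    intro a w hw
    rw [hD.sum, LinearMap.sum_apply]
    exact sum_mem fun i _ => smul_mem _ _ (hX i w hw)
  have hcomm : ∀ X Y u, D X (D Y u) = D Y (D X u) + D (X * Y - Y * X) u := by
    intro X Y u
    rw [hD.bracket]
    simp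
  have hS : ∀ S, star S = -S → ∀ w ∈ L, w ∈ L ⊓ L.comap (D S) := by
    intro S hS w hw
    refine cyclicSpan_le (fun i => D (cliff i)) v ?_ (fun i w hw => ?_) hw
    · refine ⟨self_mem_cyclicSpan _ v, ?_⟩
      rw [SetLike.mem_coe, mem_comap, h.skew S hS]
      exact zero_mem _
    · refine ⟨hX i w hw.1, ?_⟩
      rw [SetLike.mem_coe, mem_comap, hcomm]
      obtain ⟨a, ha⟩ := exists_bracket_cliff hS i
      rw [ha]
      exact add_mem (hX i _ hw.2) (hsum a w hw.1)
  have h1 : ∀ w ∈ L, D 1 w = 0 := by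
    intro w hw
    refine cyclicSpan_le (P := LinearMap.ker (D 1)) (fun i => D (cliff i)) v h.one (fun i w hw => ?_) hw
    rw [LinearMap.mem_ker] at hw ⊢
    have h0 := hD.smul 0 0
    rw [hcomm, hw, one_mul, mul_one, sub_self, map_zero, zero_add]
    rw [smul_zero] at h0
    rw [h0]
    simp
  obtain ⟨c, a, S, hS', rfl⟩ := exists_cartan M
  rw [hD.add, hD.add, hD.smul, LinearMap.add_apply, LinearMap.add_apply, LinearMap.smul_apply,
    h1 w hw, smul_zero, zero_add]
  exact add_mem (hsum a w hw) (hS S hS' w hw).2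

/-- Operators compatible with the action of `K` on the Lie algebra preserve the filtration. -/
lemma IsLieAction.compact_mem (hD : IsLieAction D) {k : GLH ℝ} (hk : k ∈ maxCompact)
    {ρ : End ℂ V} (hρ : ∀ M u, ρ (D M u) = D (k.val * M * (k⁻¹).val) (ρ u)) (hv : ρ v = v)
    {n : ℕ} {w : V} (hw : w ∈ cyclicFilt (fun i => D (cliff i)) v n) :
    ρ w ∈ cyclicFilt (fun i => D (cliff i)) v n := by
  induction n generalizing w with
  | zero =>
    obtain ⟨c, rfl⟩ := Submodule.mem_span_singleton.1 hw
    rw [map_smul, hv]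
    exact hw
  | succ n ih =>
    suffices cyclicFilt (fun i => D (cliff i)) v (n + 1) ≤
      (cyclicFilt (fun i => D (cliff i)) v (n + 1)).comap ρ from this hw
    refine cyclicFilt_succ_le _ v (fun w hw => cyclicFilt_le_succ _ v n (ih hw)) fun i w hw => ?_
    rw [mem_comap, hρ]
    obtain ⟨a, ha⟩ := exists_conj_cliff hk i
    rw [ha, hD.sum, LinearMap.sum_apply]
    exact sum_mem fun j _ => smul_mem _ _
      (apply_mem_cyclicFilt (fun i => D (cliff i)) v (ih hw) j)

variable {V' : Type*} [AddCommGroup V'] [Module ℂ V'] {D' : gl2 → End ℂ V'} {v' : V'}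

lemma IsLieAction.prod (hD : IsLieAction D) (hD' : IsLieAction D') :
    IsLieAction fun M => (D M).prodMap (D' M) := by
  refine ⟨fun X Y => ?_, fun c X => ?_, fun X Y => ?_⟩
  · simp only [hD.add, hD'.add]
    rfl
  · simp only [hD.smul, hD'.smul]
    rfl
  · simp only [hD.bracket, hD'.bracket]
    rfl

lemma IsSphericalInfty.prod (h : IsSphericalInfty D v lam) (h' : IsSphericalInfty D' v' lam) :
    IsSphericalInfty (fun M => (D M).prodMap (D' M)) (v, v') lam := by
  refine ⟨fun S hS => ?_, ?_, ?_⟩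
  · simp [h.skew S hS, h'.skew S hS]
  · simp [h.one, h'.one]
  · simp only [LinearMap.prodMap_apply]
    refine Prod.ext ?_ ?_
    · rw [Prod.fst_sum, h.eigen]
      rfl
    · rw [Prod.snd_sum, h'.eigen]
      rfl

/-- The intertwining map between two modules over the Lie algebra with a spherical vector. -/
lemma IsSphericalInfty.exists_intertwining (hD : IsLieAction D) (hD' : IsLieAction D')
    (h : IsSphericalInfty D v lam) (h' : IsSphericalInfty D' v' lam)
    (hlam : ∀ n : ℕ, 1 ≤ n → lam ≠ 4 * (n + 3) * (n - 1)) (hv : v ≠ 0)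
    (htop : cyclicSpan (fun i => D (cliff i)) v = ⊤) :
    ∃ φ : V →ₗ[ℂ] V', φ v = v' ∧ (∀ M u, φ (D M u) = D' M (φ u)) ∧
      ∀ (k : GLH ℝ) (_ : k ∈ maxCompact) (ρ : End ℂ V) (ρ' : End ℂ V'),
        (∀ M u, ρ (D M u) = D (k.val * M * (k⁻¹).val) (ρ u)) → ρ v = v →
        (∀ M u, ρ' (D' M u) = D' (k.val * M * (k⁻¹).val) (ρ' u)) → ρ' v' = v' →
        ∀ u, φ (ρ u) = ρ' (φ u) := by
  set E : gl2 → End ℂ (V × V') := fun M => (D M).prodMap (D' M) with hE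
  have hEL := hD.prod hD'
  have hw : IsSphericalInfty E (v, v') lam := h.prod h'
  set L := cyclicSpan (fun i => E (cliff i)) (v, v') with hL
  have inj : ∀ x ∈ L, x.1 = 0 → x = 0 := by
    intro x hx hx0
    by_contra hne
    have := (hw.isClassOne hEL).vec_mem hlam (N := L ⊓ LinearMap.ker (LinearMap.fst ℂ V V'))
      inf_le_left (fun i w hw => ⟨apply_mem_cyclicSpan _ _ hw.1 i, by
        have h0 : w.1 = 0 := hw.2
        change D (cliff i) w.1 = 0
        rw [h0, map_zero]⟩)
      (fun h0 => hne ((Submodule.mem_bot ℂ).1 (h0 ▸ Submodule.mem_inf.2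
        ⟨hx, LinearMap.mem_ker.2 hx0⟩)))
    exact hv this.2
  have surj : ∀ u, ∃ u', (u, u') ∈ L := by
    have : cyclicSpan (fun i => D (cliff i)) v ≤ L.map (LinearMap.fst ℂ V V') := by
      refine cyclicSpan_le _ v ⟨_, self_mem_cyclicSpan _ _, rfl⟩ ?_
      rintro i _ ⟨x, hx, rfl⟩
      exact ⟨E (cliff i) x, apply_mem_cyclicSpan _ _ hx i, rfl⟩
    intro u
    obtain ⟨x, hx, rfl⟩ := this (by rw [htop]; trivial : u ∈ _)
    exact ⟨x.2, hx⟩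
  have uniq : ∀ u a b, (u, a) ∈ L → (u, b) ∈ L → a = b := by
    intro u a b ha hb
    have := inj _ (L.sub_mem ha hb) (sub_self u)
    exact sub_eq_zero.1 (congrArg Prod.snd this)
  choose φ hφ using surj
  let Φ : V →ₗ[ℂ] V' :=
    { toFun := φ
      map_add' := fun a b => uniq _ _ _ (hφ (a + b)) (L.add_mem (hφ a) (hφ b))
      map_smul' := fun c a => uniq _ _ _ (hφ (c • a)) (L.smul_mem c (hφ a)) }
  refine ⟨Φ, uniq _ _ _ (hφ v) (self_mem_cyclicSpan _ _), fun M u => ?_, ?_⟩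
  · exact uniq _ _ _ (hφ (D M u)) (hw.lie_mem hEL M (hφ u))
  · intro k hk ρ ρ' h1 h2 h3 h4 u
    refine uniq _ _ _ (hφ (ρ u)) ?_
    obtain ⟨n, hn⟩ := (mem_cyclicSpan _ _).1 (hφ u)
    refine (mem_cyclicSpan _ _).2 ⟨n, ?_⟩
    exact hEL.compact_mem hk (ρ := ρ.prodMap ρ')
      (fun M u => Prod.ext (h1 M u.1) (h3 M u.2)) (by rw [LinearMap.prodMap_apply, h2, h4]) hn

end LieAction

/-! ### Functions invariant under `K` and the Casimir operator -/

variable {f : GLH ℝ → ℂ} {g : GLH ℝ}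

lemma lieDeriv_eq_of_line (hf : IsSmooth f) {X : gl2} {φ : ℝ → ℂ} {d : ℂ}
    (h : ∀ (t : ℝ) (u : GLH ℝ), u.val = g.val * (1 + t • X) → f u = φ t) (hd : HasDerivAt φ d 0) :
    lieDeriv X f g = d := by
  have h1 : HasDerivAt (fun t : ℝ => arr g + t • mulRightL X (arr g)) (mulRightL X (arr g)) 0 := by
    simpa using ((hasDerivAt_id (0 : ℝ)).smul_const (mulRightL X (arr g))).const_add (arr g)
  have h2 := (hf.differentiableAt g).hasFDerivAt.comp_hasDerivAt_of_eq (0 : ℝ) h1 (by simp)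
  refine h2.unique (hd.congr_of_eventuallyEq ?_)
  have hc : ContinuousAt (fun t : ℝ => arr g + t • mulRightL X (arr g)) 0 := h1.continuousAt
  have hn : unitSet ∈ nhds ((fun t : ℝ => arr g + t • mulRightL X (arr g)) 0) := by
    refine isOpen_unitSet.mem_nhds ?_
    simpa using arr_mem g
  filter_upwards [hc hn] with t ht
  obtain ⟨u, hu⟩ := exists_arr ht
  change extend f (arr g + t • mulRightL X (arr g)) = φ t
  refine (congrArg (extend f) hu.symm).trans ((extend_arr f u).trans (h t u ?_))
  have e : u.val = g.val + t • (g.val * X) := congrArg Matrix.of hu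
  rw [e, mul_add, mul_one, Matrix.mul_smul]

/-- The one-parameter subgroups of `K`. -/
lemma exists_compact_curve {S : gl2} (hS : star S = -S) : ∃ c : ℝ → GLH ℝ,
    (∀ t, c t ∈ maxCompact) ∧ c 0 = 1 ∧ ∀ a b, HasDerivAt (fun t => (c t).val a b) (S a b) 0 := by
  let _ : NormedAlgebra ℚ ℍ[ℝ] := NormedAlgebra.restrictScalars ℚ ℝ ℍ[ℝ]
  have hstar : ∀ t : ℝ, star (NormedSpace.exp (t • S)) = NormedSpace.exp (-(t • S)) := by
    intro t
    have e : star (t • S) = -(t • S) := by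
      ext a b : 1
      have := congrFun (congrFun hS a) b
      rw [star_apply] at this
      rw [star_apply, Matrix.smul_apply, Quaternion.star_smul, this, Matrix.neg_apply,
        Matrix.neg_apply, Matrix.smul_apply, smul_neg]
    have h0 : ContinuousStar ℍ[ℝ] := ⟨contDiff_star.continuous⟩
    rw [← e]
    exact NormedSpace.star_exp (t • S)
  have hmul : ∀ A : gl2, NormedSpace.exp A * NormedSpace.exp (-A) = 1 := by
    intro A
    have := Matrix.exp_add_of_commute A (-A) ((Commute.refl A).neg_right)
    rw [add_neg_cancel, NormedSpace.exp_zero] at this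
    exact this.symm
  let c : ℝ → GLH ℝ := fun t => ⟨NormedSpace.exp (t • S), NormedSpace.exp (-(t • S)), hmul _,
    by simpa using hmul (-(t • S))⟩
  refine ⟨c, fun t => mem_maxCompact_of_mul_star ?_, ?_, fun a b => ?_⟩
  · change NormedSpace.exp (t • S) * star (NormedSpace.exp (t • S)) = 1
    rw [hstar, hmul]
  · refine Units.ext ?_
    change NormedSpace.exp ((0 : ℝ) • S) = 1
    rw [zero_smul, NormedSpace.exp_zero]
  · let _ : NormedRing gl2 := Matrix.linftyOpNormedRing
    let _ : NormedAlgebra ℝ gl2 := Matrix.linftyOpNormedAlgebra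
    have : CompleteSpace gl2 := FiniteDimensional.complete ℝ gl2
    have h1 := hasDerivAt_exp_smul_const (𝕂 := ℝ) S (0 : ℝ)
    let e : gl2 →L[ℝ] ℍ[ℝ] := LinearMap.toContinuousLinearMap
      { toFun := fun A => A a b
        map_add' := fun _ _ => rfl
        map_smul' := fun _ _ => rfl }
    have h2 := e.hasFDerivAt.comp_hasDerivAt (0 : ℝ) h1
    have e2 : e (NormedSpace.exp ((0 : ℝ) • S) * S) = S a b := by
      have e3 : NormedSpace.exp ((0 : ℝ) • S) * S = S := by
        rw [zero_smul, NormedSpace.exp_zero, one_mul]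
      exact congrFun (congrFun e3 a) b
    exact h2.congr_deriv e2

lemma hasDerivAt_mul_left_entry (g : GLH ℝ) {c : ℝ → GLH ℝ} {t : ℝ} {X : gl2}
    (hc : ∀ a b, HasDerivAt (fun u => (c u).val a b) (X a b) t) (a b : Fin 2) :
    HasDerivAt (fun u => (g * c u).val a b) ((g.val * X) a b) t := by
  simp only [Units.val_mul, mul_apply]
  exact HasDerivAt.fun_sum fun i _ => (hc i b).const_mul (g.val a i)

lemma lieDeriv_skew (hf : IsSmooth f) (hK : ∀ g, ∀ k ∈ maxCompact, f (g * k) = f g) {S : gl2}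
    (hS : star S = -S) : lieDeriv S f = 0 := by
  funext g
  obtain ⟨c, hc, h0, hd⟩ := exists_compact_curve hS
  have h1 := hf.hasDerivAt (c := fun u => g * c u) (t := 0) (X := S) fun a b => by
    rw [h0, mul_one]
    exact hasDerivAt_mul_left_entry g hd a b
  simp only [hK g _ (hc _), h0, mul_one] at h1
  exact h1.unique (hasDerivAt_const 0 (f g))

lemma lieDeriv_one (hf : IsSmooth f) (hZ : ∀ c hc g, f (zMat c hc * g) = f g) : lieDeriv 1 f = 0 := by
  funext g
  have h1 := hf.hasDerivAt (c := fun u => zMat (Real.exp u) (Real.exp_pos u) * g) (t := 0) (X := 1)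
    fun a b => by
      have e : ∀ u a b, (zMat (Real.exp u) (Real.exp_pos u) * g).val a b = Real.exp u • g.val a b := by
        intro u a b
        rw [Units.val_mul, mul_apply, Fin.sum_univ_two]
        fin_cases a <;> simp [zMat, upper, realUnit, coe_mul_eq_smul]
      rw [mul_one]
      simp only [e]
      exact (Real.hasDerivAt_exp 0).smul_const (g.val a b)
  simp only [hZ] at h1
  have e : zMat (Real.exp 0) (Real.exp_pos 0) * g = g := by
    refine Units.ext ?_
    ext a b : 1
    rw [Units.val_mul, mul_apply, Fin.sum_univ_two]
    fin_cases a <;> simp [zMat, upper, realUnit]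
  rw [e] at h1
  exact h1.unique (hasDerivAt_const 0 (f g))

/-- The Casimir operator on functions invariant under `K` and `Z⁺`. -/
lemma casimir_eq_sum (hf : IsSmooth f) (hK : ∀ g, ∀ k ∈ maxCompact, f (g * k) = f g)
    (hZ : ∀ c hc g, f (zMat c hc * g) = f g) (g : GLH ℝ) :
    casimir f g = (1 / 32) * ∑ i, lieDeriv (cliff i) (lieDeriv (cliff i) f) g := by
  have hone := lieDeriv_one hf hZ
  have hz : lieDeriv 1 (lieDeriv 1 f) g = 0 := by
    rw [hone, lieDeriv_zero]
    rfl
  -- the diagonal part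
  have hdiag : ∀ a : Fin 2, ∑ q : Fin 4, lieDeriv (single a a (quatBasis q))
      (lieDeriv (single a a (star (quatBasis q))) f) g =
      lieDeriv (single a a 1) (lieDeriv (single a a 1) f) g := by
    intro a
    have hs : ∀ q : Fin 4, q ≠ 0 → lieDeriv (single a a (star (quatBasis q))) f = 0 := by
      intro q hq
      refine lieDeriv_skew hf hK ?_
      have : star (quatBasis q) = -quatBasis q := by
        fin_cases q
        · exact absurd rfl hq
        all_goals ext <;> simp [quatBasis]
      rw [this]
      ext i j : 1
      fin_cases a <;> fin_cases i <;> fin_cases j <;> simp [star_apply, single, this]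
    rw [Finset.sum_eq_single 0]
    · simp [quatBasis]
    · intro q _ hq
      rw [hs q hq, lieDeriv_zero]
      rfl
    · simp
  have hsum : lieDeriv (single 0 0 (1 : ℍ[ℝ])) f = -lieDeriv (single 1 1 (1 : ℍ[ℝ])) f := by
    have e : (1 : gl2) = single 0 0 1 + single 1 1 1 := by
      ext i j : 1
      fin_cases i <;> fin_cases j <;> simp [single]
    rw [e, lieDeriv_add_left] at hone
    exact eq_neg_of_add_eq_zero_left hone
  have hneg : ∀ X f', IsSmooth f' → lieDeriv X (-f') = -lieDeriv X f' := by
    intro X f' hf'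
    have := lieDeriv_smul hf' (-1) X
    simpa using this
  have h0 : lieDeriv (cliff 0) (lieDeriv (cliff 0) f) g =
      2 * lieDeriv (single 0 0 1) (lieDeriv (single 0 0 1) f) g +
      2 * lieDeriv (single 1 1 1) (lieDeriv (single 1 1 1) f) g := by
    have e : cliff 0 = single 0 0 1 - single 1 1 1 := by
      rw [cliff_zero]
      ext i j : 1
      fin_cases i <;> fin_cases j <;> simp [single]
    have e1 : lieDeriv (cliff 0) f = (2 : ℂ) • lieDeriv (single 0 0 1) f := by
      rw [e, lieDeriv_sub_left, two_smul]
      nth_rewrite 3 [hsum]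
      rw [sub_eq_add_neg]
    rw [e1, lieDeriv_smul (hf.lieDeriv _), e, lieDeriv_sub_left]
    have e2 : lieDeriv (single 1 1 1) (lieDeriv (single 0 0 1) f) =
        -lieDeriv (single 1 1 1) (lieDeriv (single 1 1 1) f) := by
      rw [hsum, hneg _ _ (hf.lieDeriv _)]
    rw [e2]
    simp only [Pi.smul_apply, Pi.sub_apply, Pi.neg_apply, smul_eq_mul]
    ring
  -- the off-diagonal part
  have hoff : ∀ q : Fin 4, lieDeriv (single 0 1 (quatBasis q))
        (lieDeriv (single 1 0 (star (quatBasis q))) f) g +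
      lieDeriv (single 1 0 (star (quatBasis q)))
        (lieDeriv (single 0 1 (quatBasis q)) f) g =
      (1 / 2) * lieDeriv (cliff q.succ) (lieDeriv (cliff q.succ) f) g := by
    intro q
    have e : cliff q.succ = single 0 1 (quatBasis q) + single 1 0 (star (quatBasis q)) := by
      rw [cliff_succ]
      ext i j : 1
      fin_cases i <;> fin_cases j <;> simp [single]
    have hs : lieDeriv (single 0 1 (quatBasis q) - single 1 0 (star (quatBasis q))) f = 0 := by
      refine lieDeriv_skew hf hK ?_
      ext i j : 1
      fin_cases i <;> fin_cases j <;> simp [star_apply, single]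
    rw [lieDeriv_sub_left, sub_eq_zero] at hs
    have e1 : lieDeriv (cliff q.succ) f = (2 : ℂ) • lieDeriv (single 0 1 (quatBasis q)) f := by
      rw [e, lieDeriv_add_left, ← hs, two_smul]
    rw [e1, lieDeriv_smul (hf.lieDeriv _), ← hs, e, lieDeriv_add_left]
    simp only [Pi.smul_apply, Pi.add_apply, smul_eq_mul]
    ring
  have hbar : ∑ q : Fin 4, lieDeriv (single 1 0 (quatBasis q))
        (lieDeriv (single 0 1 (star (quatBasis q))) f) g =
      ∑ q : Fin 4, lieDeriv (single 1 0 (star (quatBasis q)))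
        (lieDeriv (single 0 1 (quatBasis q)) f) g := by
    refine sum_congr rfl fun q _ => ?_
    have hs : star (quatBasis q) = quatBasis q ∨ star (quatBasis q) = -quatBasis q := by
      fin_cases q
      · left
        simp [quatBasis]
      all_goals right; ext <;> simp [quatBasis]
    rcases hs with hs | hs
    · rw [hs]
    · have hn : ∀ (a b : Fin 2) (f' : GLH ℝ → ℂ), lieDeriv (single a b (-quatBasis q)) f' =
          -lieDeriv (single a b (quatBasis q)) f' := by
        intro a b f'
        have := lieDeriv_smul_left (-1) (single a b (quatBasis q)) f'
        rw [Matrix.smul_single] at this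
        simpa using this
      rw [hs, hn, hn, hneg _ _ (hf.lieDeriv _)]
  rw [casimir, hz, Fin.sum_univ_two, Fin.sum_univ_two, Fin.sum_univ_two, hdiag, hdiag, hbar,
    Fin.sum_univ_succ (n := 4), h0]
  have := sum_congr rfl (s₁ := (Finset.univ : Finset (Fin 4))) fun q _ => hoff q
  rw [sum_add_distrib, ← mul_sum] at this
  linear_combination (1 / 16) * this

/-- The space of smooth functions on `GL₂(ℍ)`. -/
def smoothFn : Submodule ℂ (GLH ℝ → ℂ) where
  carrier := {f | IsSmooth f}
  zero_mem' := isSmooth_zero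
  add_mem' := fun h h' => h.add h'
  smul_mem' := fun c _ h => h.smul c

/-- The action of the Lie algebra on smooth functions. -/
def smLie (X : gl2) : End ℂ smoothFn where
  toFun f := ⟨lieDeriv X f, IsSmooth.lieDeriv f.2 X⟩
  map_add' f f' := Subtype.ext (lieDeriv_add f.2 f'.2 X)
  map_smul' c f := Subtype.ext (lieDeriv_smul f.2 c X)

lemma isLieAction_smLie : IsLieAction smLie :=
  ⟨fun X Y => LinearMap.ext fun f => Subtype.ext (lieDeriv_add_left X Y f),
    fun c X => LinearMap.ext fun f => Subtype.ext (lieDeriv_smul_left c X f),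
    fun X Y => LinearMap.ext fun f => Subtype.ext (lieDeriv_bracket f.2 X Y)⟩

variable {F : GLH ℝ → ℂ}

lemma isLieAction_lieOp (hle : autRep F ≤ smoothSlices) : IsLieAction (lieOp hle) :=
  ⟨fun X Y => LinearMap.ext fun f => Subtype.ext <| funext fun g =>
      congrFun (lieDeriv_add_left X Y fun x => f.1 (x, g.2)) g.1,
    fun c X => LinearMap.ext fun f => Subtype.ext <| funext fun g =>
      congrFun (lieDeriv_smul_left c X fun x => f.1 (x, g.2)) g.1,
    fun X Y => LinearMap.ext fun f => Subtype.ext <| funext fun g =>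
      congrFun (lieDeriv_bracket (hle f.2 g.2) X Y) g.1⟩

lemma compactOp_lieOp (hle : autRep F ≤ smoothSlices) (k : maxCompact) (X : gl2) (f : autRep F) :
    compactOp F k (lieOp hle X f) =
      lieOp hle ((k : GLH ℝ).val * X * ((k : GLH ℝ)⁻¹).val) (compactOp F k f) := by
  refine Subtype.ext (funext fun g => ?_)
  have h := lieDeriv_translate_right (hle f.2 g.2) (k : GLH ℝ)
    ((k : GLH ℝ).val * X * ((k : GLH ℝ)⁻¹).val) g.1
  have e : ((k : GLH ℝ)⁻¹).val * ((k : GLH ℝ).val * X * ((k : GLH ℝ)⁻¹).val) * (k : GLH ℝ).val = X := by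
    rw [mul_assoc, mul_assoc, mul_assoc, (k : GLH ℝ).inv_mul, mul_one, ← mul_assoc,
      (k : GLH ℝ).inv_mul, one_mul]
  rw [e] at h
  have e1 : (g * ((k : GLH ℝ), 1)).2 = g.2 := mul_one _
  have e2 : (fun x => f.1 (x * (k : GLH ℝ), g.2)) = fun x => (compactOp F k f).1 (x, g.2) := by
    funext x
    rw [compactOp_apply, Prod.mk_mul_mk, mul_one]
  change lieDeriv X (fun x => f.1 (x, (g * ((k : GLH ℝ), 1)).2)) (g.1 * (k : GLH ℝ)) = _
  rw [e1, ← h, e2]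
  rfl

/-- `Φ_F` is a spherical vector for the Lie algebra. -/
lemma isSphericalInfty_autVec {r : ℂ} (hF : IsMaassForm r F) (hle : autRep F ≤ smoothSlices) :
    IsSphericalInfty (lieOp hle) (autVec F) (-4 * r ^ 2 - 16) := by
  have hslice : ∀ h : Gfin, IsSmooth (fun x => adelicLift F (x, h)) ∧
      (∀ g, ∀ k ∈ maxCompact, adelicLift F (g * k, h) = adelicLift F (g, h)) ∧
      (∀ c hc g, adelicLift F (zMat c hc * g, h) = adelicLift F (g, h)) ∧
      ∀ g, casimir (fun x => adelicLift F (x, h)) g =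
        -(1 / 2) * (r ^ 2 / 4 + 1) * adelicLift F (g, h) := by
    intro h
    rcases adelicLift_slice hF.left_invariant h with h0 | ⟨γ, hγ⟩
    · rw [funext h0]
      have hz : ∀ X, lieDeriv X (fun _ => (0 : ℂ)) = 0 := lieDeriv_zero
      refine ⟨isSmooth_zero, by simp [h0], by simp [h0], fun g => ?_⟩
      have hz' : ∀ X Y, lieDeriv X (lieDeriv Y fun _ => (0 : ℂ)) g = 0 := by
        intro X Y
        rw [hz, lieDeriv_zero]
        rfl
      simp [casimir, hz', h0]
    · rw [funext hγ]
      simp only [hγ]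
      refine ⟨hF.smooth.translate_left γ, fun g k hk => ?_, fun c hc g => ?_, fun g => ?_⟩
      · rw [← mul_assoc, hF.right_invariant _ hk]
      · have e : γ * (zMat c hc * g) = zMat c hc * (γ * g) := by
          rw [← mul_assoc, ← mul_assoc]
          congr 1
          refine Units.ext ?_
          ext a b : 1
          rw [Units.val_mul, Units.val_mul, mul_apply, mul_apply, Fin.sum_univ_two,
            Fin.sum_univ_two]
          fin_cases a <;> fin_cases b <;> simp [zMat, upper, realUnit, coe_commutes]
        rw [e, hF.zMat_mul]
      · have h1 : ∀ X, lieDeriv X (fun x => F (γ * x)) = fun x => lieDeriv X F (γ * x) := fun X =>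
          funext fun x => lieDeriv_translate_left hF.smooth γ X x
        have h2 : ∀ X Y, lieDeriv X (lieDeriv Y (fun x => F (γ * x))) g =
            lieDeriv X (lieDeriv Y F) (γ * g) := by
          intro X Y
          rw [h1, lieDeriv_translate_left (hF.smooth.lieDeriv Y)]
        rw [← hF.casimir_eq, casimir, casimir]
        simp only [h2]
  refine ⟨fun S hS => ?_, ?_, ?_⟩
  · refine Subtype.ext (funext fun g => ?_)
    obtain ⟨h1, h2, -, -⟩ := hslice g.2
    exact congrFun (lieDeriv_skew h1 h2 hS) g.1
  · refine Subtype.ext (funext fun g => ?_)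
    obtain ⟨h1, -, h3, -⟩ := hslice g.2
    exact congrFun (lieDeriv_one h1 h3) g.1
  · refine Subtype.ext (funext fun g => ?_)
    obtain ⟨h1, h2, h3, h4⟩ := hslice g.2
    have h5 := casimir_eq_sum h1 h2 h3 g.1
    rw [h4] at h5
    have e : (∑ i, lieOp hle (cliff i) (lieOp hle (cliff i) (autVec F))).1 g =
        ∑ i, lieDeriv (cliff i) (lieDeriv (cliff i) fun x => adelicLift F (x, g.2)) g.1 := by
      have := map_sum (LinearMap.proj (R := ℂ) (φ := fun _ : GA => ℂ) g ∘ₗ (autRep F).subtype)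
        (fun i => lieOp hle (cliff i) (lieOp hle (cliff i) (autVec F))) Finset.univ
      exact this
    rw [e]
    change _ = (-4 * r ^ 2 - 16) * adelicLift F (g.1, g.2)
    linear_combination (-32 : ℂ) * h5

/-! ### The spherical function of the principal series and the coordinates on the sphere -/

/-- The hermitian form with matrix `M`, evaluated at the bottom row of `A`. -/
def rowForm (M A : gl2) : ℝ := ((A * M * star A) 1 1).re

lemma rowForm_add (M M' A : gl2) : rowForm (M + M') A = rowForm M A + rowForm M' A := by
  simp [rowForm, mul_add, add_mul]

lemma rowForm_smul (c : ℝ) (M A : gl2) : rowForm (c • M) A = c * rowForm M A := by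
  simp [rowForm]

lemma rowForm_one (g : GLH ℝ) : rowForm 1 g.val = herC g := by
  rw [rowForm, mul_one, mul_star_eq]
  simp

lemma star_smul_gl2 (t : ℝ) (X : gl2) : star (t • X) = t • star X := by
  ext a b : 1
  rw [star_apply, Matrix.smul_apply, Matrix.smul_apply, Quaternion.star_smul, star_apply]

lemma rowForm_line (M : gl2) {g u X : gl2} {t : ℝ} (h : u = g * (1 + t • X)) :
    rowForm M u = rowForm M g + t * rowForm (X * M + M * star X) g +
      t ^ 2 * rowForm (X * M * star X) g := by
  have e : u * M * star u = g * (M + t • (X * M + M * star X) + t ^ 2 • (X * M * star X)) * star g := by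
    rw [h, star_mul, star_add, star_one, star_smul_gl2]
    simp only [mul_add, add_mul, mul_one, one_mul, Matrix.smul_mul, Matrix.mul_smul, mul_assoc,
      smul_add, smul_smul, pow_two]
    abel
  have : rowForm M u = rowForm (M + t • (X * M + M * star X) + t ^ 2 • (X * M * star X)) g :=
    congrArg (fun A : gl2 => (A 1 1).re) e
  rw [this, rowForm_add, rowForm_add, rowForm_smul, rowForm_smul]

lemma cliff_sq (i : Fin 5) : cliff i * cliff i = 1 := by
  have := cliff_mul_add i i
  rw [kronR, if_pos rfl, mul_one, ← two_smul ℝ] at this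
  exact smul_right_injective gl2 (two_ne_zero (α := ℝ)) this

/-- The adjugate of `g g*`. -/
def herAdj (g : GLH ℝ) : gl2 := !![(herC g : ℍ[ℝ]), -herB g; -star (herB g), (herA g : ℍ[ℝ])]

lemma mul_star_mul_herAdj (g : GLH ℝ) : g.val * star g.val * herAdj g = herN g • (1 : gl2) := by
  rw [mul_star_eq, herAdj]
  ext i j : 1
  rw [Matrix.smul_apply, mul_apply, Fin.sum_univ_two]
  fin_cases i <;> fin_cases j
  · simp only [Fin.zero_eta, of_apply, cons_val', cons_val_zero,
      cons_val_fin_one, cons_val_one, mul_neg, self_mul_star,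
      one_apply_eq]
    rw [← coe_mul, ← sub_eq_add_neg, ← coe_sub, herN, ← coe_one,
      ← coe_smul, smul_eq_mul, mul_one]
  · simp [coe_commutes (herA g) (herB g)]
  · simp [coe_commutes (herC g) (star (herB g))]
  · simp only [Fin.mk_one, of_apply, cons_val', cons_val_zero,
      cons_val_fin_one, cons_val_one, mul_neg, star_mul_self,
      one_apply_eq]
    rw [← coe_mul, ← coe_neg, ← coe_add, herN, ← coe_one,
      ← coe_smul, smul_eq_mul, mul_one]
    congr 1
    ring

/-- The trace identity which makes the reduced norm invariant to first order in traceless directions. -/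
lemma reTr_herAdj_mul (g : GLH ℝ) (X : gl2) : reTr (herAdj g * (g.val * X * star g.val)) =
    herN g * reTr X := by
  have h1 : star g.val * herAdj g * g.val = herN g • (1 : gl2) := by
    have h2 : star g.val * herAdj g = herN g • (g⁻¹).val := by
      have := congrArg (fun A => (g⁻¹).val * A) (mul_star_mul_herAdj g)
      simp only [Matrix.mul_smul, mul_one] at this
      rw [← this, mul_assoc, ← mul_assoc, g.inv_mul, one_mul]
    rw [h2, Matrix.smul_mul, g.inv_mul]
  rw [← mul_assoc, reTr_mul_comm, ← mul_assoc, ← mul_assoc, h1, Matrix.smul_mul, one_mul, reTr_smul]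

lemma hasDerivAt_quartic (a b c d e : ℝ) :
    HasDerivAt (fun t : ℝ => a + b * t + c * t ^ 2 + d * t ^ 3 + e * t ^ 4) b 0 := by
  have h1 := (hasDerivAt_id (0 : ℝ)).const_mul b
  have h2 := (hasDerivAt_pow 2 (0 : ℝ)).const_mul c
  have h3 := (hasDerivAt_pow 3 (0 : ℝ)).const_mul d
  have h4 := (hasDerivAt_pow 4 (0 : ℝ)).const_mul e
  have := (((h1.const_add a).add h2).add h3).add h4
  refine (this.congr_deriv (by simp)).congr_of_eventuallyEq (.of_forall fun t => ?_)
  simp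

lemma normSq_combination (r s : ℝ) (x y : ℍ[ℝ]) : normSq (r • x + s • y) =
    r ^ 2 * normSq x + 2 * r * s * (x * star y).re + s ^ 2 * normSq y := by
  simp only [normSq_def', re_add, imI_add, imJ_add,
    imK_add, re_smul, imI_smul, imJ_smul,
    imK_smul, smul_eq_mul, re_mul, re_star, imI_star,
    imJ_star, imK_star]
  ring

lemma herC_line (i : Fin 5) {g u : GLH ℝ} {t : ℝ} (h : u.val = g.val * (1 + t • cliff i)) :
    herC u = herC g + 2 * rowForm (cliff i) g.val * t + herC g * t ^ 2 := by
  rw [← rowForm_one, rowForm_line 1 h, mul_one, one_mul, star_cliff, cliff_sq, rowForm_add, rowForm_one]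
  ring

/-- The reduced norm has vanishing derivative in traceless hermitian directions. -/
lemma exists_herN_line (i : Fin 5) (g : GLH ℝ) : ∃ φ : ℝ → ℝ, HasDerivAt φ 0 0 ∧ φ 0 = herN g ∧
    ∀ (t : ℝ) (u : GLH ℝ), u.val = g.val * (1 + t • cliff i) → herN u = φ t := by
  set P : gl2 := g.val * cliff i * star g.val with hP
  set p := (P 0 0).re
  set q := (P 1 1).re
  set b := P 0 1
  have hH : ∀ (t : ℝ) (u : GLH ℝ), u.val = g.val * (1 + t • cliff i) →
      u.val * star u.val = (1 + t ^ 2) • (g.val * star g.val) + (2 * t) • P := by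
    intro t u h
    rw [h, star_mul, star_add, star_one, star_smul_gl2, star_cliff]
    have e : (1 + t • cliff i) * (1 + t • cliff i) = (1 + t ^ 2) • (1 : gl2) + (2 * t) • cliff i := by
      simp only [mul_add, add_mul, mul_one, one_mul, Matrix.smul_mul, Matrix.mul_smul, cliff_sq]
      module
    calc g.val * (1 + t • cliff i) * ((1 + t • cliff i) * star g.val)
        = g.val * ((1 + t • cliff i) * (1 + t • cliff i)) * star g.val := by simp only [mul_assoc]
      _ = _ := by
        rw [e, mul_add, add_mul, hP]
        simp only [Matrix.smul_mul, Matrix.mul_smul, mul_one]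
  have hA : ∀ (t : ℝ) (u : GLH ℝ), u.val = g.val * (1 + t • cliff i) →
      herA u = (1 + t ^ 2) * herA g + 2 * t * p ∧ herC u = (1 + t ^ 2) * herC g + 2 * t * q ∧
      herB u = (1 + t ^ 2) • herB g + (2 * t) • b := by
    intro t u h
    have e := hH t u h
    rw [mul_star_eq, mul_star_eq] at e
    refine ⟨?_, ?_, ?_⟩
    · simpa using congrArg (fun A : gl2 => (A 0 0).re) e
    · simpa using congrArg (fun A : gl2 => (A 1 1).re) e
    · simpa using congrArg (fun A : gl2 => A 0 1) e
  have htr : herC g * p + herA g * q = 2 * (herB g * star b).re := by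
    have h1 := reTr_herAdj_mul g (cliff i)
    have hPs : star P = P := by
      rw [hP, star_mul, star_mul, star_star, star_cliff, mul_assoc]
    have h10 : P 1 0 = star b := by
      have := congrFun (congrFun hPs 1) 0
      rw [star_apply] at this
      exact this.symm
    rw [reTr_cliff, mul_zero, ← hP, reTr, mul_apply, mul_apply, Fin.sum_univ_two,
      Fin.sum_univ_two, h10] at h1
    have h2 : (star (herB g) * b).re = (herB g * star b).re := by
      simp only [re_mul, re_star, imI_star, imJ_star,
        imK_star]
      ring
    have e1 : ∀ (c : ℝ) (x : ℍ[ℝ]), ((c : ℍ[ℝ]) * x).re = c * x.re := by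
      intro c x
      simp
    simp only [herAdj, of_apply, cons_val', cons_val_zero,
      cons_val_fin_one, cons_val_one, re_add, neg_mul, re_neg,
      e1] at h1
    change herC g * p + -(herB g * star b).re + (-(star (herB g) * b).re + herA g * q) = 0 at h1
    linarith
  refine ⟨fun t => ((1 + t ^ 2) * herA g + 2 * t * p) * ((1 + t ^ 2) * herC g + 2 * t * q) -
    ((1 + t ^ 2) ^ 2 * normSq (herB g) + 2 * (1 + t ^ 2) * (2 * t) * (herB g * star b).re +
      (2 * t) ^ 2 * normSq b), ?_, by simp [herN], fun t u h => ?_⟩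
  · have := hasDerivAt_quartic (herN g) 0 (2 * herN g + 4 * p * q - 4 * normSq b) 0 (herN g)
    refine this.congr_of_eventuallyEq (Filter.Eventually.of_forall fun t => ?_)
    simp only [herN]
    linear_combination (2 * t + 2 * t ^ 3) * htr
  · obtain ⟨h1, h2, h3⟩ := hA t u h
    rw [herN, h1, h2, h3, normSq_combination]

/-- The `i`-th coordinate of the point of the sphere `S⁴ = ℙ¹(ℍ)` given by the bottom row. -/
def omegaFn (i : Fin 5) (g : GLH ℝ) : ℂ := ((rowForm (cliff i) g.val / herC g : ℝ) : ℂ)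

/-- The spherical function of `Ind(χ_s)`, which is equal to `1` on `K`. -/
def sphFun (s : ℂ) (g : GLH ℝ) : ℂ :=
  Complex.exp ((1 + s) * ((Real.log (herN g) - 2 * Real.log (herC g) : ℝ) : ℂ))

lemma sphFun_ne_zero (s : ℂ) (g : GLH ℝ) : sphFun s g ≠ 0 := Complex.exp_ne_zero _

lemma contDiff_re : ContDiff ℝ (⊤ : ℕ∞) fun x : ℍ[ℝ] => x.re :=
  (LinearMap.toContinuousLinearMap
    { toFun := fun x : ℍ[ℝ] => x.re
      map_add' := fun _ _ => rfl
      map_smul' := fun _ _ => rfl }).contDiff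

lemma contDiff_rowForm (M : gl2) : ContDiff ℝ (⊤ : ℕ∞)
    fun A : Fin 2 → Fin 2 → ℍ[ℝ] => rowForm M (Matrix.of A) := by
  have e : (fun A : Fin 2 → Fin 2 → ℍ[ℝ] => rowForm M (Matrix.of A)) = fun A =>
      (∑ b, (∑ c, A 1 c * M c b) * star (A 1 b)).re := by
    funext A
    rw [rowForm, mul_apply]
    simp only [mul_apply, of_apply, star_apply]
  rw [e]
  refine contDiff_re.comp (ContDiff.sum fun b _ => ContDiff.mul (ContDiff.sum fun c _ => ?_) ?_)
  · exact (contDiff_entry 1 c).mul contDiff_const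
  · exact contDiff_star.comp (contDiff_entry 1 b)

lemma rowForm_one_ne_zero {A : Fin 2 → Fin 2 → ℍ[ℝ]} (hA : A ∈ unitSet) :
    rowForm 1 (Matrix.of A) ≠ 0 := by
  obtain ⟨g, rfl⟩ := exists_arr hA
  change rowForm 1 g.val ≠ 0
  rw [rowForm_one]
  exact (herC_pos g).ne'

lemma isSmooth_omegaFn (i : Fin 5) : IsSmooth (omegaFn i) := by
  refine isSmooth_of_eqOn (φ := fun A => ((rowForm (cliff i) (Matrix.of A) /
    rowForm 1 (Matrix.of A) : ℝ) : ℂ)) ?_ fun g => by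
      change ((rowForm (cliff i) g.val / rowForm 1 g.val : ℝ) : ℂ) = _
      rw [rowForm_one, omegaFn]
  exact Complex.ofRealCLM.contDiff.comp_contDiffOn
    ((contDiff_rowForm _).contDiffOn.div (contDiff_rowForm _).contDiffOn fun A hA =>
      rowForm_one_ne_zero hA)

lemma isSmooth_sphFun (s : ℂ) : IsSmooth (sphFun s) := by
  refine isSmooth_of_eqOn (φ := fun A => Complex.exp ((1 + s) * ((Real.log (arrN A) -
    2 * Real.log (rowForm 1 (Matrix.of A)) : ℝ) : ℂ))) ?_ fun g => by
      change Complex.exp ((1 + s) * ((Real.log (arrN (arr g)) - 2 * Real.log (rowForm 1 g.val) : ℝ) : ℂ)) = _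
      rw [rowForm_one, arrN_arr, sphFun]
  refine ContDiffOn.cexp (contDiffOn_const.mul (Complex.ofRealCLM.contDiff.comp_contDiffOn ?_))
  refine ContDiffOn.sub (contDiff_arrN.contDiffOn.log fun A hA => mem_unitSet_iff.1 hA)
    (contDiffOn_const.mul ((contDiff_rowForm 1).contDiffOn.log fun A hA => rowForm_one_ne_zero hA))

lemma lieDeriv_omegaFn (j k : Fin 5) : lieDeriv (cliff k) (omegaFn j) =
    fun g => 2 * (kron j k - omegaFn j g * omegaFn k g) := by
  funext g
  have hC := (herC_pos g).ne'
  set ρ := rowForm (cliff j) g.val with hρ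
  set σ := rowForm (cliff k) g.val with hσ
  set τ := rowForm (cliff k * cliff j * cliff k) g.val
  have h1 := hasDerivAt_quartic ρ (2 * kronR j k * herC g) τ 0 0
  have h2 := hasDerivAt_quartic (herC g) (2 * σ) (herC g) 0 0
  have h3 := (h1.div h2 (by simpa using hC)).ofReal_comp
  refine (lieDeriv_eq_of_line (isSmooth_omegaFn j) (fun t u h => ?_) h3).trans ?_
  · have e : rowForm (cliff j) u.val = ρ + 2 * kronR j k * herC g * t + τ * t ^ 2 := by
      rw [rowForm_line _ h, star_cliff, add_comm (cliff k * cliff j), cliff_mul_add, rowForm_smul,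
        rowForm_one]
      ring
    rw [omegaFn, e, herC_line k h, ← hσ]
    simp
  · rw [omegaFn, omegaFn, kron_eq, ← hρ, ← hσ]
    simp only [ne_eq, OfNat.ofNat_ne_zero, not_false_eq_true, zero_pow, mul_zero, add_zero]
    norm_cast
    field_simp

lemma lieDeriv_sphFun (s : ℂ) (k : Fin 5) : lieDeriv (cliff k) (sphFun s) =
    (2 * (-2 * (1 + s))) • (omegaFn k * sphFun s) := by
  funext g
  have hC := (herC_pos g).ne'
  set σ := rowForm (cliff k) g.val with hσ
  obtain ⟨φ, h1, h0, hφ⟩ := exists_herN_line k g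
  have h2 := hasDerivAt_quartic (herC g) (2 * σ) (herC g) 0 0
  have h3 := ((h1.log (by rw [h0]; exact (herN_pos g).ne')).sub
    ((h2.log (by simpa using hC)).const_mul 2)).ofReal_comp
  have h4 := (h3.const_mul (1 + s)).cexp
  refine (lieDeriv_eq_of_line (isSmooth_sphFun s) (fun t u h => ?_) h4).trans ?_
  · rw [sphFun, hφ t u h, herC_line k h, ← hσ]
    simp
  · simp only [Pi.smul_apply, Pi.mul_apply, Pi.sub_apply, smul_eq_mul, omegaFn, sphFun, h0, ← hσ]
    simp only [ne_eq, OfNat.ofNat_ne_zero, not_false_eq_true, zero_pow, mul_zero, add_zero, zero_div,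
      zero_sub]
    push_cast
    ring

lemma sum_omegaFn_sq (g : GLH ℝ) : ∑ i, omegaFn i g * omegaFn i g = 1 := by
  have hC := (herC_pos g).ne'
  have key : ∑ i, rowForm (cliff i) g.val * rowForm (cliff i) g.val = herC g * herC g := by
    have e0 : rowForm (cliff 0) g.val =
        normSq (g.val 1 0) - normSq (g.val 1 1) := by
      simp [rowForm, cliff_zero, mul_apply, Fin.sum_univ_two, star_apply,
        self_mul_star, sub_eq_add_neg]
    have e1 : ∀ q : Fin 4, rowForm (cliff q.succ) g.val =
        2 * (g.val 1 0 * quatBasis q * star (g.val 1 1)).re := by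
      intro q
      simp only [rowForm, cliff_succ, mul_apply, Fin.sum_univ_two, star_apply,
        of_apply, cons_val', cons_val_zero, cons_val_fin_one,
        cons_val_one, mul_zero, zero_add, add_zero, re_add]
      simp only [re_mul, imI_mul, imJ_mul, imK_mul,
        re_star, imI_star, imJ_star, imK_star]
      ring
    have e2 : ∀ c d : ℍ[ℝ], ∑ q : Fin 4, (c * quatBasis q * star d).re ^ 2 =
        normSq c * normSq d := by
      intro c d
      simp only [Fin.sum_univ_four, quatBasis, cons_val_zero, cons_val_one,
        Matrix.cons_val, normSq_def', re_mul, imI_mul,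
        imJ_mul, imK_mul, re_star, imI_star,
        imJ_star, imK_star, quat_re, quat_imI, quat_imJ, quat_imK,
        re_one, imI_one, imJ_one, imK_one]
      ring
    rw [Fin.sum_univ_succ, e0]
    simp only [e1]
    have e3 : ∑ q : Fin 4, 2 * (g.val 1 0 * quatBasis q * star (g.val 1 1)).re *
        (2 * (g.val 1 0 * quatBasis q * star (g.val 1 1)).re) =
        4 * (normSq (g.val 1 0) * normSq (g.val 1 1)) := by
      rw [← e2, mul_sum]
      exact sum_congr rfl fun q _ => by ring
    rw [e3, herC]
    ring
  have e : ∑ i, omegaFn i g * omegaFn i g =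
      (((∑ i, rowForm (cliff i) g.val * rowForm (cliff i) g.val) / (herC g * herC g) : ℝ) : ℂ) := by
    rw [Finset.sum_div]
    push_cast
    refine sum_congr rfl fun i _ => ?_
    rw [omegaFn]
    push_cast
    rw [div_mul_div_comm]
  rw [e, key, div_self (mul_ne_zero hC hC)]
  simp

/-! ### Transformation properties of the coordinates on the sphere -/

lemma her_mul_compact (g : GLH ℝ) {k : GLH ℝ} (hk : k ∈ maxCompact) :
    herN (g * k) = herN g ∧ herC (g * k) = herC g := by
  have e : (g * k).val * star (g * k).val = g.val * star g.val := by
    rw [Units.val_mul, star_mul, mul_assoc, ← mul_assoc k.val, mul_star_of_mem hk, one_mul]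
  rw [mul_star_eq, mul_star_eq] at e
  have hA : herA (g * k) = herA g := by simpa using congrArg (fun A : gl2 => (A 0 0).re) e
  have hC : herC (g * k) = herC g := by simpa using congrArg (fun A : gl2 => (A 1 1).re) e
  have hB : herB (g * k) = herB g := congrArg (fun A : gl2 => A 0 1) e
  exact ⟨by rw [herN, herN, hA, hB, hC], hC⟩

lemma her_upper_mul (a d : ℍ[ℝ]ˣ) (x : ℍ[ℝ]) (g : GLH ℝ) :
    herC (upper a d x * g) = normSq (d : ℍ[ℝ]) * herC g ∧
    herN (upper a d x * g) = normSq (a : ℍ[ℝ]) * normSq (d : ℍ[ℝ]) * herN g := by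
  have h0 : ∀ j, (upper a d x * g).val 0 j = a * g.val 0 j + x * g.val 1 j := by
    intro j
    simp [upper, mul_apply, Fin.sum_univ_two]
  have h1 : ∀ j, (upper a d x * g).val 1 j = d * g.val 1 j := by
    intro j
    simp [upper, mul_apply, Fin.sum_univ_two]
  have hC : herC (upper a d x * g) = normSq (d : ℍ[ℝ]) * herC g := by
    rw [herC, h1, h1, map_mul, map_mul, herC]
    ring
  refine ⟨hC, ?_⟩
  have hd : normSq (d : ℍ[ℝ]) ≠ 0 := normSq_ne_zero.2 d.ne_zero
  have hCg := (herC_pos g).ne'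
  have hB : herB (upper a d x * g) = (a * herB g + herC g • x) * star (d : ℍ[ℝ]) := by
    rw [herB, h0, h0, h1, h1, star_mul, star_mul]
    have e1 : herC g • x = x * (g.val 1 0 * star (g.val 1 0) + g.val 1 1 * star (g.val 1 1)) := by
      rw [self_mul_star, self_mul_star, ← coe_add,
        mul_coe_eq_smul]
      rfl
    rw [e1, herB]
    noncomm_ring
  have hperp : ∀ j, (upper a d x * g).val 0 j - (herC (upper a d x * g))⁻¹ •
      (herB (upper a d x * g) * (upper a d x * g).val 1 j) =
      a * (g.val 0 j - (herC g)⁻¹ • (herB g * g.val 1 j)) := by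
    intro j
    have e2 : (a * herB g + herC g • x) * star (d : ℍ[ℝ]) * (d * g.val 1 j) =
        normSq (d : ℍ[ℝ]) • ((a * herB g + herC g • x) * g.val 1 j) := by
      rw [mul_assoc, ← mul_assoc (star (d : ℍ[ℝ])), star_mul_self,
        coe_mul_eq_smul, mul_smul_comm]
    rw [h0, h1, hB, hC, e2, smul_smul, mul_inv, mul_comm _ (herC g)⁻¹, mul_assoc,
      inv_mul_cancel₀ hd, mul_one, add_mul, smul_add, smul_mul_assoc, smul_smul,
      inv_mul_cancel₀ hCg, one_smul, mul_sub, mul_smul_comm, mul_assoc]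
    abel
  rw [herN_eq, hperp, hperp, hC, map_mul, map_mul, herN_eq g]
  ring

lemma sphFun_mul_compact (s : ℂ) (g : GLH ℝ) {k : GLH ℝ} (hk : k ∈ maxCompact) :
    sphFun s (g * k) = sphFun s g := by
  rw [sphFun, (her_mul_compact g hk).1, (her_mul_compact g hk).2, sphFun]

lemma herN_one : herN 1 = 1 := by simp [herN, herA, herB, herC]

lemma herC_one : herC 1 = 1 := by simp [herC]

lemma sphFun_one (s : ℂ) : sphFun s 1 = 1 := by simp [sphFun, herN_one, herC_one]

lemma sphFun_of_mem (s : ℂ) {k : GLH ℝ} (hk : k ∈ maxCompact) : sphFun s k = 1 := by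
  have := sphFun_mul_compact s 1 hk
  rwa [one_mul, sphFun_one] at this

lemma sphFun_upper_mul (s : ℂ) (a d : ℍ[ℝ]ˣ) (x : ℍ[ℝ]) (g : GLH ℝ) : sphFun s (upper a d x * g) =
    ((normSq ((a * d⁻¹ : ℍ[ℝ]ˣ) : ℍ[ℝ]) : ℝ) : ℂ) *
      ((normSq ((a * d⁻¹ : ℍ[ℝ]ˣ) : ℍ[ℝ]) : ℝ) : ℂ) ^ s * sphFun s g := by
  have hpos : ∀ u : ℍ[ℝ]ˣ, 0 < normSq (u : ℍ[ℝ]) := fun u =>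
    lt_of_le_of_ne normSq_nonneg (normSq_ne_zero.2 u.ne_zero).symm
  have ha := hpos a
  have hd := hpos d
  have had := hpos (a * d⁻¹)
  set ν := normSq ((a * d⁻¹ : ℍ[ℝ]ˣ) : ℍ[ℝ]) with hν
  have hν' : Real.log ν = Real.log (normSq (a : ℍ[ℝ])) - Real.log (normSq (d : ℍ[ℝ])) := by
    rw [← Real.log_div ha.ne' hd.ne']
    congr 1
    rw [eq_div_iff hd.ne', hν, ← map_mul, ← Units.val_mul, inv_mul_cancel_right]
  have e : Real.log (herN (upper a d x * g)) - 2 * Real.log (herC (upper a d x * g)) =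
      Real.log ν + (Real.log (herN g) - 2 * Real.log (herC g)) := by
    rw [(her_upper_mul a d x g).1, (her_upper_mul a d x g).2,
      Real.log_mul (mul_pos ha hd).ne' (herN_pos g).ne', Real.log_mul ha.ne' hd.ne',
      Real.log_mul hd.ne' (herC_pos g).ne', hν']
    ring
  have e2 : (ν : ℂ) * (ν : ℂ) ^ s = Complex.exp ((1 + s) * ((Real.log ν : ℝ) : ℂ)) := by
    have hν0 : (ν : ℂ) ≠ 0 := Complex.ofReal_ne_zero.2 had.ne'
    rw [Complex.cpow_def_of_ne_zero hν0, ← Complex.ofReal_log had.le, add_mul, one_mul, Complex.exp_add,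
      ← Complex.ofReal_exp, Real.exp_log had, mul_comm s]
  rw [sphFun, e, e2, sphFun, ← Complex.exp_add]
  congr 1
  push_cast
  ring

/-! ### The submodule of the principal series generated by the spherical vector -/

/-- The spherical function, as an element of the module of smooth functions. -/
def sphVec (s : ℂ) : smoothFn := ⟨sphFun s, isSmooth_sphFun s⟩

lemma sum_lieDeriv_sphFun (s : ℂ) : ∑ i, lieDeriv (cliff i) (lieDeriv (cliff i) (sphFun s)) =
    (16 * s ^ 2 - 16) • sphFun s := by
  have h : ∀ i, lieDeriv (cliff i) (lieDeriv (cliff i) (sphFun s)) = fun g =>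
      2 * (-2 * (1 + s)) * (2 * (1 - omegaFn i g * omegaFn i g) +
        2 * (-2 * (1 + s)) * (omegaFn i g * omegaFn i g)) * sphFun s g := by
    intro i
    rw [lieDeriv_sphFun, lieDeriv_smul ((isSmooth_omegaFn i).mul (isSmooth_sphFun s)),
      lieDeriv_mul (isSmooth_omegaFn i) (isSmooth_sphFun s), lieDeriv_omegaFn, lieDeriv_sphFun]
    funext g
    simp only [Pi.smul_apply, Pi.add_apply, Pi.mul_apply, smul_eq_mul, kron, if_true]
    ring
  funext g
  simp only [h, Finset.sum_apply]
  rw [← sum_mul, ← mul_sum, sum_add_distrib, ← mul_sum, ← mul_sum,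
    sum_sub_distrib, sum_omegaFn_sq]
  simp
  ring

lemma isSphericalInfty_sphVec (s : ℂ) : IsSphericalInfty smLie (sphVec s) (16 * s ^ 2 - 16) := by
  refine ⟨fun S hS => Subtype.ext ?_, Subtype.ext ?_, Subtype.ext ?_⟩
  · exact lieDeriv_skew (isSmooth_sphFun s) (fun g k hk => sphFun_mul_compact s g hk) hS
  · refine lieDeriv_one (isSmooth_sphFun s) fun c hc g => ?_
    change sphFun s _ = sphFun s g
    rw [zMat, sphFun_upper_mul, mul_inv_cancel]
    simp
  · have := map_sum smoothFn.subtype (fun i => smLie (cliff i) (smLie (cliff i) (sphVec s))) Finset.univ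
    exact this.trans (sum_lieDeriv_sphFun s)

/-- The product of the coordinates `ω_i` with `i` in a list. -/
def wordFn (l : List (Fin 5)) : GLH ℝ → ℂ := (l.map omegaFn).prod

lemma wordFn_cons (i : Fin 5) (l : List (Fin 5)) : wordFn (i :: l) = omegaFn i * wordFn l := by
  simp [wordFn]

lemma isSmooth_wordFn (l : List (Fin 5)) : IsSmooth (wordFn l) := by
  induction l with
  | nil => exact isSmooth_const 1
  | cons i l ih => rw [wordFn_cons]; exact (isSmooth_omegaFn i).mul ih

/-- The polynomials of degree at most `n` in the coordinates `ω_i`. -/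
def wordDeg (n : ℕ) : Submodule ℂ (GLH ℝ → ℂ) := span ℂ (wordFn '' {l | l.length ≤ n})

lemma wordFn_mem {n : ℕ} {l : List (Fin 5)} (h : l.length ≤ n) : wordFn l ∈ wordDeg n :=
  subset_span ⟨l, h, rfl⟩

lemma wordDeg_mono {m n : ℕ} (h : m ≤ n) : wordDeg m ≤ wordDeg n :=
  span_mono (Set.image_mono fun _ hl => le_trans hl h)

lemma omegaFn_mul_mem {n : ℕ} (i : Fin 5) {f : GLH ℝ → ℂ} (hf : f ∈ wordDeg n) :
    omegaFn i * f ∈ wordDeg (n + 1) := by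
  have : wordDeg n ≤ (wordDeg (n + 1)).comap (LinearMap.mulLeft ℂ (omegaFn i)) := by
    refine Submodule.span_le.2 ?_
    rintro _ ⟨l, hl, rfl⟩
    change omegaFn i * wordFn l ∈ wordDeg (n + 1)
    rw [← wordFn_cons]
    exact wordFn_mem (by simpa using hl)
  exact this hf

lemma exists_lieDeriv_wordFn (k : Fin 5) (l : List (Fin 5)) : ∃ R ∈ wordDeg l.length,
    lieDeriv (cliff k) (wordFn l) = R - (2 * l.length : ℂ) • (omegaFn k * wordFn l) := by
  induction l with
  | nil =>
    refine ⟨0, Submodule.zero_mem _, ?_⟩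
    have : lieDeriv (cliff k) (wordFn []) = 0 := lieDeriv_const 1 _
    rw [this]
    simp
  | cons i l ih =>
    obtain ⟨R, hR, e⟩ := ih
    refine ⟨omegaFn i * R + (2 * kron i k) • wordFn l, add_mem (omegaFn_mul_mem i hR)
      (smul_mem _ _ (wordFn_mem (by simp))), ?_⟩
    rw [wordFn_cons, lieDeriv_mul (isSmooth_omegaFn i) (isSmooth_wordFn l), e, lieDeriv_omegaFn]
    funext g
    simp only [Pi.add_apply, Pi.mul_apply, Pi.sub_apply, Pi.smul_apply, smul_eq_mul, List.length_cons]
    push_cast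
    ring

/-- The space of functions generated by the spherical function under the Lie algebra. -/
def sphSpan (s : ℂ) : Submodule ℂ smoothFn := cyclicSpan (fun i => smLie (cliff i)) (sphVec s)

lemma smLie_mem_sphSpan (s : ℂ) (X : gl2) {w : smoothFn} (hw : w ∈ sphSpan s) :
    smLie X w ∈ sphSpan s :=
  (isSphericalInfty_sphVec s).lie_mem isLieAction_smLie X hw

/-- Away from the points of reducibility, the spherical vector generates all polynomials in the
`ω_i`, since the leading terms of its derivatives do not vanish. -/
lemma exists_mem_sphSpan {s : ℂ} (hs : ∀ n : ℕ, -2 * (1 + s) ≠ n) {n : ℕ} {f : GLH ℝ → ℂ}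
    (hf : f ∈ wordDeg n) : ∃ w ∈ sphSpan s, (w : GLH ℝ → ℂ) = f * sphFun s := by
  suffices h : wordDeg n ≤ ((sphSpan s).map smoothFn.subtype).comap (LinearMap.mulRight ℂ (sphFun s)) by
    exact h hf
  have h0 : wordFn [] * sphFun s ∈ (sphSpan s).map smoothFn.subtype := by
    rw [show wordFn [] = 1 from rfl, one_mul]
    exact ⟨sphVec s, self_mem_cyclicSpan _ _, rfl⟩
  clear hf f
  induction n with
  | zero =>
    refine Submodule.span_le.2 ?_
    rintro _ ⟨l, hl, rfl⟩
    rw [List.length_eq_zero_iff.1 (Nat.le_zero.1 hl)]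
    exact h0
  | succ n ih =>
    refine Submodule.span_le.2 ?_
    rintro _ ⟨l, hl, rfl⟩
    rcases l with _ | ⟨k, l⟩
    · exact h0
    have hl' : l.length ≤ n := by simpa using hl
    obtain ⟨R, hR, e⟩ := exists_lieDeriv_wordFn k l
    obtain ⟨w, hw, hwe⟩ := ih (wordFn_mem hl')
    have hD : lieDeriv (cliff k) (wordFn l * sphFun s) ∈ (sphSpan s).map smoothFn.subtype := by
      refine ⟨smLie (cliff k) w, smLie_mem_sphSpan s _ hw, ?_⟩
      exact congrArg (lieDeriv (cliff k)) hwe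
    have hR' : R * sphFun s ∈ (sphSpan s).map smoothFn.subtype := ih (wordDeg_mono hl' hR)
    have hne : 2 * (-2 * (1 + s) - l.length) ≠ 0 := mul_ne_zero two_ne_zero (sub_ne_zero.2 (hs _))
    change wordFn (k :: l) * sphFun s ∈ (sphSpan s).map smoothFn.subtype
    have : wordFn (k :: l) * sphFun s = (2 * (-2 * (1 + s) - l.length))⁻¹ •
        (lieDeriv (cliff k) (wordFn l * sphFun s) - R * sphFun s) := by
      rw [eq_inv_smul_iff₀ hne, lieDeriv_mul (isSmooth_wordFn l) (isSmooth_sphFun s), e,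
        lieDeriv_sphFun, wordFn_cons]
      funext g
      simp only [Pi.add_apply, Pi.mul_apply, Pi.sub_apply, Pi.smul_apply, smul_eq_mul]
      ring
    rw [this]
    exact smul_mem _ _ (sub_mem hD hR')

/-! ### Translation by the maximal compact subgroup -/

/-- Right translation of smooth functions. -/
def smRight (k : GLH ℝ) : End ℂ smoothFn where
  toFun f := ⟨fun g => f.1 (g * k), IsSmooth.translate_right f.2 k⟩
  map_add' _ _ := rfl
  map_smul' _ _ := rfl

lemma smRight_smLie (k : GLH ℝ) (X : gl2) (f : smoothFn) :
    smRight k (smLie X f) = smLie (k.val * X * (k⁻¹).val) (smRight k f) := by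
  refine Subtype.ext (funext fun g => ?_)
  have h := lieDeriv_translate_right f.2 k (k.val * X * (k⁻¹).val) g
  have e : (k⁻¹).val * (k.val * X * (k⁻¹).val) * k.val = X := by
    rw [mul_assoc, mul_assoc, mul_assoc, k.inv_mul, mul_one, ← mul_assoc, k.inv_mul, one_mul]
  rw [e] at h
  exact h.symm

lemma smRight_sphVec (s : ℂ) {k : GLH ℝ} (hk : k ∈ maxCompact) : smRight k (sphVec s) = sphVec s :=
  Subtype.ext (funext fun g => sphFun_mul_compact s g hk)

lemma smRight_mem_cyclicFilt (s : ℂ) {k : GLH ℝ} (hk : k ∈ maxCompact) {n : ℕ} {w : smoothFn}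
    (hw : w ∈ cyclicFilt (fun i => smLie (cliff i)) (sphVec s) n) :
    smRight k w ∈ cyclicFilt (fun i => smLie (cliff i)) (sphVec s) n :=
  isLieAction_smLie.compact_mem hk (fun M u => smRight_smLie k M u) (smRight_sphVec s hk) hw

/-- The smooth functions with the transformation property of the principal series. -/
def inducedFn (s : ℂ) : Submodule ℂ smoothFn where
  carrier := {f | ∀ (a d : ℍ[ℝ]ˣ) x g, f.1 (upper a d x * g) =
    ((normSq ((a * d⁻¹ : ℍ[ℝ]ˣ) : ℍ[ℝ]) : ℝ) : ℂ) *
      ((normSq ((a * d⁻¹ : ℍ[ℝ]ˣ) : ℍ[ℝ]) : ℝ) : ℂ) ^ s * f.1 g}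
  zero_mem' := by simp
  add_mem' {f f'} h h' a d x g := by
    change f.1 _ + f'.1 _ = _ * (f.1 g + f'.1 g)
    rw [h, h', mul_add]
  smul_mem' c f h a d x g := by
    change c * f.1 _ = _ * (c * f.1 g)
    rw [h]
    ring

lemma smLie_mem_inducedFn {s : ℂ} {f : smoothFn} (hf : f ∈ inducedFn s) (X : gl2) :
    smLie X f ∈ inducedFn s := by
  intro a d x g
  have h1 := lieDeriv_translate_left f.2 (upper a d x) X g
  have h2 := congrFun (lieDeriv_smul f.2 (((normSq ((a * d⁻¹ : ℍ[ℝ]ˣ) : ℍ[ℝ]) : ℝ) : ℂ) *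
      ((normSq ((a * d⁻¹ : ℍ[ℝ]ˣ) : ℍ[ℝ]) : ℝ) : ℂ) ^ s) X) g
  rw [funext fun g => hf a d x g] at h1
  exact h1.symm.trans h2

lemma sphSpan_le_inducedFn (s : ℂ) : sphSpan s ≤ inducedFn s :=
  cyclicSpan_le _ _ (fun a d x g => sphFun_upper_mul s a d x g) fun i _ hw =>
    smLie_mem_inducedFn hw (cliff i)

lemma mem_principalSeriesInfty {s : ℂ} {w : smoothFn} (hw : w ∈ sphSpan s) :
    (w : GLH ℝ → ℂ) ∈ principalSeriesInfty s := by
  refine ⟨w.2, ?_, sphSpan_le_inducedFn s hw⟩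
  obtain ⟨n, hn⟩ := (mem_cyclicSpan _ _).1 hw
  have := finite_cyclicFilt (fun i => smLie (cliff i)) (sphVec s) n
  exact isKFinite_of_le ((cyclicFilt (fun i => smLie (cliff i)) (sphVec s) n).map smoothFn.subtype)
    fun k => ⟨smRight k w, smRight_mem_cyclicFilt s k.2 hn, rfl⟩

instance free_smoothFn (W : Submodule ℂ smoothFn) : Module.Free ℂ W := Module.Free.of_divisionRing ℂ W

/-- The derivative of the translates of a vector in a finite dimensional space of functions along a
curve. Linear functionals on such a space are combinations of point evaluations. -/
lemma hasDerivAt_smRight {U : Submodule ℂ smoothFn} [Module.Finite ℂ U] {c : ℝ → GLH ℝ} {X : gl2}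
    (h0 : c 0 = 1) (hc : ∀ a b, HasDerivAt (fun t => (c t).val a b) (X a b) 0) {v : smoothFn}
    (hU : ∀ t, smRight (c t) v ∈ U) (ℓ : smoothFn →ₗ[ℂ] ℂ) :
    HasDerivAt (fun t => ℓ (smRight (c t) v)) (ℓ (smLie X v)) 0 := by
  obtain ⟨W, hfin, hUW, hX⟩ : ∃ W : Submodule ℂ smoothFn, Module.Finite ℂ W ∧ U ≤ W ∧ smLie X v ∈ W :=
    ⟨U ⊔ ℂ ∙ smLie X v, inferInstance, le_sup_left,
      mem_sup_right (Submodule.mem_span_singleton_self _)⟩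
  have hW : ∀ t, smRight (c t) v ∈ W := fun t => hUW (hU t)
  let ev : GLH ℝ → Module.Dual ℂ W := fun g =>
    (LinearMap.proj (R := ℂ) (φ := fun _ : GLH ℝ => ℂ) g ∘ₗ smoothFn.subtype) ∘ₗ W.subtype
  have hspan : span ℂ (Set.range ev) = ⊤ := by
    refine Submodule.span_eq_top_of_ne_zero (R := ℂ) (M := W) (s := Set.range ev) fun z hz => ?_
    by_contra! h
    exact hz (Subtype.ext (Subtype.ext (funext fun g => h (ev g) ⟨g, rfl⟩)))
  have key : ∀ ℓ' ∈ span ℂ (Set.range ev),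
      HasDerivAt (fun t => ℓ' ⟨smRight (c t) v, hW t⟩) (ℓ' ⟨smLie X v, hX⟩) 0 := by
    intro ℓ' hℓ
    induction hℓ using span_induction with
    | mem x hx =>
      obtain ⟨g, rfl⟩ := hx
      have := IsSmooth.hasDerivAt v.2 (c := fun u => g * c u) (t := 0) (X := X) fun a b => by
        rw [h0, mul_one]
        exact hasDerivAt_mul_left_entry g hc a b
      rw [h0, mul_one] at this
      exact this
    | zero => exact hasDerivAt_const _ _
    | add x y _ _ hx hy => exact hx.add hy
    | smul a x _ hx => exact hx.const_mul a
  exact key (ℓ ∘ₗ W.subtype) (hspan ▸ mem_top)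

/-! ### Square integrable functions on the maximal compact subgroup -/

lemma isCompact_unitary : IsCompact {A : gl2 | A * star A = 1 ∧ star A * A = 1} := by
  have : ProperSpace ℍ[ℝ] := FiniteDimensional.proper ℝ ℍ[ℝ]
  have hK : IsCompact (Set.univ.pi fun _ : Fin 2 => Set.univ.pi fun _ : Fin 2 =>
      Metric.closedBall (0 : ℍ[ℝ]) 1) :=
    isCompact_univ_pi fun _ => isCompact_univ_pi fun _ => isCompact_closedBall 0 1
  refine IsCompact.of_isClosed_subset hK ?_ fun A hA a _ b _ => ?_
  · exact (isClosed_eq (continuous_id.matrix_mul continuous_star) continuous_const).inter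
      (isClosed_eq (continuous_star.matrix_mul continuous_id) continuous_const)
  · have h1 := congrArg (fun x : ℍ[ℝ] => x.re) (congrFun (congrFun hA.1 a) a)
    simp only [mul_apply, Fin.sum_univ_two, star_apply, self_mul_star,
      one_apply_eq, re_add, re_coe, re_one,
      normSq_eq_norm_mul_self] at h1
    rw [mem_closedBall_zero_iff]
    fin_cases b <;> simp <;> nlinarith [mul_self_nonneg ‖A a 0‖, mul_self_nonneg ‖A a 1‖]

instance compactSpace_maxCompact : CompactSpace maxCompact := by
  have := isCompact_iff_compactSpace.1 isCompact_unitary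
  let φ : {A : gl2 | A * star A = 1 ∧ star A * A = 1} → maxCompact := fun A =>
    ⟨⟨A.1, star A.1, A.2.1, A.2.2⟩, mem_maxCompact_of_mul_star A.2.1⟩
  have hs : Function.Surjective φ := fun k =>
    ⟨⟨(k : GLH ℝ).val, mul_star_of_mem k.2, star_mul_of_mem k.2⟩, Subtype.ext (Units.ext rfl)⟩
  refine hs.compactSpace (Continuous.subtype_mk (Units.continuous_iff.2 ⟨?_, ?_⟩) _)
  · exact continuous_subtype_val
  · exact continuous_star.comp continuous_subtype_val

instance measurableSpace_maxCompact : MeasurableSpace maxCompact := borel _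

instance borelSpace_maxCompact : BorelSpace maxCompact := ⟨rfl⟩

/-- Haar measure on the maximal compact subgroup. -/
abbrev haarK : MeasureTheory.Measure maxCompact := MeasureTheory.Measure.haar

lemma continuous_compact {f : GLH ℝ → ℂ} (hf : IsSmooth f) : Continuous fun k : maxCompact => f k := by
  have h0 : Continuous fun g : GLH ℝ => g.val := Units.continuous_val
  have h1 : Continuous fun k : maxCompact => arr (k : GLH ℝ) := h0.comp continuous_subtype_val
  have h2 : Continuous fun k : maxCompact => extend f (arr (k : GLH ℝ)) :=
    continuous_iff_continuousAt.2 fun k =>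
      ContinuousAt.comp (f := fun k : maxCompact => arr (k : GLH ℝ)) (g := extend f)
        (hf.differentiableAt (k : GLH ℝ)).continuousAt h1.continuousAt
  simpa only [extend_arr] using h2

/-- The restriction of a smooth function to `K`, composed with inversion so that right translation
becomes left translation. -/
def resK : smoothFn →ₗ[ℂ] C(maxCompact, ℂ) where
  toFun f := ⟨fun k => f.1 ((k⁻¹ : maxCompact) : GLH ℝ), (continuous_compact f.2).comp continuous_inv⟩
  map_add' _ _ := rfl
  map_smul' _ _ := rfl

/-- The restriction of a smooth function to `K` as a square integrable function. -/
def resL : smoothFn →ₗ[ℂ] MeasureTheory.Lp ℂ 2 haarK :=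
  (ContinuousMap.toLp 2 haarK ℂ).toLinearMap ∘ₗ resK

lemma inner_resL (f h : smoothFn) : inner ℂ (resL f) (resL h) =
    ∫ x, resK h x * (starRingEnd ℂ) (resK f x) ∂haarK :=
  MeasureTheory.ContinuousMap.inner_toLp haarK (resK f) (resK h)

lemma inner_resL_smRight (k : maxCompact) (f h : smoothFn) :
    inner ℂ (resL (smRight k f)) (resL (smRight k h)) = inner ℂ (resL f) (resL h) := by
  rw [inner_resL, inner_resL]
  have e : ∀ (f : smoothFn) (x : maxCompact), resK (smRight k f) x = resK f (k⁻¹ * x) := by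
    intro f x
    change f.1 (((x⁻¹ : maxCompact) : GLH ℝ) * k) = f.1 (((k⁻¹ * x)⁻¹ : maxCompact) : GLH ℝ)
    rw [mul_inv_rev, inv_inv]
    rfl
  simp only [e]
  exact MeasureTheory.integral_mul_left_eq_self
    (fun x => resK h x * (starRingEnd ℂ) (resK f x)) k⁻¹

lemma eq_zero_of_compact {s : ℂ} {f : smoothFn} (hf : f ∈ inducedFn s)
    (h : ∀ k ∈ maxCompact, f.1 k = 0) : f = 0 := by
  refine Subtype.ext (funext fun g => ?_)
  obtain ⟨k, hk, e⟩ := exists_iwasawa_real g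
  rw [e, hf, h k hk, mul_zero]
  rfl

lemma eq_zero_of_resL {s : ℂ} {f : smoothFn} (hf : f ∈ inducedFn s) (h : resL f = 0) : f = 0 := by
  refine eq_zero_of_compact hf fun k hk => ?_
  have h1 : resK f = 0 := ContinuousMap.toLp_injective haarK (h.trans (map_zero _).symm)
  have := congrArg (fun φ : C(maxCompact, ℂ) => φ (⟨k, hk⟩⁻¹)) h1
  simpa [resK] using this

/-- `U` is a finite dimensional space of functions which is stable under `K`. -/
structure IsCompactStable (U : Submodule ℂ smoothFn) : Prop where
  finite : Module.Finite ℂ U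
  stable : ∀ k ∈ maxCompact, ∀ v ∈ U, smRight k v ∈ U

lemma IsCompactStable.smLie_mem {U : Submodule ℂ smoothFn} (hU : IsCompactStable U) {S : gl2}
    (hS : star S = -S) {v : smoothFn} (hv : v ∈ U) : smLie S v ∈ U := by
  have := hU.finite
  by_contra hn
  obtain ⟨ℓ, h1, h2⟩ := Submodule.exists_dual_map_eq_bot_of_notMem hn
    (@Module.Projective.of_free ℂ _ _ _ _ (Module.Free.of_divisionRing ℂ (smoothFn ⧸ U)))
  obtain ⟨c, hc, h0, hd⟩ := exists_compact_curve hS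
  have hz : ∀ u ∈ U, ℓ u = 0 := fun u hu => (Submodule.mem_bot ℂ).1 (h2 ▸ mem_map_of_mem hu)
  have := hasDerivAt_smRight h0 hd (fun t => hU.stable _ (hc t) v hv) ℓ
  simp only [fun t => hz _ (hU.stable _ (hc t) v hv)] at this
  exact h1 (this.unique (hasDerivAt_const 0 0))

/-- The Lie algebra of `K` acts by skew adjoint operators. -/
lemma inner_resL_skew {U : Submodule ℂ smoothFn} (hU : IsCompactStable U) {S : gl2} (hS : star S = -S)
    {f h : smoothFn} (hf : f ∈ U) (hh : h ∈ U) :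
    inner ℂ (resL h) (resL (smLie S f)) = -inner ℂ (resL (smLie S h)) (resL f) := by
  have := hU.finite
  obtain ⟨c, hc, h0, hd⟩ := exists_compact_curve hS
  let pair : smoothFn → smoothFn →ₗ[ℂ] ℂ := fun h => (innerSL ℂ (resL h)).toLinearMap ∘ₗ resL
  have h1 := hasDerivAt_smRight h0 hd (fun t => hU.stable _ (hc t) f hf) (pair h)
  have hd' : ∀ a b, HasDerivAt (fun t => ((c t)⁻¹).val a b) ((-S) a b) 0 := by
    intro a b
    have e : (fun t => ((c t)⁻¹).val a b) = fun t => star ((c t).val b a) := by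
      funext t
      have : ((c t)⁻¹).val = star (c t).val := by
        rw [← one_mul (star _), ← (c t).inv_mul, mul_assoc, mul_star_of_mem (hc t), mul_one]
      rw [this, star_apply]
    rw [e, ← hS, star_apply]
    exact starQuatL.hasFDerivAt.comp_hasDerivAt (0 : ℝ) (hd b a)
  have h2 := (hasDerivAt_smRight (c := fun t => (c t)⁻¹) (by rw [h0, inv_one]) hd'
    (fun t => hU.stable _ (inv_mem (hc t)) h hh) (pair f)).star
  have e : (fun t => pair h (smRight (c t) f)) = fun t => star (pair f (smRight (c t)⁻¹ h)) := by
    funext t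
    change inner ℂ (resL h) (resL (smRight (c t) f)) =
      (starRingEnd ℂ) (inner ℂ (resL f) (resL (smRight (c t)⁻¹ h)))
    rw [inner_conj_symm, ← inner_resL_smRight ⟨c t, hc t⟩ (smRight (c t)⁻¹ h)]
    congr 2
    refine Subtype.ext (funext fun g => ?_)
    change h.1 g = h.1 (g * c t * (c t)⁻¹)
    rw [mul_inv_cancel_right]
  rw [e] at h1
  have h3 := h1.unique h2
  have hneg : smLie (-S) h = -smLie S h := by
    have := isLieAction_smLie.smul (-1) S
    rw [neg_one_smul] at this
    rw [this]
    simp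
  change inner ℂ (resL h) (resL (smLie S f)) =
    (starRingEnd ℂ) (inner ℂ (resL f) (resL (smLie (-S) h))) at h3
  rw [h3, inner_conj_symm, hneg, map_neg, inner_neg_left]

/-! ### Density of the polynomials on the sphere -/

lemma rowForm_skew {S : gl2} (hS : star S = -S) (A : gl2) : rowForm S A = 0 := by
  have h1 : star (A * S * star A) = -(A * S * star A) := by
    rw [star_mul, star_mul, star_star, hS]
    noncomm_ring
  have h2 := congrArg (fun x : ℍ[ℝ] => x.re) (congrFun (congrFun h1 1) 1)
  simp only [star_apply, re_star, Matrix.neg_apply, re_neg] at h2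
  rw [rowForm]
  linarith

lemma rowForm_sum {ι : Type*} (t : Finset ι) (M : ι → gl2) (A : gl2) :
    rowForm (∑ i ∈ t, M i) A = ∑ i ∈ t, rowForm (M i) A :=
  map_sum (⟨⟨fun M => rowForm M A, by simp [rowForm]⟩, fun M M' => rowForm_add M M' A⟩ : gl2 →+ ℝ) M t

lemma herC_of_mem {k : GLH ℝ} (hk : k ∈ maxCompact) : herC k = 1 := by
  have := (her_mul_compact 1 hk).2
  rwa [one_mul, herC_one] at this

/-- The coordinates `ω_i` separate the points of `K ∩ P \ K`. -/
lemma eq_of_omegaFn {s : ℂ} {f : smoothFn} (hf : f ∈ inducedFn s) {k k' : GLH ℝ} (hk : k ∈ maxCompact)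
    (hk' : k' ∈ maxCompact) (h : ∀ i, omegaFn i k = omegaFn i k') : f.1 k = f.1 k' := by
  have hω : ∀ i, rowForm (cliff i) k.val = rowForm (cliff i) k'.val := by
    intro i
    have := h i
    rwa [omegaFn, omegaFn, herC_of_mem hk, herC_of_mem hk', div_one, div_one, Complex.ofReal_inj] at this
  set u := k' * k⁻¹ with hu
  have huK : u ∈ maxCompact := mul_mem hk' (inv_mem hk)
  have hinv : (k⁻¹).val = star k.val := by
    rw [← one_mul (star _), ← k.inv_mul, mul_assoc, mul_star_of_mem hk, mul_one]
  have hform : ∀ A : gl2, rowForm (star k.val * single 0 0 1 * k.val) A =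
      normSq ((A * star k.val) 1 0) := by
    intro A
    have e : A * (star k.val * single 0 0 1 * k.val) * star A =
        (A * star k.val) * single 0 0 1 * star (A * star k.val) := by
      rw [star_mul, star_star]
      noncomm_ring
    rw [rowForm, e]
    generalize A * star k.val = B
    simp [mul_apply, Fin.sum_univ_two, single, star_apply, self_mul_star]
  have h10 : u.val 1 0 = 0 := by
    obtain ⟨c, a, S, hS, e⟩ := exists_cartan (star k.val * single 0 0 1 * k.val)
    have h1 : ∀ g : GLH ℝ, rowForm (star k.val * single 0 0 1 * k.val) g.val =
        c * herC g + ∑ i, a i * rowForm (cliff i) g.val := by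
      intro g
      rw [e, rowForm_add, rowForm_add, rowForm_skew hS, rowForm_smul, rowForm_one, rowForm_sum, add_zero]
      simp only [rowForm_smul]
    have h2 : rowForm (star k.val * single 0 0 1 * k.val) k'.val =
        rowForm (star k.val * single 0 0 1 * k.val) k.val := by
      rw [h1, h1, herC_of_mem hk, herC_of_mem hk']
      simp only [hω]
    rw [hform, hform, mul_star_of_mem hk] at h2
    rw [hu, Units.val_mul, hinv]
    exact normSq_eq_zero.1 (h2.trans (by simp))
  have h00 : normSq (u.val 0 0) = 1 := by
    have := congrArg (fun x : ℍ[ℝ] => x.re) (congrFun (congrFun (star_mul_of_mem huK) 0) 0)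
    simpa [mul_apply, Fin.sum_univ_two, star_apply, h10, star_mul_self] using this
  have h11 : normSq (u.val 1 1) = 1 := by
    have := congrArg (fun x : ℍ[ℝ] => x.re) (congrFun (congrFun (mul_star_of_mem huK) 1) 1)
    simpa [mul_apply, Fin.sum_univ_two, star_apply, h10, self_mul_star] using this
  have n0 : u.val 0 0 ≠ 0 := fun h0 => by simp [h0] at h00
  have n1 : u.val 1 1 ≠ 0 := fun h0 => by simp [h0] at h11
  have eu : k' = upper (Units.mk0 _ n0) (Units.mk0 _ n1) (u.val 0 1) * k := by
    rw [eq_mul_of_mul_inv_eq hu.symm]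
    congr 1
    refine Units.ext ?_
    ext i j : 1
    fin_cases i <;> fin_cases j <;> simp [upper, h10]
  rw [eu, hf]
  have : normSq ((Units.mk0 _ n0 * (Units.mk0 _ n1)⁻¹ : ℍ[ℝ]ˣ) : ℍ[ℝ]) = 1 := by
    rw [Units.val_mul, map_mul, Units.val_inv_eq_inv_val, map_inv₀, Units.val_mk0, Units.val_mk0, h00, h11]
    simp
  rw [this]
  simp

lemma wordDeg_mul {m n : ℕ} {f f' : GLH ℝ → ℂ} (hf : f ∈ wordDeg m) (hf' : f' ∈ wordDeg n) :
    f * f' ∈ wordDeg (m + n) := by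
  have h := Submodule.mul_mem_mul hf hf'
  rw [wordDeg, wordDeg, Submodule.span_mul_span] at h
  refine Submodule.span_le.2 ?_ h
  rintro _ ⟨_, ⟨l, hl, rfl⟩, _, ⟨l', hl', rfl⟩, rfl⟩
  have : wordFn l * wordFn l' = wordFn (l ++ l') := by simp [wordFn]
  change wordFn l * wordFn l' ∈ wordDeg (m + n)
  rw [this]
  exact wordFn_mem (by
    rw [List.length_append]
    exact add_le_add hl hl')

/-- By the Stone–Weierstrass theorem, a vector of the principal series which is orthogonal to all
polynomials in the `ω_i` vanishes. -/
lemma eq_zero_of_words {s : ℂ} {f : smoothFn} (hf : f ∈ inducedFn s)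
    (h : ∀ n, ∀ φ ∈ wordDeg n, ∃ w : smoothFn, (w : GLH ℝ → ℂ) = φ * sphFun s ∧
      inner ℂ (resL w) (resL f) = 0) : f = 0 := by
  have hre : ∀ i (k : maxCompact), omegaFn i k = ((omegaFn i k).re : ℂ) := fun i k => by simp [omegaFn]
  let Ω : maxCompact → (Fin 5 → ℝ) := fun k i => (omegaFn i ((k⁻¹ : maxCompact) : GLH ℝ)).re
  have hΩ : Continuous Ω := continuous_pi fun i => Complex.continuous_re.comp
    ((continuous_compact (isSmooth_omegaFn i)).comp continuous_inv)
  have := isCompact_iff_compactSpace.1 (isCompact_range hΩ)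
  let Ω' : C(maxCompact, Set.range Ω) := ⟨Set.rangeFactorization Ω, hΩ.subtype_mk _⟩
  have hq : Topology.IsQuotientMap Ω' := Ω'.continuous.isClosedMap.isQuotientMap Ω'.continuous
    Set.rangeFactorization_surjective
  have hfac : Function.FactorsThrough (resK f) Ω' := by
    intro a b hab
    refine eq_of_omegaFn hf (inv_mem a.2) (inv_mem b.2) fun i => ?_
    have := congrFun (congrArg Subtype.val hab) i
    exact (hre i a⁻¹).trans ((congrArg Complex.ofReal this).trans (hre i b⁻¹).symm)
  let φ : C(Set.range Ω, ℂ) := hq.lift (resK f) hfac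
  have hφ : ∀ k, φ (Ω' k) = resK f k := fun k =>
    congrArg (fun ψ : C(maxCompact, ℂ) => ψ k) (hq.lift_comp (resK f) hfac)
  let coord : Fin 5 → C(Set.range Ω, ℝ) := fun i =>
    ⟨fun x => x.1 i, (continuous_apply i).comp continuous_subtype_val⟩
  let A : Subalgebra ℝ C(Set.range Ω, ℝ) := Algebra.adjoin ℝ (Set.range coord)
  have hA : A.SeparatesPoints := by
    intro x y hxy
    by_contra! hn
    refine hxy (Subtype.ext (funext fun i => hn _ ⟨coord i, Algebra.subset_adjoin ⟨i, rfl⟩, rfl⟩))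
  let J : C(ℝ, ℂ) := ⟨_, Complex.continuous_ofReal⟩
  let T : C(Set.range Ω, ℝ) → MeasureTheory.Lp ℂ 2 haarK := fun a =>
    ContinuousMap.toLp 2 haarK ℂ ((J.comp a).comp Ω')
  have hT : Continuous T := (ContinuousMap.toLp 2 haarK ℂ).continuous.comp
    ((ContinuousMap.continuous_precomp Ω').comp (ContinuousMap.continuous_postcomp J))
  have hword : ∀ a ∈ A, ∃ n, ∃ ψ ∈ wordDeg n, ∀ k : maxCompact,
      (a (Ω' k) : ℂ) = ψ ((k⁻¹ : maxCompact) : GLH ℝ) := by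
    intro a ha
    induction ha using Algebra.adjoin_induction with
    | mem x hx =>
      obtain ⟨i, rfl⟩ := hx
      refine ⟨1, omegaFn i, ?_, fun k => (hre i k⁻¹).symm⟩
      have : wordFn [i] = omegaFn i := by simp [wordFn]
      exact this ▸ wordFn_mem (by simp)
    | algebraMap r =>
      refine ⟨0, (r : ℂ) • wordFn [], smul_mem _ _ (wordFn_mem (by simp)), fun k => ?_⟩
      simp [wordFn]
    | add x y _ _ hx hy =>
      obtain ⟨m, ψ, hψ, ex⟩ := hx
      obtain ⟨n, χ, hχ, ey⟩ := hy
      refine ⟨m + n, ψ + χ, add_mem (wordDeg_mono (by omega) hψ)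
        (wordDeg_mono (by omega) hχ), fun k => ?_⟩
      rw [Pi.add_apply, ← ex, ← ey, ContinuousMap.add_apply, Complex.ofReal_add]
    | mul x y _ _ hx hy =>
      obtain ⟨m, ψ, hψ, ex⟩ := hx
      obtain ⟨n, χ, hχ, ey⟩ := hy
      refine ⟨m + n, ψ * χ, wordDeg_mul hψ hχ, fun k => ?_⟩
      rw [Pi.mul_apply, ← ex, ← ey, ContinuousMap.mul_apply, Complex.ofReal_mul]
  have horth : ∀ a, inner ℂ (T a) (resL f) = 0 := by
    have hcl : IsClosed {a | inner ℂ (T a) (resL f) = 0} :=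
      isClosed_eq (hT.inner continuous_const) continuous_const
    have hsub : (A : Set C(Set.range Ω, ℝ)) ⊆ {a | inner ℂ (T a) (resL f) = 0} := by
      intro a ha
      obtain ⟨n, ψ, hψ, e⟩ := hword a ha
      obtain ⟨w, hw, h0⟩ := h n ψ hψ
      have : T a = resL w := by
        refine congrArg (ContinuousMap.toLp 2 haarK ℂ) (ContinuousMap.ext fun k => ?_)
        change (a (Ω' k) : ℂ) = w.1 ((k⁻¹ : maxCompact) : GLH ℝ)
        rw [hw, Pi.mul_apply, sphFun_of_mem s (k⁻¹ : maxCompact).2, mul_one, e]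
      change inner ℂ (T a) (resL f) = 0
      rw [this, h0]
    intro a
    have htop := ContinuousMap.subalgebra_topologicalClosure_eq_top_of_separatesPoints A hA
    have ha : a ∈ A.topologicalClosure := htop ▸ Algebra.mem_top
    exact hcl.closure_subset_iff.2 hsub ha
  have hdec : resL f = T ((⟨_, Complex.continuous_re⟩ : C(ℂ, ℝ)).comp φ) +
      Complex.I • T ((⟨_, Complex.continuous_im⟩ : C(ℂ, ℝ)).comp φ) := by
    change ContinuousMap.toLp 2 haarK ℂ (resK f) = _
    rw [← map_smul, ← map_add]
    refine congrArg (ContinuousMap.toLp 2 haarK ℂ) (ContinuousMap.ext fun k => ?_)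
    change resK f k = ((φ (Ω' k)).re : ℂ) + Complex.I * ((φ (Ω' k)).im : ℂ)
    rw [hφ, mul_comm, Complex.re_add_im]
  refine eq_zero_of_resL hf (inner_self_eq_zero (𝕜 := ℂ).1 ?_)
  nth_rewrite 1 [hdec]
  rw [inner_add_left, inner_smul_left, horth, horth]
  simp

/-! ### `K`-finite vectors of the principal series -/

lemma IsCompactStable.sup {U U' : Submodule ℂ smoothFn} (h : IsCompactStable U)
    (h' : IsCompactStable U') : IsCompactStable (U ⊔ U') := by
  have := h.finite
  have := h'.finite
  refine ⟨Submodule.finite_sup U U', fun k hk v hv => ?_⟩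
  obtain ⟨a, ha, b, hb, rfl⟩ := Submodule.mem_sup.1 hv
  rw [map_add]
  exact Submodule.add_mem_sup (h.stable k hk a ha) (h'.stable k hk b hb)

/-- The Casimir operator of `K` on smooth functions. -/
def casimirK : End ℂ smoothFn := sumC fun i => smLie (cliff i)

lemma casimirK_apply (f : smoothFn) : casimirK f = ∑ i, ∑ j,
    smLie (cliff i * cliff j - cliff j * cliff i) (smLie (cliff i * cliff j - cliff j * cliff i) f) := by
  simp only [casimirK, sumC, LinearMap.sum_apply, End.mul_apply, commY,
    ← isLieAction_smLie.bracket]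

lemma IsCompactStable.casimirK_mem {U : Submodule ℂ smoothFn} (hU : IsCompactStable U) {f : smoothFn}
    (hf : f ∈ U) : casimirK f ∈ U := by
  rw [casimirK_apply]
  exact sum_mem fun i _ => sum_mem fun j _ =>
    hU.smLie_mem (star_bracket_cliff i j) (hU.smLie_mem (star_bracket_cliff i j) hf)

lemma inner_resL_casimirK {U : Submodule ℂ smoothFn} (hU : IsCompactStable U)
    {f h : smoothFn} (hf : f ∈ U) (hh : h ∈ U) :
    inner ℂ (resL h) (resL (casimirK f)) = inner ℂ (resL (casimirK h)) (resL f) := by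
  simp only [casimirK_apply, map_sum, inner_sum, sum_inner]
  refine sum_congr rfl fun i _ => sum_congr rfl fun j _ => ?_
  have hS := star_bracket_cliff i j
  rw [inner_resL_skew hU hS (hU.smLie_mem hS hf) hh, inner_resL_skew hU hS hf (hU.smLie_mem hS hh),
    neg_neg]

lemma aeval_functional {V : Type*} [AddCommGroup V] [Module ℂ V] {T : End ℂ V}
    {P : Submodule ℂ V} (hP : ∀ x ∈ P, T x ∈ P) {ℓ : V →ₗ[ℂ] ℂ} {μ : ℂ}
    (hℓ : ∀ x ∈ P, ℓ (T x) = μ * ℓ x) (p : Polynomial ℂ) {x : V} (hx : x ∈ P) :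
    Polynomial.aeval T p x ∈ P ∧ ℓ (Polynomial.aeval T p x) = p.eval μ * ℓ x := by
  induction p using Polynomial.induction_on' with
  | add p q hp hq =>
    rw [map_add, LinearMap.add_apply, map_add, hp.2, hq.2, Polynomial.eval_add, add_mul]
    exact ⟨add_mem hp.1 hq.1, rfl⟩
  | monomial n a =>
    have hn : (T ^ n) x ∈ P ∧ ℓ ((T ^ n) x) = μ ^ n * ℓ x := by
      induction n with
      | zero => simpa using hx
      | succ n ih =>
        rw [pow_succ', End.mul_apply]
        exact ⟨hP _ ih.1, by rw [hℓ _ ih.1, ih.2]; ring⟩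
    rw [Polynomial.aeval_monomial, End.mul_apply, Module.algebraMap_end_apply, map_smul, hn.2,
      Polynomial.eval_monomial, smul_eq_mul, mul_assoc]
    exact ⟨smul_mem _ _ hn.1, rfl⟩

lemma exists_aeval_eq_zero {V : Type*} [AddCommGroup V] [Module ℂ V] {T : End ℂ V}
    {U : Submodule ℂ V} [Module.Finite ℂ U] (hU : ∀ u ∈ U, T u ∈ U) :
    ∃ p : Polynomial ℂ, p ≠ 0 ∧ ∀ u ∈ U, Polynomial.aeval T p u = 0 := by
  let T' : End ℂ U := T.restrict hU
  have h : ∀ (p : Polynomial ℂ) (u : U), Polynomial.aeval T p u.1 = (Polynomial.aeval T' p u).1 := by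
    intro p u
    induction p using Polynomial.induction_on' with
    | add p q hp hq => simp [hp, hq]
    | monomial n a =>
      rw [Polynomial.aeval_monomial, Polynomial.aeval_monomial, End.mul_apply,
        End.mul_apply, End.pow_restrict]
      rfl
  exact ⟨T'.charpoly, T'.charpoly_monic.ne_zero, fun u hu => by
    rw [h _ ⟨u, hu⟩, LinearMap.aeval_self_charpoly]
    rfl⟩

/-- The eigenvalue of the Casimir operator of `K` on the graded piece of degree `m + 1`. -/
def weightK (m : ℕ) : ℂ := -(32 * (m + 1) * (m + 4))

lemma weightK_injective : Function.Injective weightK := by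
  intro a b h
  have h1 : ((a + 1) * (a + 4) : ℂ) = (b + 1) * (b + 4) := by
    simp only [weightK] at h
    linear_combination (-1 / 32 : ℂ) * h
  have h2 : (a + 1) * (a + 4) = (b + 1) * (b + 4) := by exact_mod_cast h1
  rcases lt_trichotomy a b with h3 | h3 | h3
  · nlinarith
  · exact h3
  · nlinarith

/-- For every finite dimensional space of `K`-finite vectors, the Casimir operator of `K` excludes
almost all harmonic degrees, and the remaining ones belong to the space of polynomials. -/
theorem mem_sphSpan {s : ℂ} (hs : ∀ n : ℕ, -2 * (1 + s) ≠ n) {U : Submodule ℂ smoothFn}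
    (hU : IsCompactStable U) (hUi : U ≤ inducedFn s) : U ≤ sphSpan s := by
  intro f hf
  let L : ℕ → Submodule ℂ smoothFn := cyclicFilt (fun i => smLie (cliff i)) (sphVec s)
  have hL : ∀ n, IsCompactStable (L n) := fun n =>
    ⟨finite_cyclicFilt _ _ n, fun k hk w hw => smRight_mem_cyclicFilt s hk hw⟩
  have hLs : ∀ n, L n ≤ sphSpan s := cyclicFilt_le_cyclicSpan _ _
  have hcl := (isSphericalInfty_sphVec s).isClassOne isLieAction_smLie
  have hweight : ∀ m, ∀ w ∈ L (m + 1), casimirK w - weightK m • w ∈ L m := by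
    intro m w hw
    have h1 := hcl.sumQ_eq (hLs _ hw)
    have h2 := hcl.sumQ_sub_mem hw
    have e : casimirK w - weightK m • w = (8 : ℂ) • (sumQ (fun i => smLie (cliff i)) w -
        gradedEigenvalue (16 * s ^ 2 - 16) (m + 1) • w) := by
      rw [smul_sub, h1, gradedEigenvalue, weightK, smul_smul]
      change casimirK w - _ = _ + casimirK w - _
      push_cast
      module
    rw [e]
    exact smul_mem _ _ h2
  have := hU.finite
  obtain ⟨p, hp0, hp⟩ := exists_aeval_eq_zero fun u hu => hU.casimirK_mem (f := u) hu
  obtain ⟨n, hn⟩ : ∃ n, ∀ m, n ≤ m → p.eval (weightK m) ≠ 0 := by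
    have hfin : {m | p.eval (weightK m) = 0}.Finite := by
      refine (p.roots.toFinset.finite_toSet.preimage weightK_injective.injOn).subset fun m hm => ?_
      simpa [hp0] using hm
    obtain ⟨N, hN⟩ := hfin.bddAbove
    exact ⟨N + 1, fun m hm h0 => by have := hN h0; omega⟩
  have := (hL n).finite
  have hfinmap : Module.Finite ℂ ((L n).map resL) := Finite.map (L n) resL
  obtain ⟨_, ⟨g, hg, rfl⟩, y, hy, hsum⟩ :=
    Submodule.exists_add_mem_mem_orthogonal (K := (L n).map resL) (resL f)
  have hy' : y = resL (f - g) := by rw [map_sub, hsum, add_sub_cancel_left]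
  let W : Submodule ℂ smoothFn := U ⊔ L n
  have hW : IsCompactStable W := hU.sup (hL n)
  let P : ℕ → Submodule ℂ smoothFn := fun k => W ⊓ (((L k).map resL)ᗮ).comap resL
  have hP : ∀ k x, x ∈ P k ↔ x ∈ W ∧ ∀ h ∈ L k, inner ℂ (resL h) (resL x) = 0 := by
    intro k x
    refine and_congr_right fun _ => ?_
    rw [SetLike.mem_coe, mem_comap, Submodule.mem_orthogonal]
    exact ⟨fun h w hw => h _ (mem_map_of_mem hw), by rintro h _ ⟨w, hw, rfl⟩; exact h w hw⟩
  have hsymm : ∀ k, ∀ x ∈ W, ∀ h ∈ L k,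
      inner ℂ (resL h) (resL (casimirK x)) = inner ℂ (resL (casimirK h)) (resL x) := fun k x hx h hh =>
    inner_resL_casimirK (hW.sup (hL k)) (mem_sup_left hx) (mem_sup_right hh)
  have hstab : ∀ k, ∀ x ∈ P k, casimirK x ∈ P k := by
    intro k x hx
    obtain ⟨h1, h2⟩ := (hP k x).1 hx
    exact (hP k _).2 ⟨hW.casimirK_mem h1, fun h hh => by
      rw [hsymm k x h1 h hh, h2 _ ((hL k).casimirK_mem hh)]⟩
  have hWi : W ≤ inducedFn s := sup_le hUi ((hLs n).trans (sphSpan_le_inducedFn s))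
  have hfg : f - g ∈ P n := by
    refine ⟨sub_mem (mem_sup_left hf) (mem_sup_right hg), ?_⟩
    rw [SetLike.mem_coe, mem_comap, ← hy']
    exact hy
  have hzero : ∀ (V : Submodule ℂ smoothFn), (∀ x ∈ V, casimirK x ∈ V) → ∀ x ∈ V,
      Polynomial.aeval casimirK p x ∈ V := fun V hV x hx =>
    (aeval_functional (ℓ := 0) (μ := 0) hV (by simp) p hx).1
  -- The polynomial of the Casimir operator maps the difference to `L n`, to which it is orthogonal.
  have hker : Polynomial.aeval casimirK p (f - g) = 0 := by
    have h1 := hzero _ (hstab n) _ hfg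
    have h2 : Polynomial.aeval casimirK p (f - g) ∈ L n := by
      rw [map_sub, hp f hf, zero_sub]
      exact Submodule.neg_mem _ (hzero _ (fun x hx => (hL n).casimirK_mem hx) g hg)
    have h3 := ((hP n _).1 h1).2 _ h2
    exact eq_zero_of_resL (hWi ((hP n _).1 h1).1) (inner_self_eq_zero (𝕜 := ℂ).1 h3)
  have hall : ∀ k, n ≤ k → f - g ∈ P k := by
    intro k hk
    induction k, hk using Nat.le_induction with
    | base => exact hfg
    | succ k hk ih =>
      refine (hP _ _).2 ⟨((hP _ _).1 hfg).1, fun h hh => ?_⟩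
      let ℓ : smoothFn →ₗ[ℂ] ℂ := (innerSL ℂ (resL h)).toLinearMap ∘ₗ resL
      have hℓ : ∀ x ∈ P k, ℓ (casimirK x) = weightK k * ℓ x := by
        intro x hx
        obtain ⟨h1, h2⟩ := (hP k x).1 hx
        change inner ℂ (resL h) (resL (casimirK x)) = weightK k * inner ℂ (resL h) (resL x)
        rw [hsymm _ x h1 h hh, ← sub_add_cancel (casimirK h) (weightK k • h), map_add, inner_add_left,
          h2 _ (hweight k h hh), zero_add, map_smul, inner_smul_left]
        exact congrArg (· * _) (Complex.conj_eq_iff_real.2 ⟨-(32 * (k + 1) * (k + 4)), by simp [weightK]⟩)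
      have := (aeval_functional (hstab k) hℓ p ih).2
      rw [hker, map_zero] at this
      exact (mul_eq_zero.1 this.symm).resolve_left (hn k hk)
  have h0 : f - g = 0 := by
    refine eq_zero_of_words (hWi ((hP _ _).1 hfg).1) fun m φ hφ => ?_
    obtain ⟨w, hw, e⟩ := exists_mem_sphSpan hs hφ
    obtain ⟨k, hk⟩ := (mem_cyclicSpan _ _).1 hw
    exact ⟨w, e, ((hP _ _).1 (hall (k + n) (by omega))).2 w (cyclicFilt_mono _ _ (by omega) hk)⟩
  rw [sub_eq_zero.1 h0]
  exact hLs n hg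

/-! ### The principal series as a `(𝔤, K)`-module -/

variable {s : ℂ}

/-- The module generated by the spherical vector. -/
def SphMod (s : ℂ) : Type := sphSpan s

instance addCommGroup_sphMod (s : ℂ) : AddCommGroup (SphMod s) := inferInstanceAs (AddCommGroup (sphSpan s))

instance module_sphMod (s : ℂ) : Module ℂ (SphMod s) := inferInstanceAs (Module ℂ (sphSpan s))

/-- The inclusion into the space of smooth functions. -/
def sphIncl (s : ℂ) : SphMod s →ₗ[ℂ] smoothFn where
  toFun w := w.1
  map_add' _ _ := rfl
  map_smul' _ _ := rfl

lemma sphIncl_injective (s : ℂ) : Function.Injective (sphIncl s) := Subtype.val_injective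

/-- The action of the Lie algebra on the module generated by the spherical vector. -/
def sphLie (s : ℂ) (X : gl2) : End ℂ (SphMod s) where
  toFun w := ⟨smLie X w.1, smLie_mem_sphSpan s X w.2⟩
  map_add' w w' := Subtype.ext (map_add (smLie X) w.1 w'.1)
  map_smul' c w := Subtype.ext (map_smul (smLie X) c w.1)

lemma smRight_mem_sphSpan {k : GLH ℝ} (hk : k ∈ maxCompact) {w : smoothFn} (hw : w ∈ sphSpan s) :
    smRight k w ∈ sphSpan s := by
  obtain ⟨n, hn⟩ := (mem_cyclicSpan _ _).1 hw
  exact cyclicFilt_le_cyclicSpan _ _ n (smRight_mem_cyclicFilt s hk hn)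

/-- The action of `K` on the module generated by the spherical vector. -/
def sphAct (s : ℂ) : Representation ℂ maxCompact (SphMod s) where
  toFun k :=
    { toFun := fun w => ⟨smRight k w.1, smRight_mem_sphSpan k.2 w.2⟩
      map_add' := fun _ _ => rfl
      map_smul' := fun _ _ => rfl }
  map_one' := LinearMap.ext fun w => Subtype.ext <| Subtype.ext <| funext fun g => by
    change w.1.1 (g * 1) = w.1.1 g
    rw [mul_one]
  map_mul' k k' := LinearMap.ext fun w => Subtype.ext <| Subtype.ext <| funext fun g => by
    change w.1.1 (g * (k * k')) = w.1.1 (g * k * k')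
    rw [mul_assoc]

lemma isLieAction_sphLie (s : ℂ) : IsLieAction (sphLie s) :=
  ⟨fun X Y => LinearMap.ext fun w => Subtype.ext (LinearMap.congr_fun (isLieAction_smLie.add X Y) w.1),
    fun c X => LinearMap.ext fun w => Subtype.ext (LinearMap.congr_fun (isLieAction_smLie.smul c X) w.1),
    fun X Y => LinearMap.ext fun w =>
      Subtype.ext (LinearMap.congr_fun (isLieAction_smLie.bracket X Y) w.1)⟩

lemma sphAct_sphLie (k : maxCompact) (X : gl2) (w : SphMod s) : sphAct s k (sphLie s X w) =
    sphLie s ((k : GLH ℝ).val * X * ((k : GLH ℝ)⁻¹).val) (sphAct s k w) :=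
  Subtype.ext (smRight_smLie k X w.1)

/-- The spherical vector, as a generator. -/
def sphGen (s : ℂ) : SphMod s := ⟨sphVec s, self_mem_cyclicSpan _ _⟩

lemma sphGen_ne_zero (s : ℂ) : sphGen s ≠ 0 := fun h =>
  sphFun_ne_zero s 1 (congrFun (congrArg (fun w : SphMod s => w.1.1) h) 1)

lemma isSphericalInfty_sphGen (s : ℂ) : IsSphericalInfty (sphLie s) (sphGen s) (16 * s ^ 2 - 16) := by
  have h := isSphericalInfty_sphVec s
  refine ⟨fun S hS => Subtype.ext (h.skew S hS), Subtype.ext h.one, Subtype.ext ?_⟩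
  exact (map_sum (sphIncl s) (fun i => sphLie s (cliff i) (sphLie s (cliff i) (sphGen s)))
    Finset.univ).trans h.eigen

lemma eq_top_of_sphGen_mem {P : Submodule ℂ (SphMod s)} (h : sphGen s ∈ P)
    (h' : ∀ i, ∀ w ∈ P, sphLie s (cliff i) w ∈ P) : P = ⊤ := by
  have : sphSpan s ≤ P.map (sphIncl s) := by
    refine cyclicSpan_le _ _ ⟨_, h, rfl⟩ ?_
    rintro i _ ⟨w, hw, rfl⟩
    exact ⟨_, h' i w hw, rfl⟩
  rw [eq_top_iff]
  intro w _
  obtain ⟨w', hw', e⟩ := this w.2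
  rwa [← Subtype.ext e]

lemma finite_of_finite_map {V V' : Type*} [AddCommGroup V] [Module ℂ V] [AddCommGroup V'] [Module ℂ V']
    {φ : V →ₗ[ℂ] V'} (hφ : Function.Injective φ) {U : Submodule ℂ V} {U' : Submodule ℂ V'}
    (hU' : Module.Finite ℂ U') (h : U.map φ ≤ U') : Module.Finite ℂ U := by
  have : Module.Finite ℂ (U.map φ) := Submodule.finiteDimensional_of_le h
  exact Finite.equiv (Submodule.equivMapOfInjective φ hφ U).symm

/-- The `(𝔤, K)`-module generated by the spherical vector. -/
def sphModule (s : ℂ) : GKModule (SphMod s) where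
  act := sphAct s
  lie := sphLie s
  lie_add := (isLieAction_sphLie s).add
  lie_smul := (isLieAction_sphLie s).smul
  lie_bracket := (isLieAction_sphLie s).bracket
  act_lie k X := LinearMap.ext fun w => by
    rw [End.mul_apply, End.mul_apply, sphAct_sphLie, ← End.mul_apply (sphAct s k),
      ← map_mul, mul_inv_cancel, map_one]
    rfl
  finite w := by
    obtain ⟨n, hn⟩ := (mem_cyclicSpan _ _).1 w.2
    refine finite_of_finite_map (φ := sphIncl s) (sphIncl_injective s)
      (finite_cyclicFilt (fun i => smLie (cliff i)) (sphVec s) n) ?_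
    rw [map_span, span_le]
    rintro _ ⟨_, ⟨k, rfl⟩, rfl⟩
    exact smRight_mem_cyclicFilt s k.2 hn
  differential X c h0 hc w ℓ := by
    obtain ⟨n, hn⟩ := (mem_cyclicSpan _ _).1 w.2
    have := finite_cyclicFilt (fun i => smLie (cliff i)) (sphVec s) n
    obtain ⟨ℓ', rfl⟩ : ∃ ℓ' : smoothFn →ₗ[ℂ] ℂ, ℓ' ∘ₗ sphIncl s = ℓ := by
      obtain ⟨p, hp⟩ := LinearMap.exists_leftInverse_of_injective (sphIncl s)
        (LinearMap.ker_eq_bot.2 (sphIncl_injective s))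
      exact ⟨ℓ ∘ₗ p, by rw [LinearMap.comp_assoc, hp, LinearMap.comp_id]⟩
    exact hasDerivAt_smRight (c := fun t => (c t : GLH ℝ)) (by rw [h0]; rfl) hc
      (fun t => smRight_mem_cyclicFilt s (c t).2 hn) ℓ'

/-- Away from the points of reducibility, the module generated by the spherical vector is the space
of all `K`-finite vectors of the principal series. -/
lemma exists_equiv_principalSeriesInfty (hs : ∀ n : ℕ, -2 * (1 + s) ≠ n) :
    ∃ e : SphMod s ≃ₗ[ℂ] principalSeriesInfty s, ∀ w, (e w : GLH ℝ → ℂ) = w.1.1 := by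
  let φ : SphMod s →ₗ[ℂ] principalSeriesInfty s :=
    { toFun := fun w => ⟨w.1.1, mem_principalSeriesInfty w.2⟩
      map_add' := fun _ _ => rfl
      map_smul' := fun _ _ => rfl }
  refine ⟨LinearEquiv.ofBijective φ ⟨fun w w' h => Subtype.ext (Subtype.ext
    (congrArg (fun f : principalSeriesInfty s => (f : GLH ℝ → ℂ)) h)), ?_⟩,
    fun w => rfl⟩
  rintro ⟨f, hf, hK, hi⟩
  let U : Submodule ℂ smoothFn := span ℂ (Set.range fun k : maxCompact => smRight k ⟨f, hf⟩)
  have hU : IsCompactStable U := by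
    refine ⟨finite_of_finite_map (φ := smoothFn.subtype) Subtype.val_injective hK ?_, fun k hk v hv => ?_⟩
    · rw [map_span, span_le]
      rintro _ ⟨_, ⟨k, rfl⟩, rfl⟩
      exact subset_span ⟨k, rfl⟩
    · suffices U ≤ U.comap (smRight k) from this hv
      refine Submodule.span_le.2 ?_
      rintro _ ⟨k', rfl⟩
      refine subset_span ⟨⟨k, hk⟩ * k', Subtype.ext (funext fun g => ?_)⟩
      change f (g * (k * k')) = f (g * k * k')
      rw [mul_assoc]
  have hUi : U ≤ inducedFn s := by
    refine Submodule.span_le.2 ?_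
    rintro _ ⟨k, rfl⟩ a d x g
    change f (upper a d x * g * k) = _ * f (g * k)
    rw [mul_assoc, hi]
  have hmem : (⟨f, hf⟩ : smoothFn) ∈ U := subset_span ⟨1, Subtype.ext (funext fun g =>
    congrArg f (mul_one g))⟩
  exact ⟨⟨_, mem_sphSpan hs hU hUi hmem⟩, rfl⟩

/-! ### The archimedean component -/

/-- The operators of a `(𝔤, K)`-module. -/
def GKModule.op {V : Type*} [AddCommGroup V] [Module ℂ V] (π : GKModule V) :
    maxCompact ⊕ gl2 → End ℂ V := Sum.elim (fun k => π.act k) π.lie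

lemma GKModule.isIrreducible_iff {V : Type*} [AddCommGroup V] [Module ℂ V] (π : GKModule V) :
    π.IsIrreducible ↔ OpSimple π.op :=
  and_congr_right fun _ => forall_congr' fun _ =>
    ⟨fun h hU => h (fun k => hU (.inl k)) fun X => hU (.inr X), fun h h1 h2 =>
      h (Sum.rec h1 h2)⟩

lemma opSimple_sphModule (hlam : ∀ n : ℕ, 1 ≤ n → 16 * s ^ 2 - 16 ≠ 4 * (n + 3) * (n - 1)) :
    OpSimple (sphModule s).op := by
  refine ⟨⟨sphGen s, 0, sphGen_ne_zero s⟩, fun U hU => or_iff_not_imp_left.2 fun hne => ?_⟩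
  refine eq_top_of_sphGen_mem ?_ fun i w hw => hU (.inr (cliff i)) w hw
  exact ((isSphericalInfty_sphGen s).isClassOne (isLieAction_sphLie s)).vec_mem hlam
    (fun w _ => by
      have : cyclicSpan (fun i => sphLie s (cliff i)) (sphGen s) = ⊤ := eq_top_of_sphGen_mem
        (self_mem_cyclicSpan _ _) fun i w hw => apply_mem_cyclicSpan _ _ hw i
      rw [this]
      trivial) (fun i w hw => hU (.inr (cliff i)) w hw) hne

/-- Schur's lemma: the `K`-fixed vectors of the principal series are the multiples of the spherical
vector. -/
lemma schur_sphModule {φ : SphMod s →ₗ[ℂ] SphMod s}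
    (hφ : φ ∈ opHom (sphModule s).op (sphModule s).op) : ∃ c : ℂ, φ = c • LinearMap.id := by
  set w := φ (sphGen s) with hw
  have hfix : ∀ k ∈ maxCompact, w.1.1 k = w.1.1 1 := by
    intro k hk
    have h1 := hφ (.inl ⟨k, hk⟩) (sphGen s)
    have h2 : (sphModule s).op (.inl ⟨k, hk⟩) (sphGen s) = sphGen s :=
      Subtype.ext (smRight_sphVec s hk)
    rw [h2] at h1
    have := congrFun (congrArg (fun w : SphMod s => w.1.1) h1) 1
    refine Eq.trans ?_ this.symm
    change w.1.1 k = w.1.1 (1 * k)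
    rw [one_mul]
  have h0 : w = w.1.1 1 • sphGen s := by
    refine sub_eq_zero.1 (Subtype.ext ?_)
    refine eq_zero_of_compact (sphSpan_le_inducedFn s (w - w.1.1 1 • sphGen s).2) fun k hk => ?_
    change w.1.1 k - w.1.1 1 * sphFun s k = 0
    rw [hfix k hk, sphFun_of_mem s hk, mul_one, sub_self]
  have : LinearMap.ker (φ - w.1.1 1 • LinearMap.id) = ⊤ := by
    refine eq_top_of_sphGen_mem ?_ fun i u hu => ?_
    · rw [LinearMap.mem_ker, LinearMap.sub_apply, ← hw, LinearMap.smul_apply, LinearMap.id_apply, ← h0,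
        sub_self]
    · rw [LinearMap.mem_ker, LinearMap.sub_apply, LinearMap.smul_apply, LinearMap.id_apply,
        sub_eq_zero] at hu ⊢
      have := hφ (.inr (cliff i)) u
      change φ (sphLie s (cliff i) u) = sphLie s (cliff i) (φ u) at this
      rw [this, hu, map_smul]
  exact ⟨w.1.1 1, sub_eq_zero.1 (LinearMap.ker_eq_top.1 this)⟩

variable {F : GLH ℝ → ℂ} {r : ℂ}

lemma compactOp_autVec (hF : IsMaassForm r F) (k : maxCompact) : compactOp F k (autVec F) = autVec F := by
  refine Subtype.ext (funext fun g => ?_)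
  rw [compactOp_apply]
  change adelicLift F (g.1 * k, g.2 * 1) = adelicLift F (g.1, g.2)
  rw [mul_one]
  rcases adelicLift_slice hF.left_invariant g.2 with h0 | ⟨γ, hγ⟩
  · rw [h0, h0]
  · rw [hγ, hγ, ← mul_assoc, hF.right_invariant _ k.2]

/-- The operators of `K` and of the Lie algebra on `Π_F`. -/
def inftyOp (hle : autRep F ≤ smoothSlices) : maxCompact ⊕ gl2 → End ℂ (autRep F) :=
  Sum.elim (compactOp F) (lieOp hle)

lemma finOp_mem_opHom (hle : autRep F ≤ smoothSlices) (h : Gfin) :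
    finOp F h ∈ opHom (inftyOp hle) (inftyOp hle) :=
  Sum.rec (fun k f => finOp_comm_compactOp h k f) (fun X f => finOp_comm_lieOp hle h X f)

/-- `Π_F` is isotypic for the `(𝔤, K)`-module generated by a spherical vector with the same
eigenvalue of the Casimir operator. -/
lemma iSup_range_inftyOp (hF : IsMaassForm r F) (hle : autRep F ≤ smoothSlices)
    (hs : 16 * s ^ 2 - 16 = -4 * r ^ 2 - 16)
    (hlam : ∀ n : ℕ, 1 ≤ n → -4 * r ^ 2 - 16 ≠ 4 * (n + 3) * (n - 1)) :
    ⨆ φ : opHom (sphModule s).op (inftyOp hle), LinearMap.range φ.1 = ⊤ := by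
  obtain ⟨φ, h1, h2, h3⟩ := (isSphericalInfty_sphGen s).exists_intertwining (isLieAction_sphLie s)
    (isLieAction_lieOp hle) (hs ▸ isSphericalInfty_autVec hF hle) (hs ▸ hlam) (sphGen_ne_zero s)
    (eq_top_of_sphGen_mem (self_mem_cyclicSpan _ _) fun i w hw => apply_mem_cyclicSpan _ _ hw i)
  let φ' : opHom (sphModule s).op (inftyOp hle) := ⟨φ, Sum.rec (fun k => h3 k k.2 _ _
    (fun M u => sphAct_sphLie k M u) (Subtype.ext (smRight_sphVec s k.2))
    (fun M u => compactOp_lieOp hle k M u) (compactOp_autVec hF k)) h2⟩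
  refine autRep_eq_top hle (mem_iSup_of_mem φ' ⟨_, h1⟩) (fun h f hf => ?_)
    (fun k f hf => ?_) fun X f hf => ?_
  · exact apply_mem_iSup_range (finOp_mem_opHom hle h) hf
  · exact apply_mem_iSup_range_self (τ := inftyOp hle) (.inl k) hf
  · exact apply_mem_iSup_range_self (τ := inftyOp hle) (.inr X) hf

/-- The archimedean component: `Φ_F` is a spherical vector with the same eigenvalue of the Casimir
operator as that of an irreducible principal series. -/
theorem localComponent_infty (hF : IsMaassForm r F) (h0 : F ≠ 0)
    (hr : ∀ n : ℕ, 1 ≤ n → r ^ 2 ≠ -(n + 1) ^ 2) :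
    (∃ (V : Type) (_ : AddCommGroup V) (_ : Module ℂ V) (π : GKModule V),
        IsLocalComponentInfty F π) ∧
      ∀ (V : Type*) [AddCommGroup V] [Module ℂ V] (π : GKModule V), IsLocalComponentInfty F π →
        ∀ s : ℂ, s ^ 2 = -r ^ 2 / 4 → IsoPrincipalSeriesInfty π s := by
  have hinv := hF.left_invariant
  have hle := autRep_le_smoothSlices hF.smooth hinv
  have hne : Nontrivial (autRep F) := ⟨⟨autVec F, 0, autVec_ne_zero hinv h0⟩⟩
  have hlam : ∀ n : ℕ, 1 ≤ n → -4 * r ^ 2 - 16 ≠ 4 * (n + 3) * (n - 1) := fun n hn h =>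
    hr n hn (by linear_combination (-1 / 4 : ℂ) * h)
  have hs : ∀ s : ℂ, s ^ 2 = -r ^ 2 / 4 → 16 * s ^ 2 - 16 = -4 * r ^ 2 - 16 := fun s h => by
    rw [h]
    ring
  constructor
  · have hs' := hs (Complex.I * r / 2) (by rw [div_pow, mul_pow, Complex.I_sq]; ring)
    have hsimple := opSimple_sphModule (s := Complex.I * r / 2) (hs' ▸ hlam)
    obtain ⟨W, i1, i2, e, he, hT⟩ := exists_tensor_decomposition hsimple
      (fun φ hφ => schur_sphModule hφ) (iSup_range_inftyOp hF hle hs' hlam)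
    refine ⟨_, _, _, sphModule _, (GKModule.isIrreducible_iff _).2 hsimple, W, i1, i2, e,
      fun k v w => congrArg Subtype.val (he (.inl k) v w),
      fun X v w => congrArg Subtype.val (he (.inr X) v w), fun h => ?_⟩
    obtain ⟨T, hT⟩ := hT (finOp F h) (finOp_mem_opHom hle h)
    exact ⟨T, fun v w => congrArg Subtype.val (hT v w)⟩
  · rintro V _ _ π ⟨hπ, W, i1, i2, e, he1, he2, -⟩ s hsr
    obtain ⟨ψ, hψ⟩ := exists_opHom_ne_zero (ρ := π.op) (τ := inftyOp hle) e
      (Sum.rec (fun k v w => Subtype.ext (he1 k v w)) fun X v w => Subtype.ext (he2 X v w))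
    obtain ⟨e', he'⟩ := exists_equiv_of_opHom (opSimple_sphModule (hs s hsr ▸ hlam))
      (fun φ hφ => schur_sphModule hφ) (iSup_range_inftyOp hF hle (hs s hsr) hlam)
      (π.isIrreducible_iff.1 hπ) ψ hψ
    obtain ⟨ε, hε⟩ := exists_equiv_principalSeriesInfty (s := s) fun n hn => hr (n + 1) (by omega) (by
      push_cast
      linear_combination (4 : ℂ) * hsr - (n + 2 - 2 * s) * hn)
    refine ⟨e'.trans ε, fun k v => ?_, fun X v => ?_⟩
    · rw [LinearEquiv.trans_apply, LinearEquiv.trans_apply, hε, hε]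
      exact congrArg (fun w : SphMod s => w.1.1) (he' (.inl k) v)
    · rw [LinearEquiv.trans_apply, LinearEquiv.trans_apply, hε, hε]
      exact congrArg (fun w : SphMod s => w.1.1) (he' (.inr X) v)

/-! ### The spectral parameter of a cusp form -/

open MeasureTheory in
/-- For real `ν`, the function `e^z K_ν(z)` is decreasing. -/
lemma norm_besselK_le {ν : ℝ} {z z₀ : ℝ} (h0 : 0 < z₀) (hz : z₀ ≤ z) :
    ‖besselK ν z‖ ≤ Real.exp (-(z - z₀)) * ‖besselK ν z₀‖ := by
  have e : ∀ z, besselK ν z =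
      ((∫ t in Set.Ioi (0 : ℝ), Real.exp (-z * Real.cosh t) * Real.cosh (ν * t) : ℝ) : ℂ) := by
    intro z
    rw [besselK, ← integral_complex_ofReal]
    simp
  have hpos : ∀ z, 0 ≤ ∫ t in Set.Ioi (0 : ℝ), Real.exp (-z * Real.cosh t) * Real.cosh (ν * t) :=
    fun z => integral_nonneg fun t => by positivity
  rw [e, e, Complex.norm_of_nonneg (hpos _), Complex.norm_of_nonneg (hpos _), ← integral_const_mul]
  refine integral_mono_of_nonneg (.of_forall fun t => by positivity) (Integrable.const_mul ?_ _)
    (.of_forall fun t => ?_)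
  · refine Integrable.mono' (((integrable_exp_neg_mul_sq (b := z₀ / 8) (by positivity)).const_mul
      (Real.exp (2 * ν ^ 2 / z₀))).restrict) (by fun_prop) ?_
    filter_upwards [ae_restrict_mem measurableSet_Ioi] with t ht
    have ht : 0 < t := ht
    rw [Real.norm_of_nonneg (by positivity), ← Real.exp_add]
    have h1 : t ^ 2 / 4 ≤ Real.cosh t := by
      have := Real.quadratic_le_exp_of_nonneg ht.le
      rw [Real.cosh_eq]
      linarith [Real.exp_pos (-t)]
    have h2 : Real.cosh (ν * t) ≤ Real.exp |ν * t| := by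
      rw [← Real.cosh_abs, Real.cosh_eq]
      linarith [Real.exp_le_exp.2 (neg_le_self (abs_nonneg (ν * t)))]
    refine (mul_le_mul_of_nonneg_left h2 (by positivity)).trans ?_
    rw [← Real.exp_add, Real.exp_le_exp, abs_mul, abs_of_pos ht]
    have h3 : |ν| * t ≤ z₀ * t ^ 2 / 8 + 2 * ν ^ 2 / z₀ := by
      rw [← sq_abs ν, div_add_div _ _ (by norm_num) h0.ne', le_div_iff₀ (by positivity)]
      nlinarith [sq_nonneg (z₀ * t - 4 * |ν|)]
    nlinarith [mul_le_mul_of_nonneg_left h1 h0.le]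
  · dsimp only
    rw [← mul_assoc, ← Real.exp_add]
    refine mul_le_mul_of_nonneg_right (Real.exp_le_exp.2 ?_) (by positivity)
    nlinarith [Real.one_le_cosh t]

/-- Every quaternion is congruent to one of norm at most `1 / 2` modulo the Hurwitz order: of the
two nearest points with integral and with half-integral coordinates, one is close enough. -/
lemma exists_hurwitz_near (x : ℍ[ℝ]) : ∃ o ∈ hurwitz ℤ ℝ, normSq (x - o) ≤ 1 / 2 := by
  have key : ∀ t : ℝ, ∃ m n : ℤ, (t - m) ^ 2 + (t - (n + 1 / 2)) ^ 2 ≤ 1 / 4 := by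
    intro t
    have h1 := Int.floor_le t
    have h2 := Int.lt_floor_add_one t
    rcases le_total (t - ⌊t⌋) (1 / 2) with h3 | h3
    · exact ⟨⌊t⌋, ⌊t⌋, by nlinarith⟩
    · exact ⟨⌊t⌋ + 1, ⌊t⌋, by push_cast; nlinarith⟩
  choose m n h using key
  have h₀ := h x.re
  have h₁ := h x.imI
  have h₂ := h x.imJ
  have h₃ := h x.imK
  by_cases hx : (x.re - m x.re) ^ 2 + (x.imI - m x.imI) ^ 2 + (x.imJ - m x.imJ) ^ 2 +
      (x.imK - m x.imK) ^ 2 ≤ 1 / 2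
  · refine ⟨quat (m x.re : ℝ) (m x.imI) (m x.imJ) (m x.imK), ⟨m x.re - m x.imK, m x.imI - m x.imK,
      m x.imJ - m x.imK, 2 * m x.imK, by ext <;> simp⟩, ?_⟩
    rw [normSq_def']
    simpa using hx
  · refine ⟨quat ((n x.re : ℝ) + 1 / 2) (n x.imI + 1 / 2) (n x.imJ + 1 / 2) (n x.imK + 1 / 2),
      ⟨n x.re - n x.imK, n x.imI - n x.imK, n x.imJ - n x.imK, 2 * n x.imK + 1, by
        ext <;> simp <;> ring⟩, ?_⟩
    rw [normSq_def']
    simp only [re_sub, imI_sub, imJ_sub, imK_sub,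
      quat_re, quat_imI, quat_imJ, quat_imK]
    linarith

/-- The point `x + y j` of hyperbolic space, represented by the matrix with rows `(y, x)`, `(0, 1)`. -/
def halfPt (x : ℍ[ℝ]) (y : ℝ) (hy : 0 < y) : GLH ℝ := upper (realUnit y hy.ne') 1 x

section

variable {r : ℂ} {F : GLH ℝ → ℂ}

lemma nMat_mem {o : ℍ[ℝ]} (ho : o ∈ hurwitz ℤ ℝ) : nMat o ∈ glOrder ℤ ℝ := by
  have h : ∀ x ∈ hurwitz ℤ ℝ, ∀ a b, (nMat x).val a b ∈ hurwitz ℤ ℝ := by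
    intro x hx a b
    fin_cases a <;> fin_cases b <;> simp [nMat, upper, hx, one_mem, zero_mem]
  refine ⟨h o ho, ?_⟩
  have e : (nMat o)⁻¹ = nMat (-o) := by rw [nMat, nMat, upper_inv]; simp
  exact fun a b => e ▸ h _ (neg_mem ho) a b

lemma nMat_mul_halfPt (o x : ℍ[ℝ]) (y : ℝ) (hy : 0 < y) :
    nMat o * halfPt x y hy = halfPt (x + o) y hy := by
  rw [nMat, halfPt, upper_mul, halfPt]
  simp

lemma herC_halfPt (x : ℍ[ℝ]) (y : ℝ) (hy : 0 < y) : herC (halfPt x y hy) = 1 := by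
  simp [herC, halfPt, upper]

lemma herN_halfPt (x : ℍ[ℝ]) (y : ℝ) (hy : 0 < y) : herN (halfPt x y hy) = y ^ 2 := by
  rw [herN, herC_halfPt]
  simp [herA, herB, halfPt, upper, realUnit, normSq_coe]

lemma IsMaassForm.apply_halfPt (hF : IsMaassForm r F) (x : ℍ[ℝ]) (y : ℝ) (hy : 0 < y) :
    F (halfPt x y hy) = F (nMat x * aMat y hy) := by
  rw [halfPt, hF.apply_upper, aMat_congr (y' := y)]
  · simp
  · simp [realUnit, abs_of_pos hy]

/-- The height of a point of hyperbolic space: the coordinate `y` of `x + y j`. -/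
def height (g : GLH ℝ) : ℝ := √(herN g) / herC g

lemma height_pos (g : GLH ℝ) : 0 < height g := div_pos (Real.sqrt_pos.2 (herN_pos g)) (herC_pos g)

lemma height_halfPt (x : ℍ[ℝ]) (y : ℝ) (hy : 0 < y) : height (halfPt x y hy) = y := by
  rw [height, herC_halfPt, herN_halfPt, Real.sqrt_sq hy.le, div_one]

lemma sphFun_two (g : GLH ℝ) : sphFun 2 g = (height g : ℂ) ^ 6 := by
  have h1 := herN_pos g
  have h2 := herC_pos g
  have h3 : Real.log (height g) = Real.log (herN g) / 2 - Real.log (herC g) := by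
    rw [height, Real.log_div (Real.sqrt_pos.2 h1).ne' h2.ne', Real.log_sqrt h1.le]
  rw [sphFun, show (1 + 2 : ℂ) * ((Real.log (herN g) - 2 * Real.log (herC g) : ℝ) : ℂ) =
    (6 : ℕ) * (Real.log (height g) : ℂ) by rw [h3]; push_cast; ring, Complex.exp_nat_mul,
    ← Complex.ofReal_exp, Real.exp_log (height_pos g)]

lemma IsMaassForm.exists_halfPt (hF : IsMaassForm r F) (g : GLH ℝ) :
    ∃ x, F g = F (halfPt x (height g) (height_pos g)) := by
  obtain ⟨k, hk, e⟩ := exists_iwasawa_real g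
  rw [e, hF.right_invariant _ hk, hF.apply_upper, aMat_congr (y' := height g), ← hF.apply_halfPt]
  · simp only [← e]
    exact ⟨_, rfl⟩
  change ‖((√(herN g / herC g) : ℝ) : ℍ[ℝ])‖ / ‖((√(herC g) : ℝ) : ℍ[ℝ])‖ = _
  have h2 := herC_pos g
  rw [norm_coe, norm_coe, Real.norm_of_nonneg (Real.sqrt_nonneg _),
    Real.norm_of_nonneg (Real.sqrt_nonneg _), Real.sqrt_div (herN_pos g).le, div_div,
    Real.mul_self_sqrt h2.le, height]

lemma IsMaassForm.exists_translate (hF : IsMaassForm r F) (x : ℍ[ℝ]) :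
    ∃ x', normSq x' ≤ 1 / 2 ∧ ∀ y hy, F (halfPt x y hy) = F (halfPt x' y hy) := by
  obtain ⟨o, ho, h⟩ := exists_hurwitz_near x
  refine ⟨_, h, fun y hy => ?_⟩
  rw [← hF.left_invariant _ (nMat_mem ho) (halfPt (x - o) y hy), nMat_mul_halfPt, sub_add_cancel]

/-- The Weyl element. -/
def weylEl : GLH ℝ where
  val := !![0, 1; 1, 0]
  inv := !![0, 1; 1, 0]
  val_inv := by
    ext a b : 1
    fin_cases a <;> fin_cases b <;> simp
  inv_val := by
    ext a b : 1
    fin_cases a <;> fin_cases b <;> simp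

lemma weylEl_mem : weylEl ∈ glOrder ℤ ℝ := by
  have h : ∀ a b, weylEl.val a b ∈ hurwitz ℤ ℝ := by
    intro a b
    fin_cases a <;> fin_cases b <;> simp [weylEl, one_mem, zero_mem]
  exact ⟨h, h⟩

lemma height_weylEl_mul (x : ℍ[ℝ]) (y : ℝ) (hy : 0 < y) :
    height (weylEl * halfPt x y hy) = y / (normSq x + y ^ 2) := by
  have e : (weylEl * halfPt x y hy).val = !![0, 1; (y : ℍ[ℝ]), x] := by
    rw [Units.val_mul]
    ext a b : 1
    fin_cases a <;> fin_cases b <;> simp [weylEl, halfPt, upper, realUnit]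
  have hA : herA (weylEl * halfPt x y hy) = 1 := by simp [herA, e]
  have hC : herC (weylEl * halfPt x y hy) = normSq x + y ^ 2 := by
    simp [herC, e, normSq_coe, add_comm]
  have hB : normSq (herB (weylEl * halfPt x y hy)) = normSq x := by
    simp [herB, e]
  rw [height, herN, hA, hB, hC, one_mul, add_sub_cancel_left, Real.sqrt_sq hy.le]

/-- Reduction theory: the values of `F` are taken at height at least `1 / 2`. Below that height,
translation into the ball `|x|² ≤ 1 / 2` and inversion raise the height by a factor at least `4 / 3`. -/
lemma IsMaassForm.exists_high (hF : IsMaassForm r F) (g : GLH ℝ) :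
    ∃ x y, ∃ hy : 0 < y, 1 / 2 ≤ y ∧ F g = F (halfPt x y hy) := by
  have key : ∀ (k : ℕ) (g : GLH ℝ), 1 / 2 ≤ (4 / 3) ^ k * height g →
      ∃ x y, ∃ hy : 0 < y, 1 / 2 ≤ y ∧ F g = F (halfPt x y hy) := by
    intro k
    induction k with
    | zero =>
      intro g hg
      obtain ⟨x, hx⟩ := hF.exists_halfPt g
      exact ⟨x, _, height_pos g, by simpa using hg, hx⟩
    | succ k ih =>
      intro g hg
      obtain ⟨x, hx⟩ := hF.exists_halfPt g
      rcases le_total (1 / 2) (height g) with h | h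
      · exact ⟨x, _, height_pos g, h, hx⟩
      obtain ⟨x', h', e⟩ := hF.exists_translate x
      rw [hx, e, ← hF.left_invariant _ weylEl_mem]
      refine ih _ (hg.trans ?_)
      have hy := height_pos g
      have hD : 0 < normSq x' + height g ^ 2 :=
        add_pos_of_nonneg_of_pos normSq_nonneg (by positivity)
      rw [height_weylEl_mul, pow_succ, mul_assoc]
      refine mul_le_mul_of_nonneg_left ?_ (by positivity)
      rw [le_div_iff₀ hD]
      nlinarith
  obtain ⟨k, hk⟩ := pow_unbounded_of_one_lt (1 / 2 / height g) (by norm_num : (1 : ℝ) < 4 / 3)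
  exact key k g ((div_le_iff₀ (height_pos g)).1 hk.le)

lemma HasCuspExpansion.exists_bound (hF : IsMaassForm r F) {A : ℍ[ℝ] → ℂ} (hA : HasCuspExpansion r F A)
    {ν : ℝ} (hν : Complex.I * r = ν) : ∃ S : ℝ, 0 ≤ S ∧ ∀ x y hy, 1 / 2 ≤ y →
      ‖F (halfPt x y hy)‖ ≤ S * (y ^ 2 * Real.exp (-(y - 1 / 2))) := by
  have h1 := (hA 0 (1 / 2) (by norm_num)).summable.norm
  refine ⟨4 * ∑' β : FourierIndex, ‖A β * whittaker r ‖(β : ℍ[ℝ])‖ (1 / 2) * fchar β 0‖,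
    mul_nonneg (by norm_num) (tsum_nonneg fun _ => norm_nonneg _), fun x y hy h => ?_⟩
  rw [hF.apply_halfPt, ← (hA x y hy).tsum_eq, mul_right_comm, ← tsum_mul_left]
  refine tsum_of_norm_bounded (h1.mul_left _).hasSum fun β => ?_
  have hβ : 1 ≤ ‖(β : ℍ[ℝ])‖ := by
    have := one_le_normSq β.2.1 β.2.2
    rw [normSq_eq_norm_mul_self] at this
    nlinarith [norm_nonneg (β : ℍ[ℝ])]
  have hn : 0 < 2 * Real.pi * ‖(β : ℍ[ℝ])‖ := by positivity
  have h2 := norm_besselK_le (ν := ν) (z := 2 * Real.pi * ‖(β : ℍ[ℝ])‖ * y)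
    (z₀ := 2 * Real.pi * ‖(β : ℍ[ℝ])‖ * (1 / 2)) (by positivity) (by gcongr)
  have h3 : Real.exp (-(2 * Real.pi * ‖(β : ℍ[ℝ])‖ * y - 2 * Real.pi * ‖(β : ℍ[ℝ])‖ * (1 / 2))) ≤
      Real.exp (-(y - 1 / 2)) := by
    rw [Real.exp_le_exp]
    have : 1 ≤ 2 * Real.pi * ‖(β : ℍ[ℝ])‖ := by nlinarith [Real.pi_gt_three]
    nlinarith
  have h4 := h2.trans (mul_le_mul_of_nonneg_right h3 (norm_nonneg _))
  simp only [norm_mul, norm_fchar, mul_one, whittaker, hν, norm_pow, Complex.norm_real,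
    Real.norm_of_nonneg hy.le]
  rw [Real.norm_of_nonneg (by norm_num : (0 : ℝ) ≤ 1 / 2)]
  calc _ ≤ ‖A β‖ * (y ^ 2 * (Real.exp (-(y - 1 / 2)) *
        ‖besselK ν (2 * Real.pi * ‖(β : ℍ[ℝ])‖ * (1 / 2))‖)) := by gcongr
    _ = _ := by ring

end

/-- The one-parameter subgroup `exp(tX)`, where `X = cliff i` has square `1`. -/
def boost (i : Fin 5) (t : ℝ) : GLH ℝ where
  val := Real.cosh t • 1 + Real.sinh t • cliff i
  inv := Real.cosh t • 1 - Real.sinh t • cliff i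
  val_inv := by
    simp only [add_mul, mul_sub, smul_mul_assoc, mul_smul_comm, one_mul, mul_one, cliff_sq]
    trans (Real.cosh t ^ 2 - Real.sinh t ^ 2) • 1
    · module
    · rw [Real.cosh_sq_sub_sinh_sq, one_smul]
  inv_val := by
    simp only [sub_mul, mul_add, smul_mul_assoc, mul_smul_comm, one_mul, mul_one, cliff_sq]
    trans (Real.cosh t ^ 2 - Real.sinh t ^ 2) • 1
    · module
    · rw [Real.cosh_sq_sub_sinh_sq, one_smul]

lemma hasDerivAt_boost (g : GLH ℝ) (i : Fin 5) (t : ℝ) (a b : Fin 2) :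
    HasDerivAt (fun u => (g * boost i u).val a b) (((g * boost i t).val * cliff i) a b) t := by
  have e : ∀ u, (g * boost i u).val = Real.cosh u • g.val + Real.sinh u • (g.val * cliff i) := by
    intro u
    rw [Units.val_mul, boost]
    simp only [mul_add, mul_smul_comm, mul_one]
  simp only [e, add_mul, smul_mul_assoc, mul_assoc, cliff_sq, mul_one, Matrix.add_apply, Matrix.smul_apply]
  rw [add_comm]
  exact ((Real.hasDerivAt_cosh t).smul_const _).add ((Real.hasDerivAt_sinh t).smul_const _)

/-- The second derivative test. -/
lemma lieDeriv_cliff_nonpos {f : GLH ℝ → ℂ} (hf : IsSmooth f) (g : GLH ℝ) (i : Fin 5)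
    (h : IsLocalMax (fun t => (f (g * boost i t)).re) 0) :
    (lieDeriv (cliff i) (lieDeriv (cliff i) f) g).re ≤ 0 := by
  have d : ∀ {f : GLH ℝ → ℂ}, IsSmooth f → ∀ t, HasDerivAt (fun t => (f (g * boost i t)).re)
      (lieDeriv (cliff i) f (g * boost i t)).re t := fun hf t =>
    Complex.reCLM.hasFDerivAt.comp_hasDerivAt t (hf.hasDerivAt (hasDerivAt_boost g i t))
  have h1 : deriv (fun t => (f (g * boost i t)).re) = fun t => (lieDeriv (cliff i) f (g * boost i t)).re :=
    funext fun t => (d hf t).deriv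
  have h2 : deriv (deriv fun t => (f (g * boost i t)).re) 0 =
      (lieDeriv (cliff i) (lieDeriv (cliff i) f) g).re := by
    rw [h1, (d (hf.lieDeriv _) 0).deriv]
    congr 3
    ext1
    simp [boost]
  rw [← h2]
  by_contra! hpos
  have hmin := isLocalMin_of_deriv_deriv_pos hpos h.deriv_eq_zero (d hf 0).continuousAt
  -- a local maximum that is also a local minimum is a point where the function is locally constant
  have hc : (fun t => (f (g * boost i t)).re) =ᶠ[nhds 0] fun _ => (f (g * boost i 0)).re := by
    filter_upwards [h, hmin] with t h h' using le_antisymm h h'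
  rw [hc.deriv.deriv_eq] at hpos
  simp at hpos

lemma IsMaassForm.bounded_decay {r : ℂ} {F : GLH ℝ → ℂ} {A : ℍ[ℝ] → ℂ} {ν : ℝ} (hF : IsMaassForm r F)
    (hA : HasCuspExpansion r F A) (hν : Complex.I * r = ν) :
    BddAbove (Set.range fun g => ‖F g‖) ∧ ∀ c > 0, ∃ Y : ℝ, 1 ≤ Y ∧
      ∀ x y hy, Y ≤ y → ‖F (halfPt x y hy)‖ ≤ c := by
  obtain ⟨S, hS, h⟩ := hA.exists_bound hF hν
  have e : ∀ y : ℝ, y ^ 2 * Real.exp (-(y - 1 / 2)) = Real.exp (1 / 2) * (y ^ 2 * Real.exp (-y)) := by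
    intro y
    rw [neg_sub, sub_eq_add_neg, Real.exp_add]
    ring
  constructor
  · refine ⟨S * (Real.exp (1 / 2) * 2), ?_⟩
    rintro _ ⟨g, rfl⟩
    obtain ⟨x, y, hy, h2, hg⟩ := hF.exists_high g
    dsimp only
    rw [hg]
    refine (h x y hy h2).trans ?_
    rw [e]
    gcongr
    rw [Real.exp_neg, ← div_eq_mul_inv, div_le_iff₀ (Real.exp_pos y)]
    linarith [Real.quadratic_le_exp_of_nonneg hy.le]
  · intro c hc
    have ht := ((Real.tendsto_pow_mul_exp_neg_atTop_nhds_zero 2).const_mul (Real.exp (1 / 2))).const_mul S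
    rw [mul_zero, mul_zero] at ht
    obtain ⟨Y, hY⟩ := Filter.eventually_atTop.1 (ht.eventually (ge_mem_nhds hc))
    refine ⟨max Y 1, le_max_right _ _, fun x y hy h2 => (h x y hy ?_).trans ?_⟩
    · linarith [le_max_right Y 1]
    · rw [e]
      exact hY y ((le_max_left _ _).trans h2)

/-- The values `r ^ 2 = -(n + 1) ^ 2`, at which the principal series is reducible, do not occur
for cusp forms. There `F` would be a bounded function decaying at the cusp, and an eigenfunction of
the hyperbolic Laplacian with a nonnegative eigenvalue, against the maximum principle. The term
`ε y ^ 6`, with positive eigenvalue, makes the principle strict also when `F` is harmonic, and is so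
small that a maximum over `1 / 4 ≤ y ≤ Y` is still attained in the interior. -/
theorem spectralParameter_ne {r : ℂ} {F : GLH ℝ → ℂ} {u : ℝ → ℂ} {A : ℍ[ℝ] → ℂ} (hF : IsMaassForm r F)
    (hA : HasFourierExpansion r F u A) (hc : IsCuspidal F) (h0 : F ≠ 0) (n : ℕ) (hn : 1 ≤ n) :
    r ^ 2 ≠ -(n + 1) ^ 2 := by
  intro hr
  obtain ⟨ν, hν⟩ : ∃ ν : ℝ, Complex.I * r = ν := by
    have : (Complex.I * r) ^ 2 = (n + 1 : ℂ) ^ 2 := by rw [mul_pow, Complex.I_sq, hr]; ring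
    rcases sq_eq_sq_iff_eq_or_eq_neg.1 this with h | h
    · exact ⟨n + 1, by rw [h]; push_cast; ring⟩
    · exact ⟨-(n + 1), by rw [h]; push_cast; ring⟩
  obtain ⟨hbdd, hdecay⟩ := IsMaassForm.bounded_decay hF (hasCuspExpansion hF hA hc) hν
  set M := ⨆ g, ‖F g‖ with hM
  have hle : ∀ g, ‖F g‖ ≤ M := le_ciSup hbdd
  have hM0 : 0 < M := by
    obtain ⟨g, hg⟩ := Function.ne_iff.1 h0
    exact (norm_pos_iff.2 hg).trans_le (hle g)
  obtain ⟨Y, hY1, hY⟩ := hdecay (M / 2) (by positivity)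
  -- the perturbation `ε y ^ 6` is at most `M / 2` up to the height `Y`
  set ε := M / (2 * Y ^ 6) with hε
  have hε0 : 0 < ε := by positivity
  have hεY : ε * Y ^ 6 = M / 2 := by rw [hε]; field_simp
  have hεM : ε ≤ M / 2 := by rw [← hεY]; exact le_mul_of_one_le_right hε0.le (one_le_pow₀ hY1)
  obtain ⟨g₁, hg₁⟩ := exists_lt_of_lt_ciSup (show M - ε / 128 < ⨆ g, ‖F g‖ by linarith)
  obtain ⟨x₀, y₁, hy₁, h₁, e₁⟩ := hF.exists_high g₁
  rw [e₁] at hg₁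
  have hy₁Y : y₁ < Y := by
    by_contra! h
    linarith [hY x₀ y₁ hy₁ h]
  obtain ⟨ζ, hζ, hζ₁⟩ : ∃ ζ : ℂ, ‖ζ‖ = 1 ∧ ‖F (halfPt x₀ y₁ hy₁)‖ = ζ * F (halfPt x₀ y₁ hy₁) :=
    Complex.exists_norm_eq_mul_self _
  set ψ : GLH ℝ → ℂ := ζ • F + (ε : ℂ) • sphFun 2 with hψ
  have hs : IsSmooth ψ := (hF.smooth.smul _).add ((isSmooth_sphFun 2).smul _)
  have hre : ∀ g, (ψ g).re = (ζ * F g).re + ε * height g ^ 6 := by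
    intro g
    rw [hψ, Pi.add_apply, Pi.smul_apply, Pi.smul_apply, sphFun_two, smul_eq_mul, smul_eq_mul,
      Complex.add_re, ← Complex.ofReal_pow, ← Complex.ofReal_mul, Complex.ofReal_re]
  have hζF : ∀ g, (ζ * F g).re ≤ ‖F g‖ := fun g =>
    (Complex.re_le_norm _).trans (by rw [norm_mul, hζ, one_mul])
  obtain ⟨p, hp⟩ : ∃ p : GLH ℝ, height p ∈ Set.Icc (1 / 4) Y ∧
      ∀ g, height g ∈ Set.Icc (1 / 4) Y → (ψ g).re ≤ (ψ p).re := by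
    have : ProperSpace ℍ[ℝ] := FiniteDimensional.proper ℝ ℍ[ℝ]
    let T : Set (ℍ[ℝ] × ℝ) := Metric.closedBall 0 1 ×ˢ Set.Icc (1 / 4) Y
    have hT : IsCompact T := (isCompact_closedBall _ _).prod isCompact_Icc
    have : CompactSpace T := isCompact_iff_compactSpace.1 hT
    have hpos : ∀ q : T, 0 < q.1.2 := fun q => lt_of_lt_of_le (by norm_num) q.2.2.1
    have hcont : Continuous fun q : T => (ψ (halfPt q.1.1 q.1.2 (hpos q))).re := by
      refine Complex.continuous_re.comp (hs.continuous_comp _ fun a b => ?_)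
      have : Continuous fun q : T => ((q.1.2 : ℝ) : ℍ[ℝ]) :=
        continuous_coe.comp (continuous_snd.comp continuous_subtype_val)
      have : Continuous fun q : T => q.1.1 := continuous_fst.comp continuous_subtype_val
      fin_cases a <;> fin_cases b <;> simp [halfPt, upper, realUnit] <;>
        first | assumption | exact continuous_const
    obtain ⟨q, -, hq⟩ := isCompact_univ.exists_isMaxOn ⟨⟨(0, Y), by
      simp, by linarith, le_rfl⟩, Set.mem_univ _⟩ hcont.continuousOn
    refine ⟨halfPt q.1.1 q.1.2 (hpos q), by rw [height_halfPt]; exact q.2.2, fun g hg => ?_⟩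
    obtain ⟨x, hx⟩ := hF.exists_halfPt g
    obtain ⟨x', hx', e'⟩ := hF.exists_translate x
    have hx1 : ‖x'‖ ≤ 1 := by
      rw [normSq_eq_norm_mul_self] at hx'
      nlinarith [norm_nonneg x']
    have := hq (Set.mem_univ ⟨(x', height g), mem_closedBall_zero_iff.2 hx1, hg⟩)
    refine le_trans (le_of_eq ?_) this
    dsimp only
    rw [hre, hre, height_halfPt, hx, e']
  have hψp : M - ε / 128 + ε / 64 < (ψ p).re := by
    refine lt_of_lt_of_le ?_ (hp.2 (halfPt x₀ y₁ hy₁) ?_)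
    · rw [hre, ← hζ₁, Complex.ofReal_re, height_halfPt]
      have : (1 / 2 : ℝ) ^ 6 ≤ y₁ ^ 6 := by gcongr
      nlinarith
    · rw [height_halfPt]
      exact ⟨by linarith, hy₁Y.le⟩
  obtain ⟨x, hx⟩ := hF.exists_halfPt p
  rw [hre] at hψp
  have hlow : 1 / 4 < height p := by
    refine lt_of_le_of_ne hp.1.1 fun h => ?_
    rw [← h] at hψp
    linarith [hζF p, hle p]
  have hhigh : height p < Y := by
    refine lt_of_le_of_ne hp.1.2 fun h => ?_
    have := hY x (height p) (height_pos p) h.ge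
    rw [h] at hψp
    rw [← hx] at this
    linarith [hζF p]
  have hpY : ε * height p ^ 6 ≤ M / 2 := by
    rw [← hεY]
    have := height_pos p
    gcongr
  have hmax : ∀ i, (lieDeriv (cliff i) (lieDeriv (cliff i) ψ) p).re ≤ 0 := by
    refine fun i => lieDeriv_cliff_nonpos hs p i ?_
    have hp0 : p * boost i 0 = p := by
      ext1
      simp [boost]
    have hcont : ContinuousAt (fun t => height (p * boost i t)) 0 := by
      have h := Complex.continuous_re.continuousAt.comp
        ((isSmooth_sphFun 2).hasDerivAt (hasDerivAt_boost p i 0)).continuousAt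
      have e : (fun t => height (p * boost i t)) = fun t => ((sphFun 2 (p * boost i t)).re) ^ (1 / 6 : ℝ) := by
        funext t
        rw [sphFun_two, ← Complex.ofReal_pow, Complex.ofReal_re, ← Real.rpow_natCast,
          ← Real.rpow_mul (height_pos _).le]
        norm_num
      rw [e]
      exact h.rpow_const (Or.inr (by norm_num))
    have hev : ∀ᶠ t in nhds 0, height (p * boost i t) ∈ Set.Ioo (1 / 4) Y :=
      hcont.eventually_mem (isOpen_Ioo.mem_nhds (by rw [hp0]; exact ⟨hlow, hhigh⟩))
    filter_upwards [hev] with t ht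
    rw [hp0]
    exact hp.2 _ ⟨ht.1.le, ht.2.le⟩
  have hsum : ∑ i, lieDeriv (cliff i) (lieDeriv (cliff i) ψ) p =
      (4 * (n + 1) ^ 2 - 16 : ℝ) * (ζ * F p) + 48 * (ε * height p ^ 6 : ℝ) := by
    have h1 := casimir_eq_sum hF.smooth (fun g k hk => hF.right_invariant g hk) hF.zMat_mul p
    rw [hF.casimir_eq, hr] at h1
    have h2 := congrFun (sum_lieDeriv_sphFun 2) p
    rw [Finset.sum_apply, Pi.smul_apply, smul_eq_mul, sphFun_two] at h2
    have h3 : ∀ i, lieDeriv (cliff i) (lieDeriv (cliff i) ψ) p =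
        ζ * lieDeriv (cliff i) (lieDeriv (cliff i) F) p +
          ε * lieDeriv (cliff i) (lieDeriv (cliff i) (sphFun 2)) p := by
      intro i
      rw [hψ, lieDeriv_add (hF.smooth.smul _) ((isSmooth_sphFun 2).smul _), lieDeriv_smul hF.smooth,
        lieDeriv_smul (isSmooth_sphFun 2), lieDeriv_add ((hF.smooth.lieDeriv _).smul _)
          (((isSmooth_sphFun 2).lieDeriv _).smul _), lieDeriv_smul (hF.smooth.lieDeriv _),
        lieDeriv_smul ((isSmooth_sphFun 2).lieDeriv _)]
      rfl
    simp only [h3, sum_add_distrib, ← mul_sum, h2]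
    push_cast
    linear_combination (-32 * ζ) * h1
  have hn' : (1 : ℝ) ≤ n := by exact_mod_cast hn
  have h1 := Finset.sum_nonpos fun i (_ : i ∈ Finset.univ) => hmax i
  rw [← Complex.re_sum, hsum, Complex.add_re, Complex.re_ofReal_mul, ← Complex.ofReal_ofNat,
    ← Complex.ofReal_mul, Complex.ofReal_re] at h1
  have h2 : 0 ≤ (4 * ((n : ℝ) + 1) ^ 2 - 16) * (ζ * F p).re :=
    mul_nonneg (by nlinarith) (by linarith)
  have h3 : 0 < ε * height p ^ 6 := mul_pos hε0 (pow_pos (height_pos p) 6)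
  linarith

end QuatMaass

end

theorem proposition5p2 (r : ℂ) (ε : ℝ) (hε : ε = 1 ∨ ε = -1) (F : QuatMaass.GLH ℝ → ℂ)
    (hF : QuatMaass.IsMaassSpace r ε F) (hcusp : QuatMaass.IsCuspidal F)
    (hHecke : QuatMaass.IsHeckeEigenform F) :
    -- `Π_F` has a local component at two, and any such is as claimed
    ((∃ (V : Type) (_ : AddCommGroup V) (_ : Module ℂ V)
        (π : Representation ℂ (QuatMaass.Gp QuatMaass.two) V),
        QuatMaass.IsLocalComponent F QuatMaass.two π) ∧
      ∀ (V : Type*) [AddCommGroup V] [Module ℂ V]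
        (π : Representation ℂ (QuatMaass.Gp QuatMaass.two) V),
        QuatMaass.IsLocalComponent F QuatMaass.two π →
        ∀ χ₁ χ₂ : ℍ[ℚ_[QuatMaass.two]]ˣ →* ℂˣ,
          QuatMaass.IsUnramified QuatMaass.two χ₁ → QuatMaass.IsUnramified QuatMaass.two χ₂ →
          (χ₁ (QuatMaass.varpiUnit ℚ_[QuatMaass.two]) : ℂ) = ((-√2 * ε : ℝ) : ℂ) →
          (χ₂ (QuatMaass.varpiUnit ℚ_[QuatMaass.two]) : ℂ) = ((-ε / √2 : ℝ) : ℂ) →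
          QuatMaass.IsUniqueConstituent
            (QuatMaass.principalSeries QuatMaass.two χ₁ χ₂).toRepresentation π) ∧
    -- `Π_F` has an archimedean component, and any such is as claimed
    ((∃ (V : Type) (_ : AddCommGroup V) (_ : Module ℂ V) (π : QuatMaass.GKModule V),
        QuatMaass.IsLocalComponentInfty F π) ∧
      ∀ (V : Type*) [AddCommGroup V] [Module ℂ V] (π : QuatMaass.GKModule V),
        QuatMaass.IsLocalComponentInfty F π →
        QuatMaass.IsoPrincipalSeriesInfty π (Complex.I * r / 2) ∧
        QuatMaass.IsoPrincipalSeriesInfty π (-(Complex.I * r / 2))) := by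
  obtain ⟨u, A, hA, -⟩ := hF.2
  have hr := QuatMaass.spectralParameter_ne hF.1 hA hcusp hHecke.1
  obtain ⟨h1, h2⟩ := QuatMaass.localComponent_infty hF.1 hHecke.1 hr
  refine ⟨QuatMaass.localComponent_two hε hF hcusp hHecke, h1, fun V _ _ π hπ => ⟨h2 V π hπ _ ?_, h2 V π hπ _ ?_⟩⟩
  · rw [div_pow, mul_pow, Complex.I_sq]
    ring
  · rw [neg_sq, div_pow, mul_pow, Complex.I_sq]
    ring
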